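/- **Setting.** Let $V$ be a positive definite quadratic space of dimension $3$ over $\mathbb{Q}$ with symmetric bilinear form $B$ and $Q(x)=B(x,x)$. A lattice is a finitely generated $\mathbb{Z}$-submodule $L\subset V$ with $\mathbb{Q}L=V$ and $B(L,L)\subseteq\mathbb{Z}$. Its discriminant $d_L$ is the determinant of a Gram matrix $A$ of $L$, and its level $N_L$ is the smallest positive integer $N$ such that $NA^{-1}$ is integral. A (ternary) coset $aL+\nu$ of conductor $a$ consists of a lattice $L$ on $V$ and $\nu\in L$ such that $a$ is the smallest positive integer $m$ with $m\nu\in aL$. Its theta series is $\Theta_{aL+\nu}(z)=\sum_{x\in aL+\nu}e^{2\pi i Q(x)z}$ for $z$ in the upper half-plane. Write $V_q=V\otimes\mathbb{Q}_q$ and $L_q=L\otimes\mathbb{Z}_q$ for a prime $q$, and let $O^+$ denote the special orthogonal group. The proper class $\mathrm{cls}^+(aL+\nu)$ is the orbit of $aL+\nu$ under $O^+(V)$. The proper genus $\mathrm{gen}^+(aL+\nu)$ is the set of cosets $aK+\mu$ of conductor $a$ such that for every prime $q$ there is $\sigma_q\in O^+(V_q)$ with $\sigma_q(aL_q+\nu)=aK_q+\mu$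 (equivalently, the orbit under the adelic group $O^+_A(V)$). Let $p$ be a prime with $p\nmid 4N_La^2$ and let $\bar p$ be an integer with $p\bar p\equiv 1\pmod a$. For a coset $aM+\xi$ in $V$ of conductor $a$ with $p\nmid 4N_Ma^2$, the set $R_p(aM+\xi)$ of its $p$-neighbours consists of the cosets $aK+\mu$ of conductor $a$ such that $aK_q+\mu=aM_q+\bar p\xi$ for all primes $q\ne p$, $(M_p:M_p\cap K_p)=(K_p:M_p\cap K_p)=p$ and $Q(K_p)\mathbb{Z}_p=\mathbb{Z}_p$. Let $\theta(z)=\sum_{n\in\mathbb{Z}}e^{2\pi i n^2z}$ and $j(\gamma,z)=\theta(\gamma z)/\theta(z)$ for $\gamma\in\Gamma_0(4)$. For $\Gamma\subseteq\Gamma_0(N)$ with $4\mid N$ and a character $\psi$ modulo $N$, let $M_{3/2}(\Gamma,\psi)$ be the space of functions $f$ on the upper half-plane, holomorphic there and at all cusps, with $f(\gamma z)=\psi(d)j(\gamma,z)^3f(z)$ for all $\gamma=\left(\begin{smallmatrix}*&*\\ *&d\end{smallmatrix}\right)\in\Gamma$. On $M_{3/2}(\Gamma_0(N),\psi)$ let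 $T(p^2)$ be Shimura's Hecke operator $$(f|T(p^2))(z)=p^{-2}\sum_{\delta}\psi(a_\delta)\,j(\delta,z)^{-3}f\!\left(\frac{\delta z}{p^2}\right),$$ where $\delta=\left(\begin{smallmatrix}a_\delta&b_\delta\\ c_\delta&d_\delta\end{smallmatrix}\right)$ runs over representatives of $\{\gamma\in\Gamma_0(N):p^2\mid b_\gamma\}\backslash\Gamma_0(N)$; for $M\mid N$ let $T(p^2)$ act on $$M_{3/2}(\Gamma_0(N)\cap\Gamma_1(M),\psi)=\bigoplus_{\chi\bmod M}M_{3/2}(\Gamma_0(N),\chi\psi)$$ as the direct sum of these operators over all Dirichlet characters $\chi$ modulo $M$. **Theorem.** Let $aL+\nu$ be a ternary coset of conductor $a$, let $p$ be a prime with $p\nmid 4N_La^2$, and let $T(p^2)$ be the Hecke operator on $M_{3/2}(\Gamma_0(4N_La^2)\cap\Gamma_1(a),\chi_{4d_L})$, where $\chi_{4d_L}=\left(\frac{4d_L}{\cdot}\right)$. All the theta series to which $T(p^2)$ is applied below lie in this space. 1. The set $R_p(aL+\nu)$ has exactly $p+1$ elements, and $$\Theta_{aL+\nu}\,|\,T(p^2)=\sum_{aK+\mu\in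 R_p(aL+\nu)}\Theta_{aK+\mu}.$$ 2. Let $\{aL_i+\nu_i\}_{1\le i\le h}$ be a system of representatives of the proper classes in $\mathrm{gen}^+(aL+\nu)$, let $$\pi_{ij}(p^2)=\left|\{aK+\mu\in R_p(aL_i+\nu_i): aK+\mu\in\mathrm{cls}^+(aL_j+\bar p\nu_j)\}\right|,$$ and for $k\ge 0$ let $\Theta_{G_k}$ be the column vector with entries $\Theta_{aL_i+\bar p^k\nu_i}$, $1\le i\le h$. Then for every integer $k\ge 0$, with $T(p^2)$ acting entrywise, $$\Theta_{G_k}\,|\,T(p^2)=\big(\pi_{ij}(p^2)\big)\,\Theta_{G_{k+1}}.$$ -/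

import Mathlib

open scoped TensorProduct Matrix MatrixGroups UpperHalfPlane Manifold ModularForm

noncomputable section

/-! ### Lattice cosets on a rational quadratic space -/

section Cosets

variable {V : Type*} [AddCommGroup V] [Module ℚ V]

/-- `L` is an integral lattice on the quadratic space `(V, B)`. -/
structure IsIntegralLattice (B : LinearMap.BilinForm ℚ V) (L : Submodule ℤ V) : Prop where
  fg : L.FG
  span_eq_top : Submodule.span ℚ (L : Set V) = ⊤
  integral : ∀ x ∈ L, ∀ y ∈ L, ∃ m : ℤ, B x y = m

/-- `aL + ν` is a lattice coset of conductor `a`: `L` is an integral lattice on `V`, `ν ∈ L`, and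
`a` is the smallest positive integer `m` such that `m ν ∈ aL`. -/
structure IsCoset (B : LinearMap.BilinForm ℚ V) (a : ℕ) (L : Submodule ℤ V) (ν : V) : Prop where
  lattice : IsIntegralLattice B L
  mem : ν ∈ L
  conductor : IsLeast {m : ℕ | 0 < m ∧ ∃ x ∈ L, m • ν = a • x} a

/-- The subset `aL + ν` of `V`. -/
def cosetSet (a : ℕ) (L : Submodule ℤ V) (ν : V) : Set V :=
  {x | ∃ y ∈ L, x = a • y + ν}

/-- The localization `V_q = ℚ_q ⊗ V`. -/
abbrev LocalSpace (V : Type*) [AddCommGroup V] [Module ℚ V] (q : ℕ) [Fact q.Prime] : Type _ :=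
  ℚ_[q] ⊗[ℚ] V

/-- The localization `L_q`, i.e. the `ℤ_q`-span of `L` in `V_q`. -/
def localLattice (q : ℕ) [Fact q.Prime] (L : Submodule ℤ V) :
    Submodule ℤ_[q] (LocalSpace V q) :=
  Submodule.span ℤ_[q] ((fun x : V => (1 : ℚ_[q]) ⊗ₜ[ℚ] x) '' (L : Set V))

/-- The local coset `aL_q + ν` in `V_q`. -/
def localCoset (q : ℕ) [Fact q.Prime] (a : ℕ) (L : Submodule ℤ V) (ν : V) :
    Set (LocalSpace V q) :=
  {x | ∃ y ∈ localLattice q L, x = a • y + (1 : ℚ_[q]) ⊗ₜ[ℚ] ν}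

/-- `σ` lies in the special orthogonal group `O⁺(W)` of the symmetric bilinear space `(W, B)`. -/
def IsRotation {F W : Type*} [Field F] [AddCommGroup W] [Module F W]
    (B : LinearMap.BilinForm F W) (σ : W ≃ₗ[F] W) : Prop :=
  (∀ x y, B (σ x) (σ y) = B x y) ∧ LinearMap.det (σ : W →ₗ[F] W) = 1

/-- The proper class of a subset `S` of `V`: its orbit under `O⁺(V)`. -/
def properClass (B : LinearMap.BilinForm ℚ V) (S : Set V) : Set (Set V) :=
  {S' | ∃ σ : V ≃ₗ[ℚ] V, IsRotation B σ ∧ S' = σ '' S}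

/-- The proper genus of `aL + ν`: the cosets `aK + μ` for which there are `σ_q ∈ O⁺(V_q)` with
`σ_q (aL_q + ν) = aK_q + μ` for every prime `q`. (As `K_q = L_q` and `ν ∈ L_q = aL_q` for almost
all `q`, the family `(σ_q)` automatically satisfies `σ_q L_q = L_q` for almost all `q`, so this is
the orbit of `aL + ν` under the adelic group.) -/
def properGenus (B : LinearMap.BilinForm ℚ V) (a : ℕ) (L : Submodule ℤ V) (ν : V) :
    Set (Set V) :=
  {S | ∃ (K : Submodule ℤ V) (μ : V), IsCoset B a K μ ∧ S = cosetSet a K μ ∧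
    ∀ (q : ℕ) [Fact q.Prime], ∃ σ : LocalSpace V q ≃ₗ[ℚ_[q]] LocalSpace V q,
      IsRotation (B.baseChange ℚ_[q]) σ ∧ σ '' localCoset q a L ν = localCoset q a K μ}

/-- The set `R_p(aL + ν)` of `p`-neighbours of `aL + ν`, where `pbar` is an inverse of `p`
modulo `a`. -/
def neighbours (B : LinearMap.BilinForm ℚ V) (p : ℕ) [Fact p.Prime] (pbar : ℤ) (a : ℕ)
    (L : Submodule ℤ V) (ν : V) : Set (Set V) :=
  {S | ∃ (K : Submodule ℤ V) (μ : V), IsCoset B a K μ ∧ S = cosetSet a K μ ∧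
    (∀ (q : ℕ) [Fact q.Prime], q ≠ p → localCoset q a K μ = localCoset q a L (pbar • ν)) ∧
    (localLattice p L ⊓ localLattice p K).toAddSubgroup.relIndex
      (localLattice p L).toAddSubgroup = p ∧
    (localLattice p L ⊓ localLattice p K).toAddSubgroup.relIndex
      (localLattice p K).toAddSubgroup = p ∧
    Submodule.span ℤ_[p] {t : ℚ_[p] | ∃ x ∈ localLattice p K, t = B.baseChange ℚ_[p] x x} =
      LinearMap.range (Algebra.linearMap ℤ_[p] ℚ_[p])}

/-- `c_p(aL + ν, aM + ξ)`: the number of `p`-neighbours of `aL + ν` in the proper class of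
`S = aM + ξ`. -/
def neighbourCount (B : LinearMap.BilinForm ℚ V) (p : ℕ) [Fact p.Prime] (pbar : ℤ) (a : ℕ)
    (L : Submodule ℤ V) (ν : V) (S : Set V) : ℕ :=
  {T ∈ neighbours B p pbar a L ν | T ∈ properClass B S}.ncard

/-- The theta series `∑_{x ∈ S} e^{2πi Q(x) z}` with `Q(x) = B(x, x)`. -/
def thetaSeries (B : LinearMap.BilinForm ℚ V) (S : Set V) (z : ℍ) : ℂ :=
  ∑' x : S, Complex.exp (2 * Real.pi * Complex.I * ((B x x : ℚ) : ℂ) * z)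

/-- The cosets `aL_i + ν_i` represent the proper classes in `gen⁺(aL + ν)`, each exactly once. -/
def IsClassRepresentatives (B : LinearMap.BilinForm ℚ V) (a : ℕ) (L : Submodule ℤ V) (ν : V)
    {h : ℕ} (Li : Fin h → Submodule ℤ V) (νi : Fin h → V) : Prop :=
  (∀ i, IsCoset B a (Li i) (νi i) ∧ cosetSet a (Li i) (νi i) ∈ properGenus B a L ν) ∧
  ∀ S ∈ properGenus B a L ν, ∃! i, S ∈ properClass B (cosetSet a (Li i) (νi i))

/-- The matrix `(π_ij(p²))` with `π_ij(p²) = c_p(aL_i + ν_i, aL_j + pbar ν_j)`. -/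
def neighbourMatrix (B : LinearMap.BilinForm ℚ V) (p : ℕ) [Fact p.Prime] (pbar : ℤ) (a : ℕ)
    {h : ℕ} (Li : Fin h → Submodule ℤ V) (νi : Fin h → V) : Matrix (Fin h) (Fin h) ℂ :=
  Matrix.of fun i j =>
    (neighbourCount B p pbar a (Li i) (νi i) (cosetSet a (Li j) (pbar • νi j)) : ℂ)

/-- The vector `Θ_{G_k}(z)` with entries `Θ_{aL_i + pbar^k ν_i}(z)`. -/
def thetaVector (B : LinearMap.BilinForm ℚ V) (pbar : ℤ) (a : ℕ) {h : ℕ}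
    (Li : Fin h → Submodule ℤ V) (νi : Fin h → V) (k : ℕ) (z : ℍ) : Fin h → ℂ :=
  fun i => thetaSeries B (cosetSet a (Li i) (pbar ^ k • νi i)) z

end Cosets

/-- The level of a lattice with Gram matrix `A`: the smallest positive integer `N` such that
`N A⁻¹` has integral entries. -/
def gramLevel {n : ℕ} (A : Matrix (Fin n) (Fin n) ℤ) : ℕ :=
  sInf {N : ℕ | 0 < N ∧ ∃ C : Matrix (Fin n) (Fin n) ℤ,
    (N : ℚ) • (A.map (Int.cast : ℤ → ℚ))⁻¹ = C.map (Int.cast : ℤ → ℚ)}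

/-! ### Modular forms of half-integral weight and the Hecke operators `T(p²)` -/

/-- `θ(z) = ∑_{n ∈ ℤ} e^{2πi n² z}`. -/
def shimuraTheta (z : ℍ) : ℂ := jacobiTheta (2 * z)

/-- The automorphy factor `j(γ, z) = θ(γz) / θ(z)` of weight `1/2`, for `γ ∈ Γ₀(4)`
(the function `θ` has no zeros on `ℍ`). -/
def thetaFactor (γ : SL(2, ℤ)) (z : ℍ) : ℂ := shimuraTheta (γ • z) / shimuraTheta z

/-- The quadratic character `χ_{4D}(m) = (4D / m)`, for `D > 0` and `m ≠ 0`. (For positive `4D` the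
Kronecker symbol is even in `m`, and both sides vanish if `m` is even.) -/
def chiFour (D : ℤ) (m : ℤ) : ℂ := (jacobiSym (4 * D) m.natAbs : ℂ)

/-- `f ∈ M_{k/2}(Γ, ψ)`, for `Γ ⊆ Γ₀(4)`: `f` is holomorphic on `ℍ`,
`f(γz) = ψ(d) j(γ, z)^k f(z)` for all `γ = (a, b; c, d) ∈ Γ`, and `f` is holomorphic at all cusps,
i.e. for each `ρ = (a, b; c, d) ∈ SL₂(ℤ)` the function `f(ρz)² (cz + d)^{-k}` is bounded as
`Im z → ∞`. -/
structure IsHalfIntegralForm (Γ : Subgroup SL(2, ℤ)) (k : ℕ) (ψ : ℤ → ℂ) (f : ℍ → ℂ) : Prop where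
  holo : MDifferentiable 𝓘(ℂ) 𝓘(ℂ) f
  transform : ∀ γ ∈ Γ, ∀ z : ℍ, f (γ • z) = ψ (γ 1 1) * thetaFactor γ z ^ k * f z
  bdd_at_cusps : ∀ ρ : SL(2, ℤ),
    UpperHalfPlane.IsBoundedAtImInfty ((fun z => f z ^ 2) ∣[(k : ℤ)] ρ)

/-- The subgroup `Γ₀(N) ∩ ξ⁻¹ Γ₀(N) ξ` of `Γ₀(N)`, where `ξ = diag(1, p²)`: the elements whose upper
right entry is divisible by `p²`. -/
def heckeSubgroup (N p : ℕ) : Subgroup (CongruenceSubgroup.Gamma0 N) where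
  carrier := {γ | ((p : ℤ) ^ 2) ∣ (γ : SL(2, ℤ)) 0 1}
  one_mem' := by simp
  mul_mem' := by
    intro x y hx hy
    simp only [Set.mem_ofPred_eq, Subgroup.coe_mul, Matrix.SpecialLinearGroup.coe_mul,
      Matrix.mul_apply, Fin.sum_univ_two] at *
    exact dvd_add (Dvd.dvd.mul_left hy _) (Dvd.dvd.mul_right hx _)
  inv_mem' := by
    intro x hx
    simpa [Matrix.SpecialLinearGroup.coe_inv, Matrix.adjugate_fin_two] using hx

/-- Shimura's Hecke operator `T(p²)` on `M_{k/2}(Γ₀(N), ψ)`, given by the double coset of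
`ξ = (diag(1, p²), p^{1/2})`. Let `Δ₀` be the group of pairs `γ* = (γ, j(γ, ·))` with `γ ∈ Γ₀(N)`.
As `δ` runs over representatives of the right cosets `(Γ₀(N) ∩ ξ⁻¹ Γ₀(N) ξ) δ` in `Γ₀(N)`, one has
`Δ₀ ξ Δ₀ = ⊔ Δ₀ (ξ δ*)`, and `ξ δ*` has matrix `(a_δ, b_δ; p² c_δ, p² d_δ)` and automorphy
factor `p^{1/2} j(δ, z)`. Hence
`p^{k/2 - 2} ∑_δ ψ(a_δ) f | [ξ δ*]_k = p^{-2} ∑_δ ψ(a_δ) j(δ, z)^{-k} f(δz / p²)`.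
The sum is finite, and independent of the choice of representatives for `f ∈ M_{k/2}(Γ₀(N), ψ)`. -/
def shimuraHecke (N k p : ℕ) (ψ : ℤ → ℂ) (f : ℍ → ℂ) (z : ℍ) : ℂ :=
  ((p : ℂ) ^ 2)⁻¹ * ∑ᶠ c : Quotient (QuotientGroup.rightRel (heckeSubgroup N p)),
    let δ : SL(2, ℤ) := (Quotient.out c : CongruenceSubgroup.Gamma0 N)
    ψ (δ 0 0) * (thetaFactor δ z ^ k)⁻¹ *
      f (UpperHalfPlane.ofComplex (((δ • z : ℍ) : ℂ) / (p : ℂ) ^ 2))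

/-- The product of a Dirichlet character modulo `M` with `ψ`, as a function on the integers. -/
def twist {M : ℕ} (χ : DirichletCharacter ℂ M) (ψ : ℤ → ℂ) : ℤ → ℂ := fun m => χ m * ψ m

/-- The family `(f_χ)` is a decomposition `f = ∑_χ f_χ` with `f_χ ∈ M_{k/2}(Γ₀(N), χψ)`, where `χ`
runs over all Dirichlet characters modulo `M`. -/
def IsNebentypusDecomposition (N M k : ℕ) (ψ : ℤ → ℂ) (f : ℍ → ℂ)
    (fam : DirichletCharacter ℂ M → ℍ → ℂ) : Prop :=
  (∀ χ, IsHalfIntegralForm (CongruenceSubgroup.Gamma0 N) k (twist χ ψ) (fam χ)) ∧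
  ∀ z, f z = ∑ᶠ χ, fam χ z

/-- `f | T(p²) = g`, where `T(p²)` is the Hecke operator on
`M_{k/2}(Γ₀(N) ∩ Γ₁(M), ψ) = ⨁_χ M_{k/2}(Γ₀(N), χψ)` that is the direct sum over the Dirichlet
characters `χ` modulo `M` of Shimura's operators: `f` lies in this space, it has a decomposition
`f = ∑_χ f_χ`, and `g = ∑_χ f_χ | T(p²)` for every such decomposition. -/
def HasHeckeImage (N M k p : ℕ) (ψ : ℤ → ℂ) (f g : ℍ → ℂ) : Prop :=
  IsHalfIntegralForm (CongruenceSubgroup.Gamma0 N ⊓ CongruenceSubgroup.Gamma1 M) k ψ f ∧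
  (∃ fam, IsNebentypusDecomposition N M k ψ f fam) ∧
  ∀ fam, IsNebentypusDecomposition N M k ψ f fam →
    ∀ z, g z = ∑ᶠ χ, shimuraHecke N k p (twist χ ψ) (fam χ) z

end

/-! Shimura's operator is made explicit, and the theorem then becomes an identity between indicator
functions of lattice cosets. Write `N` for the level, `D` for the discriminant and `j` for the
automorphy factor.

The right cosets defining `T(p²)` are represented by `p²` translations and by `p` matrices that
differ by translations by multiples of `p` from one matrix `δ₀` with rows `(pt, β)` and `(4Na², p)`
(`heckeRep_bijective`). Summing over translations detects integrality of `Q`. So `Θ | T(p²)` at `z`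
is the theta sum over the `x` with `px ∈ aL + ν` and `Q(x) ∈ ℤ`, plus `p⁻¹` times an automorphy
factor times the theta sum over the `x` with `px ∈ aL + pν` and `pQ(x) ∈ ℤ`, the latter evaluated at
`w = δ₀ z` (`HasLevel.finsum_shimuraHecke`).

Since `L` is unimodular at `p`, its neighbours `K` correspond to the `p + 1` isotropic lines of a
regular ternary form over `𝔽_p` (`IsGoodPrime.ncard_nbrLattices`). A vector `y` of `p⁻¹L` outside
`L` with `pQ(y) ∈ ℤ` lies in `L + K` for exactly one `K`, and if `Q(y) ∈ ℤ` it lies in exactly one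
`K`. The first fact writes the second weight as the sum of the indicators of `a(L + K) + ν` minus
`p` times that of `aL + ν` (`IsGoodPrime.ind_mul_indInt_p`). Poisson summation, applied twice, moves
these theta sums from `w` back to `z`: `L + K` becomes `L ∩ K`, with a Gauss sum `p` times that of
`L` (`IsGoodPrime.thetaSum_sup`), which cancels `p⁻¹`. The second fact shows that the indicators now
present at `z` add up to those of the `aK + ptν` (`IsGoodPrime.sum_ind_nbr`).

The transformation law itself (`HasLevel.thetaSum_moebius`) is proved for a prime lower right entry,
where the Gauss sum is explicit, and in general by Dirichlet's theorem. The cube of `θ` is the theta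
series of `ℤ³` and obeys the same law, so comparing the two yields `j³` with no evaluation of roots
of unity. Division by `θ³` is legitimate because `θ` has no zeros (`shimuraTheta_ne_zero`).

The locally defined neighbours of `aL + ν` are identified with the `aK + ptν`
(`IsGoodPrime.neighbours_eq`), which gives the first assertion. For the second, level and
discriminant are genus invariants (`HasLevel.of_isLocalIsometry`), so the first computation applies
to each `L_i`. Multiplied by `p`, a neighbouring coset lies in the proper genus, because the
negative of a suitable reflection carries `L` to `K` at `p` (`IsGoodPrime.exists_rotation`). Sorting
the neighbours by class produces the matrix. -/

noncomputable section

/-! ### The exponential `e(t)` on rationals -/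

/-- `e(t) = exp (2πi t)` for rational `t`. -/
def ec (t : ℚ) : ℂ := Complex.exp (2 * Real.pi * Complex.I * (t : ℂ))

lemma ec_add (s t : ℚ) : ec (s + t) = ec s * ec t := by
  simp only [ec, ← Complex.exp_add]; congr 1; push_cast; ring

lemma ec_zero : ec 0 = 1 := by simp [ec]

lemma ec_eq_one_iff (t : ℚ) : ec t = 1 ↔ ∃ m : ℤ, t = m := by
  rw [ec, Complex.exp_eq_one_iff]
  refine exists_congr fun m => ?_
  have h : (2 * Real.pi * Complex.I : ℂ) ≠ 0 := Complex.two_pi_I_ne_zero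
  constructor
  · intro H
    have : (t : ℂ) = m := by
      apply mul_left_cancel₀ h; rw [H]; ring
    exact_mod_cast this
  · rintro rfl; push_cast; ring

lemma ec_int (m : ℤ) : ec m = 1 := (ec_eq_one_iff _).2 ⟨m, rfl⟩

lemma norm_ec (t : ℚ) : ‖ec t‖ = 1 := by
  rw [ec, show (2 * Real.pi * Complex.I * (t : ℂ)) = ((2 * Real.pi * t : ℝ) : ℂ) * Complex.I by
    push_cast; ring]
  exact Complex.norm_exp_ofReal_mul_I _

lemma ec_eq_of_sub {s t : ℚ} (h : ∃ m : ℤ, s - t = m) : ec s = ec t := by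
  have : s = t + (s - t) := by ring
  rw [this, ec_add, (ec_eq_one_iff _).2 h, mul_one]

lemma ec_nat_mul (n : ℕ) (t : ℚ) : ec (n * t) = ec t ^ n := by
  induction n with
  | zero => simp [ec_zero]
  | succ n ih => rw [Nat.cast_succ, add_mul, one_mul, ec_add, ih, pow_succ]

/-- Orthogonality of the additive characters of `ℤ/n`. -/
lemma sum_ec_range (n : ℕ) (hn : n ≠ 0) (t : ℚ) (ht : ∃ m : ℤ, n * t = m) [Decidable (∃ m : ℤ, t = m)] :
    ∑ j ∈ Finset.range n, ec (j * t) = if ∃ m : ℤ, t = m then (n : ℂ) else 0 := by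
  simp only [ec_nat_mul]
  split_ifs with h
  · simp [(ec_eq_one_iff t).2 h]
  · have h1 : ec t ≠ 1 := fun H => h ((ec_eq_one_iff t).1 H)
    rw [geom_sum_eq h1, ← ec_nat_mul, (ec_eq_one_iff _).2 ht, sub_self, zero_div]

section Theta

variable {V : Type*} [AddCommGroup V] [Module ℚ V]

/-! ### Indicators of lattice cosets and transversals -/

open Classical in
/-- The indicator function of the coset `M + h`. -/
def ind (M : Submodule ℤ V) (h x : V) : ℂ := if x - h ∈ M then 1 else 0

lemma ind_of_mem {M : Submodule ℤ V} {h x : V} (H : x - h ∈ M) : ind M h x = 1 := if_pos H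

lemma ind_of_notMem {M : Submodule ℤ V} {h x : V} (H : x - h ∉ M) : ind M h x = 0 := if_neg H

lemma ind_comm (M : Submodule ℤ V) (h x : V) : ind M h x = ind M x h := by
  have : x - h ∈ M ↔ h - x ∈ M := by rw [← neg_sub, M.neg_mem_iff]
  by_cases H : x - h ∈ M
  · rw [ind_of_mem H, ind_of_mem (this.1 H)]
  · rw [ind_of_notMem H, ind_of_notMem (this.not.1 H)]

lemma ind_congr {M M' : Submodule ℤ V} {h h' x x' : V} (H : x - h ∈ M ↔ x' - h' ∈ M') :
    ind M h x = ind M' h' x' := by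
  by_cases H' : x - h ∈ M
  · rw [ind_of_mem H', ind_of_mem (H.1 H')]
  · rw [ind_of_notMem H', ind_of_notMem (H.not.1 H')]

lemma ind_eq_of_sub_mem {M : Submodule ℤ V} {h h' : V} (H : h - h' ∈ M) : ind M h = ind M h' := by
  ext x
  apply ind_congr
  rw [show x - h' = (x - h) + (h - h') by abel]
  exact (M.add_mem_iff_left H).symm

/-- The family `t` is a system of representatives for the cosets of `N` in `M + h`. -/
def IsCosetReps {ι : Type*} [Fintype ι] (t : ι → V) (N M : Submodule ℤ V) (h : V) : Prop :=
  ∀ x, ∑ i, ind N (t i) x = ind M h x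

lemma IsCosetReps.sub_mem {ι : Type*} [Fintype ι] {t : ι → V} {N M : Submodule ℤ V} {h : V}
    (ht : IsCosetReps t N M h) (i : ι) : t i - h ∈ M := by
  by_contra H
  have h1 := ht (t i)
  rw [ind_of_notMem H] at h1
  -- Passing to real parts, a vanishing sum of nonnegative terms has only zero terms; but the `i`-th
  -- one equals `1`.
  have h2 : ∑ j, (ind N (t j) (t i)).re = 0 := by
    rw [← Complex.re_sum, h1, Complex.zero_re]
  rw [Finset.sum_eq_zero_iff_of_nonneg] at h2
  · have := h2 i (Finset.mem_univ _)
    rw [ind_of_mem (by simp)] at this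
    simp at this
  · intro j _
    unfold ind; split_ifs <;> simp

/-- Double counting: both sides equal the sum over the pairs `(i, j)` for which `t i` and `t' j` lie
in the same coset of `N`. -/
lemma IsCosetReps.sum_eq {ι κ : Type*} [Fintype ι] [Fintype κ] {t : ι → V} {t' : κ → V}
    {N M : Submodule ℤ V} {h : V} (ht : IsCosetReps t N M h) (ht' : IsCosetReps t' N M h) (f : V → ℂ)
    (hf : ∀ x y, x - h ∈ M → y - h ∈ M → y - x ∈ N → f y = f x) :
    ∑ i, f (t i) = ∑ j, f (t' j) := by
  calc ∑ i, f (t i) = ∑ i, (∑ j, ind N (t' j) (t i)) * f (t i) := by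
        refine Finset.sum_congr rfl fun i _ => ?_
        rw [ht' (t i), ind_of_mem (ht.sub_mem i), one_mul]
    _ = ∑ j, ∑ i, ind N (t' j) (t i) * f (t i) := by
        simp only [Finset.sum_mul]; exact Finset.sum_comm
    _ = ∑ j, ∑ i, ind N (t i) (t' j) * f (t' j) := by
        refine Finset.sum_congr rfl fun j _ => Finset.sum_congr rfl fun i _ => ?_
        rw [ind_comm]
        by_cases H : t' j - t i ∈ N
        · rw [hf _ _ (ht.sub_mem i) (ht'.sub_mem j) H]
        · rw [ind_of_notMem H, zero_mul, zero_mul]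
    _ = ∑ j, f (t' j) := by
        refine Finset.sum_congr rfl fun j _ => ?_
        rw [← Finset.sum_mul, ht (t' j), ind_of_mem (ht'.sub_mem j), one_mul]

lemma IsCosetReps.add {ι : Type*} [Fintype ι] {t : ι → V} {N M : Submodule ℤ V} {h : V}
    (ht : IsCosetReps t N M h) (g : V) : IsCosetReps (fun i => t i + g) N M (h + g) := by
  intro x
  have := ht (x - g)
  rw [← ind_congr (M := M) (h := h + g) (x := x) (by rw [sub_add_eq_sub_sub_swap])] at this
  rw [← this]
  exact Finset.sum_congr rfl fun i _ => ind_congr (by rw [sub_add_eq_sub_sub_swap])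

/-- Translation by an element of `M` only permutes the cosets of `N` in `M + h`. All evaluations of
character sums and the completion of squares in Gauss sums go through this invariance. -/
lemma IsCosetReps.sum_add {ι : Type*} [Fintype ι] {t : ι → V}
    {N M : Submodule ℤ V} {h : V} (ht : IsCosetReps t N M h) (f : V → ℂ)
    (hf : ∀ x y, x - h ∈ M → y - h ∈ M → y - x ∈ N → f y = f x) {g : V} (hg : g ∈ M) :
    ∑ i, f (t i + g) = ∑ i, f (t i) := by
  refine IsCosetReps.sum_eq (t := fun i => t i + g) ?_ ht f hf
  have h1 := ht.add g
  intro x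
  rw [h1 x]
  exact congrFun (ind_eq_of_sub_mem (by simpa using hg)) x

/-- Allows a phase `e(r Q(x))` that depends only on `x` modulo `N` to be pulled out of a theta sum,
coset by coset. -/
lemma IsCosetReps.ind_mul {ι : Type*} [Fintype ι] {t : ι → V}
    {N M : Submodule ℤ V} {h : V} (ht : IsCosetReps t N M h) (f : V → ℂ)
    (hf : ∀ x y, x - h ∈ M → y - h ∈ M → y - x ∈ N → f y = f x) (x : V) :
    f x * ind M h x = ∑ i, f (t i) * ind N (t i) x := by
  rw [← ht x, Finset.mul_sum]
  refine Finset.sum_congr rfl fun i _ => ?_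
  by_cases H : x - t i ∈ N
  · by_cases H' : x - h ∈ M
    · rw [hf _ _ (ht.sub_mem i) H' H]
    · have h1 := ht x
      rw [ind_of_notMem H'] at h1
      have h2 : ∑ j, (ind N (t j) x).re = 0 := by
        rw [← Complex.re_sum, h1, Complex.zero_re]
      rw [Finset.sum_eq_zero_iff_of_nonneg] at h2
      · have := h2 i (Finset.mem_univ _)
        rw [ind_of_mem H] at this
        simp at this
      · intro j _
        unfold ind; split_ifs <;> simp
  · rw [ind_of_notMem H, mul_zero, mul_zero]

lemma isCosetReps_quotient {N M : Submodule ℤ V} (hNM : N ≤ M)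
    [Fintype (M ⧸ N.submoduleOf M)] (h : V) :
    IsCosetReps (fun q : M ⧸ N.submoduleOf M => (q.out : V) + h) N M h := by
  classical
  intro x
  by_cases H : x - h ∈ M
  · rw [ind_of_mem H]
    have key : ∀ q : M ⧸ N.submoduleOf M, ind N ((q.out : V) + h) x =
        if q = Submodule.Quotient.mk ⟨x - h, H⟩ then 1 else 0 := by
      intro q
      have : q = Submodule.Quotient.mk ⟨x - h, H⟩ ↔ x - ((q.out : V) + h) ∈ N := by
        conv_lhs => rw [← Quotient.out_eq q]
        change (Submodule.Quotient.mk (q.out) : M ⧸ N.submoduleOf M) = _ ↔ _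
        rw [eq_comm, Submodule.Quotient.eq]
        change x - h - (q.out : V) ∈ N ↔ _
        rw [sub_sub, add_comm h]
      simp [ind, this]
    simp [key]
  · rw [ind_of_notMem H]
    refine Finset.sum_eq_zero fun q _ => ind_of_notMem fun H' => H ?_
    have := M.add_mem (hNM H') q.out.2
    convert this using 1
    dsimp only
    abel

lemma IsCosetReps.card_ne_zero {ι : Type*} [Fintype ι] {t : ι → V} {N M : Submodule ℤ V} {h : V}
    (ht : IsCosetReps t N M h) : (Fintype.card ι : ℂ) ≠ 0 := by
  have h1 := ht h
  rw [ind_of_mem (by simp)] at h1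
  intro H
  have : IsEmpty ι := Fintype.card_eq_zero_iff.1 (by exact_mod_cast H)
  simp at h1

/-! ### Full lattices -/

/-- `M` is a full lattice in `V`. -/
def IsFull (M : Submodule ℤ V) : Prop := M.FG ∧ Submodule.span ℚ (M : Set V) = ⊤

lemma exists_nat_smul_mem_of_mem_span {N : Submodule ℤ V} {x : V}
    (hx : x ∈ Submodule.span ℚ (N : Set V)) : ∃ k : ℕ, 0 < k ∧ k • x ∈ N := by
  induction hx using Submodule.span_induction with
  | mem x h => exact ⟨1, one_pos, by simpa using h⟩
  | zero => exact ⟨1, one_pos, by simp⟩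
  | add x y _ _ hx hy =>
    obtain ⟨k, hk, hkx⟩ := hx
    obtain ⟨l, hl, hly⟩ := hy
    refine ⟨k * l, Nat.mul_pos hk hl, ?_⟩
    rw [smul_add]
    refine N.add_mem ?_ ?_
    · rw [mul_comm, mul_smul]; exact N.smul_of_tower_mem l hkx
    · rw [mul_smul]; exact N.smul_of_tower_mem k hly
  | smul a x _ hx =>
    obtain ⟨k, hk, hkx⟩ := hx
    refine ⟨a.den * k, Nat.mul_pos a.den_pos hk, ?_⟩
    have : (a.den * k) • a • x = a.num • (k • x) := by
      rw [← Nat.cast_smul_eq_nsmul ℚ (a.den * k), smul_smul, ← Int.cast_smul_eq_zsmul ℚ a.num,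
        ← Nat.cast_smul_eq_nsmul ℚ k, smul_smul]
      congr 1
      have := Rat.den_mul_eq_num a
      push_cast
      rw [← this]; ring
    rw [this]
    exact N.smul_mem _ hkx

lemma exists_nat_smul_mem {M N : Submodule ℤ V} (hM : M.FG)
    (hN : Submodule.span ℚ (N : Set V) = ⊤) : ∃ k : ℕ, 0 < k ∧ ∀ x ∈ M, k • x ∈ N := by
  classical
  obtain ⟨s, rfl⟩ := hM
  induction s using Finset.induction_on with
  | empty => exact ⟨1, one_pos, by simp⟩
  | insert a s _ ih =>
    obtain ⟨k, hk, hks⟩ := ih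
    obtain ⟨l, hl, hla⟩ := exists_nat_smul_mem_of_mem_span (N := N) (x := a) (by simp [hN])
    refine ⟨k * l, Nat.mul_pos hk hl, fun x hx => ?_⟩
    rw [Finset.coe_insert] at hx
    induction hx using Submodule.span_induction with
    | mem x h =>
      rcases h with rfl | h
      · rw [mul_smul]; exact N.smul_of_tower_mem k hla
      · rw [mul_comm, mul_smul]
        exact N.smul_of_tower_mem l (hks _ (Submodule.subset_span h))
    | zero => simp
    | add x y _ _ hx hy => rw [smul_add]; exact N.add_mem hx hy
    | smul a x _ hx => rw [smul_comm]; exact N.smul_mem _ hx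

/-- The quotient is finitely generated and killed by a positive integer, hence finite. -/
lemma exists_isCosetReps {N M : Submodule ℤ V} (hNM : N ≤ M) (hM : M.FG)
    (hN : Submodule.span ℚ (N : Set V) = ⊤) (h : V) :
    ∃ (n : ℕ) (t : Fin n → V), IsCosetReps t N M h := by
  obtain ⟨k, hk, hkM⟩ := exists_nat_smul_mem hM hN
  have : Module.Finite ℤ M := Module.Finite.iff_fg.2 hM
  have hfin : Finite (M ⧸ N.submoduleOf M) := by
    apply Module.finite_of_fg_torsion
    intro q
    obtain ⟨x, rfl⟩ := Submodule.Quotient.mk_surjective _ q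
    refine ⟨⟨k, mem_nonZeroDivisors_of_ne_zero (by exact_mod_cast hk.ne')⟩, ?_⟩
    change (k : ℤ) • Submodule.Quotient.mk x = (0 : M ⧸ N.submoduleOf M)
    rw [← Submodule.Quotient.mk_smul, Submodule.Quotient.mk_eq_zero]
    change (k : ℤ) • (x : V) ∈ N
    simpa using hkM x x.2
  have := Fintype.ofFinite (M ⧸ N.submoduleOf M)
  refine ⟨_, fun i => (((Fintype.equivFin (M ⧸ N.submoduleOf M)).symm i).out : V) + h, fun x => ?_⟩
  rw [← isCosetReps_quotient hNM h x]
  exact Equiv.sum_comp (Fintype.equivFin (M ⧸ N.submoduleOf M)).symm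
    (fun q => ind N ((q.out : V) + h) x)

end Theta

section Theta

variable {V : Type*} [AddCommGroup V] [Module ℚ V]

/-! ### Theta sums attached to weight functions -/

/-- `e(Q(x) z)`. -/
def qexp (B : LinearMap.BilinForm ℚ V) (x : V) (z : ℂ) : ℂ :=
  Complex.exp (2 * Real.pi * Complex.I * ((B x x : ℚ) : ℂ) * z)

/-- `∑ φ(x) e(Q(x) z)`, the sum being over all `x` in `V`. -/
def thetaSum (B : LinearMap.BilinForm ℚ V) (φ : V → ℂ) (z : ℂ) : ℂ := ∑' x, φ x * qexp B x z

/-- The theta sum of `φ` converges absolutely on the upper half-plane. -/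
def ThetaSummable (B : LinearMap.BilinForm ℚ V) (φ : V → ℂ) : Prop :=
  ∀ z : ℂ, 0 < z.im → Summable fun x => φ x * qexp B x z

/-- The dual of `M` for the bilinear form `2B`. -/
def dualTwo (B : LinearMap.BilinForm ℚ V) (M : Submodule ℤ V) : Submodule ℤ V where
  carrier := {y | ∀ x ∈ M, ∃ m : ℤ, 2 * B x y = m}
  add_mem' := by
    intro y y' hy hy' x hx
    obtain ⟨m, hm⟩ := hy x hx
    obtain ⟨m', hm'⟩ := hy' x hx
    exact ⟨m + m', by rw [map_add, mul_add, hm, hm']; push_cast; rfl⟩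
  zero_mem' := fun x _ => ⟨0, by simp⟩
  smul_mem' := by
    intro c y hy x hx
    obtain ⟨m, hm⟩ := hy x hx
    exact ⟨c * m, by rw [map_zsmul, zsmul_eq_mul, mul_left_comm, hm]; push_cast; rfl⟩

lemma mem_dualTwo {B : LinearMap.BilinForm ℚ V} {M : Submodule ℤ V} {y : V} :
    y ∈ dualTwo B M ↔ ∀ x ∈ M, ∃ m : ℤ, 2 * B x y = m := Iff.rfl

variable {B : LinearMap.BilinForm ℚ V}

lemma ThetaSummable.add {φ ψ : V → ℂ} (hφ : ThetaSummable B φ) (hψ : ThetaSummable B ψ) :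
    ThetaSummable B (fun x => φ x + ψ x) := fun z hz => by
  simpa only [add_mul] using (hφ z hz).add (hψ z hz)

lemma ThetaSummable.const_mul {φ : V → ℂ} (hφ : ThetaSummable B φ) (c : ℂ) :
    ThetaSummable B (fun x => c * φ x) := fun z hz => by
  simpa only [mul_assoc] using (hφ z hz).mul_left c

lemma ThetaSummable.sum {ι : Type*} {s : Finset ι} {φ : ι → V → ℂ}
    (hφ : ∀ i ∈ s, ThetaSummable B (φ i)) : ThetaSummable B (fun x => ∑ i ∈ s, φ i x) :=
  fun z hz => by
    simpa only [Finset.sum_mul] using summable_sum fun i hi => hφ i hi z hz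

lemma ThetaSummable.of_norm_le {φ ψ : V → ℂ} (hφ : ThetaSummable B φ) (C : ℝ)
    (h : ∀ x, ‖ψ x‖ ≤ C * ‖φ x‖) : ThetaSummable B ψ := fun z hz => by
  refine Summable.of_norm_bounded ((hφ z hz).norm.mul_left C) fun x => ?_
  rw [norm_mul, norm_mul, ← mul_assoc]
  exact mul_le_mul_of_nonneg_right (h x) (norm_nonneg _)

lemma thetaSum_add {φ ψ : V → ℂ} (hφ : ThetaSummable B φ) (hψ : ThetaSummable B ψ) {z : ℂ}
    (hz : 0 < z.im) :
    thetaSum B (fun x => φ x + ψ x) z = thetaSum B φ z + thetaSum B ψ z := by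
  simp only [thetaSum, add_mul]
  exact (hφ z hz).tsum_add (hψ z hz)

lemma thetaSum_const_mul (φ : V → ℂ) (c : ℂ) (z : ℂ) :
    thetaSum B (fun x => c * φ x) z = c * thetaSum B φ z := by
  simp only [thetaSum, mul_assoc, tsum_mul_left]

lemma thetaSum_sum {ι : Type*} {s : Finset ι} {φ : ι → V → ℂ}
    (hφ : ∀ i ∈ s, ThetaSummable B (φ i)) {z : ℂ} (hz : 0 < z.im) :
    thetaSum B (fun x => ∑ i ∈ s, φ i x) z = ∑ i ∈ s, thetaSum B (φ i) z := by
  simp only [thetaSum, Finset.sum_mul]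
  exact Summable.tsum_finsetSum fun i hi => hφ i hi z hz

lemma qexp_add (x : V) (z w : ℂ) : qexp B x (z + w) = qexp B x z * qexp B x w := by
  simp only [qexp, mul_add, Complex.exp_add]

lemma qexp_ratCast (x : V) (r : ℚ) : qexp B x r = ec (B x x * r) := by
  simp only [qexp, ec]; push_cast; ring_nf

lemma thetaSum_add_rat (φ : V → ℂ) (z : ℂ) (r : ℚ) :
    thetaSum B φ (z + r) = thetaSum B (fun x => ec (B x x * r) * φ x) z := by
  simp only [thetaSum, qexp_add, qexp_ratCast]
  exact tsum_congr fun x => by ring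

/-- Substitution `x ↦ r x`. As sums run over all of `V`, rescaling the variable by a square is the
same as rescaling the weight. -/
lemma thetaSum_smul (φ : V → ℂ) (z : ℂ) {r : ℚ} (hr : r ≠ 0) :
    thetaSum B φ ((r : ℂ) ^ 2 * z) = thetaSum B (fun x => φ (r⁻¹ • x)) z := by
  unfold thetaSum
  rw [← (LinearEquiv.smulOfNeZero ℚ V r hr).toEquiv.tsum_eq (fun x => φ (r⁻¹ • x) * qexp B x z)]
  refine tsum_congr fun x => ?_
  simp only [LinearEquiv.coe_toEquiv, LinearEquiv.smulOfNeZero_apply]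
  rw [inv_smul_smul₀ hr]
  congr 1
  simp only [qexp, map_smul, LinearMap.smul_apply, smul_eq_mul]
  congr 1
  push_cast
  ring

/-! ### One-dimensional Gaussian sums -/

/-- `e(q (n + h)² z)`. -/
def gaussTerm (q h : ℚ) (z : ℂ) (n : ℤ) : ℂ :=
  Complex.exp (2 * Real.pi * Complex.I * ((q * (n + h) ^ 2 : ℚ) : ℂ) * z)

lemma gaussTerm_eq (q h : ℚ) (z : ℂ) (n : ℤ) : gaussTerm q h z n =
    Complex.exp (2 * Real.pi * Complex.I * (q * h ^ 2) * z) *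
      jacobiTheta₂_term n (2 * q * h * z) (2 * q * z) := by
  rw [gaussTerm, jacobiTheta₂_term, ← Complex.exp_add]
  congr 1
  push_cast
  ring

lemma im_two_mul_rat_mul {q : ℚ} (hq : 0 < q) {z : ℂ} (hz : 0 < z.im) :
    0 < (2 * (q : ℂ) * z).im := by
  have : (2 * (q : ℂ) * z) = ((2 * q : ℝ) : ℂ) * z := by push_cast; ring
  rw [this, Complex.im_ofReal_mul]
  have : (0 : ℝ) < q := by exact_mod_cast hq
  positivity

lemma summable_gaussTerm {q : ℚ} (hq : 0 < q) (h : ℚ) {z : ℂ} (hz : 0 < z.im) :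
    Summable (gaussTerm q h z) := by
  rw [funext (gaussTerm_eq q h z)]
  exact ((summable_jacobiTheta₂_term_iff _ _).2 (im_two_mul_rat_mul hq hz)).mul_left _

lemma tsum_gaussTerm (q h : ℚ) (z : ℂ) : ∑' n, gaussTerm q h z n =
    Complex.exp (2 * Real.pi * Complex.I * (q * h ^ 2) * z) *
      jacobiTheta₂ (2 * q * h * z) (2 * q * z) := by
  simp only [gaussTerm_eq, tsum_mul_left]; rfl

lemma im_neg_one_div {z : ℂ} (hz : 0 < z.im) : 0 < (-1 / z).im := by
  have h0 : z ≠ 0 := by rintro rfl; simp at hz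
  rw [neg_div, Complex.neg_im, one_div, Complex.inv_im, neg_div, neg_neg]
  exact div_pos hz (Complex.normSq_pos.2 h0)

/-- The functional equation of `jacobiTheta₂`, arranged so that the constant depends on `q` alone
and the square root on `Z` alone. This keeps the constant uniform in `h` and `Z`. -/
lemma tsum_gaussTerm_inv {q : ℚ} (hq : 0 < q) (h : ℚ) {Z : ℂ} (hZ : 0 < Z.im) :
    ∑' n, gaussTerm q h (-1 / Z) n = ((2 * q : ℝ) : ℂ) ^ (-1 / 2 : ℂ) *
      ((Complex.I / Z) ^ (1 / 2 : ℂ))⁻¹ * ∑' m : ℤ, ec (h * m) * gaussTerm (1 / (4 * q)) 0 Z m := by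
  have hq' : (q : ℂ) ≠ 0 := by exact_mod_cast hq.ne'
  have hZ0 : Z ≠ 0 := by rintro rfl; simp at hZ
  have hIZ : Complex.I / Z ≠ 0 := div_ne_zero Complex.I_ne_zero hZ0
  rw [tsum_gaussTerm, jacobiTheta₂_functional_equation]
  have e1 : -Complex.I * (2 * q * (-1 / Z)) = ((2 * q : ℝ) : ℂ) * (Complex.I / Z) := by
    push_cast; field_simp
  -- The principal branches multiply because `2 * q` is a positive real number.
  have e2 : (((2 * q : ℝ) : ℂ) * (Complex.I / Z)) ^ (1 / 2 : ℂ) =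
      ((2 * q : ℝ) : ℂ) ^ (1 / 2 : ℂ) * (Complex.I / Z) ^ (1 / 2 : ℂ) := by
    have hp : (0 : ℝ) < 2 * q := by
      have : (0 : ℝ) < q := by exact_mod_cast hq
      positivity
    have hp' : ((2 * q : ℝ) : ℂ) ≠ 0 := by exact_mod_cast hp.ne'
    rw [Complex.cpow_def_of_ne_zero (mul_ne_zero hp' hIZ), Complex.cpow_def_of_ne_zero hp',
      Complex.cpow_def_of_ne_zero hIZ, Complex.log_ofReal_mul hp hIZ, ← Complex.exp_add,
      ← Complex.ofReal_log hp.le]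
    congr 1; ring
  have e3 : (-1 / 2 : ℂ) = -(1 / 2) := by ring
  have e4 : (2 * q * h * (-1 / Z)) / (2 * q * (-1 / Z)) = (h : ℂ) := by field_simp
  have e5 : -1 / (2 * q * (-1 / Z)) = 2 * ((1 / (4 * q) : ℚ) : ℂ) * Z := by
    push_cast; field_simp; ring
  rw [e1, e2, e3, e4, e5, Complex.cpow_neg]
  have e6 : ∑' m : ℤ, ec (h * m) * gaussTerm (1 / (4 * q)) 0 Z m =
      jacobiTheta₂ h (2 * ((1 / (4 * q) : ℚ) : ℂ) * Z) := by
    refine tsum_congr fun m => ?_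
    rw [ec, gaussTerm, jacobiTheta₂_term, ← Complex.exp_add]
    congr 1; push_cast; ring
  rw [e6]
  -- The Gaussian prefactor of the shifted sum cancels the exponential in the functional equation.
  have e7 : Complex.exp (2 * Real.pi * Complex.I * (q * h ^ 2) * (-1 / Z)) *
      Complex.exp (-Real.pi * Complex.I * (2 * q * h * (-1 / Z)) ^ 2 / (2 * q * (-1 / Z))) = 1 := by
    rw [← Complex.exp_add, ← Complex.exp_zero]
    congr 1; field_simp; ring
  rw [one_div, mul_inv]
  linear_combination (((2 * q : ℝ) : ℂ) ^ (1 / 2 : ℂ))⁻¹ * ((Complex.I / Z) ^ (1 / 2 : ℂ))⁻¹ *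
    jacobiTheta₂ h (2 * ((1 / (4 * q) : ℚ) : ℂ) * Z) * e7

/-! ### Orthogonal lattices -/

lemma summable_and_tsum_of_prod_three {f : V → ℂ} {f0 f1 f2 : ℤ → ℂ} {g : ℤ × ℤ × ℤ → V}
    (hg : Function.Injective g) (h : ∀ n, f (g n) = f0 n.1 * (f1 n.2.1 * f2 n.2.2))
    (hf : ∀ x, x ∉ Set.range g → f x = 0) (h0 : Summable f0) (h1 : Summable f1)
    (h2 : Summable f2) :
    Summable f ∧ ∑' x, f x = (∑' n, f0 n) * ((∑' n, f1 n) * ∑' n, f2 n) := by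
  have h12 := summable_mul_of_summable_norm h1.norm h2.norm
  have h012 := summable_mul_of_summable_norm h0.norm h12.norm
  constructor
  · rw [← hg.summable_iff hf]
    exact h012.congr fun n => (h n).symm
  · rw [← hg.tsum_eq (f := f) (fun x hx => by by_contra H; exact hx (hf x H)),
      tsum_mul_tsum_of_summable_norm h1.norm h2.norm,
      tsum_mul_tsum_of_summable_norm h0.norm h12.norm]
    exact tsum_congr h

lemma bilin_diag {e : Fin 3 → V} (he : ∀ i j, i ≠ j → B (e i) (e j) = 0) (c d : Fin 3 → ℚ) :
    B (∑ i, c i • e i) (∑ i, d i • e i) = ∑ i, B (e i) (e i) * (c i * d i) := by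
  simp [Fin.sum_univ_three, he 0 1 (by decide), he 0 2 (by decide), he 1 0 (by decide),
    he 1 2 (by decide), he 2 0 (by decide), he 2 1 (by decide)]
  ring

/-- The triple `(n₀, n₁, n₂)` as a function on `Fin 3`. -/
def triple {R : Type*} (n : R × R × R) : Fin 3 → R := ![n.1, n.2.1, n.2.2]

lemma triple_injective {R : Type*} : Function.Injective (triple (R := R)) := by
  intro a b h
  have h0 := congrFun h 0
  have h1 := congrFun h 1
  have h2 := congrFun h 2
  simp [triple] at h0 h1 h2
  exact Prod.ext h0 (Prod.ext h1 h2)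

lemma triple_surjective {R : Type*} : Function.Surjective (triple (R := R)) := by
  intro f
  refine ⟨(f 0, f 1, f 2), ?_⟩
  ext i; fin_cases i <;> rfl

lemma mem_span_range_basis_iff (e : Module.Basis (Fin 3) ℚ V) (x : V) :
    x ∈ Submodule.span ℤ (Set.range e) ↔ ∃ n : Fin 3 → ℤ, x = ∑ i, (n i : ℚ) • e i := by
  rw [Submodule.mem_span_range_iff_exists_fun]
  refine exists_congr fun n => ?_
  rw [eq_comm]
  simp only [Int.cast_smul_eq_zsmul]

/-- For an orthogonal basis, the theta sums of the lattice and of its dual (with basis `e i / (2 Q(e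
i))`) are products of three one-dimensional sums, to which `tsum_gaussTerm_inv` applies. -/
lemma exists_poisson_orthogonal (e : Module.Basis (Fin 3) ℚ V)
    (he : ∀ i j, i ≠ j → B (e i) (e j) = 0) (hq : ∀ i, 0 < B (e i) (e i)) :
    (∀ h, ThetaSummable B (ind (Submodule.span ℤ (Set.range e)) h)) ∧
    (ThetaSummable B (ind (dualTwo B (Submodule.span ℤ (Set.range e))) 0)) ∧
    ∃ C : ℂ, C ≠ 0 ∧ ∀ h (Z : ℂ), 0 < Z.im →
      thetaSum B (ind (Submodule.span ℤ (Set.range e)) h) (-1 / Z) =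
        C * (((Complex.I / Z) ^ (1 / 2 : ℂ))⁻¹) ^ 3 *
          thetaSum B (fun y => ec (2 * B h y) *
            ind (dualTwo B (Submodule.span ℤ (Set.range e))) 0 y) Z := by
  set M := Submodule.span ℤ (Set.range e) with hM
  have hqe : ∀ c : Fin 3 → ℚ, ∀ z, qexp B (∑ i, c i • e i) z =
      ∏ i, Complex.exp (2 * Real.pi * Complex.I * ((B (e i) (e i) * c i ^ 2 : ℚ) : ℂ) * z) := by
    intro c z
    rw [qexp, bilin_diag he, ← Complex.exp_sum]
    congr 1
    push_cast
    rw [Finset.mul_sum, Finset.sum_mul]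
    exact Finset.sum_congr rfl fun i _ => by ring
  -- parametrization of `M + h`
  let g : V → ℤ × ℤ × ℤ → V := fun h n => ∑ i, ((triple n i : ℤ) + e.repr h i : ℚ) • e i
  have hg : ∀ h, Function.Injective (g h) := by
    intro h a b hab
    apply triple_injective
    ext i
    have := congrFun (congrArg (fun x => (e.repr x : Fin 3 → ℚ)) hab) i
    simp only [g, e.repr_sum_self] at this
    exact_mod_cast add_right_cancel this
  have hgr : ∀ h x, x ∈ Set.range (g h) ↔ x - h ∈ M := by
    intro h x
    have key : ∀ n : Fin 3 → ℤ, (∑ i, ((n i : ℤ) + e.repr h i : ℚ) • e i) =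
        (∑ i, (n i : ℚ) • e i) + h := by
      intro n
      conv_rhs => rw [← e.sum_repr h]
      rw [← Finset.sum_add_distrib]
      simp only [add_smul]
    rw [hM, mem_span_range_basis_iff]
    constructor
    · rintro ⟨n, rfl⟩
      exact ⟨triple n, by simp only [g]; rw [key]; simp⟩
    · rintro ⟨n, hn⟩
      obtain ⟨n, rfl⟩ := triple_surjective n
      refine ⟨n, ?_⟩
      simp only [g]; rw [key, ← hn]; abel
  have hprod : ∀ h (z : ℂ), 0 < z.im → _ := fun h z hz =>
    summable_and_tsum_of_prod_three (f := fun x => ind M h x * qexp B x z) (hg h)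
      (f0 := gaussTerm (B (e 0) (e 0)) (e.repr h 0) z)
      (f1 := gaussTerm (B (e 1) (e 1)) (e.repr h 1) z)
      (f2 := gaussTerm (B (e 2) (e 2)) (e.repr h 2) z)
      (fun n => by
        rw [ind_of_mem ((hgr h _).1 ⟨n, rfl⟩), one_mul, hqe, Fin.prod_univ_three, mul_assoc]
        rfl)
      (fun x hx => by rw [ind_of_notMem (fun H => hx ((hgr h x).2 H)), zero_mul])
      (summable_gaussTerm (hq 0) _ hz) (summable_gaussTerm (hq 1) _ hz)
      (summable_gaussTerm (hq 2) _ hz)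
  -- parametrization of the dual
  let g' : ℤ × ℤ × ℤ → V := fun n => ∑ i, ((triple n i : ℤ) / (2 * B (e i) (e i)) : ℚ) • e i
  have hg' : Function.Injective g' := by
    intro a b hab
    apply triple_injective
    ext i
    have h1 := congrFun (congrArg (fun x => (e.repr x : Fin 3 → ℚ)) hab) i
    have h2 : (2 * B (e i) (e i)) ≠ 0 := by have := hq i; positivity
    simp only [g', e.repr_sum_self] at h1
    have h3 := (div_left_inj' h2).1 h1
    exact_mod_cast h3
  have hgr' : ∀ y, y ∈ Set.range g' ↔ y ∈ dualTwo B M := by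
    intro y
    constructor
    · rintro ⟨m, rfl⟩ x hx
      rw [hM, mem_span_range_basis_iff] at hx
      obtain ⟨n, rfl⟩ := hx
      refine ⟨∑ i, n i * triple m i, ?_⟩
      simp only [g']
      rw [bilin_diag he, Finset.mul_sum]
      push_cast
      refine Finset.sum_congr rfl fun i _ => ?_
      have := (hq i).ne'
      field_simp
    · intro hy
      have : ∀ i, ∃ m : ℤ, 2 * B (e i) y = m := fun i =>
        hy _ (Submodule.subset_span ⟨i, rfl⟩)
      choose m hm using this
      obtain ⟨m, rfl⟩ := triple_surjective m
      refine ⟨m, ?_⟩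
      conv_rhs => rw [← e.sum_repr y]
      refine Finset.sum_congr rfl fun i _ => ?_
      congr 1
      rw [← hm i]
      conv_lhs => rw [← e.sum_repr y]
      have h2 : B (e i) (∑ j, e.repr y j • e j) = e.repr y i * B (e i) (e i) := by
        rw [map_sum]
        rw [Finset.sum_eq_single i]
        · simp
        · intro j _ hj; simp [he i j (Ne.symm hj)]
        · simp
      rw [h2]
      have := (hq i).ne'
      field_simp
  have hq4 : ∀ i, 0 < 1 / (4 * B (e i) (e i)) := fun i => by have := hq i; positivity
  have hprod' : ∀ h (z : ℂ), 0 < z.im → _ := fun h z hz =>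
    summable_and_tsum_of_prod_three
      (f := fun y => ec (2 * B h y) * ind (dualTwo B M) 0 y * qexp B y z) hg'
      (f0 := fun m => ec (e.repr h 0 * m) * gaussTerm (1 / (4 * B (e 0) (e 0))) 0 z m)
      (f1 := fun m => ec (e.repr h 1 * m) * gaussTerm (1 / (4 * B (e 1) (e 1))) 0 z m)
      (f2 := fun m => ec (e.repr h 2 * m) * gaussTerm (1 / (4 * B (e 2) (e 2))) 0 z m)
      (fun n => by
        have h1 : 2 * B h (g' n) = e.repr h 0 * n.1 + (e.repr h 1 * n.2.1 + e.repr h 2 * n.2.2) := by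
          conv_lhs => rw [← e.sum_repr h]
          simp only [g']
          rw [bilin_diag he, Fin.sum_univ_three]
          have h0 := (hq 0).ne'
          have h1 := (hq 1).ne'
          have h2 := (hq 2).ne'
          simp only [triple, Matrix.cons_val_zero, Matrix.cons_val_one, Matrix.cons_val]
          field_simp
          ring
        have h2 : qexp B (g' n) z = gaussTerm (1 / (4 * B (e 0) (e 0))) 0 z n.1 *
            (gaussTerm (1 / (4 * B (e 1) (e 1))) 0 z n.2.1 *
             gaussTerm (1 / (4 * B (e 2) (e 2))) 0 z n.2.2) := by
          have aux : ∀ i (m : ℤ), B (e i) (e i) * (m / (2 * B (e i) (e i))) ^ 2 =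
              1 / (4 * B (e i) (e i)) * (m + 0) ^ 2 := by
            intro i m
            have := (hq i).ne'
            field_simp
            ring
          simp only [g']
          rw [hqe, Fin.prod_univ_three, mul_assoc, aux, aux, aux]
          rfl
        rw [ind_of_mem (by rw [sub_zero]; exact (hgr' _).1 ⟨n, rfl⟩), mul_one, h1, h2, ec_add,
          ec_add]
        ring)
      (fun x hx => by
        rw [ind_of_notMem (fun H => hx ((hgr' x).2 (by simpa using H))), mul_zero, zero_mul])
      (by
        refine Summable.of_norm_bounded (summable_gaussTerm (hq4 0) 0 hz).norm fun m => ?_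
        rw [norm_mul, norm_ec, one_mul])
      (by
        refine Summable.of_norm_bounded (summable_gaussTerm (hq4 1) 0 hz).norm fun m => ?_
        rw [norm_mul, norm_ec, one_mul])
      (by
        refine Summable.of_norm_bounded (summable_gaussTerm (hq4 2) 0 hz).norm fun m => ?_
        rw [norm_mul, norm_ec, one_mul])
  refine ⟨fun h z hz => (hprod h z hz).1, fun z hz => ?_,
    ∏ i, ((2 * B (e i) (e i) : ℝ) : ℂ) ^ (-1 / 2 : ℂ), ?_, ?_⟩
  · simpa [ec_zero] using (hprod' 0 z hz).1
  · refine Finset.prod_ne_zero_iff.2 fun i _ => ?_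
    rw [Complex.cpow_ne_zero_iff]
    left
    have : (0 : ℝ) < B (e i) (e i) := by exact_mod_cast hq i
    exact_mod_cast (by positivity : (2 * B (e i) (e i) : ℝ) ≠ 0)
  · intro h Z hZ
    rw [thetaSum, (hprod h _ (im_neg_one_div hZ)).2, thetaSum, (hprod' h Z hZ).2,
      tsum_gaussTerm_inv (hq 0) _ hZ, tsum_gaussTerm_inv (hq 1) _ hZ, tsum_gaussTerm_inv (hq 2) _ hZ,
      Fin.prod_univ_three]
    ring

end Theta

section Theta

variable {V : Type*} [AddCommGroup V] [Module ℚ V] {B : LinearMap.BilinForm ℚ V}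

/-! ### Poisson summation for lattice cosets -/

/-- The lattice `r M`. -/
def scale (r : ℚ) (M : Submodule ℤ V) : Submodule ℤ V :=
  M.map ((r • LinearMap.id : V →ₗ[ℚ] V).restrictScalars ℤ)

lemma mem_scale {r : ℚ} {M : Submodule ℤ V} {x : V} : x ∈ scale r M ↔ ∃ y ∈ M, r • y = x := by
  simp [scale]

lemma smul_mem_scale (r : ℚ) {M : Submodule ℤ V} {x : V} (hx : x ∈ M) : r • x ∈ scale r M :=
  mem_scale.2 ⟨x, hx, rfl⟩

lemma mem_scale_iff {r : ℚ} (hr : r ≠ 0) {M : Submodule ℤ V} {x : V} :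
    x ∈ scale r M ↔ r⁻¹ • x ∈ M := by
  rw [mem_scale]
  constructor
  · rintro ⟨y, hy, rfl⟩; rwa [inv_smul_smul₀ hr]
  · intro h; exact ⟨_, h, smul_inv_smul₀ hr x⟩

lemma smul_mem_scale_iff {r : ℚ} (hr : r ≠ 0) {M : Submodule ℤ V} {x : V} :
    r • x ∈ scale r M ↔ x ∈ M := by
  rw [mem_scale_iff hr, inv_smul_smul₀ hr]

lemma scale_scale (r s : ℚ) (M : Submodule ℤ V) : scale r (scale s M) = scale (r * s) M := by
  ext x
  simp only [mem_scale]
  constructor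
  · rintro ⟨y, ⟨z, hz, rfl⟩, rfl⟩; exact ⟨z, hz, by rw [mul_smul]⟩
  · rintro ⟨z, hz, rfl⟩; exact ⟨_, ⟨z, hz, rfl⟩, by rw [mul_smul]⟩

lemma scale_mono (r : ℚ) {M M' : Submodule ℤ V} (h : M ≤ M') : scale r M ≤ scale r M' :=
  Submodule.map_mono h

lemma scale_int_le (n : ℤ) (M : Submodule ℤ V) : scale n M ≤ M := by
  intro x hx
  obtain ⟨y, hy, rfl⟩ := mem_scale.1 hx
  rw [Int.cast_smul_eq_zsmul]
  exact M.smul_mem n hy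

lemma scale_nat_le (n : ℕ) (M : Submodule ℤ V) : scale n M ≤ M := by
  exact_mod_cast scale_int_le n M

lemma IsFull.scale {M : Submodule ℤ V} (hM : IsFull M) {r : ℚ} (hr : r ≠ 0) :
    IsFull (scale r M) := by
  refine ⟨hM.1.map _, ?_⟩
  rw [eq_top_iff, ← hM.2, Submodule.span_le]
  intro x hx
  rw [← inv_smul_smul₀ hr x]
  exact Submodule.smul_mem _ _ (Submodule.subset_span (smul_mem_scale r hx))

lemma IsFull.of_le {M M' : Submodule ℤ V} (hM : IsFull M) (h : M ≤ M') (hM' : M'.FG) :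
    IsFull M' := by
  refine ⟨hM', ?_⟩
  rw [eq_top_iff, ← hM.2]
  exact Submodule.span_mono h

lemma IsFull.fg_of_le {M M' : Submodule ℤ V} (hM : IsFull M) (h : M' ≤ M) : M'.FG := by
  have : Module.Finite ℤ M := Module.Finite.iff_fg.2 hM.1
  have := (inferInstance : IsNoetherian ℤ M)
  have h1 : (Submodule.comap M.subtype M').FG := IsNoetherian.noetherian _
  have h2 := h1.map M.subtype
  rwa [Submodule.map_comap_subtype, inf_eq_right.2 h] at h2

/-- Diagonalize the form over `ℚ` and clear denominators. -/
lemma exists_orthogonal_basis_mem (hV : Module.finrank ℚ V = 3)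
    (hsymm : ∀ x y, B x y = B y x) (hpos : ∀ x, x ≠ 0 → 0 < B x x) {M : Submodule ℤ V}
    (hM : IsFull M) : ∃ e : Module.Basis (Fin 3) ℚ V, (∀ i j, i ≠ j → B (e i) (e j) = 0) ∧
      (∀ i, 0 < B (e i) (e i)) ∧ ∀ i, e i ∈ M := by
  have : FiniteDimensional ℚ V := Module.finite_of_finrank_pos (by omega)
  have hs : LinearMap.IsSymm B := ⟨fun x y => hsymm x y⟩
  obtain ⟨v, hv⟩ := LinearMap.BilinForm.exists_orthogonal_basis hs
  obtain ⟨w, hw⟩ : ∃ w : Module.Basis (Fin 3) ℚ V, ∀ i j, i ≠ j → B (w i) (w j) = 0 := by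
    refine ⟨v.reindex (finCongr hV), fun i j hij => ?_⟩
    simp only [Module.Basis.reindex_apply]
    exact hv (fun h => hij ((finCongr hV).symm.injective h))
  have : ∀ i, ∃ k : ℕ, 0 < k ∧ k • w i ∈ M := fun i =>
    exists_nat_smul_mem_of_mem_span (by rw [hM.2]; trivial)
  choose k hk hkM using this
  have hk' : ∀ i, IsUnit (k i : ℚ) := fun i => by
    rw [isUnit_iff_ne_zero]; exact_mod_cast (hk i).ne'
  refine ⟨w.isUnitSMul hk', fun i j hij => ?_, fun i => ?_, fun i => ?_⟩
  · simp [Module.Basis.isUnitSMul_apply, hw i j hij]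
  · exact hpos _ (Module.Basis.ne_zero _ i)
  · rw [Module.Basis.isUnitSMul_apply, Nat.cast_smul_eq_nsmul]; exact hkM i

/-- For fixed `y`, the phase is a character of `M / N`. If it is nontrivial, translating by some `x
∈ M` multiplies the sum by a number different from `1`, so the sum vanishes. -/
lemma sum_ec_dual {ι : Type*} [Fintype ι] {t : ι → V} {N M : Submodule ℤ V}
    (hsymm : ∀ x y, B x y = B y x)
    (ht : IsCosetReps t N M 0) {y : V} (hy : y ∈ dualTwo B N) :
    ∑ i, ec (2 * B (t i) y) = Fintype.card ι * ind (dualTwo B M) 0 y := by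
  by_cases H : y ∈ dualTwo B M
  · rw [ind_of_mem (by simpa using H), mul_one]
    have : ∀ i, ec (2 * B (t i) y) = 1 := fun i =>
      (ec_eq_one_iff _).2 (H _ (by simpa using ht.sub_mem i))
    simp [this]
  · rw [ind_of_notMem (by simpa using H), mul_zero]
    have : ∃ x ∈ M, ¬ ∃ m : ℤ, 2 * B x y = m := by
      by_contra! H'
      exact H fun x hx => by
        obtain ⟨m, hm⟩ := H' x hx
        exact ⟨m, hm⟩
    obtain ⟨x, hx, hxy⟩ := this
    have h1 := ht.sum_add (fun x => ec (2 * B x y)) (by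
      intro x x' _ _ hxx'
      apply ec_eq_of_sub
      obtain ⟨m, hm⟩ := hy _ hxx'
      exact ⟨m, by rw [← hm, map_sub, LinearMap.sub_apply]; ring⟩) hx
    simp only [map_add, LinearMap.add_apply, mul_add, ec_add] at h1
    rw [← Finset.sum_mul] at h1
    have h2 : ec (2 * B x y) - 1 ≠ 0 := by
      rw [sub_ne_zero]; exact fun h => hxy ((ec_eq_one_iff _).1 h)
    have h3 : (∑ i, ec (2 * B (t i) y)) * (ec (2 * B x y) - 1) = 0 := by
      rw [mul_sub, h1, mul_one, sub_self]
    exact (mul_eq_zero.1 h3).resolve_right h2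

lemma dualTwo_anti {N M : Submodule ℤ V} (h : N ≤ M) : dualTwo B M ≤ dualTwo B N :=
  fun _ hy x hx => hy x (h hx)

lemma ThetaSummable.ec_mul {φ : V → ℂ} (hφ : ThetaSummable B φ) (f : V → ℚ) :
    ThetaSummable B (fun x => ec (f x) * φ x) :=
  hφ.of_norm_le 1 fun x => by rw [norm_mul, norm_ec]

/-- Poisson summation for theta sums of lattice cosets, with the convergence statements. -/
lemma exists_poisson (hV : Module.finrank ℚ V = 3)
    (hsymm : ∀ x y, B x y = B y x) (hpos : ∀ x, x ≠ 0 → 0 < B x x) {M : Submodule ℤ V}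
    (hM : IsFull M) :
    (∀ h, ThetaSummable B (ind M h)) ∧ (ThetaSummable B (ind (dualTwo B M) 0)) ∧
    ∃ C : ℂ, C ≠ 0 ∧ ∀ h (Z : ℂ), 0 < Z.im →
      thetaSum B (ind M h) (-1 / Z) = C * (((Complex.I / Z) ^ (1 / 2 : ℂ))⁻¹) ^ 3 *
          thetaSum B (fun y => ec (2 * B h y) * ind (dualTwo B M) 0 y) Z := by
  obtain ⟨e, he, hq, heM⟩ := exists_orthogonal_basis_mem hV hsymm hpos hM
  obtain ⟨h1, h2, C, hC, h3⟩ := exists_poisson_orthogonal e he hq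
  set M0 := Submodule.span ℤ (Set.range e) with hM0
  have hle : M0 ≤ M := by
    rw [hM0, Submodule.span_le]
    rintro _ ⟨i, rfl⟩
    exact heM i
  have hspan : Submodule.span ℚ (M0 : Set V) = ⊤ := by
    rw [eq_top_iff, ← e.span_eq, Submodule.span_le]
    exact fun x hx => Submodule.subset_span (Submodule.subset_span hx)
  -- A general lattice is cut into cosets of an orthogonal sublattice.
  obtain ⟨n, t, ht⟩ := exists_isCosetReps hle hM.1 hspan 0
  have ht' : ∀ h, IsCosetReps (fun i => t i + h) M0 M h := fun h => by
    simpa using ht.add h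
  have hind : ∀ h, ind M h = fun x => ∑ i, ind M0 (t i + h) x := fun h => by
    ext x; exact (ht' h x).symm
  refine ⟨fun h => ?_, ?_, n * C, mul_ne_zero ?_ hC, fun h Z hZ => ?_⟩
  · rw [hind]; exact ThetaSummable.sum fun i _ => h1 _
  · refine h2.of_norm_le 1 fun x => ?_
    by_cases H : x ∈ dualTwo B M
    · rw [ind_of_mem (by simpa using H), ind_of_mem (by simpa using dualTwo_anti hle H)]; simp
    · rw [ind_of_notMem (by simpa using H)]; simp
  · simpa using ht.card_ne_zero
  · rw [hind, thetaSum_sum (fun i _ => h1 _) (im_neg_one_div hZ)]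
    simp only [h3 _ Z hZ]
    rw [← Finset.mul_sum, ← thetaSum_sum (fun i _ => h2.ec_mul _) hZ]
    -- Summing the characters over `M / M0` projects the dual of `M0` onto the dual of `M`.
    have : ∀ y, ∑ i, ec (2 * B (t i + h) y) * ind (dualTwo B M0) 0 y =
        n * (ec (2 * B h y) * ind (dualTwo B M) 0 y) := by
      intro y
      by_cases H : y ∈ dualTwo B M0
      · rw [ind_of_mem (by simpa using H)]
        have := sum_ec_dual hsymm ht H
        rw [Fintype.card_fin] at this
        simp only [map_add, LinearMap.add_apply, mul_add, ec_add, mul_one]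
        rw [← Finset.sum_mul, this]; ring
      · rw [ind_of_notMem (by simpa using H),
          ind_of_notMem (by simpa using fun h => H (dualTwo_anti hle h))]
        simp
    simp only [this, thetaSum_const_mul]
    ring

/-! ### The transformation law -/

lemma bilin_add_self (hsymm : ∀ x y, B x y = B y x) (x y : V) :
    B (x + y) (x + y) = B x x + 2 * B x y + B y y := by
  simp only [map_add, LinearMap.add_apply, hsymm y x]; ring

/-- The factor of automorphy of weight `3/2` (up to a root of unity) that arises from applying
Poisson summation twice. -/
def weilFactor (c d : ℤ) (z : ℂ) : ℂ :=
  (((Complex.I / (-1 / z + (-(c / d : ℚ) : ℚ))) ^ (1 / 2 : ℂ))⁻¹) ^ 3 *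
    ((((Complex.I / (-1 / z)) ^ (1 / 2 : ℂ))⁻¹) ^ 3)⁻¹

/-- Decomposes the Möbius map into an inversion, a translation by `-c / d`, a second inversion, the
scaling by `d⁻²` and a translation by `β / d`. -/
lemma moebius_eq {α β c d z : ℂ} (hdet : α * d - β * c = 1) (hd : d ≠ 0) (hcz : c * z + d ≠ 0)
    (hz : z ≠ 0) {Z : ℂ} (hZ : Z = -1 / z - c / d) :
    (α * z + β) / (c * z + d) = -1 / Z * (d ^ 2)⁻¹ + β / d := by
  have h1 : -1 / Z = d * z / (c * z + d) := by
    rw [hZ, show -1 / z - c / d = -(c * z + d) / (d * z) by field_simp; ring]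
    rw [neg_div (d * z), div_neg, neg_div, neg_neg, one_div_div]
  rw [h1]
  have : d * z / (c * z + d) * (d ^ 2)⁻¹ + β / d = (z + β * (c * z + d)) / (d * (c * z + d)) := by
    generalize c * z + d = w at hcz
    field_simp
  rw [this, div_eq_div_iff hcz (mul_ne_zero hd hcz)]
  linear_combination z * (c * z + d) * hdet

/-- Poisson summation, used twice. On a coset of `d M'` the phase `e(β Q(x) / d)` is constant;
inverting that coset gives a sum over the dual of `M'` at `Z = -1/z - c/d`, where the translation by
`-c/d` contributes another quadratic phase. Completing the square in the sum over representatives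
absorbs this phase, and a second inversion returns to `z`. Two lattices are admitted because the law
is needed both for `M' = M` and for the pair made of the intersection and the sum of `L` and a
neighbour. The conditions `h2` and `h3` are what completing the square requires. -/
lemma thetaSum_transform (hV : Module.finrank ℚ V = 3)
    (hsymm : ∀ x y, B x y = B y x) (hpos : ∀ x, x ≠ 0 → 0 < B x x) {M M' : Submodule ℤ V}
    (hM : IsFull M) (hM' : IsFull M') (hle : M' ≤ M) {ν : V} {α β c d : ℤ}
    (hdet : α * d - β * c = 1) (hd : 0 < d)
    (h1 : ∀ x ∈ M, ∀ y ∈ M', ∃ m : ℤ, B x y = m) (hν : ∀ y ∈ M', ∃ m : ℤ, B ν y = m)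
    (h2 : ∀ y ∈ dualTwo B M', (c / 2 : ℚ) • y ∈ M)
    (h3 : ∀ x ∈ M, ∀ y ∈ dualTwo B M', ∃ m : ℤ, α * (2 * B x y) = m)
    {ι : Type*} [Fintype ι] {t : ι → V} (ht : IsCosetReps t (scale d M') M ν)
    {z : ℂ} (hz : 0 < z.im) :
    thetaSum B (ind M ν) ((α * z + β) / (c * z + d)) =
      weilFactor c d z * (∑ i, ec (B (t i) (t i) * (β / d))) *
        thetaSum B (ind M' ((α : ℚ) • ν)) z := by
  have hz0 : z ≠ 0 := by rintro rfl; simp at hz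
  have hdC : (d : ℂ) ≠ 0 := by exact_mod_cast hd.ne'
  have hdQ : (d : ℚ) ≠ 0 := by exact_mod_cast hd.ne'
  have hcz : (c * z + d : ℂ) ≠ 0 := by
    intro h
    have him : (c : ℝ) * z.im = 0 := by simpa using congrArg Complex.im h
    have hc : (c : ℝ) = 0 := (mul_eq_zero.1 him).resolve_right hz.ne'
    have hc' : c = 0 := by exact_mod_cast hc
    rw [hc'] at h
    simp at h
    exact hd.ne' h
  obtain ⟨s1, s2, C, hC, hP⟩ := exists_poisson hV hsymm hpos hM'
  obtain ⟨s1M, -⟩ := exists_poisson hV hsymm hpos hM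
  have htM : ∀ i, ∀ y ∈ M', ∃ m : ℤ, B (t i) y = m := by
    intro i y hy
    obtain ⟨m, hm⟩ := h1 _ (ht.sub_mem i) y hy
    obtain ⟨m', hm'⟩ := hν y hy
    refine ⟨m + m', ?_⟩
    rw [map_sub, LinearMap.sub_apply, hm', sub_eq_iff_eq_add] at hm
    rw [hm]; push_cast; rfl
  set Z : ℂ := -1 / z + ((-(c / d : ℚ) : ℚ) : ℂ) with hZdef
  have hZ : 0 < Z.im := by
    rw [hZdef, Complex.add_im, Complex.ratCast_im, add_zero]
    exact im_neg_one_div hz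
  have hZ0 : Z ≠ 0 := by intro h; rw [h] at hZ; simp at hZ
  have hsum_i : ∀ i, ThetaSummable B (ind (scale d M') (t i)) := fun i =>
    (exists_poisson hV hsymm hpos (hM'.scale hdQ)).1 _
  -- each coset
  have hcoset : ∀ i, thetaSum B (ind (scale d M') (t i)) ((α * z + β) / (c * z + d)) =
      ec (B (t i) (t i) * (β / d)) * (C * (((Complex.I / Z) ^ (1 / 2 : ℂ))⁻¹) ^ 3 *
        thetaSum B (fun y => ec (B y y * (-(c / d : ℚ))) *
          (ec (2 * B ((d : ℚ)⁻¹ • t i) y) * ind (dualTwo B M') 0 y)) (-1 / z)) := by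
    intro i
    have hdet' : (α * d - β * c : ℂ) = 1 := by exact_mod_cast hdet
    have e1 : (α * z + β) / (c * z + d) = (-1 / Z * (((d : ℚ) : ℂ) ^ 2)⁻¹) +
        ((β / d : ℚ) : ℂ) := by
      rw [moebius_eq hdet' hdC hcz hz0 (Z := Z) (by rw [hZdef]; push_cast; ring)]
      push_cast; ring
    rw [e1, thetaSum_add_rat]
    -- With `x = t i + d y`, the exponent changes by the integer `β (2 B(t i, y) + d Q(y))`.
    have e2 : ∀ x, ec (B x x * (β / d : ℚ)) * ind (scale d M') (t i) x =
        ec (B (t i) (t i) * (β / d)) * ind (scale d M') (t i) x := by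
      intro x
      by_cases H : x - t i ∈ scale d M'
      · congr 1
        apply ec_eq_of_sub
        obtain ⟨y, hy, hyx⟩ := mem_scale.1 H
        obtain ⟨m, hm⟩ := htM i y hy
        obtain ⟨m', hm'⟩ := h1 y (hle hy) y hy
        have hx : x = t i + (d : ℚ) • y := by rw [hyx]; abel
        refine ⟨β * (2 * m + d * m'), ?_⟩
        rw [hx, bilin_add_self hsymm]
        simp only [map_smul, LinearMap.smul_apply, smul_eq_mul, hm, hm']
        push_cast
        field_simp
        ring
      · rw [ind_of_notMem H, mul_zero, mul_zero]
    simp only [e2]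
    rw [thetaSum_const_mul]
    congr 1
    have e3 : ind (scale d M') (t i) =
        fun x => ind M' ((d : ℚ)⁻¹ • t i) ((d : ℚ)⁻¹ • x) := by
      ext x
      apply ind_congr
      rw [← smul_sub, mem_scale_iff hdQ]
    have e4 : ((d : ℚ) : ℂ) ^ 2 * (-1 / Z * (((d : ℚ) : ℂ) ^ 2)⁻¹) = -1 / Z := by
      push_cast; field_simp
    rw [e3, ← thetaSum_smul _ _ hdQ, e4, hP _ Z hZ]
    congr 1
    conv_lhs => rw [hZdef, thetaSum_add_rat]
  have hLHS : ind M ν = fun x => ∑ i, ind (scale d M') (t i) x := by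
    ext x; exact (ht x).symm
  have him : 0 < ((α * z + β) / (c * z + d) : ℂ).im := by
    have : (α * z + β) / (c * z + d) = -1 / Z * ((d ^ 2 : ℝ)⁻¹ : ℝ) + ((β / d : ℚ) : ℂ) := by
      have hdet' : (α * d - β * c : ℂ) = 1 := by exact_mod_cast hdet
      rw [moebius_eq hdet' hdC hcz hz0 (Z := Z) (by rw [hZdef]; push_cast; ring)]
      push_cast; ring
    rw [this, Complex.add_im, Complex.ratCast_im, add_zero, mul_comm, Complex.im_ofReal_mul]
    have hdR : (0 : ℝ) < d := by exact_mod_cast hd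
    have := im_neg_one_div hZ
    positivity
  rw [hLHS, thetaSum_sum (fun i _ => hsum_i i) him]
  simp only [hcoset]
  -- the Gauss sum
  have hgauss : ∀ y ∈ dualTwo B M', ∑ i, ec (B (t i) (t i) * (β / d)) *
      (ec (B y y * (-(c / d : ℚ))) * ec (2 * B ((d : ℚ)⁻¹ • t i) y)) =
      (∑ i, ec (B (t i) (t i) * (β / d))) * ec (2 * B ((α : ℚ) • ν) y) := by
    intro y hy
    have hcy : (c : ℚ) • y ∈ M := by
      have := M.add_mem (h2 y hy) (h2 y hy)
      rwa [← add_smul, add_halves] at this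
    have hQy : ∃ m : ℤ, α * c * B y y = m := by
      obtain ⟨m, hm⟩ := h3 _ (h2 y hy) y hy
      refine ⟨m, ?_⟩
      rw [← hm]; simp only [map_smul, LinearMap.smul_apply, smul_eq_mul]; ring
    -- The representatives are translated by `c y ∈ M`. Since `β c = α d - 1`, the fractional terms
    -- in `y` cancel, leaving `2 α B(t i, y) + α c Q(y)`, which is `2 B(α ν, y)` modulo integers.
    have hshift := ht.sum_add
      (fun x => ec (B x x * (β / d) + (B y y * (-(c / d : ℚ)) + 2 * B ((d : ℚ)⁻¹ • x) y))) (by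
        intro x x' hx _ hxx'
        apply ec_eq_of_sub
        obtain ⟨w, hw, hwx⟩ := mem_scale.1 hxx'
        obtain ⟨m, hm⟩ : ∃ m : ℤ, B x w = m := by
          obtain ⟨m, hm⟩ := h1 _ hx w hw
          obtain ⟨m', hm'⟩ := hν w hw
          refine ⟨m + m', ?_⟩
          rw [map_sub, LinearMap.sub_apply, hm', sub_eq_iff_eq_add] at hm
          rw [hm]; push_cast; rfl
        obtain ⟨m', hm'⟩ := h1 w (hle hw) w hw
        obtain ⟨m'', hm''⟩ := hy w hw
        have hx : x' = x + (d : ℚ) • w := by rw [hwx]; abel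
        refine ⟨β * (2 * m + d * m') + m'', ?_⟩
        rw [hx, bilin_add_self hsymm]
        simp only [map_smul, LinearMap.smul_apply, smul_eq_mul, hm, hm', map_add,
          LinearMap.add_apply]
        push_cast
        rw [← hm'']
        field_simp
        ring) hcy
    rw [Finset.sum_mul]
    simp only [← ec_add]
    rw [← hshift]
    refine Finset.sum_congr rfl fun i _ => ec_eq_of_sub ?_
    obtain ⟨m, hm⟩ := hQy
    obtain ⟨m', hm'⟩ := h3 _ (ht.sub_mem i) y hy
    refine ⟨m + m', ?_⟩
    have hdet' : (α * d - β * c : ℚ) = 1 := by exact_mod_cast hdet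
    rw [bilin_add_self hsymm]
    push_cast
    rw [← hm, ← hm']
    simp only [map_smul, LinearMap.smul_apply, smul_eq_mul, map_add,
          LinearMap.add_apply, map_sub, LinearMap.sub_apply]
    field_simp
    linear_combination (-c * B y y - 2 * B (t i) y) * hdet'
  have hsumm : ∀ i, ThetaSummable B (fun y => ec (B y y * (-(c / d : ℚ))) *
          (ec (2 * B ((d : ℚ)⁻¹ • t i) y) * ind (dualTwo B M') 0 y)) := fun i =>
    (s2.ec_mul _).ec_mul _
  have hcomb : ∑ i, ec (B (t i) (t i) * (β / d)) *
      thetaSum B (fun y => ec (B y y * (-(c / d : ℚ))) *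
          (ec (2 * B ((d : ℚ)⁻¹ • t i) y) * ind (dualTwo B M') 0 y)) (-1 / z) =
      (∑ i, ec (B (t i) (t i) * (β / d))) *
        thetaSum B (fun y => ec (2 * B ((α : ℚ) • ν) y) * ind (dualTwo B M') 0 y) (-1 / z) := by
    rw [← thetaSum_const_mul]
    simp only [← thetaSum_const_mul]
    rw [← thetaSum_sum (fun i _ => (hsumm i).const_mul _) (im_neg_one_div hz)]
    congr 1
    ext y
    by_cases H : y ∈ dualTwo B M'
    · rw [← mul_assoc, ← hgauss y H, ind_of_mem (by simpa using H), Finset.sum_mul]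
      exact Finset.sum_congr rfl fun i _ => by ring
    · rw [ind_of_notMem (by simpa using H)]; simp
  -- The second inversion is Poisson summation for the shift `α ν`, read backwards. The constant `C`
  -- is the same as in the first one and drops out.
  have hz' : z = -1 / (-1 / z) := by field_simp
  have hfin := hP ((α : ℚ) • ν) (-1 / z) (im_neg_one_div hz)
  rw [← hz'] at hfin
  have hne : (((Complex.I / (-1 / z)) ^ (1 / 2 : ℂ))⁻¹) ^ 3 ≠ 0 := by
    refine pow_ne_zero _ (inv_ne_zero ?_)
    rw [Complex.cpow_ne_zero_iff]
    left
    exact div_ne_zero Complex.I_ne_zero (div_ne_zero (by norm_num) hz0)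
  rw [hfin, weilFactor, ← hZdef]
  calc _ = (C * (((Complex.I / Z) ^ (1 / 2 : ℂ))⁻¹) ^ 3) * ∑ i, ec (B (t i) (t i) * (β / d)) *
      thetaSum B (fun y => ec (B y y * (-(c / d : ℚ))) *
          (ec (2 * B ((d : ℚ)⁻¹ • t i) y) * ind (dualTwo B M') 0 y)) (-1 / z) := by
        rw [Finset.mul_sum]; exact Finset.sum_congr rfl fun i _ => by ring
    _ = _ := by
        rw [hcomb]
        generalize (((Complex.I / (-1 / z)) ^ (1 / 2 : ℂ))⁻¹) ^ 3 = s' at hne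
        generalize (((Complex.I / Z) ^ (1 / 2 : ℂ))⁻¹) ^ 3 = s
        generalize (∑ i, ec (B (t i) (t i) * (β / d))) = G
        field_simp

end Theta

section Theta

variable {V : Type*} [AddCommGroup V] [Module ℚ V] {B : LinearMap.BilinForm ℚ V}

/-! ### Holomorphy and growth of theta sums -/

lemma norm_qexp (x : V) (z : ℂ) :
    ‖qexp B x z‖ = Real.exp (-(2 * Real.pi * (B x x : ℚ) * z.im)) := by
  rw [qexp, Complex.norm_exp]
  congr 1
  rw [show 2 * Real.pi * Complex.I * ((B x x : ℚ) : ℂ) * z =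
    ((2 * Real.pi * (B x x : ℚ) : ℝ) : ℂ) * (Complex.I * z) by push_cast; ring,
    Complex.re_ofReal_mul, Complex.I_mul_re]
  ring

lemma bilin_self_nonneg (hpos : ∀ x, x ≠ 0 → 0 < B x x) (x : V) : (0 : ℝ) ≤ (B x x : ℚ) := by
  by_cases hx : x = 0
  · simp [hx]
  · exact_mod_cast (hpos x hx).le

lemma norm_qexp_le (hpos : ∀ x, x ≠ 0 → 0 < B x x) (x : V) {z w : ℂ} (h : w.im ≤ z.im) :
    ‖qexp B x z‖ ≤ ‖qexp B x w‖ := by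
  rw [norm_qexp, norm_qexp, Real.exp_le_exp, neg_le_neg_iff]
  have := bilin_self_nonneg hpos x
  have := Real.pi_pos
  gcongr

lemma ThetaSummable.norm_thetaSum_le (hpos : ∀ x, x ≠ 0 → 0 < B x x) {φ ψ : V → ℂ}
    (hψ : ThetaSummable B ψ) (h : ∀ x, ‖φ x‖ ≤ ‖ψ x‖) {z w : ℂ} (hw : 0 < w.im)
    (hzw : w.im ≤ z.im) : ‖thetaSum B φ z‖ ≤ ∑' x, ‖ψ x * qexp B x w‖ := by
  refine tsum_of_norm_bounded (hψ w hw).norm.hasSum fun x => ?_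
  rw [norm_mul, norm_mul]
  exact mul_le_mul (h x) (norm_qexp_le hpos x hzw) (norm_nonneg _) (norm_nonneg _)

/-- Locally uniform convergence: above height `z.im / 2` every term is dominated by its value on the
line at that height. -/
lemma ThetaSummable.differentiableAt (hpos : ∀ x, x ≠ 0 → 0 < B x x) {φ : V → ℂ}
    (hφ : ThetaSummable B φ) {z : ℂ} (hz : 0 < z.im) : DifferentiableAt ℂ (thetaSum B φ) z := by
  have hU : IsOpen {w : ℂ | z.im / 2 < w.im} := isOpen_lt continuous_const Complex.continuous_im
  have h1 : DifferentiableOn ℂ (fun w => ∑' x, φ x * qexp B x w) {w : ℂ | z.im / 2 < w.im} := by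
    refine Complex.differentiableOn_tsum_of_summable_norm
      (u := fun x => ‖φ x * qexp B x ((z.im / 2 : ℝ) * Complex.I)‖)
      (hφ _ (by simpa using hz)).norm (fun x => ?_) hU (fun x w hw => ?_)
    · apply Differentiable.differentiableOn
      unfold qexp
      fun_prop
    · rw [norm_mul, norm_mul]
      refine mul_le_mul_of_nonneg_left (norm_qexp_le hpos x ?_) (norm_nonneg _)
      have : z.im / 2 < w.im := hw
      simpa using this.le
  exact h1.differentiableAt (hU.mem_nhds (by simpa using hz))

/-- A fixed vector pairs with a finitely generated module with bounded denominators, so some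
positive multiple of it lies in the dual. -/
lemma span_dualTwo_eq_top (hsymm : ∀ x y, B x y = B y x) {M : Submodule ℤ V} (hM : M.FG) :
    Submodule.span ℚ (dualTwo B M : Set V) = ⊤ := by
  rw [eq_top_iff]
  intro y _
  have key : ∃ k : ℕ, 0 < k ∧ ∀ x ∈ M, ∃ m : ℤ, 2 * B x y * k = m := by
    classical
    obtain ⟨s, rfl⟩ := hM
    induction s using Finset.induction_on with
    | empty =>
      refine ⟨1, one_pos, fun x hx => ⟨0, ?_⟩⟩
      have : x = 0 := by simpa using hx
      simp [this]
    | insert a s _ ih =>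
      obtain ⟨k, hk, hks⟩ := ih
      refine ⟨(2 * B a y).den * k, Nat.mul_pos (Rat.den_pos _) hk, fun x hx => ?_⟩
      rw [Finset.coe_insert] at hx
      obtain ⟨n, x', hx', rfl⟩ := Submodule.mem_span_insert.1 hx
      obtain ⟨m, hm⟩ := hks x' hx'
      refine ⟨n * (2 * B a y).num * k + m * (2 * B a y).den, ?_⟩
      have h1 := Rat.mul_den_eq_num (2 * B a y)
      rw [map_add, LinearMap.add_apply, map_zsmul, LinearMap.smul_apply, zsmul_eq_mul]
      push_cast
      rw [← hm, ← h1]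
      ring
  obtain ⟨k, hk, hkM⟩ := key
  have hk0 : (k : ℚ) ≠ 0 := by exact_mod_cast hk.ne'
  rw [← inv_smul_smul₀ hk0 y]
  refine Submodule.smul_mem _ _ (Submodule.subset_span fun x hx => ?_)
  obtain ⟨m, hm⟩ := hkM x hx
  exact ⟨m, by rw [← hm, map_smul, smul_eq_mul]; ring⟩

lemma norm_half_cpow_inv_pow_three_sq {Z : ℂ} :
    ‖(((Complex.I / Z) ^ (1 / 2 : ℂ))⁻¹) ^ 3‖ ^ 2 = ‖Z‖ ^ 3 := by
  have h1 : ((Complex.I / Z) ^ (1 / 2 : ℂ)) ^ 2 = Complex.I / Z := by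
    have := Complex.cpow_nat_inv_pow (Complex.I / Z) (n := 2) two_ne_zero
    rwa [show ((2 : ℕ) : ℂ)⁻¹ = 1 / 2 by norm_num] at this
  have h2 : ‖((Complex.I / Z) ^ (1 / 2 : ℂ))‖ ^ 2 = ‖Z‖⁻¹ := by
    rw [← norm_pow, h1, norm_div, Complex.norm_I, one_div]
  rw [norm_pow, norm_inv, ← pow_mul, mul_comm 3 2, pow_mul, inv_pow, h2, inv_inv]

/-- Moderate growth at all cusps of the theta sum of a lattice coset. -/
lemma exists_norm_thetaSum_le (hV : Module.finrank ℚ V = 3)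
    (hsymm : ∀ x y, B x y = B y x) (hpos : ∀ x, x ≠ 0 → 0 < B x x) {M : Submodule ℤ V}
    (hM : IsFull M) (h : V) {α β c d : ℤ} (hdet : α * d - β * c = 1) :
    ∃ K : ℝ, 0 ≤ K ∧ ∀ z : ℂ, 1 ≤ z.im →
      ‖thetaSum B (ind M h) ((α * z + β) / (c * z + d))‖ ^ 2 ≤ K * ‖c * z + d‖ ^ 3 := by
  by_cases hc : c = 0
  · subst hc
    refine ⟨(∑' x, ‖ind M h x * qexp B x Complex.I‖) ^ 2, by positivity, fun z hz => ?_⟩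
    have hdd : (d : ℂ) * d = 1 := by
      have : α * d = 1 := by simpa using hdet
      rcases Int.isUnit_iff.1 (IsUnit.of_mul_eq_one_right _ this) with rfl | rfl <;> norm_num
    have had : (α : ℂ) * d = 1 := by
      have : α * d = 1 := by simpa using hdet
      exact_mod_cast this
    have hnd : ‖(d : ℂ)‖ = 1 := by
      have h1 : ‖(d : ℂ)‖ * ‖(d : ℂ)‖ = 1 := by rw [← norm_mul, hdd, norm_one]
      nlinarith [norm_nonneg (d : ℂ)]
    have hd0 : (d : ℂ) ≠ 0 := by intro h; simp [h] at hdd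
    have hα : (α : ℂ) = d := by linear_combination (-α : ℂ) * hdd + (d : ℂ) * had
    have hval : (α * z + β) / (((0 : ℤ) : ℂ) * z + d) = z + ((β * d : ℤ) : ℂ) := by
      push_cast
      rw [zero_mul, zero_add, div_eq_iff hd0]
      linear_combination z * hα - β * hdd
    have hsum := (exists_poisson hV hsymm hpos hM).1 h
    have h1 := hsum.norm_thetaSum_le hpos (fun x => le_rfl) (z := z + ((β * d : ℤ) : ℂ))
      (w := Complex.I) (by simp) (by simpa using hz)
    rw [hval, Int.cast_zero, zero_mul, zero_add, hnd, one_pow, mul_one]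
    gcongr
  · have hcC : (c : ℂ) ≠ 0 := by exact_mod_cast hc
    have hcQ : (c : ℚ) ≠ 0 := by exact_mod_cast hc
    have hM1 : (M ⊔ Submodule.span ℤ {h}).FG := hM.1.sup (Submodule.fg_span_singleton h)
    obtain ⟨k, hk, hkM⟩ := exists_nat_smul_mem hM.1 (span_dualTwo_eq_top hsymm hM1 (B := B))
    have hr : (2 * c * k : ℚ) ≠ 0 := by
      have : (k : ℚ) ≠ 0 := by exact_mod_cast hk.ne'
      positivity
    -- So small a sublattice that `e(α Q(x) / c)` is constant on its cosets in `M + h`; the integer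
    -- `k` clears the denominators of `2 B` on `M + ℤ h`.
    set N := scale (2 * c * k : ℚ) M with hN
    have hNM : N ≤ M := by
      have := scale_int_le (2 * c * k) M
      push_cast at this
      exact this
    have hNfull : IsFull N := hM.scale hr
    obtain ⟨n, t, ht⟩ := exists_isCosetReps hNM hM.1 hNfull.2 h
    obtain ⟨s1, s2, C, hC, hP⟩ := exists_poisson hV hsymm hpos hNfull
    have hsum := (exists_poisson hV hsymm hpos hM).1 h
    have hdiv : ∀ x ∈ M ⊔ Submodule.span ℤ {h}, ∀ y ∈ M, ∃ m : ℤ, 2 * k * B x y = m := by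
      intro x hx y hy
      obtain ⟨m, hm⟩ := hkM y hy x hx
      refine ⟨m, ?_⟩
      rw [← hm, map_nsmul, nsmul_eq_mul]; ring
    have hf := ht.ind_mul (fun x => ec (B x x * (α / c))) (by
      intro x y hx _ hxy
      apply ec_eq_of_sub
      obtain ⟨u, hu, huy⟩ := mem_scale.1 hxy
      have hx' : x ∈ M ⊔ Submodule.span ℤ {h} := by
        rw [← sub_add_cancel x h]
        exact Submodule.add_mem_sup hx (Submodule.mem_span_singleton_self h)
      obtain ⟨m, hm⟩ := hdiv x hx' u hu
      obtain ⟨m', hm'⟩ := hdiv u (Submodule.mem_sup_left hu) u hu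
      have hy : y = x + (2 * c * k : ℚ) • u := by rw [huy]; abel
      refine ⟨α * (2 * m + 2 * c * k * m'), ?_⟩
      rw [hy, bilin_add_self hsymm]
      simp only [map_smul, LinearMap.smul_apply, smul_eq_mul]
      push_cast
      rw [← hm, ← hm']
      field_simp
      ring)
    set K0 := ∑' y, ‖ind (dualTwo B N) 0 y * qexp B y Complex.I‖ with hK0
    have hK0' : 0 ≤ K0 := tsum_nonneg fun _ => norm_nonneg _
    refine ⟨(n * ‖C‖ * K0) ^ 2 * ‖(c : ℂ)‖ ^ 3, by positivity, fun z hz => ?_⟩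
    have hzpos : 0 < z.im := by linarith
    have hc2 : (1 : ℝ) ≤ c ^ 2 := by
      have : 0 < c ^ 2 := by positivity
      exact_mod_cast this
    have hZim : 1 ≤ (c * (c * z + d) : ℂ).im := by
      have : (c * (c * z + d) : ℂ).im = c ^ 2 * z.im := by
        simp; ring
      rw [this]; nlinarith
    have hcz : (c * z + d : ℂ) ≠ 0 := by
      intro h0; rw [h0] at hZim; norm_num at hZim
    -- One inversion suffices at the cusp `α / c`: the new variable `c (c z + d)` has imaginary part
    -- `c² Im z ≥ 1`, so the dual theta sum is bounded by its absolute sum at `i`.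
    have hval : (α * z + β) / (c * z + d) = -1 / (c * (c * z + d)) + ((α / c : ℚ) : ℂ) := by
      have hdet' : (α * d - β * c : ℂ) = 1 := by exact_mod_cast hdet
      push_cast
      rw [div_add_div _ _ (mul_ne_zero hcC hcz) hcC, div_eq_div_iff hcz
        (mul_ne_zero (mul_ne_zero hcC hcz) hcC)]
      linear_combination (-(c * (c * z + d) : ℂ)) * hdet'
    have hZpos : 0 < (c * (c * z + d) : ℂ).im := by linarith
    have e1 : thetaSum B (ind M h) ((α * z + β) / (c * z + d)) =
        ∑ i, ec (B (t i) (t i) * (α / c)) *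
          thetaSum B (ind N (t i)) (-1 / (c * (c * z + d))) := by
      rw [hval, thetaSum_add_rat]
      simp only [hf]
      rw [thetaSum_sum (fun i _ => (s1 _).const_mul _) (im_neg_one_div hZpos)]
      simp only [thetaSum_const_mul]
    have e2 : ‖thetaSum B (ind M h) ((α * z + β) / (c * z + d))‖ ≤
        n * ‖C‖ * K0 * ‖(((Complex.I / (c * (c * z + d))) ^ (1 / 2 : ℂ))⁻¹) ^ 3‖ := by
      rw [e1]
      calc _ ≤ ∑ i : Fin n, ‖C‖ * ‖(((Complex.I / (c * (c * z + d))) ^ (1 / 2 : ℂ))⁻¹) ^ 3‖ * K0 := by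
            refine norm_sum_le_of_le _ fun i _ => ?_
            rw [norm_mul, norm_ec, one_mul, hP _ _ hZpos, norm_mul, norm_mul]
            refine mul_le_mul_of_nonneg_left ?_ (by positivity)
            refine s2.norm_thetaSum_le hpos (fun x => ?_) (by simp) (by simpa using hZim)
            rw [norm_mul, norm_ec, one_mul]
        _ = _ := by
            rw [Finset.sum_const, Finset.card_univ, Fintype.card_fin, nsmul_eq_mul]; ring
    calc _ ≤ (n * ‖C‖ * K0 * ‖(((Complex.I / (c * (c * z + d))) ^ (1 / 2 : ℂ))⁻¹) ^ 3‖) ^ 2 := by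
          gcongr
      _ = _ := by
          rw [mul_pow, norm_half_cpow_inv_pow_three_sq, norm_mul, mul_pow]; ring

end Theta

/-! ### The theta function has no zeros -/

section ThetaNonvanishing

open Complex

/-- The three even theta constants are non-zero at `τ`. -/
def ThetaConstantsNeZero (τ : ℂ) : Prop :=
  jacobiTheta₂ 0 τ ≠ 0 ∧ jacobiTheta₂ (1 / 2) τ ≠ 0 ∧ jacobiTheta₂ (τ / 2) τ ≠ 0

/-- The exponents match because `n² ≡ n` modulo `2`. -/
lemma jacobiTheta₂_zero_add_one (τ : ℂ) : jacobiTheta₂ 0 (τ + 1) = jacobiTheta₂ (1 / 2) τ := by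
  refine tsum_congr fun n => ?_
  obtain ⟨k, hk⟩ := Int.even_mul_pred_self n
  have hk' : (n : ℂ) * (n - 1) = k + k := by exact_mod_cast hk
  rw [jacobiTheta₂_term, jacobiTheta₂_term, Complex.exp_eq_exp_iff_exists_int]
  exact ⟨k, by linear_combination (Real.pi * I) * hk'⟩

lemma jacobiTheta₂_half_add_one (τ : ℂ) : jacobiTheta₂ (1 / 2) (τ + 1) = jacobiTheta₂ 0 τ := by
  rw [← jacobiTheta₂_zero_add_one, add_assoc, one_add_one_eq_two, jacobiTheta₂_add_right]

lemma jacobiTheta₂_half_period_add_one (τ : ℂ) :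
    jacobiTheta₂ ((τ + 1) / 2) (τ + 1) = jacobiTheta₂ (τ / 2) τ := by
  refine tsum_congr fun n => ?_
  obtain ⟨k, hk⟩ := Int.even_mul_succ_self n
  have hk' : (n : ℂ) * (n + 1) = k + k := by exact_mod_cast hk
  rw [jacobiTheta₂_term, jacobiTheta₂_term, Complex.exp_eq_exp_iff_exists_int]
  exact ⟨k, by linear_combination (Real.pi * I) * hk'⟩

lemma thetaConstantsNeZero_add_one (τ : ℂ) :
    ThetaConstantsNeZero (τ + 1) ↔ ThetaConstantsNeZero τ := by
  simp only [ThetaConstantsNeZero, jacobiTheta₂_zero_add_one, jacobiTheta₂_half_add_one,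
    jacobiTheta₂_half_period_add_one]
  tauto

/-- Up to nonvanishing factors, the functional equation fixes the first theta constant and exchanges
the other two. -/
lemma thetaConstantsNeZero_inv {τ : ℂ} (hτ : τ ≠ 0) :
    ThetaConstantsNeZero (-1 / τ) ↔ ThetaConstantsNeZero τ := by
  have hu : ∀ z : ℂ, 1 / (-I * τ) ^ (1 / 2 : ℂ) * cexp (-Real.pi * I * z ^ 2 / τ) ≠ 0 := fun z => by
    refine mul_ne_zero (one_div_ne_zero ?_) (Complex.exp_ne_zero _)
    rw [Complex.cpow_ne_zero_iff]
    left
    exact mul_ne_zero (neg_ne_zero.2 I_ne_zero) hτ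
  have h : ∀ z, jacobiTheta₂ z τ ≠ 0 ↔ jacobiTheta₂ (z / τ) (-1 / τ) ≠ 0 := fun z => by
    rw [jacobiTheta₂_functional_equation z τ, mul_ne_zero_iff]
    exact and_iff_right (hu z)
  have e1 : (τ / 2) / τ = 1 / 2 := by field_simp
  have e2 : (1 / 2 : ℂ) / τ = -(-1 / τ / 2) := by field_simp
  simp only [ThetaConstantsNeZero]
  rw [h 0, h (1 / 2), h (τ / 2), e1, e2, jacobiTheta₂_neg_left, zero_div]
  tauto

/-- Joint nonvanishing is invariant under `SL(2, ℤ)`, since the generators `S` and `T` permute the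
three constants up to nonzero factors. A single constant would be stable only under a smaller group,
whose fundamental domain reaches real cusps. -/
lemma thetaConstantsNeZero_smul (γ : SL(2, ℤ)) :
    ∀ z : ℍ, ThetaConstantsNeZero (γ • z : ℍ) ↔ ThetaConstantsNeZero z := by
  have : γ ∈ Subgroup.closure {ModularGroup.S, ModularGroup.T} := by
    simp [SpecialLinearGroup.SL2Z_generators]
  induction this using Subgroup.closure_induction with
  | one => simp
  | mem g hg =>
    intro z
    rcases hg with rfl | rfl
    · rw [UpperHalfPlane.modular_S_smul, ← thetaConstantsNeZero_inv z.ne_zero]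
      have : (((UpperHalfPlane.mk (-(z : ℂ))⁻¹ z.im_inv_neg_coe_pos : ℍ)) : ℂ) = -1 / z := by
        change (-(z : ℂ))⁻¹ = _
        rw [inv_neg, neg_div, one_div]
      rw [this]
    · rw [UpperHalfPlane.modular_T_smul, UpperHalfPlane.coe_vadd, ofReal_one, add_comm,
        thetaConstantsNeZero_add_one]
  | mul g h _ _ ig ih => intro z; rw [mul_smul, ig, ih]
  | inv g _ ig => intro z; rw [← ig, smul_inv_smul]

lemma exp_neg_pi_im_lt {z : ℍ} (h : 3 ≤ 4 * z.im ^ 2) : Real.exp (-Real.pi * z.im) < 1 / 3 := by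
  have h1 : (0.8 : ℝ) ≤ z.im := by
    by_contra! H
    have := z.im_pos
    nlinarith
  have h2 : (2 : ℝ) ≤ Real.pi * z.im := by nlinarith [Real.pi_gt_three]
  have h3 : Real.exp (-Real.pi * z.im) ≤ Real.exp (-2) := by
    rw [Real.exp_le_exp]; linarith
  have h4 : (3 : ℝ) < Real.exp 2 := by
    have := Real.add_one_lt_exp (x := 2) (by norm_num)
    linarith
  refine h3.trans_lt ?_
  rw [Real.exp_neg, one_div]
  exact inv_strictAnti₀ (by norm_num) h4

/-- For `x < 1/3`, the bound `2x / (1 - x)` for the distance of the theta constant from `1` is less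
than `1`. -/
lemma jacobiTheta_ne_zero_of_exp_lt {τ : ℂ} (hτ : 0 < τ.im)
    (h : Real.exp (-Real.pi * τ.im) < 1 / 3) : jacobiTheta₂ 0 τ ≠ 0 := by
  intro H
  have h1 := norm_jacobiTheta_sub_one_le hτ
  rw [jacobiTheta_eq_jacobiTheta₂, H, zero_sub, norm_neg, norm_one] at h1
  have hx := Real.exp_pos (-Real.pi * τ.im)
  set x := Real.exp (-Real.pi * τ.im)
  have h2 : 0 < 1 - x := by linarith
  rw [div_mul_eq_mul_div, le_div_iff₀ h2] at h1
  linarith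

/-- The terms at `n` and `-n-1` coincide. The value is twice a sum over `n ≥ 0` with leading term
`1` and a tail bounded by `x / (1 - x) < 1`. -/
lemma jacobiTheta₂_half_period_ne_zero {τ : ℂ} (hτ : 0 < τ.im)
    (h : Real.exp (-Real.pi * τ.im) < 1 / 3) : jacobiTheta₂ (τ / 2) τ ≠ 0 := by
  set x := Real.exp (-Real.pi * τ.im) with hx
  have hx0 : 0 < x := Real.exp_pos _
  have hs := hasSum_jacobiTheta₂_term (τ / 2) hτ
  have hsum := hs.summable
  have hterm : ∀ n : ℤ, jacobiTheta₂_term n (τ / 2) τ = cexp (Real.pi * I * (n * (n + 1)) * τ) := by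
    intro n; rw [jacobiTheta₂_term]; congr 1; ring
  have hnat : Summable fun n : ℕ => jacobiTheta₂_term n (τ / 2) τ :=
    hsum.comp_injective Nat.cast_injective
  have h1 := HasSum.of_nat_of_neg_add_one hnat.hasSum (f := fun n => jacobiTheta₂_term n (τ / 2) τ)
    (m' := ∑' n : ℕ, jacobiTheta₂_term n (τ / 2) τ) (by
      have : (fun n : ℕ => jacobiTheta₂_term (-((n : ℤ) + 1)) (τ / 2) τ) =
          fun n : ℕ => jacobiTheta₂_term n (τ / 2) τ := by
        ext n
        rw [hterm, hterm]; congr 1; push_cast; ring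
      rw [this]
      exact hnat.hasSum)
  have h2 := hs.unique h1
  have hbound : ∀ n : ℕ, ‖jacobiTheta₂_term ((n + 1 : ℕ) : ℤ) (τ / 2) τ‖ ≤ x ^ (n + 1) := by
    intro n
    rw [hterm, Complex.norm_exp, hx, ← Real.exp_nat_mul, Real.exp_le_exp]
    have e : (Real.pi * I * ((((n + 1 : ℕ) : ℤ) : ℂ) * ((((n + 1 : ℕ) : ℤ) : ℂ) + 1)) * τ).re =
        -(Real.pi * ((n + 1) * (n + 1 + 1)) * τ.im) := by
      have : (Real.pi * I * ((((n + 1 : ℕ) : ℤ) : ℂ) * ((((n + 1 : ℕ) : ℤ) : ℂ) + 1)) * τ) =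
        ((Real.pi * ((n + 1) * (n + 1 + 1)) : ℝ) : ℂ) * (I * τ) := by push_cast; ring
      rw [this, Complex.re_ofReal_mul, Complex.I_mul_re]; ring
    rw [e]
    have h3 : 0 ≤ Real.pi * τ.im * ((n + 1) * (n + 1)) := by positivity
    push_cast
    nlinarith
  have hgeo : HasSum (fun n : ℕ => x ^ (n + 1)) (x * (1 - x)⁻¹) := by
    simpa only [pow_succ'] using (hasSum_geometric_of_lt_one hx0.le (by linarith)).mul_left x
  have h3 : ‖∑' n : ℕ, jacobiTheta₂_term ((n + 1 : ℕ) : ℤ) (τ / 2) τ‖ ≤ x * (1 - x)⁻¹ :=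
    tsum_of_norm_bounded hgeo hbound
  rw [h2, ← two_mul, hnat.tsum_eq_zero_add]
  intro H
  have h4 := (mul_eq_zero.1 H).resolve_left two_ne_zero
  have h5 : jacobiTheta₂_term ((0 : ℕ) : ℤ) (τ / 2) τ = 1 := by simp [jacobiTheta₂_term]
  rw [h5, add_comm, add_eq_zero_iff_eq_neg] at h4
  rw [h4, norm_neg, norm_one, ← div_eq_mul_inv, le_div_iff₀ (by linarith)] at h3
  linarith

lemma thetaConstantsNeZero (z : ℍ) : ThetaConstantsNeZero z := by
  obtain ⟨γ, hγ⟩ := ModularGroup.exists_smul_mem_fd z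
  rw [← thetaConstantsNeZero_smul γ]
  set w := γ • z
  have hw := exp_neg_pi_im_lt (ModularGroup.three_le_four_mul_im_sq_of_mem_fd hγ)
  refine ⟨jacobiTheta_ne_zero_of_exp_lt w.im_pos hw, ?_,
    jacobiTheta₂_half_period_ne_zero w.im_pos hw⟩
  -- The second constant at `w` is the first one at `w + 1`, a point of the same height.
  rw [← jacobiTheta₂_zero_add_one]
  refine jacobiTheta_ne_zero_of_exp_lt ?_ ?_
  · simpa using w.im_pos
  · simpa using hw

lemma shimuraTheta_ne_zero (z : ℍ) : shimuraTheta z ≠ 0 := by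
  have h : 0 < (2 * (z : ℂ)).im := by simpa using z.im_pos
  have := (thetaConstantsNeZero ⟨2 * z, h⟩).1
  rwa [shimuraTheta, jacobiTheta_eq_jacobiTheta₂]

end ThetaNonvanishing

/-! ### The cube of the theta function -/

/-- The sum of three squares, as a bilinear form. -/
def stdForm : LinearMap.BilinForm ℚ (Fin 3 → ℚ) := Matrix.toBilin' 1

lemma stdForm_apply (x y : Fin 3 → ℚ) : stdForm x y = ∑ i, x i * y i := by
  simp [stdForm, Matrix.toBilin'_apply', dotProduct]

lemma stdForm_symm (x y : Fin 3 → ℚ) : stdForm x y = stdForm y x := by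
  simp [stdForm_apply, mul_comm]

lemma stdForm_pos (x : Fin 3 → ℚ) (hx : x ≠ 0) : 0 < stdForm x x := by
  rw [stdForm_apply]
  obtain ⟨i, hi⟩ := Function.ne_iff.1 hx
  refine Finset.sum_pos' (fun i _ => mul_self_nonneg _) ⟨i, Finset.mem_univ _, ?_⟩
  exact mul_self_pos.2 hi

/-- The lattice `ℤ³`. -/
def stdLattice : Submodule ℤ (Fin 3 → ℚ) := Submodule.span ℤ (Set.range (Pi.basisFun ℚ (Fin 3)))

lemma mem_stdLattice {x : Fin 3 → ℚ} : x ∈ stdLattice ↔ ∃ n : Fin 3 → ℤ, ∀ i, x i = n i := by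
  rw [stdLattice, mem_span_range_basis_iff]
  refine exists_congr fun n => ?_
  rw [funext_iff]
  refine forall_congr' fun i => ?_
  simp [Pi.single_apply]

lemma isFull_stdLattice : IsFull stdLattice := by
  refine ⟨Submodule.fg_span (Set.finite_range _), ?_⟩
  rw [eq_top_iff, ← (Pi.basisFun ℚ (Fin 3)).span_eq, Submodule.span_le]
  exact fun x hx => Submodule.subset_span (Submodule.subset_span hx)

/-- Makes `θ³` a ternary theta series, subject to the same transformation law as the cosets under
study; the cube of the automorphy factor then never has to be computed explicitly. -/
lemma shimuraTheta_pow_three (z : ℍ) :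
    shimuraTheta z ^ 3 = thetaSum stdForm (ind stdLattice 0) z := by
  have hθ : shimuraTheta z = ∑' n, gaussTerm 1 0 z n := by
    rw [shimuraTheta, jacobiTheta]
    refine tsum_congr fun n => ?_
    rw [gaussTerm]; congr 1; push_cast; ring
  have hs := summable_gaussTerm one_pos 0 z.im_pos
  have h := (summable_and_tsum_of_prod_three
    (f := fun x => ind stdLattice 0 x * qexp stdForm x z)
    (g := fun n => fun i => ((triple n i : ℤ) : ℚ)) (f0 := gaussTerm 1 0 z)
    (f1 := gaussTerm 1 0 z) (f2 := gaussTerm 1 0 z)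
    (fun a b hab => triple_injective (funext fun i => Int.cast_injective (congrFun hab i)))
    (fun n => by
      rw [ind_of_mem (by rw [sub_zero, mem_stdLattice]; exact ⟨_, fun i => rfl⟩), one_mul, qexp,
        stdForm_apply, gaussTerm, gaussTerm, gaussTerm, ← Complex.exp_add, ← Complex.exp_add,
        Fin.sum_univ_three]
      congr 1
      simp only [triple, Matrix.cons_val_zero, Matrix.cons_val_one, Matrix.cons_val]
      push_cast; ring)
    (fun x hx => by
      rw [ind_of_notMem, zero_mul]
      rw [sub_zero, mem_stdLattice]
      rintro ⟨n, hn⟩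
      obtain ⟨n, rfl⟩ := triple_surjective n
      exact hx ⟨n, funext fun i => (hn i).symm⟩) hs hs hs).2
  rw [thetaSum, h, hθ]; ring

/-! ### Quadratic Gauss sums over a finite field -/

section Gauss

variable {F : Type*} [Field F] [Fintype F] [DecidableEq F]

/-- An element `s` has `1 + χ(s)` square roots, so the sum becomes a Gauss sum twisted by the
quadratic character `χ`, in which `w` can be substituted away. -/
lemma sum_addChar_mul_sq (hF : ringChar F ≠ 2) {ψ : AddChar F ℂ} (hψ : ψ.IsPrimitive) {w : F}
    (hw : w ≠ 0) : ∑ t, ψ (w * t ^ 2) = (quadraticChar F w : ℂ) * ∑ t, ψ (t ^ 2) := by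
  have key : ∀ w : F, w ≠ 0 → ∑ t, ψ (w * t ^ 2) = ∑ s, (quadraticChar F s : ℂ) * ψ (w * s) := by
    intro w hw
    have h1 : ∑ t, ψ (w * t ^ 2) = ∑ s, ∑ t with t ^ 2 = s, ψ (w * s) := by
      rw [← Finset.sum_fiberwise Finset.univ (fun t : F => t ^ 2)]
      refine Finset.sum_congr rfl fun s _ => Finset.sum_congr rfl fun t ht => ?_
      rw [(Finset.mem_filter.1 ht).2]
    have h2 : ∀ s : F, ∑ t with t ^ 2 = s, ψ (w * s) = (quadraticChar F s + 1 : ℂ) * ψ (w * s) := by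
      intro s
      rw [Finset.sum_const, nsmul_eq_mul]
      congr 1
      have := quadraticChar_card_sqrts hF s
      rw [show ({x : F | x ^ 2 = s}.toFinset) = Finset.univ.filter (fun t : F => t ^ 2 = s) by
        ext; simp] at this
      exact_mod_cast this
    rw [h1, Finset.sum_congr rfl fun s _ => h2 s]
    simp only [add_mul, one_mul, Finset.sum_add_distrib]
    have h3 : ∑ s, ψ (w * s) = 0 := by
      rw [← AddChar.sum_eq_zero_of_ne_one (hψ hw)]
      exact Finset.sum_congr rfl fun s _ => by rw [AddChar.mulShift_apply]
    rw [h3, add_zero]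
  have h1 := key 1 one_ne_zero
  simp only [one_mul] at h1
  rw [key w hw, h1, Finset.mul_sum]
  rw [← Equiv.sum_comp (Equiv.mulLeft₀ w hw) (fun s => (quadraticChar F w : ℂ) *
    ((quadraticChar F s : ℂ) * ψ s))]
  refine Finset.sum_congr rfl fun s _ => ?_
  simp only [Equiv.mulLeft₀_apply, map_mul]
  have := quadraticChar_sq_one hw
  have h2 : (quadraticChar F w : ℂ) ^ 2 = 1 := by exact_mod_cast this
  push_cast
  linear_combination (-(quadraticChar F s : ℂ) * ψ (w * s)) * h2

/-- In odd characteristic the form can be diagonalized; the determinant changes by a square, and the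
sum factors into three one-dimensional ones. -/
lemma sum_addChar_quadratic (hF : ringChar F ≠ 2) {ψ : AddChar F ℂ} (hψ : ψ.IsPrimitive)
    {A : Matrix (Fin 3) (Fin 3) F} (hA : A.IsSymm) (hdet : A.det ≠ 0) :
    ∑ x : Fin 3 → F, ψ (x ⬝ᵥ A *ᵥ x) = (quadraticChar F A.det : ℂ) * (∑ t, ψ (t ^ 2)) ^ 3 := by
  have h2 : (2 : F) ≠ 0 := Ring.two_ne_zero hF
  let _ : Invertible (2 : F) := invertibleOfNonzero h2
  set Q := Matrix.toBilin' A with hQ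
  have hs : LinearMap.IsSymm Q := ⟨fun x y => by
    simp only [hQ, Matrix.toBilin'_apply', RingHom.id_apply]
    rw [Matrix.dotProduct_mulVec, ← Matrix.mulVec_transpose, hA, dotProduct_comm]⟩
  obtain ⟨v, hv⟩ := LinearMap.BilinForm.exists_orthogonal_basis hs
  have hfin : Module.finrank F (Fin 3 → F) = 3 := by simp
  set w := v.reindex (finCongr hfin) with hw
  have hw' : ∀ i j, i ≠ j → Q (w i) (w j) = 0 := by
    intro i j hij
    simp only [hw, Module.Basis.reindex_apply]
    exact hv (fun h => hij ((finCongr hfin).symm.injective h))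
  have hmat : LinearMap.BilinForm.toMatrix w Q = Matrix.diagonal fun i => Q (w i) (w i) := by
    ext i j
    rw [LinearMap.BilinForm.toMatrix_apply, Matrix.diagonal_apply]
    split_ifs with h
    · rw [h]
    · exact hw' i j h
  have hconj := LinearMap.BilinForm.toMatrix_mul_basis_toMatrix (Pi.basisFun F (Fin 3)) w Q
  have hAQ : LinearMap.BilinForm.toMatrix (Pi.basisFun F (Fin 3)) Q = A := by
    rw [LinearMap.BilinForm.toMatrix_basisFun, hQ, LinearMap.BilinForm.toMatrix'_toBilin']
  rw [hAQ, hmat] at hconj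
  have hdets := congrArg Matrix.det hconj
  rw [Matrix.det_mul, Matrix.det_mul, Matrix.det_transpose, Matrix.det_diagonal] at hdets
  set P := ((Pi.basisFun F (Fin 3)).toMatrix w).det with hP
  have hP0 : P ≠ 0 := by
    have := (Pi.basisFun F (Fin 3)).invertibleToMatrix w
    exact (Matrix.isUnit_det_of_invertible _).ne_zero
  have hprod0 : ∏ i, Q (w i) (w i) ≠ 0 := by
    rw [← hdets]; exact mul_ne_zero (mul_ne_zero hP0 hdet) hP0
  have hq0 : ∀ i, Q (w i) (w i) ≠ 0 := fun i => Finset.prod_ne_zero_iff.1 hprod0 i (Finset.mem_univ _)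
  have hchar : (quadraticChar F A.det : ℂ) = ∏ i, (quadraticChar F (Q (w i) (w i)) : ℂ) := by
    have h1 : quadraticChar F (∏ i, Q (w i) (w i)) = quadraticChar F A.det := by
      rw [← hdets, show P * A.det * P = P ^ 2 * A.det by ring, map_mul, quadraticChar_sq_one' hP0,
        one_mul]
    rw [← h1, map_prod]; push_cast; rfl
  have hsum : ∑ x : Fin 3 → F, ψ (x ⬝ᵥ A *ᵥ x) = ∏ i, ∑ t, ψ (Q (w i) (w i) * t ^ 2) := by
    rw [Finset.prod_univ_sum, Fintype.piFinset_univ, ← Equiv.sum_comp w.equivFun.symm.toEquiv]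
    refine Finset.sum_congr rfl fun c _ => ?_
    have h1 : w.equivFun.symm c ⬝ᵥ A *ᵥ w.equivFun.symm c = ∑ i, Q (w i) (w i) * c i ^ 2 := by
      rw [← Matrix.toBilin'_apply', ← hQ, w.equivFun_symm_apply]
      rw [Fin.sum_univ_three, Fin.sum_univ_three]
      simp only [map_add, map_smul, LinearMap.add_apply, LinearMap.smul_apply, smul_eq_mul,
        hw' 0 1 (by decide), hw' 0 2 (by decide), hw' 1 0 (by decide),
        hw' 1 2 (by decide), hw' 2 0 (by decide), hw' 2 1 (by decide)]
      ring
    change ψ (w.equivFun.symm c ⬝ᵥ A *ᵥ w.equivFun.symm c) = _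
    rw [h1, Fin.sum_univ_three, AddChar.map_add_eq_mul, AddChar.map_add_eq_mul, Fin.prod_univ_three]
  rw [hsum, hchar]
  simp only [sum_addChar_mul_sq hF hψ (hq0 _), Finset.prod_mul_distrib]
  simp

end Gauss

/-! ### Gauss sums of lattices -/

section LatticeGauss

variable {V : Type*} [AddCommGroup V] [Module ℚ V] {B : LinearMap.BilinForm ℚ V}

lemma IsCosetReps.exists_sub_mem {ι : Type*} [Fintype ι] {t : ι → V} {N M : Submodule ℤ V} {h : V}
    (ht : IsCosetReps t N M h) {x : V} (hx : x - h ∈ M) : ∃ i, x - t i ∈ N := by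
  by_contra! H
  have h1 := ht x
  rw [ind_of_mem hx, Finset.sum_eq_zero fun i _ => ind_of_notMem (H i)] at h1
  exact zero_ne_one h1

lemma IsCosetReps.eq_of_sub_mem {ι : Type*} [Fintype ι] {t : ι → V} {N M : Submodule ℤ V} {h : V}
    (ht : IsCosetReps t N M h) {i j : ι} (hij : t i - t j ∈ N) : i = j := by
  classical
  by_contra H
  have h1 := ht (t i)
  rw [ind_of_mem (ht.sub_mem i)] at h1
  have h2 : ∑ k, (ind N (t k) (t i)).re = 1 := by rw [← Complex.re_sum, h1, Complex.one_re]
  have h3 : ∑ k ∈ {i, j}, (ind N (t k) (t i)).re ≤ ∑ k, (ind N (t k) (t i)).re := by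
    refine Finset.sum_le_sum_of_subset_of_nonneg (Finset.subset_univ _) fun k _ _ => ?_
    unfold ind; split_ifs <;> simp
  rw [Finset.sum_pair H, h2, ind_of_mem (by simp), ind_of_mem hij] at h3
  norm_num at h3

/-- `A` is a Gram matrix of `L` for the basis `b`. -/
def IsGram (B : LinearMap.BilinForm ℚ V) {L : Submodule ℤ V} (b : Module.Basis (Fin 3) ℤ L)
    (A : Matrix (Fin 3) (Fin 3) ℤ) : Prop :=
  ∀ i j, ((A i j : ℤ) : ℚ) = B (b i) (b j)

lemma IsGram.apply {L : Submodule ℤ V} {b : Module.Basis (Fin 3) ℤ L}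
    {A : Matrix (Fin 3) (Fin 3) ℤ} (hA : IsGram B b A) (x y : L) :
    B x y = ((b.repr x ⬝ᵥ A *ᵥ b.repr y : ℤ) : ℚ) := by
  have hx : ∀ x : L, (x : V) = ∑ i, ((b.repr x i : ℤ) : ℚ) • (b i : V) := fun x => by
    calc (x : V) = ((∑ i, b.repr x i • b i : L) : V) := by rw [b.sum_repr]
      _ = _ := by simp only [Submodule.coe_sum, Submodule.coe_smul, Int.cast_smul_eq_zsmul]
  rw [hx x, hx y]
  simp only [map_sum, LinearMap.sum_apply, map_smul, LinearMap.smul_apply, smul_eq_mul, ← hA _ _,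
    dotProduct, Matrix.mulVec]
  push_cast
  simp only [Fin.sum_univ_three]
  ring

lemma IsGram.symm {L : Submodule ℤ V} {b : Module.Basis (Fin 3) ℤ L}
    {A : Matrix (Fin 3) (Fin 3) ℤ} (hA : IsGram B b A) (hsymm : ∀ x y, B x y = B y x) :
    A.IsSymm := by
  ext i j
  have : ((A j i : ℤ) : ℚ) = A i j := by rw [hA, hA, hsymm]
  exact_mod_cast this

lemma ec_div_eq_stdAddChar (ℓ : ℕ) [NeZero ℓ] (m : ℤ) :
    ec (m / ℓ) = ZMod.stdAddChar (m : ZMod ℓ) := by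
  rw [ZMod.stdAddChar_coe, ec]
  congr 1
  push_cast
  ring

/-- As `a` is prime to `ℓ`, reduction modulo `ℓ L` identifies the cosets of `ℓ a L` in `a L + ν`
with all of `(ℤ/ℓ)³`. The sum is therefore complete and independent of `ν`. -/
lemma sum_ec_cosetReps {L : Submodule ℤ V} {b : Module.Basis (Fin 3) ℤ L}
    {A : Matrix (Fin 3) (Fin 3) ℤ} (hA : IsGram B b A)
    {a : ℕ} {ℓ : ℕ} [NeZero ℓ] (haℓ : IsCoprime (a : ℤ) ℓ) {ν : V} (hν : ν ∈ L) (β : ℤ)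
    {ι : Type*} [Fintype ι] {t : ι → V}
    (ht : IsCosetReps t (scale (ℓ : ℤ) (scale a L)) (scale a L) ν) :
    ∑ i, ec (B (t i) (t i) * (β / ℓ)) = ∑ x : Fin 3 → ZMod ℓ,
      ZMod.stdAddChar (x ⬝ᵥ ((β : ZMod ℓ) • A.map (Int.cast : ℤ → ZMod ℓ)) *ᵥ x) := by
  have htL : ∀ i, t i ∈ L := fun i => by
    have := L.add_mem (scale_nat_le a L (ht.sub_mem i)) hν
    rwa [sub_add_cancel] at this
  let red : L → (Fin 3 → ZMod ℓ) := fun x i => ((b.repr x i : ℤ) : ZMod ℓ)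
  have hℓ0 : (ℓ : ℚ) ≠ 0 := by exact_mod_cast NeZero.ne ℓ
  have hred : ∀ x y : L, red x = red y ↔ ∃ u ∈ L, (x : V) - y = (ℓ : ℚ) • u := by
    intro x y
    constructor
    · intro h
      have : ∀ i, ∃ k : ℤ, b.repr x i - b.repr y i = ℓ * k := fun i => by
        have h1 := congrFun h i
        simp only [red] at h1
        rw [eq_comm, ZMod.intCast_eq_intCast_iff_dvd_sub] at h1
        exact h1
      choose k hk using this
      refine ⟨(∑ i, k i • b i : L), SetLike.coe_mem _, ?_⟩
      have h2 : x - y = (ℓ : ℤ) • ∑ i, k i • b i := by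
        apply b.repr.injective
        ext i
        rw [map_sub, map_zsmul, Finsupp.sub_apply, Finsupp.smul_apply, b.repr_sum_self, hk i]
        simp
      have h3 := congrArg (Subtype.val) h2
      rw [Submodule.coe_sub, Submodule.coe_smul] at h3
      rw [h3, ← Int.cast_smul_eq_zsmul ℚ, Int.cast_natCast]
    · rintro ⟨u, hu, hxy⟩
      have h2 : x - y = (ℓ : ℤ) • (⟨u, hu⟩ : L) := by
        apply Subtype.ext
        rw [Submodule.coe_sub, hxy, Submodule.coe_smul, ← Int.cast_smul_eq_zsmul ℚ, Int.cast_natCast]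
      ext i
      simp only [red]
      rw [eq_comm, ZMod.intCast_eq_intCast_iff_dvd_sub]
      refine ⟨b.repr ⟨u, hu⟩ i, ?_⟩
      rw [← Finsupp.sub_apply, ← map_sub, h2, map_zsmul]
      simp
  have hbij : Function.Bijective (fun i => red ⟨t i, htL i⟩) := by
    constructor
    · intro i j hij
      obtain ⟨u, hu, hxy⟩ := (hred _ _).1 hij
      apply ht.eq_of_sub_mem
      -- the difference lies in `aL ∩ ℓL`
      have h1 : t i - t j ∈ scale (a : ℚ) L := by
        have := (scale (a : ℚ) L).sub_mem (ht.sub_mem i) (ht.sub_mem j)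
        simpa using this
      obtain ⟨w, hw, hwx⟩ := mem_scale.1 h1
      obtain ⟨r, s, hrs⟩ := haℓ
      have hrs' : (r : ℚ) * a + s * ℓ = 1 := by exact_mod_cast hrs
      simp only at hxy
      rw [scale_scale, mem_scale]
      refine ⟨(r : ℤ) • u + (s : ℤ) • w, L.add_mem (L.smul_mem _ hu) (L.smul_mem _ hw), ?_⟩
      calc _ = ((r : ℚ) * a) • ((ℓ : ℚ) • u) + ((s : ℚ) * ℓ) • ((a : ℚ) • w) := by
            simp only [← Int.cast_smul_eq_zsmul ℚ, smul_add, smul_smul]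
            congr 2 <;> push_cast <;> ring
        _ = t i - t j := by rw [← hxy, hwx, ← add_smul, hrs', one_smul]
    · intro x
      obtain ⟨r, s, hrs⟩ := haℓ
      -- The coefficient `r` is an inverse of `a` modulo `ℓ`, so `a k + ν ≡ x` coordinatewise.
      let k : Fin 3 → ℤ := fun i => r * ((x i).val - b.repr ⟨ν, hν⟩ i)
      have hmem : (a : ℚ) • ((∑ i, k i • b i : L) : V) ∈ scale (a : ℚ) L :=
        smul_mem_scale _ (SetLike.coe_mem _)
      obtain ⟨i, hi⟩ := ht.exists_sub_mem (x := (a : ℚ) • ((∑ i, k i • b i : L) : V) + ν)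
        (by simpa using hmem)
      rw [scale_scale, mem_scale] at hi
      obtain ⟨u, hu, hui⟩ := hi
      refine ⟨i, ?_⟩
      have h1 : red ((a : ℤ) • (∑ i, k i • b i : L) + ⟨ν, hν⟩) = red ⟨t i, htL i⟩ := by
        rw [hred]
        refine ⟨(a : ℤ) • u, L.smul_mem _ hu, ?_⟩
        rw [Submodule.coe_add, Submodule.coe_smul]
        simp only [← Int.cast_smul_eq_zsmul ℚ, Int.cast_natCast]
        rw [← hui, smul_smul]
        push_cast
        rfl
      change red ⟨t i, htL i⟩ = x
      rw [← h1]
      ext j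
      simp only [red]
      rw [map_add, map_zsmul, Finsupp.add_apply, Finsupp.smul_apply, b.repr_sum_self]
      simp only [k, smul_eq_mul]
      have hra : (r : ZMod ℓ) * a = 1 := by
        have := congrArg (Int.cast : ℤ → ZMod ℓ) hrs
        simpa using this
      push_cast
      rw [ZMod.natCast_zmod_val]
      linear_combination (x j - (b.repr ⟨ν, hν⟩ j : ZMod ℓ)) * hra
  rw [← hbij.sum_comp]
  refine Finset.sum_congr rfl fun i _ => ?_
  have h1 := hA.apply ⟨t i, htL i⟩ ⟨t i, htL i⟩
  simp only at h1
  rw [h1, show (((b.repr ⟨t i, htL i⟩ ⬝ᵥ A *ᵥ b.repr ⟨t i, htL i⟩ : ℤ) : ℚ) * (β / ℓ)) =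
    ((β * (b.repr ⟨t i, htL i⟩ ⬝ᵥ A *ᵥ b.repr ⟨t i, htL i⟩) : ℤ) : ℚ) / ℓ by push_cast; ring,
    ec_div_eq_stdAddChar]
  congr 1
  simp only [red, dotProduct, Matrix.mulVec, Matrix.smul_apply, Matrix.map_apply, smul_eq_mul]
  push_cast
  rw [Finset.mul_sum]
  refine Finset.sum_congr rfl fun j _ => ?_
  rw [Finset.mul_sum, Finset.mul_sum, Finset.mul_sum]
  exact Finset.sum_congr rfl fun k _ => by ring

/-- The Gauss sum of a lattice modulo an odd prime. -/
lemma sum_ec_cosetReps_prime (hsymm : ∀ x y, B x y = B y x)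
    {L : Submodule ℤ V} {b : Module.Basis (Fin 3) ℤ L}
    {A : Matrix (Fin 3) (Fin 3) ℤ} (hA : IsGram B b A)
    {a : ℕ} {ℓ : ℕ} [Fact ℓ.Prime] (hℓ2 : ℓ ≠ 2) (haℓ : IsCoprime (a : ℤ) ℓ) {ν : V} (hν : ν ∈ L)
    {β : ℤ} (hβ : (β : ZMod ℓ) ≠ 0) (hdet : (A.det : ZMod ℓ) ≠ 0)
    {ι : Type*} [Fintype ι] {t : ι → V}
    (ht : IsCosetReps t (scale (ℓ : ℤ) (scale a L)) (scale a L) ν) :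
    ∑ i, ec (B (t i) (t i) * (β / ℓ)) = (quadraticChar (ZMod ℓ) A.det : ℂ) *
      ((quadraticChar (ZMod ℓ) β : ℂ) * (∑ x : ZMod ℓ, ZMod.stdAddChar (x ^ 2)) ^ 3) := by
  have hd : ((β : ZMod ℓ) • A.map (Int.cast : ℤ → ZMod ℓ)).det = (β : ZMod ℓ) ^ 3 * A.det := by
    rw [Matrix.det_smul, Fintype.card_fin]
    congr 1
    exact (Int.cast_det (R := ZMod ℓ) A).symm
  rw [sum_ec_cosetReps hA haℓ hν β ht, sum_addChar_quadratic (by rwa [ZMod.ringChar_zmod_n])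
    (ZMod.isPrimitive_stdAddChar ℓ) _ (by rw [hd]; exact mul_ne_zero (pow_ne_zero 3 hβ) hdet), hd]
  · rw [map_mul, pow_succ, map_mul, quadraticChar_sq_one' hβ]
    push_cast
    ring
  · have := hA.symm hsymm
    ext i j
    simp [this.apply i j]

end LatticeGauss

/-! ### The quadratic character `χ_{4D}` -/

lemma chiFour_mul (D : ℤ) {m n : ℤ} (hm : m ≠ 0) (hn : n ≠ 0) :
    chiFour D (m * n) = chiFour D m * chiFour D n := by
  rw [chiFour, Int.natAbs_mul, jacobiSym.mul_right' _ (Int.natAbs_ne_zero.2 hm)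
    (Int.natAbs_ne_zero.2 hn)]
  push_cast
  rfl

lemma chiFour_neg (D m : ℤ) : chiFour D (-m) = chiFour D m := by
  rw [chiFour, Int.natAbs_neg, chiFour]

lemma chiFour_one (D : ℤ) : chiFour D 1 = 1 := by simp [chiFour]

lemma chiFour_prime (D : ℤ) {ℓ : ℕ} [Fact ℓ.Prime] (hℓ : ℓ ≠ 2) :
    chiFour D ℓ = (quadraticChar (ZMod ℓ) D : ℂ) := by
  have h2 : (2 : ZMod ℓ) ≠ 0 := Ring.two_ne_zero (by rwa [ZMod.ringChar_zmod_n])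
  rw [chiFour, Int.natAbs_natCast, ← jacobiSym.legendreSym.to_jacobiSym, legendreSym]
  congr 1
  push_cast
  rw [show (4 : ZMod ℓ) = 2 ^ 2 by norm_num, map_mul, quadraticChar_sq_one' h2, one_mul]

/-- Modulo `4s - 1` one has `4s ≡ 1`, and `4` is a square. -/
lemma jacobiSym_four_mul_sub_one {s : ℕ} (hs : 0 < s) : jacobiSym s (4 * s - 1) = 1 := by
  have hodd : Odd (4 * s - 1) := ⟨2 * s - 1, by omega⟩
  have h1 : jacobiSym (4 * s) (4 * s - 1) = 1 := by
    rw [jacobiSym.mod_left' (a₂ := 1), jacobiSym.one_left]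
    apply Int.ModEq.symm
    rw [Int.modEq_iff_dvd]
    exact ⟨1, by push_cast [show 1 ≤ 4 * s by omega]; ring⟩
  rwa [jacobiSym.mul_left, jacobiSym.at_four hodd, one_mul] at h1

/-- The case `u ≡ -u'` reduces to a congruence `u ≡ u''` with `u'' = (4s - 1) u'`, the extra factor
having trivial symbol. -/
lemma jacobiSym_nat_congr {s u u' : ℕ} (hs : 0 < s) (hu : Odd u) (hu' : Odd u')
    (h : (4 * s : ℤ) ∣ u - u' ∨ (4 * s : ℤ) ∣ u + u') : jacobiSym s u = jacobiSym s u' := by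
  have key : ∀ u u' : ℕ, Odd u → Odd u' → (4 * s : ℤ) ∣ u - u' →
      jacobiSym s u = jacobiSym s u' := by
    intro u u' hu hu' h
    rw [jacobiSym.mod_right' s hu, jacobiSym.mod_right' s hu']
    congr 1
    have : (u' : ℤ) ≡ u [ZMOD (4 * s : ℕ)] := (Int.modEq_iff_dvd).2 (by push_cast; exact h)
    exact ((Int.natCast_modEq_iff.1 this).symm)
  rcases h with h | h
  · exact key u u' hu hu' h
  · have hodd : Odd (4 * s - 1) := ⟨2 * s - 1, by omega⟩
    rw [key u ((4 * s - 1) * u') hu (hodd.mul hu') ?_,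
      jacobiSym.mul_right' _ (by omega) (by rintro rfl; simp at hu'),
      jacobiSym_four_mul_sub_one hs, one_mul]
    push_cast [show 1 ≤ 4 * s by omega]
    obtain ⟨k, hk⟩ := h
    exact ⟨k - u', by linear_combination hk⟩

/-- `χ_{4D}` is periodic modulo `4N` if every prime divisor of `D` divides `N`. -/
lemma chiFour_congr {D : ℤ} (hD : 0 < D) {N : ℕ}
    (hDN : ∀ q : ℕ, q.Prime → (q : ℤ) ∣ D → q ∣ N) {m m' : ℤ} (hm : IsCoprime m (4 * N : ℤ))
    (hm' : IsCoprime m' (4 * N : ℤ)) (h : (4 * N : ℤ) ∣ m - m') : chiFour D m = chiFour D m' := by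
  -- Only the squarefree part `s` of `D` matters, and `s` divides `N` because each of its primes
  -- does.
  obtain ⟨s, t, hst, hs⟩ := Nat.sq_mul_squarefree D.natAbs
  have hDst : D = (t : ℤ) ^ 2 * s := by
    have : (D.natAbs : ℤ) = D := Int.natAbs_of_nonneg hD.le
    rw [← this, ← hst]; push_cast; ring
  have hspos : 0 < s := Nat.pos_of_ne_zero hs.ne_zero
  have hsN : s ∣ N := by
    rw [← Nat.prod_primeFactors_of_squarefree hs]
    refine Finset.prod_primes_dvd _ (fun q hq => (Nat.prime_of_mem_primeFactors hq).prime)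
      fun q hq => hDN q (Nat.prime_of_mem_primeFactors hq) ?_
    rw [hDst]
    exact Dvd.dvd.mul_left (Int.natCast_dvd_natCast.2 (Nat.dvd_of_mem_primeFactors hq)) _
  have hodd : ∀ m : ℤ, IsCoprime m (4 * N : ℤ) → Odd m.natAbs := by
    intro m hm
    rw [Int.natAbs_odd, ← Int.not_even_iff_odd]
    intro hev
    have h2 : (2 : ℤ) ∣ 4 * N := ⟨2 * N, by ring⟩
    have := hm.isUnit_of_dvd' hev.two_dvd h2
    rw [Int.isUnit_iff] at this; omega
  have hred : ∀ m : ℤ, IsCoprime m (4 * N : ℤ) → chiFour D m = (jacobiSym s m.natAbs : ℂ) := by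
    intro m hm
    rw [chiFour, hDst, show 4 * ((t : ℤ) ^ 2 * s) = (2 * t) ^ 2 * s by ring, jacobiSym.mul_left,
      jacobiSym.sq_one', one_mul]
    by_contra hg
    obtain ⟨q, hq, hqg⟩ := Nat.exists_prime_and_dvd hg
    have hq1 : (q : ℤ) ∣ 2 * t := (Int.natCast_dvd_natCast.2 hqg).trans (Int.gcd_dvd_left _ _)
    have hq2 : (q : ℤ) ∣ m := Int.dvd_natAbs.1 ((Int.natCast_dvd_natCast.2 hqg).trans (Int.gcd_dvd_right _ _))
    have hq3 : (q : ℤ) ∣ 4 * N := by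
      rcases (Nat.prime_iff_prime_int.1 hq).dvd_or_dvd hq1 with h | h
      · exact h.trans ⟨2 * N, by ring⟩
      · have : (q : ℤ) ∣ N := Int.natCast_dvd_natCast.2 (hDN q hq (by
          rw [hDst, pow_two, mul_assoc]; exact h.mul_right _))
        exact this.mul_left _
    have := hm.isUnit_of_dvd' hq2 hq3
    exact (Nat.prime_iff_prime_int.1 hq).not_isUnit this
  rw [hred m hm, hred m' hm']
  congr 1
  refine jacobiSym_nat_congr hspos (hodd m hm) (hodd m' hm') ?_
  have h4 : (4 * s : ℤ) ∣ m - m' := by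
    refine (mul_dvd_mul_left 4 (Int.natCast_dvd_natCast.2 hsN)).trans h
  obtain ⟨k, hk⟩ := h4
  -- Passing to absolute values turns `m ≡ m'` into a congruence up to sign.
  rcases Int.natAbs_eq m with h1 | h1 <;> rcases Int.natAbs_eq m' with h2 | h2
  · left; rw [← h1, ← h2]; exact ⟨k, hk⟩
  · right; exact ⟨k, by linarith⟩
  · right; exact ⟨-k, by linarith⟩
  · left; exact ⟨-k, by linarith⟩

section Transformation

variable {V : Type*} [AddCommGroup V] [Module ℚ V] {B : LinearMap.BilinForm ℚ V}

/-! ### Lattices of given level and discriminant -/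

/-- `L` is a full integral lattice of discriminant `D` whose dual `L^#` satisfies `N L^# ⊆ L`. -/
structure HasLevel (B : LinearMap.BilinForm ℚ V) (L : Submodule ℤ V) (N : ℕ) (D : ℤ) : Prop where
  full : IsFull L
  pos : 0 < N
  gram : ∃ (b : Module.Basis (Fin 3) ℤ L) (A C : Matrix (Fin 3) (Fin 3) ℤ),
    IsGram B b A ∧ A.det = D ∧ A * C = (N : ℤ) • (1 : Matrix (Fin 3) (Fin 3) ℤ)

lemma HasLevel.integral {L : Submodule ℤ V} {N : ℕ} {D : ℤ} (h : HasLevel B L N D) {x y : V}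
    (hx : x ∈ L) (hy : y ∈ L) : ∃ m : ℤ, B x y = m := by
  obtain ⟨b, A, C, hA, -, -⟩ := h.gram
  exact ⟨_, hA.apply ⟨x, hx⟩ ⟨y, hy⟩⟩

lemma HasLevel.dvd_pow {L : Submodule ℤ V} {N : ℕ} {D : ℤ} (h : HasLevel B L N D) :
    D ∣ (N : ℤ) ^ 3 := by
  obtain ⟨b, A, C, hA, rfl, hC⟩ := h.gram
  have := congrArg Matrix.det hC
  rw [Matrix.det_mul, Matrix.det_smul, Matrix.det_one, Fintype.card_fin, mul_one] at this
  exact ⟨_, this.symm⟩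

lemma HasLevel.prime_dvd {L : Submodule ℤ V} {N : ℕ} {D : ℤ} (h : HasLevel B L N D) (q : ℕ)
    (hq : q.Prime) (hqD : (q : ℤ) ∣ D) : q ∣ N := by
  have := (Nat.prime_iff_prime_int.1 hq).dvd_of_dvd_pow (hqD.trans h.dvd_pow)
  exact Int.natCast_dvd_natCast.1 this

/-- A `ℤ`-basis of a full lattice is a `ℚ`-basis of the space. -/
lemma exists_basis_rat {L : Submodule ℤ V} (hL : Submodule.span ℚ (L : Set V) = ⊤)
    {ι : Type*} (b : Module.Basis ι ℤ L) : ∃ e : Module.Basis ι ℚ V, ∀ i, e i = b i := by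
  have hli : LinearIndependent ℤ (fun i => (b i : V)) := by
    have := b.linearIndependent.map' L.subtype L.ker_subtype
    exact this
  have hli' : LinearIndependent ℚ (fun i => (b i : V)) :=
    (LinearIndependent.iff_fractionRing (R := ℤ) (K := ℚ)).1 hli
  refine ⟨Module.Basis.mk hli' ?_, fun i => Module.Basis.mk_apply _ _ i⟩
  rw [← hL, Submodule.span_le]
  intro x hx
  have h1 : x = ∑ i ∈ (b.repr ⟨x, hx⟩).support, ((b.repr ⟨x, hx⟩ i : ℤ) : ℚ) • (b i : V) := by
    have := congrArg Subtype.val (b.linearCombination_repr ⟨x, hx⟩)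
    rw [Finsupp.linearCombination_apply, Finsupp.sum] at this
    simp only [Submodule.coe_sum, Submodule.coe_smul] at this
    simp only [Int.cast_smul_eq_zsmul]
    exact this.symm
  rw [h1]
  exact Submodule.sum_mem _ fun i _ => Submodule.smul_mem _ _ (Submodule.subset_span ⟨i, rfl⟩)

/-- The coordinates of `u` are obtained by applying `A⁻¹` to the integers `B(b i, u)`, and `N A⁻¹`
is integral. -/
lemma HasLevel.smul_mem {L : Submodule ℤ V} {N : ℕ} {D : ℤ} (h : HasLevel B L N D) {u : V}
    (hu : ∀ x ∈ L, ∃ m : ℤ, B x u = m) : (N : ℚ) • u ∈ L := by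
  obtain ⟨b, A, C, hA, -, hC⟩ := h.gram
  obtain ⟨e, he⟩ := exists_basis_rat h.full.2 b
  have hm : ∀ i, ∃ m : ℤ, B (b i) u = m := fun i => hu _ (b i).2
  choose m hm using hm
  have hN : (N : ℚ) ≠ 0 := by exact_mod_cast h.pos.ne'
  have hCQ : A.map (Int.cast : ℤ → ℚ) * ((N : ℚ)⁻¹ • C.map (Int.cast : ℤ → ℚ)) = 1 := by
    have h1 := congrArg (fun M : Matrix (Fin 3) (Fin 3) ℤ => M.map (Int.castRingHom ℚ)) hC
    simp only [Matrix.map_mul] at h1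
    rw [Matrix.mul_smul]
    have h2 : A.map (Int.cast : ℤ → ℚ) * C.map (Int.cast : ℤ → ℚ) =
        (N : ℚ) • (1 : Matrix (Fin 3) (Fin 3) ℚ) := by
      refine h1.trans ?_
      ext i j
      simp only [Matrix.map_apply, Matrix.smul_apply, Matrix.one_apply]
      split_ifs <;> simp
    rw [h2, smul_smul, inv_mul_cancel₀ hN, one_smul]
  rw [mul_eq_one_comm] at hCQ
  have hAr : A.map (Int.cast : ℤ → ℚ) *ᵥ (e.repr u) = fun i => (m i : ℚ) := by
    funext i
    rw [← hm i]
    conv_rhs => rw [← e.sum_repr u]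
    simp only [map_sum, map_smul, he, ← hA _ _, Matrix.mulVec, dotProduct, Matrix.map_apply,
      smul_eq_mul]
    exact Finset.sum_congr rfl fun j _ => mul_comm _ _
  have hr : (e.repr u : Fin 3 → ℚ) =
      (N : ℚ)⁻¹ • (C.map (Int.cast : ℤ → ℚ) *ᵥ fun i => (m i : ℚ)) := by
    rw [← hAr, Matrix.mulVec_mulVec, ← Matrix.smul_mulVec, ← Matrix.smul_mul, hCQ,
      Matrix.one_mulVec]
  have hNr : ∀ i, (N : ℚ) * e.repr u i = ((∑ j, C i j * m j : ℤ) : ℚ) := by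
    intro i
    rw [hr, Pi.smul_apply, smul_eq_mul, mul_inv_cancel_left₀ hN]
    simp [Matrix.mulVec, dotProduct]
  rw [← e.sum_repr u, Finset.smul_sum]
  refine Submodule.sum_mem _ fun i _ => ?_
  rw [smul_smul, hNr, he, Int.cast_smul_eq_zsmul]
  exact Submodule.smul_mem _ _ (b i).2

lemma hasLevel_stdLattice : HasLevel stdForm stdLattice 1 1 := by
  refine ⟨isFull_stdLattice, one_pos, (Pi.basisFun ℚ (Fin 3)).restrictScalars ℤ, 1, 1, ?_, by simp,
    by simp⟩
  intro i j
  have h : ∀ i, (((Pi.basisFun ℚ (Fin 3)).restrictScalars ℤ i :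
      Submodule.span ℤ (Set.range (Pi.basisFun ℚ (Fin 3)))) : Fin 3 → ℚ) = Pi.single i 1 := fun i => by
    rw [Module.Basis.restrictScalars_apply, Pi.basisFun_apply]
  refine Eq.trans ?_ (congrArg₂ (fun x y => stdForm x y) (h i) (h j)).symm
  simp [stdForm_apply, Matrix.one_apply, Pi.single_apply, eq_comm]

lemma scale_one (M : Submodule ℤ V) : scale 1 M = M := by
  ext x; simp [mem_scale]

lemma HasLevel.isFull_scale {L : Submodule ℤ V} {N : ℕ} {D : ℤ} (h : HasLevel B L N D) {a : ℕ}
    (ha : 0 < a) : IsFull (scale a L) :=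
  h.full.scale (by exact_mod_cast ha.ne')

/-- This is where the level `4Na²` comes from: `2a y` lies in the dual of `L`, so `2aN y ∈ L`, and
`c / 2` is an integral multiple of `a · 2aN`. -/
lemma HasLevel.sub_mem_dual {L : Submodule ℤ V} {N : ℕ} {D : ℤ} (h : HasLevel B L N D) {a : ℕ}
    (ha : 0 < a) {c : ℤ} (hc : (4 * N * a ^ 2 : ℤ) ∣ c) {y : V} (hy : y ∈ dualTwo B (scale a L)) :
    (c / 2 : ℚ) • y ∈ scale a L := by
  obtain ⟨k, rfl⟩ := hc
  have h1 : (N : ℚ) • ((2 * a : ℚ) • y) ∈ L := by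
    refine h.smul_mem fun x hx => ?_
    obtain ⟨m, hm⟩ := (mem_dualTwo.1 hy) _ (smul_mem_scale (a : ℚ) hx)
    refine ⟨m, ?_⟩
    rw [← hm]
    simp only [map_smul, LinearMap.smul_apply, smul_eq_mul]
    ring
  have h2 := smul_mem_scale (a : ℚ) (L.smul_mem k h1)
  convert h2 using 1
  rw [← Int.cast_smul_eq_zsmul ℚ, smul_smul, smul_smul, smul_smul]
  congr 1
  push_cast; ring

/-- The transformation of theta series of cosets under matrices whose lower right entry is an odd
prime. -/
lemma HasLevel.thetaSum_prime (hV : Module.finrank ℚ V = 3)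
    (hsymm : ∀ x y, B x y = B y x) (hpos : ∀ x, x ≠ 0 → 0 < B x x) {L : Submodule ℤ V} {N : ℕ}
    {D : ℤ} (h : HasLevel B L N D) {a : ℕ} (ha : 0 < a) {ν : V} (hν : ν ∈ L) {α β c : ℤ} {ℓ : ℕ}
    [Fact ℓ.Prime] (hdet : α * ℓ - β * c = 1) (hc : (4 * N * a ^ 2 : ℤ) ∣ c) {z : ℂ}
    (hz : 0 < z.im) :
    thetaSum B (ind (scale a L) ν) ((α * z + β) / (c * z + ℓ)) =
      weilFactor c ℓ z * (chiFour D ℓ *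
        ((quadraticChar (ZMod ℓ) β : ℂ) * (∑ x : ZMod ℓ, ZMod.stdAddChar (x ^ 2)) ^ 3)) *
        thetaSum B (ind (scale a L) ((α : ℚ) • ν)) z := by
  have hℓ : ℓ.Prime := Fact.out
  have hcop : IsCoprime (ℓ : ℤ) c := ⟨α, -β, by linear_combination hdet⟩
  have hnd : ∀ k : ℤ, k ∣ c → ¬ (ℓ : ℤ) ∣ k := by
    intro k hk hlk
    exact (Nat.prime_iff_prime_int.1 hℓ).not_isUnit
      (hcop.isUnit_of_dvd' dvd_rfl (hlk.trans hk))
  have hℓ2 : ℓ ≠ 2 := by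
    rintro rfl
    exact hnd _ hc ⟨2 * N * a ^ 2, by push_cast; ring⟩
  have haℓ : IsCoprime (a : ℤ) ℓ :=
    (hcop.symm.of_isCoprime_of_dvd_left ((Dvd.intro_left (4 * N * a : ℤ) (by ring)).trans hc))
  have hβ : (β : ZMod ℓ) ≠ 0 := by
    intro h0
    have := congrArg (Int.cast : ℤ → ZMod ℓ) hdet
    push_cast at this
    simp [h0] at this
  obtain ⟨b, A, C, hA, hAD, hC⟩ := h.gram
  have hD : (A.det : ZMod ℓ) ≠ 0 := by
    intro h0
    rw [hAD, ZMod.intCast_zmod_eq_zero_iff_dvd] at h0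
    have := (Nat.prime_iff_prime_int.1 hℓ).dvd_of_dvd_pow (h0.trans h.dvd_pow)
    exact hnd _ ((Dvd.intro_left (4 * a ^ 2 : ℤ) (by ring)).trans hc) this
  have hfull := h.isFull_scale ha
  have hℓQ : (((ℓ : ℤ) : ℤ) : ℚ) ≠ 0 := by exact_mod_cast hℓ.ne_zero
  obtain ⟨n, t, ht⟩ := exists_isCosetReps (N := scale ((ℓ : ℤ) : ℚ) (scale a L)) (M := scale a L)
    (scale_int_le _ _) hfull.1 (hfull.scale hℓQ).2 ν
  have hint : ∀ x ∈ scale a L, ∀ y ∈ scale a L, ∃ m : ℤ, B x y = m := fun x hx y hy =>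
    h.integral (scale_nat_le _ _ hx) (scale_nat_le _ _ hy)
  have key := thetaSum_transform (α := α) (β := β) (c := c) (d := ℓ) hV hsymm hpos hfull hfull le_rfl hdet
    (by exact_mod_cast hℓ.pos) hint
    (fun y hy => h.integral hν (scale_nat_le _ _ hy))
    (fun y hy => h.sub_mem_dual ha hc hy)
    (fun x hx y hy => by
      obtain ⟨m, hm⟩ := mem_dualTwo.1 hy x hx
      exact ⟨α * m, by push_cast; rw [← hm]⟩) ht hz
  rw [chiFour_prime D hℓ2, ← hAD, ← sum_ec_cosetReps_prime hsymm hA hℓ2 haℓ hν hβ hD ht]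
  exact_mod_cast key

/-- `∑ e(Q(x) z)` over the standard lattice `ℤ³`, i.e. `θ(z)³`. -/
def thetaCube (z : ℂ) : ℂ := thetaSum stdForm (ind stdLattice 0) z

lemma HasLevel.bilin_self_int {L : Submodule ℤ V} {N : ℕ} {D : ℤ} (h : HasLevel B L N D) {a : ℕ}
    {ν x : V} (hν : ν ∈ L) (hx : x - ν ∈ scale a L) : ∃ m : ℤ, B x x = m := by
  have : x ∈ L := by simpa using L.add_mem (scale_nat_le _ _ hx) hν
  exact h.integral this this

lemma thetaSum_add_int {φ : V → ℂ} (hφ : ∀ x, φ x ≠ 0 → ∃ m : ℤ, B x x = m) (z : ℂ) (n : ℤ) :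
    thetaSum B φ (z + n) = thetaSum B φ z := by
  have := thetaSum_add_rat (B := B) φ z n
  rw [Rat.cast_intCast] at this
  rw [this]
  congr 1
  funext x
  by_cases h0 : φ x = 0
  · rw [h0, mul_zero]
  · obtain ⟨m, hm⟩ := hφ x h0
    rw [hm, show (m * n : ℚ) = ((m * n : ℤ) : ℚ) by push_cast; ring, ec_int, one_mul]

lemma HasLevel.thetaSum_add_int {L : Submodule ℤ V} {N : ℕ} {D : ℤ} (h : HasLevel B L N D) {a : ℕ}
    {ν : V} (hν : ν ∈ L) (z : ℂ) (n : ℤ) :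
    thetaSum B (ind (scale a L) ν) (z + n) = thetaSum B (ind (scale a L) ν) z := by
  refine _root_.thetaSum_add_int (fun x hx => ?_) z n
  by_contra hint
  exact hx (ind_of_notMem fun h0 => hint (h.bilin_self_int hν h0))

lemma thetaCube_add_int (z : ℂ) (n : ℤ) : thetaCube (z + n) = thetaCube z := by
  have := hasLevel_stdLattice.thetaSum_add_int (a := 1) (ν := 0) (zero_mem _) z n
  rwa [Nat.cast_one, scale_one] at this

/-- The transformation law of theta series of cosets, relative to that of `θ³`. -/
lemma HasLevel.thetaSum_moebius (hV : Module.finrank ℚ V = 3)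
    (hsymm : ∀ x y, B x y = B y x) (hpos : ∀ x, x ≠ 0 → 0 < B x x) {L : Submodule ℤ V} {N : ℕ}
    {D : ℤ} (h : HasLevel B L N D) (hD : 0 < D) {a : ℕ} (ha : 0 < a) {ν : V} (hν : ν ∈ L)
    {α β c d : ℤ} (hdet : α * d - β * c = 1) (hc : (4 * N * a ^ 2 : ℤ) ∣ c) {z : ℂ}
    (hz : 0 < z.im) :
    thetaSum B (ind (scale a L) ν) ((α * z + β) / (c * z + d)) * thetaCube z =
      chiFour D d * (thetaCube ((α * z + β) / (c * z + d)) *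
        thetaSum B (ind (scale a L) ((α : ℚ) • ν)) z) := by
  have hαν : ∀ α : ℤ, (α : ℚ) • ν ∈ L := fun α => by
    rw [Int.cast_smul_eq_zsmul]; exact L.smul_mem _ hν
  by_cases hc0 : c = 0
  · subst hc0
    have hαd : (α = 1 ∧ d = 1) ∨ (α = -1 ∧ d = -1) := by
      have : α * d = 1 := by linear_combination hdet
      rcases Int.mul_eq_one_iff_eq_one_or_neg_one.1 this with h | h <;> simp [h]
    rcases hαd with ⟨rfl, rfl⟩ | ⟨rfl, rfl⟩
    · have hz' : (((1 : ℤ) : ℂ) * z + β) / (((0 : ℤ) : ℂ) * z + (1 : ℤ)) = z + β := by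
        push_cast; ring
      rw [hz', h.thetaSum_add_int hν, thetaCube_add_int, chiFour_one]
      simp [mul_comm]
    · have hz' : (((-1 : ℤ) : ℂ) * z + β) / (((0 : ℤ) : ℂ) * z + (-1 : ℤ)) = z + (-β : ℤ) := by
        push_cast; ring
      rw [hz', h.thetaSum_add_int hν, thetaCube_add_int, chiFour_neg, chiFour_one, one_mul,
        mul_comm]
      congr 1
      -- The map `x ↦ -x` exchanges the cosets of `ν` and `-ν` and preserves `Q`.
      have := thetaSum_smul (B := B) (ind (scale a L) (((-1 : ℤ) : ℚ) • ν)) z (r := -1) (by norm_num)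
      rw [show (((-1 : ℚ) : ℚ) : ℂ) ^ 2 * z = z by push_cast; ring] at this
      rw [this]
      congr 1
      funext x
      refine ind_congr ?_
      rw [← neg_mem_iff]
      convert Iff.rfl using 2
      push_cast
      norm_num
      abel
  · have hcop : IsCoprime d (c.natAbs : ℤ) := by
      have : IsCoprime d c := ⟨α, -β, by linear_combination hdet⟩
      rw [Int.isCoprime_iff_gcd_eq_one] at this ⊢
      simpa only [Int.gcd, Int.natAbs_natCast] using this
    -- Dirichlet's theorem provides a prime `ℓ = d + c n`. Replacing `d` by `ℓ` amounts to replacing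
    -- `z` by `z - n`, which theta series of integral cosets do not notice.
    obtain ⟨ℓ, -, hℓ, hmod⟩ := Nat.forall_exists_prime_gt_and_zmodEq 2
      (Int.natAbs_ne_zero.2 hc0) hcop
    have : Fact ℓ.Prime := ⟨hℓ⟩
    have hdvd : c ∣ ℓ - d := by
      have := hmod.symm.dvd
      rwa [Int.natAbs_dvd] at this
    obtain ⟨n, hn⟩ := hdvd
    have hℓd : (ℓ : ℤ) = d + c * n := by linarith
    have hdet' : α * ℓ - (β + α * n) * c = 1 := by rw [hℓd]; linear_combination hdet
    have hz' : 0 < (z + (-n : ℤ)).im := by simpa using hz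
    have hγ : ((α : ℂ) * (z + (-n : ℤ)) + (β + α * n : ℤ)) / (c * (z + (-n : ℤ)) + ℓ) =
        (α * z + β) / (c * z + d) := by
      rw [show (ℓ : ℂ) = ((ℓ : ℤ) : ℂ) by push_cast; rfl, hℓd]
      push_cast
      congr 1 <;> ring
    -- The law for `aL + ν` and the one for `ℤ³` contain the same `weilFactor` and the same
    -- one-dimensional Gauss sum; these cancel, and only quadratic characters remain.
    have e1 := h.thetaSum_prime hV hsymm hpos ha hν hdet' hc hz'
    have e2 := hasLevel_stdLattice.thetaSum_prime (by simp) stdForm_symm stdForm_pos one_pos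
      (zero_mem stdLattice) hdet'
      ((Dvd.intro (N * a ^ 2 : ℤ) (by push_cast; ring)).trans hc) hz'
    rw [hγ] at e1 e2
    rw [h.thetaSum_add_int (hαν α)] at e1
    rw [Nat.cast_one, scale_one, smul_zero] at e2
    change thetaCube _ = _ * _ * thetaCube _ at e2
    rw [thetaCube_add_int] at e2
    have hcop' : ∀ d : ℤ, IsCoprime d c → IsCoprime d (4 * N : ℤ) := fun d hd =>
      hd.of_isCoprime_of_dvd_right ((Dvd.intro (a ^ 2 : ℤ) (by ring)).trans hc)
    have hchi : chiFour D ℓ = chiFour D d := by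
      refine chiFour_congr hD h.prime_dvd (hcop' _ ⟨α, -(β + α * n), by linear_combination hdet'⟩)
        (hcop' _ ⟨α, -β, by linear_combination hdet⟩) ?_
      rw [hn]
      exact ((Dvd.intro (a ^ 2 : ℤ) (by ring)).trans hc).mul_right _
    have hchi1 : chiFour 1 ℓ = 1 := by
      have hℓ2 : ℓ ≠ 2 := by
        rintro rfl
        have h2 : ((2 : ℕ) : ℤ) ∣ c := (Dvd.intro (2 * N * a ^ 2 : ℤ) (by push_cast; ring)).trans hc
        have : IsCoprime ((2 : ℕ) : ℤ) c := ⟨α, -(β + α * n), by linear_combination hdet'⟩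
        have := this.isUnit_of_dvd' dvd_rfl h2
        rw [Int.isUnit_iff] at this; omega
      rw [chiFour_prime 1 hℓ2]; simp
    rw [e1, e2, hchi, hchi1]
    ring

/-- The transformation law of theta series of cosets. -/
lemma HasLevel.thetaSum_smul (hV : Module.finrank ℚ V = 3)
    (hsymm : ∀ x y, B x y = B y x) (hpos : ∀ x, x ≠ 0 → 0 < B x x) {L : Submodule ℤ V} {N : ℕ}
    {D : ℤ} (h : HasLevel B L N D) (hD : 0 < D) {a : ℕ} (ha : 0 < a) {ν : V} (hν : ν ∈ L)
    (γ : SL(2, ℤ)) (hc : (4 * N * a ^ 2 : ℤ) ∣ γ 1 0) (z : ℍ) :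
    thetaSum B (ind (scale a L) ν) ((γ • z : ℍ) : ℂ) =
      chiFour D (γ 1 1) * thetaFactor γ z ^ 3 *
        thetaSum B (ind (scale a L) ((γ 0 0 : ℚ) • ν)) z := by
  have hdet : γ 0 0 * γ 1 1 - γ 0 1 * γ 1 0 = 1 := by
    rw [← Matrix.det_fin_two]; exact γ.det_coe
  have key := h.thetaSum_moebius hV hsymm hpos hD ha hν hdet hc z.im_pos
  have hcoe : ((γ • z : ℍ) : ℂ) =
      ((γ 0 0 : ℂ) * z + (γ 0 1 : ℂ)) / ((γ 1 0 : ℂ) * z + (γ 1 1 : ℂ)) := by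
    rw [UpperHalfPlane.coe_specialLinearGroup_apply]
    simp
  have hz3 : thetaCube z ≠ 0 := by
    rw [thetaCube, ← shimuraTheta_pow_three]; exact pow_ne_zero _ (shimuraTheta_ne_zero z)
  rw [← hcoe] at key
  rw [thetaFactor, div_pow, shimuraTheta_pow_three, shimuraTheta_pow_three]
  change _ = _ * (thetaCube _ / thetaCube _) * _
  field_simp
  linear_combination key

end Transformation

/-! ### Theta series of cosets as modular forms -/

/-- `f` is holomorphic on the upper half-plane and of moderate growth of weight `3/2` at all
cusps. -/
structure IsModerate (f : ℂ → ℂ) : Prop where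
  differentiableAt : ∀ z : ℂ, 0 < z.im → DifferentiableAt ℂ f z
  bound : ∀ α β c d : ℤ, α * d - β * c = 1 → ∃ K : ℝ, 0 ≤ K ∧ ∀ z : ℂ, 1 ≤ z.im →
      ‖f ((α * z + β) / (c * z + d))‖ ^ 2 ≤ K * ‖c * z + d‖ ^ 3

lemma IsModerate.const_mul {f : ℂ → ℂ} (hf : IsModerate f) (w : ℂ) :
    IsModerate (fun z => w * f z) := by
  refine ⟨fun z hz => (hf.differentiableAt z hz).const_mul w, fun α β c d h => ?_⟩
  obtain ⟨K, hK, hb⟩ := hf.bound α β c d h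
  refine ⟨‖w‖ ^ 2 * K, by positivity, fun z hz => ?_⟩
  rw [norm_mul, mul_pow, mul_assoc]
  exact mul_le_mul_of_nonneg_left (hb z hz) (by positivity)

lemma IsModerate.sum {ι : Type*} (s : Finset ι) {f : ι → ℂ → ℂ} (hf : ∀ i, IsModerate (f i)) :
    IsModerate (fun z => ∑ i ∈ s, f i z) := by
  refine ⟨fun z hz => DifferentiableAt.fun_sum fun i _ => (hf i).differentiableAt z hz,
    fun α β c d h => ?_⟩
  choose K hK hb using fun i => (hf i).bound α β c d h
  refine ⟨s.card * ∑ i ∈ s, K i, mul_nonneg (by positivity) (Finset.sum_nonneg fun i _ => hK i),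
    fun z hz => ?_⟩
  calc ‖∑ i ∈ s, f i ((α * z + β) / (c * z + d))‖ ^ 2
      ≤ (∑ i ∈ s, ‖f i ((α * z + β) / (c * z + d))‖) ^ 2 := by
        gcongr; exact norm_sum_le _ _
    _ ≤ s.card * ∑ i ∈ s, ‖f i ((α * z + β) / (c * z + d))‖ ^ 2 := sq_sum_le_card_mul_sum_sq
    _ ≤ s.card * ∑ i ∈ s, K i * ‖c * z + d‖ ^ 3 := by
        gcongr with i _; exact hb i z hz
    _ = _ := by rw [← Finset.sum_mul, mul_assoc]

lemma coe_SL_smul (γ : SL(2, ℤ)) (z : ℍ) : ((γ • z : ℍ) : ℂ) =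
    ((γ 0 0 : ℂ) * z + (γ 0 1 : ℂ)) / ((γ 1 0 : ℂ) * z + (γ 1 1 : ℂ)) := by
  rw [UpperHalfPlane.coe_specialLinearGroup_apply]
  simp

lemma SL_det (γ : SL(2, ℤ)) : γ 0 0 * γ 1 1 - γ 0 1 * γ 1 0 = 1 := by
  rw [← Matrix.det_fin_two]; exact γ.det_coe

lemma IsModerate.isHalfIntegralForm {f : ℂ → ℂ} (hf : IsModerate f) {Γ : Subgroup SL(2, ℤ)}
    {ψ : ℤ → ℂ} (htr : ∀ γ ∈ Γ, ∀ z : ℍ,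
      f ((γ • z : ℍ) : ℂ) = ψ (γ 1 1) * thetaFactor γ z ^ 3 * f z) :
    IsHalfIntegralForm Γ 3 ψ (fun z => f z) where
  holo := by
    rw [UpperHalfPlane.mdifferentiable_iff]
    have : DifferentiableOn ℂ f {z | 0 < z.im} := fun z hz =>
      (hf.differentiableAt z hz).differentiableWithinAt
    refine this.congr fun z hz => ?_
    simp only [Function.comp_apply]
    rw [UpperHalfPlane.ofComplex_apply_of_im_pos hz]
  transform := htr
  bdd_at_cusps := fun ρ => by
    obtain ⟨K, hK, hb⟩ := hf.bound _ _ _ _ (SL_det ρ)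
    rw [UpperHalfPlane.isBoundedAtImInfty_iff]
    refine ⟨K, 1, fun z hz => ?_⟩
    rw [ModularForm.SL_slash_apply, norm_mul, norm_zpow, norm_pow, coe_SL_smul,
      ModularGroup.denom_apply, zpow_neg, Nat.cast_ofNat]
    have h0 : (ρ 1 0 : ℂ) * z + ρ 1 1 ≠ 0 := by
      have := UpperHalfPlane.denom_ne_zero (ρ : GL (Fin 2) ℝ) z
      rwa [ModularGroup.denom_apply] at this
    rw [← div_eq_mul_inv, div_le_iff₀ (by positivity)]
    exact_mod_cast hb z hz

section Coset

variable {V : Type*} [AddCommGroup V] [Module ℚ V] {B : LinearMap.BilinForm ℚ V}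

/-- `(V, B)` is a positive definite ternary quadratic space. -/
structure IsTernary (B : LinearMap.BilinForm ℚ V) : Prop where
  finrank : Module.finrank ℚ V = 3
  symm : ∀ x y, B x y = B y x
  pos : ∀ x, x ≠ 0 → 0 < B x x

lemma IsTernary.thetaSummable (hB : IsTernary B) {M : Submodule ℤ V} (hM : IsFull M) (h : V) :
    ThetaSummable B (ind M h) :=
  (exists_poisson hB.finrank hB.symm hB.pos hM).1 h

lemma IsTernary.isModerate (hB : IsTernary B) {M : Submodule ℤ V} (hM : IsFull M) (h : V) :
    IsModerate (thetaSum B (ind M h)) :=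
  ⟨fun _ hz => (hB.thetaSummable hM h).differentiableAt hB.pos hz, fun _ _ _ _ hdet =>
    exists_norm_thetaSum_le hB.finrank hB.symm hB.pos hM h hdet⟩

lemma thetaSeries_eq_thetaSum {S : Set V} {M : Submodule ℤ V} {h : V}
    (hS : ∀ x, x ∈ S ↔ x - h ∈ M) (z : ℍ) : thetaSeries B S z = thetaSum B (ind M h) z := by
  rw [thetaSeries, thetaSum, tsum_subtype S (fun x => Complex.exp (2 * Real.pi * Complex.I *
    ((B x x : ℚ) : ℂ) * z))]
  refine tsum_congr fun x => ?_
  by_cases hx : x ∈ S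
  · rw [Set.indicator_of_mem hx, ind_of_mem ((hS x).1 hx), one_mul, qexp]
  · rw [Set.indicator_of_notMem hx, ind_of_notMem (fun h0 => hx ((hS x).2 h0)), zero_mul]

lemma mem_cosetSet {a : ℕ} {L : Submodule ℤ V} {ν x : V} :
    x ∈ cosetSet a L ν ↔ x - ν ∈ scale (a : ℚ) L := by
  rw [mem_scale]
  constructor
  · rintro ⟨y, hy, rfl⟩
    exact ⟨y, hy, by rw [Nat.cast_smul_eq_nsmul]; abel⟩
  · rintro ⟨y, hy, h⟩
    exact ⟨y, hy, by rw [Nat.cast_smul_eq_nsmul] at h; rw [h]; abel⟩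

/-- The theta sum of the coset `aL + ν`. -/
def cosetTheta (B : LinearMap.BilinForm ℚ V) (a : ℕ) (L : Submodule ℤ V) (ν : V) (z : ℂ) : ℂ :=
  thetaSum B (ind (scale (a : ℚ) L) ν) z

lemma thetaSeries_cosetSet (a : ℕ) (L : Submodule ℤ V) (ν : V) (z : ℍ) :
    thetaSeries B (cosetSet a L ν) z = cosetTheta B a L ν z :=
  thetaSeries_eq_thetaSum (fun _ => mem_cosetSet) z

lemma int_smul_sub_mem {a : ℕ} {L : Submodule ℤ V} {ν : V} (hν : ν ∈ L) {m n : ℤ}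
    (h : (a : ℤ) ∣ m - n) : m • ν - n • ν ∈ scale (a : ℚ) L := by
  obtain ⟨k, hk⟩ := h
  rw [← sub_smul, hk, mul_smul, ← Int.cast_smul_eq_zsmul ℚ]
  exact smul_mem_scale _ (L.smul_mem k hν)

lemma cosetTheta_congr {a : ℕ} {L : Submodule ℤ V} {ν : V} (hν : ν ∈ L) {m n : ℤ}
    (h : (a : ℤ) ∣ m - n) : cosetTheta B a L (m • ν) = cosetTheta B a L (n • ν) := by
  funext z
  rw [cosetTheta, cosetTheta, ind_eq_of_sub_mem (int_smul_sub_mem hν h)]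

/-- `(L, N, D)` with `D > 0`: the data of a lattice for which the theta series of cosets of
conductor `a` transform under `Γ₀(4Na²)`. -/
lemma HasLevel.cosetTheta_smul (hB : IsTernary B) {L : Submodule ℤ V} {N : ℕ}
    {D : ℤ} (h : HasLevel B L N D) (hD : 0 < D) {a : ℕ} (ha : 0 < a) {ν : V} (hν : ν ∈ L)
    {γ : SL(2, ℤ)} (hγ : γ ∈ CongruenceSubgroup.Gamma0 (4 * N * a ^ 2)) (z : ℍ) :
    cosetTheta B a L ν ((γ • z : ℍ) : ℂ) =
      chiFour D (γ 1 1) * thetaFactor γ z ^ 3 * cosetTheta B a L (γ 0 0 • ν) z := by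
  rw [CongruenceSubgroup.Gamma0_mem, ZMod.intCast_zmod_eq_zero_iff_dvd] at hγ
  have := h.thetaSum_smul hB.finrank hB.symm hB.pos hD ha hν γ (by exact_mod_cast hγ) z
  rwa [Int.cast_smul_eq_zsmul] at this

lemma isCoprime_of_mem_Gamma0 {N : ℕ} {γ : SL(2, ℤ)} (hγ : γ ∈ CongruenceSubgroup.Gamma0 N) :
    (N : ℤ) ∣ γ 0 0 * γ 1 1 - 1 := by
  rw [CongruenceSubgroup.Gamma0_mem, ZMod.intCast_zmod_eq_zero_iff_dvd] at hγ
  rw [show γ 0 0 * γ 1 1 - 1 = γ 0 1 * γ 1 0 by linear_combination SL_det γ]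
  exact hγ.mul_left _

lemma chiFour_ne_zero {D : ℤ} {N : ℕ} (hDN : ∀ q : ℕ, q.Prime → (q : ℤ) ∣ D → q ∣ N) {m : ℤ}
    (hm : IsCoprime m (4 * N : ℤ)) : chiFour D m ≠ 0 := by
  rw [chiFour, Int.cast_ne_zero]
  refine jacobiSym.ne_zero ?_
  by_contra hg
  obtain ⟨q, hq, hqg⟩ := Nat.exists_prime_and_dvd hg
  have hq1 : (q : ℤ) ∣ 4 * D := (Int.natCast_dvd_natCast.2 hqg).trans (Int.gcd_dvd_left _ _)
  have hq2 : (q : ℤ) ∣ m :=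
    Int.dvd_natAbs.1 ((Int.natCast_dvd_natCast.2 hqg).trans (Int.gcd_dvd_right _ _))
  have hq3 : (q : ℤ) ∣ 4 * N := by
    rcases (Nat.prime_iff_prime_int.1 hq).dvd_or_dvd hq1 with h | h
    · exact h.mul_right _
    · exact (Int.natCast_dvd_natCast.2 (hDN q hq h)).mul_left _
  exact (Nat.prime_iff_prime_int.1 hq).not_isUnit (hm.isUnit_of_dvd' hq2 hq3)

lemma HasLevel.isHalfIntegralForm (hB : IsTernary B) {L : Submodule ℤ V} {N : ℕ}
    {D : ℤ} (h : HasLevel B L N D) (hD : 0 < D) {a : ℕ} (ha : 0 < a) {ν : V} (hν : ν ∈ L) :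
    IsHalfIntegralForm (CongruenceSubgroup.Gamma0 (4 * N * a ^ 2) ⊓ CongruenceSubgroup.Gamma1 a)
      3 (chiFour D) (fun z => cosetTheta B a L ν z) := by
  refine (hB.isModerate (h.isFull_scale ha) ν).isHalfIntegralForm fun γ hγ z => ?_
  refine (h.cosetTheta_smul hB hD ha hν hγ.1 z).trans ?_
  -- On `Γ₁(a)` the upper left entry is `1` modulo `a`, so the shift `γ 0 0 • ν` defines the
  -- original coset.
  have h1 := ((CongruenceSubgroup.Gamma1_mem _ _).1 hγ.2).1
  have h2 : (a : ℤ) ∣ γ 0 0 - 1 := by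
    rw [← ZMod.intCast_zmod_eq_zero_iff_dvd]; simp [h1]
  rw [cosetTheta_congr hν h2, one_smul]
  rfl

/-- The component of `Θ_{aL + ν}` of character `χ`. -/
def nebentypusPart (B : LinearMap.BilinForm ℚ V) (a : ℕ) [NeZero a] (L : Submodule ℤ V) (ν : V)
    (χ : DirichletCharacter ℂ a) (z : ℂ) : ℂ :=
  (a.totient : ℂ)⁻¹ * ∑ t : ZMod a, χ t * cosetTheta B a L ((t.val : ℤ) • ν) z

/-- `γ` acts on the cosets of the multiples of `ν` by `t ↦ γ₀₀ t`. Reindexing extracts `χ(γ₀₀)⁻¹ =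
χ(γ₁₁)`. -/
lemma HasLevel.isHalfIntegralForm_nebentypusPart (hB : IsTernary B) {L : Submodule ℤ V} {N : ℕ}
    {D : ℤ} (h : HasLevel B L N D) (hD : 0 < D) {a : ℕ} [NeZero a] {ν : V} (hν : ν ∈ L)
    (χ : DirichletCharacter ℂ a) :
    IsHalfIntegralForm (CongruenceSubgroup.Gamma0 (4 * N * a ^ 2)) 3 (twist χ (chiFour D))
      (fun z => nebentypusPart B a L ν χ z) := by
  have ha : 0 < a := Nat.pos_of_ne_zero (NeZero.ne a)
  refine IsModerate.isHalfIntegralForm (IsModerate.const_mul (IsModerate.sum _ fun t =>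
    (hB.isModerate (h.isFull_scale ha) _).const_mul _) _) fun γ hγ z => ?_
  have hdvd := isCoprime_of_mem_Gamma0 hγ
  have hunit : ((γ 1 1 : ℤ) : ZMod a) * ((γ 0 0 : ℤ) : ZMod a) = 1 := by
    have h1 : (a : ℤ) ∣ γ 0 0 * γ 1 1 - 1 :=
      (Dvd.intro_left (4 * N * a : ℤ) (by push_cast; ring)).trans hdvd
    rw [← ZMod.intCast_zmod_eq_zero_iff_dvd] at h1
    push_cast at h1
    linear_combination h1
  change (a.totient : ℂ)⁻¹ * ∑ t : ZMod a, χ t * cosetTheta B a L ((t.val : ℤ) • ν) ((γ • z : ℍ) : ℂ)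
    = _ * (_ * ∑ t : ZMod a, χ t * cosetTheta B a L ((t.val : ℤ) • ν) z)
  have hterm : ∀ t : ZMod a, χ t * cosetTheta B a L ((t.val : ℤ) • ν) ((γ • z : ℍ) : ℂ) =
      twist χ (chiFour D) (γ 1 1) * thetaFactor γ z ^ 3 *
        (χ (((γ 0 0 : ℤ) : ZMod a) * t) *
          cosetTheta B a L (((((γ 0 0 : ℤ) : ZMod a) * t).val : ℤ) • ν) z) := by
    intro t
    rw [h.cosetTheta_smul hB hD ha (L.smul_mem _ hν) hγ z, smul_smul]
    have h2 : (a : ℤ) ∣ γ 0 0 * (t.val : ℤ) - ((((γ 0 0 : ℤ) : ZMod a) * t).val : ℤ) := by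
      rw [← ZMod.intCast_zmod_eq_zero_iff_dvd]; simp
    rw [cosetTheta_congr hν h2, twist]
    have h3 : χ t = χ ((γ 1 1 : ℤ) : ZMod a) * χ (((γ 0 0 : ℤ) : ZMod a) * t) := by
      rw [← map_mul, ← mul_assoc, hunit, one_mul]
    rw [h3]; ring
  rw [Finset.sum_congr rfl fun t _ => hterm t, ← Finset.mul_sum]
  have hre : ∑ t : ZMod a, (χ (((γ 0 0 : ℤ) : ZMod a) * t) *
          cosetTheta B a L (((((γ 0 0 : ℤ) : ZMod a) * t).val : ℤ) • ν) z) =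
      ∑ t : ZMod a, χ t * cosetTheta B a L ((t.val : ℤ) • ν) z :=
    Equiv.sum_comp (Units.mulLeft ⟨((γ 0 0 : ℤ) : ZMod a), ((γ 1 1 : ℤ) : ZMod a),
      by rw [mul_comm, hunit], hunit⟩) (fun t : ZMod a => χ t * cosetTheta B a L ((t.val : ℤ) • ν) z)
  rw [hre]
  ring

/-- By orthogonality of the Dirichlet characters, summing over `χ` leaves only `t = 1`. -/
lemma HasLevel.isNebentypusDecomposition (hB : IsTernary B) {L : Submodule ℤ V} {N : ℕ}
    {D : ℤ} (h : HasLevel B L N D) (hD : 0 < D) {a : ℕ} [NeZero a] {ν : V} (hν : ν ∈ L) :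
    IsNebentypusDecomposition (4 * N * a ^ 2) a 3 (chiFour D) (fun z => cosetTheta B a L ν z)
      (fun χ z => nebentypusPart B a L ν χ z) := by
  refine ⟨h.isHalfIntegralForm_nebentypusPart hB hD hν, fun z => ?_⟩
  rw [finsum_eq_sum_of_fintype]
  simp only [nebentypusPart]
  rw [← Finset.mul_sum, Finset.sum_comm]
  simp only [← Finset.sum_mul, DirichletCharacter.sum_characters_eq]
  simp only [ite_mul, zero_mul, Finset.sum_ite_eq', Finset.mem_univ, if_true]
  have h2 : (a : ℤ) ∣ ((1 : ZMod a).val : ℤ) - 1 := by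
    rw [← ZMod.intCast_zmod_eq_zero_iff_dvd]; simp
  rw [cosetTheta_congr hν h2, one_smul, inv_mul_cancel_left₀]
  have := Nat.totient_pos.2 (Nat.pos_of_ne_zero (NeZero.ne a))
  exact_mod_cast this.ne'

lemma thetaFactor_ne_zero (γ : SL(2, ℤ)) (z : ℍ) : thetaFactor γ z ≠ 0 :=
  div_ne_zero (shimuraTheta_ne_zero _) (shimuraTheta_ne_zero _)

/-- The components of a nebentypus decomposition of `Θ_{aL + ν}` are determined, in the sense that
the diamond operators act on their sum by multiplication on `ν`. -/
lemma HasLevel.sum_apply_mul (hB : IsTernary B) {L : Submodule ℤ V} {N : ℕ}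
    {D : ℤ} (h : HasLevel B L N D) (hD : 0 < D) {a : ℕ} [NeZero a] {ν : V} (hν : ν ∈ L)
    {fam : DirichletCharacter ℂ a → ℍ → ℂ}
    (hfam : IsNebentypusDecomposition (4 * N * a ^ 2) a 3 (chiFour D)
      (fun z => cosetTheta B a L ν z) fam) {δ : SL(2, ℤ)}
    (hδ : δ ∈ CongruenceSubgroup.Gamma0 (4 * N * a ^ 2)) (w : ℍ) :
    ∑ χ, χ ((δ 0 0 : ℤ) : ZMod a) * fam χ w = cosetTheta B a L (δ 1 1 • ν) w := by
  have ha : 0 < a := Nat.pos_of_ne_zero (NeZero.ne a)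
  -- The value of `Θ` at `δ⁻¹ w` is computed twice: from the law for the coset, and from the laws
  -- for its components. Inversion swaps the diagonal entries of `δ`.
  have hδ' := inv_mem hδ
  have e00 : (δ⁻¹ : SL(2, ℤ)) 0 0 = δ 1 1 := by
    simp [Matrix.SpecialLinearGroup.coe_inv, Matrix.adjugate_fin_two]
  have e11 : (δ⁻¹ : SL(2, ℤ)) 1 1 = δ 0 0 := by
    simp [Matrix.SpecialLinearGroup.coe_inv, Matrix.adjugate_fin_two]
  have h1 := h.cosetTheta_smul hB hD ha hν hδ' w
  have h2 := hfam.2 (δ⁻¹ • w)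
  simp only [finsum_eq_sum_of_fintype] at h2
  rw [Finset.sum_congr rfl fun χ _ => (hfam.1 χ).transform _ hδ' w] at h2
  rw [h1, e00, e11] at h2
  have h3 : chiFour D (δ 0 0) * thetaFactor δ⁻¹ w ^ 3 ≠ 0 := by
    refine mul_ne_zero (chiFour_ne_zero h.prime_dvd ?_) (pow_ne_zero _ (thetaFactor_ne_zero _ _))
    obtain ⟨k, hk⟩ := isCoprime_of_mem_Gamma0 hδ
    exact ⟨δ 1 1, -(a ^ 2 * k), by push_cast at hk; linear_combination hk⟩
  refine mul_left_cancel₀ h3 ?_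
  rw [h2, Finset.mul_sum]
  refine Finset.sum_congr rfl fun χ _ => ?_
  rw [twist]; ring

end Coset

/-! ### The Hecke operator `T(p²)` on theta series -/

lemma thetaCube_ne_zero (z : ℍ) : thetaCube z ≠ 0 := by
  rw [thetaCube, ← shimuraTheta_pow_three]; exact pow_ne_zero _ (shimuraTheta_ne_zero z)

lemma thetaFactor_pow_three (γ : SL(2, ℤ)) (z : ℍ) :
    thetaFactor γ z ^ 3 = thetaCube ((γ • z : ℍ) : ℂ) / thetaCube z := by
  rw [thetaFactor, div_pow, shimuraTheta_pow_three, shimuraTheta_pow_three]; rfl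

lemma isTernary_stdForm : IsTernary stdForm := ⟨by simp, stdForm_symm, stdForm_pos⟩

lemma chiFour_one_left {m : ℤ} (hm : Odd m) : chiFour 1 m = 1 := by
  rw [chiFour, mul_one, jacobiSym.at_four (Int.natAbs_odd.2 hm), Int.cast_one]

lemma thetaCube_sq_mul {p : ℕ} (hp : 0 < p) (z : ℂ) :
    thetaCube ((p : ℂ) ^ 2 * z) = cosetTheta stdForm p stdLattice 0 z := by
  have hp0 : (p : ℚ) ≠ 0 := by exact_mod_cast hp.ne'
  have := thetaSum_smul (B := stdForm) (ind stdLattice 0) z hp0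
  rw [Rat.cast_natCast] at this
  rw [thetaCube, this, cosetTheta]
  congr 1
  funext x
  refine ind_congr ?_
  rw [sub_zero, sub_zero, mem_scale_iff hp0]

/-- `θ(p² w)³` is the theta series of `p ℤ³`, so its behaviour under `Γ₀(4p²)` is an instance of the
law for cosets of conductor `p`. -/
lemma thetaCube_sq_mul_smul {p : ℕ} (hp : 0 < p) {γ : SL(2, ℤ)}
    (hγ : γ ∈ CongruenceSubgroup.Gamma0 (4 * 1 * p ^ 2)) (w : ℍ) :
    thetaCube ((p : ℂ) ^ 2 * (γ • w : ℍ)) =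
      thetaCube ((γ • w : ℍ) : ℂ) / thetaCube w * thetaCube ((p : ℂ) ^ 2 * w) := by
  have h := hasLevel_stdLattice.cosetTheta_smul isTernary_stdForm one_pos hp
    (zero_mem stdLattice) hγ w
  rw [thetaCube_sq_mul hp, thetaCube_sq_mul hp, h, smul_zero, thetaFactor_pow_three,
    chiFour_one_left, one_mul]
  -- The entry `γ 1 1` is odd, being invertible modulo `4p²`.
  obtain ⟨k, hk⟩ := isCoprime_of_mem_Gamma0 hγ
  by_contra hev
  rw [Int.not_odd_iff_even] at hev
  obtain ⟨j, hj⟩ := hev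
  rw [hj] at hk
  push_cast at hk
  have : 2 * (γ 0 0 * j - 2 * p ^ 2 * k) = 1 := by linear_combination hk
  omega

lemma coe_ofComplex_div {p : ℕ} (hp : 0 < p) (τ : ℍ) :
    ((UpperHalfPlane.ofComplex ((τ : ℂ) / (p : ℂ) ^ 2) : ℍ) : ℂ) = (τ : ℂ) / (p : ℂ) ^ 2 := by
  have : 0 < ((τ : ℂ) / (p : ℂ) ^ 2).im := by
    rw [show ((p : ℂ) ^ 2) = ((p ^ 2 : ℝ) : ℂ) by push_cast; rfl, Complex.div_ofReal_im]
    have := τ.im_pos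
    positivity
  rw [UpperHalfPlane.ofComplex_apply_of_im_pos this]

section Coset

variable {V : Type*} [AddCommGroup V] [Module ℚ V] {B : LinearMap.BilinForm ℚ V}

/-- The contribution of `δ` to `Θ_{aL + ν} | T(p²)`. -/
def heckeTerm (B : LinearMap.BilinForm ℚ V) (a : ℕ) (L : Submodule ℤ V) (ν : V) (D : ℤ) (p : ℕ)
    (z : ℍ) (δ : SL(2, ℤ)) : ℂ :=
  chiFour D (δ 0 0) * (thetaFactor δ z ^ 3)⁻¹ *
    cosetTheta B a L (δ 1 1 • ν) (((δ • z : ℍ) : ℂ) / (p : ℂ) ^ 2)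

lemma HasLevel.chiFour_diag_mul {L : Submodule ℤ V} {N : ℕ}
    {D : ℤ} (h : HasLevel B L N D) (hD : 0 < D) {a : ℕ} {γ : SL(2, ℤ)}
    (hγ : γ ∈ CongruenceSubgroup.Gamma0 (4 * N * a ^ 2)) :
    chiFour D (γ 0 0) * chiFour D (γ 1 1) = 1 ∧ ∀ m, IsCoprime m (4 * N : ℤ) →
      chiFour D (γ 0 0 * m) = chiFour D (γ 0 0) * chiFour D m ∧
      ∀ m', (4 * N : ℤ) ∣ m' - γ 0 0 * m → chiFour D m' = chiFour D (γ 0 0 * m) := by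
  obtain ⟨k, hk⟩ := isCoprime_of_mem_Gamma0 hγ
  push_cast at hk
  have c1 : IsCoprime (γ 0 0) (4 * N : ℤ) := ⟨γ 1 1, -(a ^ 2 * k), by linear_combination hk⟩
  have c2 : IsCoprime (γ 1 1) (4 * N : ℤ) := ⟨γ 0 0, -(a ^ 2 * k), by linear_combination hk⟩
  have hne : ∀ m : ℤ, IsCoprime m (4 * N : ℤ) → m ≠ 0 := by
    rintro m hm rfl
    rw [isCoprime_zero_left, Int.isUnit_iff] at hm
    omega
  constructor
  · rw [← chiFour_mul D (hne _ c1) (hne _ c2),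
      chiFour_congr hD h.prime_dvd (c1.mul_left c2) isCoprime_one_left ⟨a ^ 2 * k, ?_⟩, chiFour_one]
    linear_combination hk
  · intro m hm
    refine ⟨chiFour_mul D (hne _ c1) (hne _ hm), fun m' hm' => ?_⟩
    refine chiFour_congr hD h.prime_dvd ?_ (c1.mul_left hm) hm'
    obtain ⟨j, hj⟩ := hm'
    rw [show m' = γ 0 0 * m + (4 * N) * j by linear_combination hj]
    exact (IsCoprime.add_mul_left_left_iff).2 (c1.mul_left hm)

/-- Shows that the term depends only on the right coset of `δ`. Conjugating `g` by `diag(1, p²)`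
gives a matrix `g'` in `Γ₀(4Na²)` and in `Γ₀(4p²)` with `gτ / p² = g'(τ / p²)`; by
`thetaCube_sq_mul_smul`, the automorphy factors of `g` at `τ` and of `g'` at `τ / p²` agree, and the
remaining characters cancel. -/
lemma HasLevel.heckeTerm_mul (hB : IsTernary B) {L : Submodule ℤ V} {N : ℕ}
    {D : ℤ} (h : HasLevel B L N D) (hD : 0 < D) {a : ℕ} (ha : 0 < a) {ν : V} (hν : ν ∈ L)
    {p : ℕ} (hp : 0 < p) {g δ : SL(2, ℤ)} (hg : g ∈ CongruenceSubgroup.Gamma0 (4 * N * a ^ 2))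
    (hδ : δ ∈ CongruenceSubgroup.Gamma0 (4 * N * a ^ 2)) (hgp : (p : ℤ) ^ 2 ∣ g 0 1) (z : ℍ) :
    heckeTerm B a L ν D p z (g * δ) = heckeTerm B a L ν D p z δ := by
  obtain ⟨e, he⟩ := hgp
  have hp0 : (p : ℂ) ≠ 0 := by exact_mod_cast hp.ne'
  let g' : SL(2, ℤ) := ⟨!![g 0 0, e; (p : ℤ) ^ 2 * g 1 0, g 1 1], by
    rw [Matrix.det_fin_two_of]; linear_combination SL_det g + g 1 0 * he⟩
  have h00 : g' 0 0 = g 0 0 := rfl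
  have h11 : g' 1 1 = g 1 1 := rfl
  have h01 : g' 0 1 = e := rfl
  have h10 : g' 1 0 = (p : ℤ) ^ 2 * g 1 0 := rfl
  have hg4 : (4 * N * a ^ 2 : ℤ) ∣ g 1 0 := by
    rw [CongruenceSubgroup.Gamma0_mem, ZMod.intCast_zmod_eq_zero_iff_dvd] at hg
    exact_mod_cast hg
  have hg' : g' ∈ CongruenceSubgroup.Gamma0 (4 * N * a ^ 2) := by
    rw [CongruenceSubgroup.Gamma0_mem, ZMod.intCast_zmod_eq_zero_iff_dvd, h10]
    exact Dvd.dvd.mul_left (by exact_mod_cast hg4) _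
  have hg'p : g' ∈ CongruenceSubgroup.Gamma0 (4 * 1 * p ^ 2) := by
    rw [CongruenceSubgroup.Gamma0_mem, ZMod.intCast_zmod_eq_zero_iff_dvd, h10]
    obtain ⟨j, hj⟩ := hg4
    exact ⟨N * a ^ 2 * j, by rw [hj]; push_cast; ring⟩
  set τ : ℍ := δ • z with hτ
  set w : ℍ := UpperHalfPlane.ofComplex ((τ : ℂ) / (p : ℂ) ^ 2) with hw
  have hwc : (w : ℂ) = (τ : ℂ) / (p : ℂ) ^ 2 := coe_ofComplex_div hp τ
  have hτw : (τ : ℂ) = (p : ℂ) ^ 2 * w := by rw [hwc]; field_simp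
  have hgτ : ((g • τ : ℍ) : ℂ) = (p : ℂ) ^ 2 * (g' • w : ℍ) := by
    rw [coe_SL_smul g τ, coe_SL_smul g' w, h00, h01, h10, h11, hτw, he]
    push_cast
    rw [← mul_div_assoc]
    congr 1 <;> ring
  have e1 := h.cosetTheta_smul hB hD ha (L.smul_mem ((g * δ) 1 1) hν) hg' w
  have e2 := thetaCube_sq_mul_smul hp hg'p w
  have hprod00 : (g * δ) 0 0 = g 0 0 * δ 0 0 + g 0 1 * δ 1 0 := by
    simp [Matrix.mul_apply, Fin.sum_univ_two]
  have hprod11 : (g * δ) 1 1 = g 1 0 * δ 0 1 + g 1 1 * δ 1 1 := by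
    simp [Matrix.mul_apply, Fin.sum_univ_two]
  have hδ4 : (4 * N * a ^ 2 : ℤ) ∣ δ 1 0 := by
    rw [CongruenceSubgroup.Gamma0_mem, ZMod.intCast_zmod_eq_zero_iff_dvd] at hδ
    exact_mod_cast hδ
  have ec : cosetTheta B a L (g' 0 0 • (g * δ) 1 1 • ν) = cosetTheta B a L (δ 1 1 • ν) := by
    rw [smul_smul]
    refine cosetTheta_congr hν ?_
    obtain ⟨k, hk⟩ := isCoprime_of_mem_Gamma0 hg
    obtain ⟨j, hj⟩ := hg4
    push_cast at hk
    exact ⟨4 * N * a * (g 0 0 * j * δ 0 1 + k * δ 1 1), by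
      rw [h00, hprod11, hj]; linear_combination δ 1 1 * hk⟩
  have hc := h.chiFour_diag_mul hD hg
  have hδc : IsCoprime (δ 0 0) (4 * N : ℤ) := by
    obtain ⟨k, hk⟩ := isCoprime_of_mem_Gamma0 hδ
    push_cast at hk
    exact ⟨δ 1 1, -(a ^ 2 * k), by linear_combination hk⟩
  have hc2 := (hc.2 _ hδc).2 ((g * δ) 0 0) (by
    obtain ⟨j, hj⟩ := hδ4
    exact ⟨g 0 1 * a ^ 2 * j, by rw [hprod00, hj]; ring⟩)
  rw [(hc.2 _ hδc).1] at hc2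
  rw [heckeTerm, heckeTerm, thetaFactor_pow_three, thetaFactor_pow_three, mul_smul, ← hτ, hgτ, e2,
    mul_div_cancel_left₀ _ (pow_ne_zero 2 hp0), e1, ec, ← hwc, thetaFactor_pow_three, h11, hc2,
    ← hτw]
  have n1 := thetaCube_ne_zero z
  have n2 := thetaCube_ne_zero w
  have n3 := thetaCube_ne_zero (g' • w)
  have n4 := thetaCube_ne_zero τ
  field_simp
  linear_combination (chiFour D (δ 0 0) * cosetTheta B a L (δ 1 1 • ν) w) * hc.1

end Coset

/-! ### Representatives for the Hecke operator -/

/-- The translation matrices. -/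
def upperRep (b : ℤ) : SL(2, ℤ) := ⟨!![1, b; 0, 1], by simp [Matrix.det_fin_two_of]⟩

/-- The matrices `T^{ps} δ₀`, where `δ₀` has the rows `(pt, β)` and `(N, p)`. -/
def lowerRep {N p t β : ℤ} (h : p ^ 2 * t - β * N = 1) (s : ℤ) : SL(2, ℤ) :=
  ⟨!![p * t + p * s * N, β + p ^ 2 * s; N, p], by
    rw [Matrix.det_fin_two_of]; linear_combination h⟩

lemma upperRep_mem (N : ℕ) (b : ℤ) : upperRep b ∈ CongruenceSubgroup.Gamma0 N := by
  rw [CongruenceSubgroup.Gamma0_mem]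
  change (((0 : ℤ)) : ZMod N) = 0
  simp

lemma lowerRep_mem {N : ℕ} {p t β : ℤ} (h : p ^ 2 * t - β * (N : ℤ) = 1) (s : ℤ) :
    lowerRep h s ∈ CongruenceSubgroup.Gamma0 N := by
  rw [CongruenceSubgroup.Gamma0_mem]
  change (((N : ℤ)) : ZMod N) = 0
  simp

lemma mem_heckeSubgroup_mul_inv {N p : ℕ} {x y : CongruenceSubgroup.Gamma0 N} :
    y * x⁻¹ ∈ heckeSubgroup N p ↔ (p : ℤ) ^ 2 ∣ (y : SL(2, ℤ)) 0 1 * (x : SL(2, ℤ)) 0 0 -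
      (y : SL(2, ℤ)) 0 0 * (x : SL(2, ℤ)) 0 1 := by
  change (p : ℤ) ^ 2 ∣ ((y * x⁻¹ : CongruenceSubgroup.Gamma0 N) : SL(2, ℤ)) 0 1 ↔ _
  have : ((y * x⁻¹ : CongruenceSubgroup.Gamma0 N) : SL(2, ℤ)) 0 1 =
      (y : SL(2, ℤ)) 0 1 * (x : SL(2, ℤ)) 0 0 - (y : SL(2, ℤ)) 0 0 * (x : SL(2, ℤ)) 0 1 := by
    simp [Matrix.SpecialLinearGroup.coe_inv, Matrix.adjugate_fin_two, Matrix.mul_apply,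
      Fin.sum_univ_two]
    ring
  rw [this]

/-- Representatives for the cosets of `heckeSubgroup N p`. -/
def heckeRep {N p : ℕ} {t β : ℤ} (h : (p : ℤ) ^ 2 * t - β * (N : ℤ) = 1) :
    Fin (p ^ 2) ⊕ Fin p → CongruenceSubgroup.Gamma0 N :=
  Sum.elim (fun b => ⟨upperRep (b : ℕ), upperRep_mem N _⟩)
    (fun s => ⟨lowerRep h (s : ℕ), lowerRep_mem h _⟩)

/-- The right coset of a matrix is determined by its upper row as a point of the projective line
over `ℤ/p²`. The points with first coordinate prime to `p` are the `p²` translations; the others are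
the `p` remaining representatives. -/
lemma heckeRep_bijective {N p : ℕ} (hp : p.Prime) {t β : ℤ}
    (h : (p : ℤ) ^ 2 * t - β * (N : ℤ) = 1) :
    Function.Bijective (fun i => (Quotient.mk (QuotientGroup.rightRel (heckeSubgroup N p))
      (heckeRep h i))) := by
  have hpi := Nat.prime_iff_prime_int.1 hp
  have hrel : ∀ x y : CongruenceSubgroup.Gamma0 N,
      Quotient.mk (QuotientGroup.rightRel (heckeSubgroup N p)) x = Quotient.mk _ y ↔
      (p : ℤ) ^ 2 ∣ (y : SL(2, ℤ)) 0 1 * (x : SL(2, ℤ)) 0 0 -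
        (y : SL(2, ℤ)) 0 0 * (x : SL(2, ℤ)) 0 1 := by
    intro x y
    rw [Quotient.eq, QuotientGroup.rightRel_apply, mem_heckeSubgroup_mul_inv]
  have hfin : ∀ {n : ℕ} (i j : Fin n), (n : ℤ) ∣ ((i : ℕ) : ℤ) - ((j : ℕ) : ℤ) → i = j := by
    intro n i j hij
    have h1 := (Int.modEq_iff_dvd.2 hij)
    have h2 := Int.natCast_modEq_iff.1 h1
    exact Fin.ext (Nat.ModEq.eq_of_lt_of_lt h2 j.2 i.2).symm
  have hβ : ¬ (p : ℤ) ∣ β := fun hd => hpi.not_isUnit (isUnit_of_dvd_one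
    ⟨p * t - hd.choose * N, by linear_combination -h - N * hd.choose_spec⟩)
  have hN : ¬ (p : ℤ) ∣ N := fun hd => hpi.not_isUnit (isUnit_of_dvd_one
    ⟨p * t - hd.choose * β, by linear_combination -h - β * hd.choose_spec⟩)
  constructor
  · rintro (b | s) (b' | s') hij
    · rw [hrel] at hij
      change (p : ℤ) ^ 2 ∣ ((b' : ℕ) : ℤ) * 1 - 1 * ((b : ℕ) : ℤ) at hij
      rw [mul_one, one_mul] at hij
      rw [hfin b' b (by exact_mod_cast hij)]
    · rw [hrel] at hij
      change (p : ℤ) ^ 2 ∣ (β + p ^ 2 * (s' : ℕ)) * 1 - (p * t + p * (s' : ℕ) * N) * (b : ℕ) at hij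
      obtain ⟨k, hk⟩ := hij
      exact absurd ⟨p * k - p * (s' : ℕ) + (t + (s' : ℕ) * N) * (b : ℕ), by linear_combination hk⟩ hβ
    · rw [hrel] at hij
      change (p : ℤ) ^ 2 ∣ ((b' : ℕ) : ℤ) * (p * t + p * (s : ℕ) * N) - 1 * (β + p ^ 2 * (s : ℕ)) at hij
      obtain ⟨k, hk⟩ := hij
      exact absurd ⟨-(p * k) - p * (s : ℕ) + (t + (s : ℕ) * N) * (b' : ℕ), by
        linear_combination -hk⟩ hβ
    · rw [hrel] at hij
      change (p : ℤ) ^ 2 ∣ (β + p ^ 2 * (s' : ℕ)) * (p * t + p * (s : ℕ) * N) -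
        (p * t + p * (s' : ℕ) * N) * (β + p ^ 2 * (s : ℕ)) at hij
      obtain ⟨k, hk⟩ := hij
      have hp0 : (p : ℤ) ≠ 0 := by exact_mod_cast hp.ne_zero
      have h1 : (p : ℤ) ∣ (β * N) * (((s : ℕ) : ℤ) - (s' : ℕ)) := by
        refine ⟨k - t * ((s' : ℕ) - (s : ℕ)) * p, mul_left_cancel₀ hp0 ?_⟩
        linear_combination hk
      rcases hpi.dvd_or_dvd h1 with h2 | h2
      · rcases hpi.dvd_or_dvd h2 with h3 | h3
        · exact absurd h3 hβ
        · exact absurd h3 hN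
      · rw [hfin s s' h2]
  · intro c
    obtain ⟨γ, rfl⟩ := Quotient.exists_rep c
    have hdet := SL_det (γ : SL(2, ℤ))
    set x := (γ : SL(2, ℤ)) 0 0
    set y := (γ : SL(2, ℤ)) 0 1
    by_cases hx : (p : ℤ) ∣ x
    · obtain ⟨x1, hx1⟩ := hx
      have hcop : IsCoprime ((N : ℤ) * y) (p : ℤ) := by
        rw [isCoprime_comm]
        refine (IsCoprime.mul_right ?_ ?_)
        · exact (Prime.coprime_iff_not_dvd hpi).2 hN
        · exact ⟨x1 * (γ : SL(2, ℤ)) 1 1, -(γ : SL(2, ℤ)) 1 0, by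
            linear_combination hdet - (γ : SL(2, ℤ)) 1 1 * hx1⟩
      obtain ⟨u, v, huv⟩ := hcop
      have hp0 : 0 < p := hp.pos
      -- After division by `p`, the condition on `s` reads `t y + N y s ≡ β x₁` modulo `p`, and `u`
      -- inverts `N y`.
      set s0 : ℤ := u * (β * x1 - t * y) with hs0
      have hs1 : 0 ≤ s0 % p := Int.emod_nonneg _ (by exact_mod_cast hp0.ne')
      have hs2 : s0 % p < p := Int.emod_lt_of_pos _ (by exact_mod_cast hp0)
      refine ⟨Sum.inr ⟨(s0 % p).toNat, by omega⟩, ?_⟩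
      change Quotient.mk _ _ = _
      rw [hrel]
      change (p : ℤ) ^ 2 ∣ y * (p * t + p * ((s0 % p).toNat : ℕ) * N) -
        x * (β + p ^ 2 * ((s0 % p).toNat : ℕ))
      rw [Int.toNat_of_nonneg hs1, hx1]
      have hmod := Int.emod_add_mul_ediv s0 p
      set q := s0 / p
      have hm : s0 % p = s0 - p * q := by linear_combination hmod
      rw [hm, hs0]
      refine ⟨-N * y * q - v * (β * x1 - t * y) - x1 * p * (u * (β * x1 - t * y) - p * q), ?_⟩
      linear_combination (p * (β * x1 - t * y)) * huv
    · have hcop : IsCoprime x ((p : ℤ) ^ 2) :=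
        (IsCoprime.pow_left ((Prime.coprime_iff_not_dvd hpi).2 hx)).symm
      obtain ⟨u, v, huv⟩ := hcop
      have hp0 : 0 < p ^ 2 := pow_pos hp.pos 2
      set s0 : ℤ := u * y with hs0
      have hs1 : 0 ≤ s0 % (p ^ 2 : ℕ) := Int.emod_nonneg _ (by exact_mod_cast hp0.ne')
      have hs2 : s0 % (p ^ 2 : ℕ) < (p ^ 2 : ℕ) := Int.emod_lt_of_pos _ (by exact_mod_cast hp0)
      refine ⟨Sum.inl ⟨(s0 % (p ^ 2 : ℕ)).toNat, by omega⟩, ?_⟩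
      change Quotient.mk _ _ = _
      rw [hrel]
      change (p : ℤ) ^ 2 ∣ y * 1 - x * ((s0 % (p ^ 2 : ℕ)).toNat : ℕ)
      rw [Int.toNat_of_nonneg hs1]
      have hmod := Int.emod_add_mul_ediv s0 (p ^ 2 : ℕ)
      set q := s0 / (p ^ 2 : ℕ)
      refine ⟨v * y + x * q, ?_⟩
      push_cast at hmod ⊢
      rw [hs0] at hmod
      linear_combination -x * hmod - y * huv

/-! ### The Hecke sum over explicit representatives -/

section Coset

variable {V : Type*} [AddCommGroup V] [Module ℚ V] {B : LinearMap.BilinForm ℚ V}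

/-- The image of `Θ_{aL + ν}` under `T(p²)` as a sum over representatives. -/
lemma HasLevel.sum_shimuraHecke (hB : IsTernary B) {L : Submodule ℤ V} {N : ℕ}
    {D : ℤ} (h : HasLevel B L N D) (hD : 0 < D) {a : ℕ} [NeZero a] {ν : V} (hν : ν ∈ L)
    {fam : DirichletCharacter ℂ a → ℍ → ℂ}
    (hfam : IsNebentypusDecomposition (4 * N * a ^ 2) a 3 (chiFour D)
      (fun z => cosetTheta B a L ν z) fam) {p : ℕ} (hp : p.Prime) {t β : ℤ}
    (ht : (p : ℤ) ^ 2 * t - β * ((4 * N * a ^ 2 : ℕ) : ℤ) = 1) (z : ℍ) :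
    ∑ᶠ χ, shimuraHecke (4 * N * a ^ 2) 3 p (twist χ (chiFour D)) (fam χ) z =
      ((p : ℂ) ^ 2)⁻¹ * ((∑ b ∈ Finset.range (p ^ 2), heckeTerm B a L ν D p z (upperRep b)) +
        ∑ s ∈ Finset.range p, heckeTerm B a L ν D p z (lowerRep ht s)) := by
  have ha : 0 < a := Nat.pos_of_ne_zero (NeZero.ne a)
  have hbij := heckeRep_bijective hp ht
  rw [finsum_eq_sum_of_fintype]
  simp only [shimuraHecke]
  rw [← Finset.mul_sum]
  congr 1
  rw [Finset.sum_congr rfl fun χ _ => (finsum_eq_of_bijective _ hbij (fun i => rfl)).symm]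
  simp only [finsum_eq_sum_of_fintype]
  rw [Finset.sum_comm, Finset.sum_range, Finset.sum_range]
  -- The sum over `χ` collapses to a `heckeTerm` by `HasLevel.sum_apply_mul`, and `heckeTerm` does
  -- not depend on the representative picked by `Quotient.out`.
  have key : ∀ i, ∑ χ, twist χ (chiFour D) (((Quotient.out (Quotient.mk
      (QuotientGroup.rightRel (heckeSubgroup (4 * N * a ^ 2) p)) (heckeRep ht i)) :
        CongruenceSubgroup.Gamma0 (4 * N * a ^ 2)) : SL(2, ℤ)) 0 0) *
      (thetaFactor ((Quotient.out (Quotient.mk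
      (QuotientGroup.rightRel (heckeSubgroup (4 * N * a ^ 2) p)) (heckeRep ht i)) :
        CongruenceSubgroup.Gamma0 (4 * N * a ^ 2)) : SL(2, ℤ)) z ^ 3)⁻¹ *
      fam χ (UpperHalfPlane.ofComplex (((((Quotient.out (Quotient.mk
      (QuotientGroup.rightRel (heckeSubgroup (4 * N * a ^ 2) p)) (heckeRep ht i)) :
        CongruenceSubgroup.Gamma0 (4 * N * a ^ 2)) : SL(2, ℤ)) • z : ℍ) : ℂ) / (p : ℂ) ^ 2)) =
      heckeTerm B a L ν D p z (heckeRep ht i : SL(2, ℤ)) := by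
    intro i
    have hout := Quotient.mk_out (s := QuotientGroup.rightRel (heckeSubgroup (4 * N * a ^ 2) p))
      (heckeRep ht i)
    set δ : CongruenceSubgroup.Gamma0 (4 * N * a ^ 2) := Quotient.out (Quotient.mk
      (QuotientGroup.rightRel (heckeSubgroup (4 * N * a ^ 2) p)) (heckeRep ht i))
    change QuotientGroup.rightRel _ δ (heckeRep ht i) at hout
    rw [QuotientGroup.rightRel_apply] at hout
    have e1 : heckeTerm B a L ν D p z (heckeRep ht i : SL(2, ℤ)) =
        heckeTerm B a L ν D p z (δ : SL(2, ℤ)) := by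
      rw [← h.heckeTerm_mul hB hD ha hν hp.pos (heckeRep ht i * δ⁻¹).2 δ.2 hout z]
      congr 1
      rw [← Subgroup.coe_mul, inv_mul_cancel_right]
    rw [e1, heckeTerm, ← coe_ofComplex_div hp.pos, ← h.sum_apply_mul hB hD hν hfam δ.2,
      Finset.mul_sum]
    refine Finset.sum_congr rfl fun χ _ => ?_
    rw [twist, coe_ofComplex_div hp.pos]; ring
  rw [Finset.sum_congr rfl fun i _ => key i, Fintype.sum_sum_type]
  rfl

/-- The indicator function of the set of `x` with `r Q(x) ∈ ℤ`. -/
def indInt (B : LinearMap.BilinForm ℚ V) (r : ℚ) (x : V) : ℂ :=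
  open Classical in if ∃ m : ℤ, r * B x x = m then 1 else 0

/-- Averaging over the translations by `r j` detects the condition `r Q(x) ∈ ℤ`, by orthogonality of
additive characters. -/
lemma sum_thetaSum_add {φ : V → ℂ} {r : ℚ} {n : ℕ} (hn : n ≠ 0)
    (hφ : ∀ x, φ x ≠ 0 → ∃ m : ℤ, n * (r * B x x) = m) (hs : ThetaSummable B φ) {z : ℂ}
    (hz : 0 < z.im) :
    ∑ j ∈ Finset.range n, thetaSum B φ (z + (r * j : ℚ)) =
      n * thetaSum B (fun x => φ x * indInt B r x) z := by
  classical
  simp only [thetaSum_add_rat]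
  rw [← thetaSum_sum (fun i _ => hs.ec_mul _) hz, ← thetaSum_const_mul]
  congr 1
  funext x
  by_cases h0 : φ x = 0
  · simp [h0]
  rw [← Finset.sum_mul]
  have h1 := sum_ec_range n hn (r * B x x) (hφ x h0)
  rw [Finset.sum_congr rfl fun j _ => by
    rw [show B x x * (r * j : ℚ) = j * (r * B x x) by ring], h1, indInt]
  split_ifs <;> ring

end Coset

/-! ### Summation over the translations in the Hecke sum -/

section Coset

variable {V : Type*} [AddCommGroup V] [Module ℚ V] {B : LinearMap.BilinForm ℚ V}

lemma IsTernary.thetaSummable_smul (hB : IsTernary B) {M : Submodule ℤ V} (hM : IsFull M) (h : V)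
    {r : ℚ} (hr : r ≠ 0) : ThetaSummable B (fun x => ind M h (r • x)) := by
  have h1 := hB.thetaSummable (hM.scale (inv_ne_zero hr)) (r⁻¹ • h)
  convert h1 using 1
  funext x
  refine ind_congr ?_
  rw [mem_scale_iff (inv_ne_zero hr), inv_inv, smul_sub, smul_inv_smul₀ hr]

lemma cosetTheta_div_sq {a : ℕ} {L : Submodule ℤ V} {ν : V} {p : ℕ} (hp : p ≠ 0) (z : ℂ) :
    cosetTheta B a L ν (z / (p : ℂ) ^ 2) =
      thetaSum B (fun x => ind (scale (a : ℚ) L) ν ((p : ℚ) • x)) z := by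
  have := thetaSum_smul (B := B) (ind (scale (a : ℚ) L) ν) z (r := (p : ℚ)⁻¹)
    (inv_ne_zero (by exact_mod_cast hp))
  rw [inv_inv] at this
  rw [← this, cosetTheta]
  congr 1
  push_cast
  rw [inv_pow, div_eq_inv_mul]

lemma HasLevel.sq_mul_int {L : Submodule ℤ V} {N : ℕ} {D : ℤ} (h : HasLevel B L N D) {a p : ℕ}
    {ν : V} (hν : ν ∈ L) {x : V} (hx : ind (scale (a : ℚ) L) ν ((p : ℚ) • x) ≠ 0) :
    ∃ m : ℤ, (p : ℚ) ^ 2 * B x x = m := by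
  have hmem : (p : ℚ) • x - ν ∈ scale (a : ℚ) L := by
    by_contra h0; exact hx (ind_of_notMem h0)
  obtain ⟨m, hm⟩ := h.bilin_self_int hν hmem
  refine ⟨m, ?_⟩
  rw [← hm]
  simp only [map_smul, LinearMap.smul_apply, smul_eq_mul]
  ring

lemma coe_upperRep_smul (b : ℤ) (z : ℍ) : ((upperRep b • z : ℍ) : ℂ) = z + b := by
  rw [coe_SL_smul]
  change (((1 : ℤ) : ℂ) * z + (b : ℂ)) / (((0 : ℤ) : ℂ) * z + ((1 : ℤ) : ℂ)) = _
  push_cast; ring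

lemma coe_lowerRep_smul {N p t β : ℤ} (h : p ^ 2 * t - β * N = 1) (s : ℤ) (z : ℍ) :
    ((lowerRep h s • z : ℍ) : ℂ) = ((p * t + p * s * N : ℤ) * z + (β + p ^ 2 * s : ℤ)) /
      ((N : ℂ) * z + (p : ℂ)) := by
  rw [coe_SL_smul]
  rfl

lemma coe_lowerRep_smul_eq_add {N p t β : ℤ} (h : p ^ 2 * t - β * N = 1) (s : ℤ) (z : ℍ) :
    ((lowerRep h s • z : ℍ) : ℂ) = (lowerRep h 0 • z : ℍ) + (p * s : ℤ) := by
  have hden : (N : ℂ) * z + (p : ℂ) ≠ 0 := by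
    have := UpperHalfPlane.denom_ne_zero (lowerRep h 0 : GL (Fin 2) ℝ) z
    rw [ModularGroup.denom_apply] at this
    exact this
  rw [coe_lowerRep_smul, coe_lowerRep_smul, div_add' _ _ _ hden]
  congr 1
  push_cast; ring

lemma heckeTerm_upperRep {a : ℕ} {L : Submodule ℤ V} {ν : V} {D : ℤ} {p : ℕ} (hp : p ≠ 0) (z : ℍ)
    (b : ℕ) : heckeTerm B a L ν D p z (upperRep b) =
      thetaSum B (fun x => ind (scale (a : ℚ) L) ν ((p : ℚ) • x)) (z + (1 * b : ℚ)) := by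
  have h00 : upperRep b 0 0 = 1 := rfl
  have h11 : upperRep b 1 1 = 1 := rfl
  rw [heckeTerm, thetaFactor_pow_three, coe_upperRep_smul, thetaCube_add_int,
    div_self (thetaCube_ne_zero z), h00, h11, chiFour_one, one_smul, cosetTheta_div_sq hp]
  simp

/-- The matrices `lowerRep ht s` differ from `lowerRep ht 0` by the translation by `p s`. They share
the automorphy factor and, modulo `4N`, the upper left entry, so all factors in front of the theta
sum are independent of `s`. -/
lemma HasLevel.heckeTerm_lowerRep {L : Submodule ℤ V} {N : ℕ}
    {D : ℤ} (h : HasLevel B L N D) (hD : 0 < D) {a : ℕ} {ν : V} {p : ℕ} (hp : p ≠ 0) {t β M : ℤ}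
    (ht : (p : ℤ) ^ 2 * t - β * M = 1) (hM : M = 4 * N * a ^ 2) (z : ℍ) (s : ℕ) :
    heckeTerm B a L ν D p z (lowerRep ht s) =
      (chiFour D (p * t) * (thetaCube z / thetaCube ((lowerRep ht 0 • z : ℍ) : ℂ))) *
      thetaSum B (fun x => ind (scale (a : ℚ) L) ((p : ℤ) • ν) ((p : ℚ) • x))
        ((lowerRep ht 0 • z : ℍ) + ((p : ℚ) * s : ℚ)) := by
  have h00 : lowerRep ht s 0 0 = p * t + p * s * M := rfl
  have h11 : lowerRep ht s 1 1 = p := rfl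
  have hcop : ∀ s : ℤ, IsCoprime (p * t + p * s * M) (4 * N : ℤ) := fun s =>
    ⟨p, -(a ^ 2 * β) - a ^ 2 * (p ^ 2 * s), by rw [hM] at ht ⊢; linear_combination ht⟩
  have hchi : chiFour D (p * t + p * s * M) = chiFour D (p * t) := by
    refine chiFour_congr hD h.prime_dvd (hcop s) (by simpa using hcop 0) ⟨p * s * a ^ 2, ?_⟩
    rw [hM]; ring
  rw [heckeTerm, thetaFactor_pow_three, coe_lowerRep_smul_eq_add, thetaCube_add_int, h00, h11,
    hchi, inv_div, cosetTheta_div_sq hp]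
  push_cast
  rfl

/-- The image of `Θ_{aL + ν}` under `T(p²)`, after summation over translations. -/
lemma HasLevel.finsum_shimuraHecke (hB : IsTernary B) {L : Submodule ℤ V} {N : ℕ}
    {D : ℤ} (h : HasLevel B L N D) (hD : 0 < D) {a : ℕ} [NeZero a] {ν : V} (hν : ν ∈ L)
    {fam : DirichletCharacter ℂ a → ℍ → ℂ}
    (hfam : IsNebentypusDecomposition (4 * N * a ^ 2) a 3 (chiFour D)
      (fun z => cosetTheta B a L ν z) fam) {p : ℕ} (hp : p.Prime) {t β : ℤ}
    (ht : (p : ℤ) ^ 2 * t - β * ((4 * N * a ^ 2 : ℕ) : ℤ) = 1) (z : ℍ) :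
    ∑ᶠ χ, shimuraHecke (4 * N * a ^ 2) 3 p (twist χ (chiFour D)) (fam χ) z =
      thetaSum B (fun x => ind (scale (a : ℚ) L) ν ((p : ℚ) • x) * indInt B 1 x) z +
      (p : ℂ)⁻¹ * (chiFour D (p * t) *
        (thetaCube z / thetaCube ((lowerRep ht 0 • z : ℍ) : ℂ))) *
        thetaSum B (fun x => ind (scale (a : ℚ) L) ((p : ℤ) • ν) ((p : ℚ) • x) * indInt B p x)
          ((lowerRep ht 0 • z : ℍ) : ℂ) := by
  have ha : 0 < a := Nat.pos_of_ne_zero (NeZero.ne a)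
  have hp0 : (p : ℂ) ≠ 0 := by exact_mod_cast hp.ne_zero
  have hpQ : (p : ℚ) ≠ 0 := by exact_mod_cast hp.ne_zero
  have hfull := h.isFull_scale ha
  have hz3 := thetaCube_ne_zero z
  have hpν : (p : ℤ) • ν ∈ L := L.smul_mem _ hν
  rw [h.sum_shimuraHecke hB hD hν hfam hp ht z,
    Finset.sum_congr rfl fun b _ => heckeTerm_upperRep hp.ne_zero z b,
    Finset.sum_congr rfl fun s _ => h.heckeTerm_lowerRep hD hp.ne_zero ht (by push_cast; rfl) z s]
  set w : ℍ := lowerRep ht 0 • z with hw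
  -- The `p²` translations with step `1` detect `Q(x) ∈ ℤ`, the `p` translations with step `p`
  -- detect `p Q(x) ∈ ℤ`; both times `p² Q(x) ∈ ℤ` is known from `p x ∈ L`.
  rw [sum_thetaSum_add (pow_ne_zero 2 hp.ne_zero) (fun x hx => by
      obtain ⟨m, hm⟩ := h.sq_mul_int hν hx
      exact ⟨m, by rw [← hm]; push_cast; ring⟩) (hB.thetaSummable_smul hfull ν hpQ) z.im_pos,
    ← Finset.mul_sum, sum_thetaSum_add hp.ne_zero (fun x hx => by
      obtain ⟨m, hm⟩ := h.sq_mul_int hpν hx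
      exact ⟨m, by rw [← hm]; ring⟩) (hB.thetaSummable_smul hfull _ hpQ) w.im_pos]
  push_cast
  field_simp

end Coset

/-! ### Neighbours of a lattice -/

/-- The integers as a subring of `ℚ`. -/
abbrev intQ : Subring ℚ := (Int.castRingHom ℚ).range

lemma mem_intQ {t : ℚ} : t ∈ intQ ↔ ∃ m : ℤ, t = m := by
  simp [intQ, RingHom.mem_range, eq_comm]

lemma int_mem_intQ (m : ℤ) : (m : ℚ) ∈ intQ := mem_intQ.2 ⟨m, rfl⟩

lemma nat_mem_intQ (m : ℕ) : (m : ℚ) ∈ intQ := natCast_mem _ m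

lemma mem_intQ_of_coprime {k l : ℤ} (h : IsCoprime k l) {t : ℚ} (hk : k * t ∈ intQ)
    (hl : l * t ∈ intQ) : t ∈ intQ := by
  obtain ⟨u, v, huv⟩ := h
  have huv' : (u * k + v * l : ℚ) = 1 := by exact_mod_cast huv
  have : t = u * (k * t) + v * (l * t) := by linear_combination -t * huv'
  rw [this]
  exact add_mem (mul_mem (int_mem_intQ _) hk) (mul_mem (int_mem_intQ _) hl)

lemma Submodule.mem_of_coprime {V : Type*} [AddCommGroup V] {M : Submodule ℤ V} {k l : ℤ}
    (h : IsCoprime k l) {x : V} (hk : k • x ∈ M) (hl : l • x ∈ M) : x ∈ M := by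
  obtain ⟨u, v, huv⟩ := h
  have : x = u • k • x + v • l • x := by rw [smul_smul, smul_smul, ← add_smul, huv, one_smul]
  rw [this]
  exact add_mem (M.smul_mem _ hk) (M.smul_mem _ hl)

section Neighbours

variable {V : Type*} [AddCommGroup V] [Module ℚ V] {B : LinearMap.BilinForm ℚ V}

/-- The elements of `L` that have integral inner product with `y`. -/
def perpLattice (B : LinearMap.BilinForm ℚ V) (L : Submodule ℤ V) (y : V) : Submodule ℤ V where
  carrier := {l | l ∈ L ∧ B l y ∈ intQ}
  add_mem' := fun ha hb => ⟨add_mem ha.1 hb.1, by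
    rw [map_add, LinearMap.add_apply]; exact add_mem ha.2 hb.2⟩
  zero_mem' := ⟨zero_mem _, by simp⟩
  smul_mem' := fun c x hx => ⟨L.smul_mem c hx.1, by
    rw [← Int.cast_smul_eq_zsmul ℚ, map_smul, LinearMap.smul_apply, smul_eq_mul]
    exact mul_mem (int_mem_intQ c) hx.2⟩

lemma mem_perpLattice {L : Submodule ℤ V} {y l : V} :
    l ∈ perpLattice B L y ↔ l ∈ L ∧ B l y ∈ intQ := Iff.rfl

/-- The `p`-neighbour of `L` defined by `y`. -/
def nbrLattice (B : LinearMap.BilinForm ℚ V) (L : Submodule ℤ V) (y : V) : Submodule ℤ V :=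
  perpLattice B L y ⊔ Submodule.span ℤ {y}

lemma mem_nbrLattice {L : Submodule ℤ V} {y x : V} :
    x ∈ nbrLattice B L y ↔ ∃ l ∈ perpLattice B L y, ∃ k : ℤ, x = l + k • y := by
  rw [nbrLattice, Submodule.mem_sup]
  constructor
  · rintro ⟨l, hl, z, hz, rfl⟩
    obtain ⟨k, rfl⟩ := Submodule.mem_span_singleton.1 hz
    exact ⟨l, hl, k, rfl⟩
  · rintro ⟨l, hl, k, rfl⟩
    exact ⟨l, hl, _, Submodule.mem_span_singleton.2 ⟨k, rfl⟩, rfl⟩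

/-- `y` defines a `p`-neighbour of `L`. -/
structure IsNbrVector (B : LinearMap.BilinForm ℚ V) (p : ℕ) (L : Submodule ℤ V) (y : V) :
    Prop where
  smul_mem : (p : ℤ) • y ∈ L
  notMem : y ∉ L
  int : B y y ∈ intQ

/-- The `p`-neighbours of `L`. -/
def nbrLattices (B : LinearMap.BilinForm ℚ V) (p : ℕ) (L : Submodule ℤ V) :
    Set (Submodule ℤ V) :=
  {K | ∃ y, IsNbrVector B p L y ∧ K = nbrLattice B L y}

/-- `L` is a lattice of level `N` and `p` is an odd prime that does not divide `N`. -/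
structure IsGoodPrime (B : LinearMap.BilinForm ℚ V) (L : Submodule ℤ V) (N : ℕ) (D : ℤ) (p : ℕ) :
    Prop where
  ternary : IsTernary B
  level : HasLevel B L N D
  prime : p.Prime
  odd : p ≠ 2
  not_dvd : ¬ p ∣ N

variable {L : Submodule ℤ V} {N : ℕ} {D : ℤ} {p : ℕ}

lemma bilin_zsmul_left (k : ℤ) (x y : V) : B (k • x) y = k * B x y := by
  rw [← Int.cast_smul_eq_zsmul ℚ, map_smul, LinearMap.smul_apply, smul_eq_mul]

lemma bilin_zsmul_right (k : ℤ) (x y : V) : B x (k • y) = k * B x y := by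
  rw [← Int.cast_smul_eq_zsmul ℚ, map_smul, smul_eq_mul]

lemma IsTernary.self_add (hB : IsTernary B) (x y : V) :
    B (x + y) (x + y) = B x x + 2 * B x y + B y y := by
  simp only [map_add, LinearMap.add_apply, hB.symm y x]
  ring

namespace IsGoodPrime

lemma primeInt (h : IsGoodPrime B L N D p) : Prime (p : ℤ) := Nat.prime_iff_prime_int.1 h.prime

lemma coprime_of_not_dvd (h : IsGoodPrime B L N D p) {k : ℤ} (hk : ¬ (p : ℤ) ∣ k) :
    IsCoprime k (p : ℤ) := ((Prime.coprime_iff_not_dvd h.primeInt).2 hk).symm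

lemma coprime_two (h : IsGoodPrime B L N D p) : IsCoprime (2 : ℤ) (p : ℤ) := by
  refine h.coprime_of_not_dvd fun hd => ?_
  have h1 : p ∣ 2 := by exact_mod_cast hd
  exact h.odd ((Nat.prime_dvd_prime_iff_eq h.prime Nat.prime_two).1 h1)

lemma integral (h : IsGoodPrime B L N D p) {x y : V} (hx : x ∈ L) (hy : y ∈ L) :
    B x y ∈ intQ := mem_intQ.2 (h.level.integral hx hy)

lemma bilin_mul_int (h : IsGoodPrime B L N D p) {y l : V} (hy : (p : ℤ) • y ∈ L) (hl : l ∈ L) :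
    ((p : ℤ) : ℚ) * B l y ∈ intQ := by
  rw [← bilin_zsmul_right]
  exact h.integral hl hy

/-- Unimodularity at `p`. -/
lemma exists_bilin_notMem (h : IsGoodPrime B L N D p) {y : V} (hy : (p : ℤ) • y ∈ L)
    (hyL : y ∉ L) : ∃ l ∈ L, B l y ∉ intQ := by
  by_contra! H
  refine hyL (Submodule.mem_of_coprime (k := N) (l := p) ?_ ?_ hy)
  · exact h.coprime_of_not_dvd fun hd => h.not_dvd (by exact_mod_cast hd)
  · have := h.level.smul_mem (u := y) fun x hx => mem_intQ.1 (H x hx)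
    rw [← Int.cast_smul_eq_zsmul ℚ]
    exact_mod_cast this

lemma p_smul_mem_perpLattice (h : IsGoodPrime B L N D p) {y : V} (hy : (p : ℤ) • y ∈ L) {l : V}
    (hl : l ∈ L) : (p : ℤ) • l ∈ perpLattice B L y := by
  refine ⟨L.smul_mem _ hl, ?_⟩
  rw [bilin_zsmul_left]
  exact h.bilin_mul_int hy hl

lemma p_smul_self_mem_perpLattice (h : IsGoodPrime B L N D p) {y : V}
    (hy : IsNbrVector B p L y) : (p : ℤ) • y ∈ perpLattice B L y :=
  ⟨hy.smul_mem, by rw [bilin_zsmul_left]; exact mul_mem (int_mem_intQ _) hy.int⟩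

lemma nbrLattice_integral (h : IsGoodPrime B L N D p) {y : V} (hy : IsNbrVector B p L y) {x x' : V}
    (hx : x ∈ nbrLattice B L y) (hx' : x' ∈ nbrLattice B L y) : B x x' ∈ intQ := by
  obtain ⟨l, hl, k, rfl⟩ := mem_nbrLattice.1 hx
  obtain ⟨l', hl', k', rfl⟩ := mem_nbrLattice.1 hx'
  simp only [map_add, LinearMap.add_apply, bilin_zsmul_left, bilin_zsmul_right]
  refine add_mem (add_mem (h.integral hl.1 hl'.1) (mul_mem (int_mem_intQ _) ?_))
    (add_mem (mul_mem (int_mem_intQ _) hl.2) (mul_mem (int_mem_intQ _)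
      (mul_mem (int_mem_intQ _) hy.int)))
  rw [h.ternary.symm]; exact hl'.2

lemma p_smul_mem_of_mem_nbrLattice (h : IsGoodPrime B L N D p) {y x : V}
    (hy : IsNbrVector B p L y) (hx : x ∈ nbrLattice B L y) : (p : ℤ) • x ∈ L := by
  obtain ⟨l, hl, k, rfl⟩ := mem_nbrLattice.1 hx
  rw [smul_add, smul_comm]
  exact add_mem (L.smul_mem _ hl.1) (L.smul_mem _ hy.smul_mem)

lemma p_smul_mem_nbrLattice (h : IsGoodPrime B L N D p) {y x : V}
    (hy : IsNbrVector B p L y) (hx : x ∈ L) : (p : ℤ) • x ∈ nbrLattice B L y :=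
  Submodule.mem_sup_left (h.p_smul_mem_perpLattice hy.smul_mem hx)

lemma smul_mem_of_dvd (h : IsGoodPrime B L N D p) {y : V} (hy : (p : ℤ) • y ∈ L) {k : ℤ}
    (hk : (p : ℤ) ∣ k) : k • y ∈ L := by
  obtain ⟨j, rfl⟩ := hk
  rw [mul_comm, mul_smul]
  exact L.smul_mem _ hy

lemma smul_mem_iff (h : IsGoodPrime B L N D p) {y : V} (hy : (p : ℤ) • y ∈ L) (hyL : y ∉ L)
    {k : ℤ} : k • y ∈ L ↔ (p : ℤ) ∣ k :=
  ⟨fun hk => by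
    by_contra hd
    exact hyL (Submodule.mem_of_coprime (h.coprime_of_not_dvd hd) hk hy), h.smul_mem_of_dvd hy⟩

/-- A neighbour is determined by any of its vectors outside `L`. Such a vector is `l + k y` with `p
∤ k`, so it has the same integrality condition on `L` as `y` and generates the same lattice together
with `perpLattice B L y`. -/
lemma nbrLattice_eq (h : IsGoodPrime B L N D p) {y y' : V} (hy : IsNbrVector B p L y)
    (hy' : y' ∈ nbrLattice B L y) (hyL : y' ∉ L) :
    IsNbrVector B p L y' ∧ nbrLattice B L y' = nbrLattice B L y := by
  refine ⟨⟨h.p_smul_mem_of_mem_nbrLattice hy hy', hyL, h.nbrLattice_integral hy hy' hy'⟩, ?_⟩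
  obtain ⟨l, hl, k, rfl⟩ := mem_nbrLattice.1 hy'
  have hk : ¬ (p : ℤ) ∣ k := fun hd => hyL (add_mem hl.1 (h.smul_mem_of_dvd hy.smul_mem hd))
  have hcop := h.coprime_of_not_dvd hk
  have hperp : perpLattice B L (l + k • y) = perpLattice B L y := by
    ext x
    refine and_congr_right fun hx => ?_
    rw [map_add, bilin_zsmul_right]
    constructor
    · intro h1
      have h2 : (k : ℚ) * B x y ∈ intQ := by
        simpa using sub_mem h1 (h.integral hx hl.1)
      exact mem_intQ_of_coprime hcop h2 (h.bilin_mul_int hy.smul_mem hx)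
    · exact fun h1 => add_mem (h.integral hx hl.1) (mul_mem (int_mem_intQ _) h1)
  rw [nbrLattice, nbrLattice, hperp]
  apply le_antisymm
  · refine sup_le le_sup_left ?_
    rw [Submodule.span_singleton_le_iff_mem]
    exact hy'
  · refine sup_le le_sup_left ?_
    rw [Submodule.span_singleton_le_iff_mem]
    obtain ⟨u, v, huv⟩ := hcop
    have : y = (v • (p : ℤ) • y - u • l) + u • (l + k • y) := by
      rw [smul_add, smul_smul, smul_smul]
      calc y = (u * k + v * p) • y := by rw [huv, one_smul]
        _ = _ := by rw [add_smul]; abel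
    have hfin : v • (p : ℤ) • y - u • l + u • (l + k • y) ∈
        perpLattice B L y ⊔ Submodule.span ℤ {l + k • y} :=
      Submodule.add_mem_sup (sub_mem (Submodule.smul_mem _ _ (h.p_smul_self_mem_perpLattice hy))
        (Submodule.smul_mem _ _ hl)) (Submodule.smul_mem _ _ (Submodule.mem_span_singleton_self _))
    rwa [← this] at hfin

lemma self_mem_nbrLattice (y : V) : y ∈ nbrLattice B L y :=
  Submodule.mem_sup_right (Submodule.mem_span_singleton_self _)

/-- An isotropic vector modulo `L` lies in exactly one neighbour. -/
lemma mem_nbrLattices_iff (h : IsGoodPrime B L N D p) {y : V} (hyL : y ∉ L) {K : Submodule ℤ V} :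
    (K ∈ nbrLattices B p L ∧ y ∈ K) ↔ IsNbrVector B p L y ∧ K = nbrLattice B L y := by
  constructor
  · rintro ⟨⟨y1, hy1, rfl⟩, hy⟩
    have := h.nbrLattice_eq hy1 hy hyL
    exact ⟨this.1, this.2.symm⟩
  · rintro ⟨hy, rfl⟩
    exact ⟨⟨y, hy, rfl⟩, self_mem_nbrLattice y⟩

lemma mem_sup_nbrLattice (h : IsGoodPrime B L N D p) {y x : V} (hy : IsNbrVector B p L y) :
    x ∈ L ⊔ nbrLattice B L y ↔ ∃ k : ℤ, x - k • y ∈ L := by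
  constructor
  · intro hx
    obtain ⟨l, hl, z, hz, rfl⟩ := Submodule.mem_sup.1 hx
    obtain ⟨l', hl', k, rfl⟩ := mem_nbrLattice.1 hz
    exact ⟨k, by rw [← add_assoc, add_sub_cancel_right]; exact add_mem hl hl'.1⟩
  · rintro ⟨k, hk⟩
    rw [← sub_add_cancel x (k • y)]
    exact Submodule.add_mem_sup hk (Submodule.smul_mem _ _ (self_mem_nbrLattice y))

/-- A vector of `p⁻¹L` with `pQ(y) ∈ ℤ` lies in `L + K` for exactly one neighbour `K`. -/
lemma exists_unique_mem_sup (h : IsGoodPrime B L N D p) {y : V} (hy : (p : ℤ) • y ∈ L)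
    (hyL : y ∉ L) (hint : (p : ℚ) * B y y ∈ intQ) :
    ∃! K, K ∈ nbrLattices B p L ∧ y ∈ L ⊔ K := by
  have hp0 : ((p : ℤ) : ℚ) ≠ 0 := by exact_mod_cast h.prime.ne_zero
  obtain ⟨l0, hl0, hl0y⟩ := h.exists_bilin_notMem hy hyL
  obtain ⟨b, hb⟩ := mem_intQ.1 (h.bilin_mul_int hy hl0)
  obtain ⟨m, hm⟩ := mem_intQ.1 hint
  have hbp : ¬ (p : ℤ) ∣ b := by
    rintro ⟨j, rfl⟩
    refine hl0y (mem_intQ.2 ⟨j, mul_left_cancel₀ hp0 ?_⟩)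
    rw [hb]; push_cast; rfl
  -- A Hensel step. With `Q(y) = m / p`, `B(l0, y) = b / p` and `u` inverse to `2 b` modulo `p`, the
  -- vector `y - u m l0` has integral norm.
  obtain ⟨u, v, huv⟩ := h.coprime_two.mul_left (h.coprime_of_not_dvd hbp)
  have key : IsNbrVector B p L (y + (-(u * m)) • l0) := by
    refine ⟨?_, ?_, ?_⟩
    · rw [smul_add]; exact add_mem hy (L.smul_mem _ (L.smul_mem _ hl0))
    · intro h1
      exact hyL (by simpa using sub_mem h1 (L.smul_mem (-(u * m)) hl0))
    · rw [h.ternary.self_add]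
      refine add_mem ?_ (h.integral (L.smul_mem _ hl0) (L.smul_mem _ hl0))
      refine mem_intQ.2 ⟨v * m, mul_left_cancel₀ hp0 ?_⟩
      rw [bilin_zsmul_right, h.ternary.symm y l0]
      have huv' : (u * (2 * b) + v * p : ℚ) = 1 := by exact_mod_cast huv
      push_cast at hb hm ⊢
      linear_combination hm - 2 * u * m * hb - m * huv'
  refine ⟨_, ⟨⟨_, key, rfl⟩, ?_⟩, ?_⟩
  · rw [h.mem_sup_nbrLattice key]
    refine ⟨1, ?_⟩
    rw [one_smul, sub_add_cancel_left]
    exact neg_mem (L.smul_mem _ hl0)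
  · rintro _ ⟨⟨y1, hy1, rfl⟩, hmem⟩
    obtain ⟨k, hk⟩ := (h.mem_sup_nbrLattice hy1).1 hmem
    set w := k • y1 with hw
    have hwL : w ∉ L := fun h1 => hyL (by simpa using add_mem hk h1)
    obtain ⟨hwN, hwe⟩ := h.nbrLattice_eq hy1
      (Submodule.smul_mem _ k (self_mem_nbrLattice y1)) hwL
    rw [← hwe]
    set y2 := y + (-(u * m)) • l0 with hy2
    set d := w - y2 with hd
    have hdL : d ∈ L := by
      have : d = -(y - w) - (-(u * m)) • l0 := by rw [hd, hy2]; abel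
      rw [this]; exact sub_mem (neg_mem hk) (L.smul_mem _ hl0)
    have hwd : w = y2 + d := by rw [hd]; abel
    have h1 := h.ternary.self_add y2 d
    rw [← hwd] at h1
    -- Uniqueness: `w` and `y2` both have integral norm and differ by `d ∈ L`, which forces `2 B(d,
    -- y2)` to be integral, hence `B(d, y2)` since `p` is odd. So `w` lies in the neighbour of `y2`.
    have h2 : ((2 : ℤ) : ℚ) * B d y2 ∈ intQ := by
      have : ((2 : ℤ) : ℚ) * B d y2 = B w w - B y2 y2 - B d d := by
        rw [h1, h.ternary.symm d y2]; push_cast; ring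
      rw [this]
      exact sub_mem (sub_mem hwN.int key.int) (h.integral hdL hdL)
    have h3 := mem_intQ_of_coprime h.coprime_two h2 (h.bilin_mul_int key.smul_mem hdL)
    refine (h.nbrLattice_eq key ?_ hwL).2
    exact mem_nbrLattice.2 ⟨d, ⟨hdL, h3⟩, 1, by rw [one_smul, hwd]; abel⟩

lemma of_mem_sup (h : IsGoodPrime B L N D p) {y : V} {K : Submodule ℤ V}
    (hK : K ∈ nbrLattices B p L) (hy : y ∈ L ⊔ K) :
    (p : ℤ) • y ∈ L ∧ (p : ℚ) * B y y ∈ intQ := by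
  obtain ⟨y1, hy1, rfl⟩ := hK
  obtain ⟨l, hl, x, hx, rfl⟩ := Submodule.mem_sup.1 hy
  have hpx := h.p_smul_mem_of_mem_nbrLattice hy1 hx
  constructor
  · rw [smul_add]; exact add_mem (L.smul_mem _ hl) hpx
  · rw [h.ternary.self_add, mul_add, mul_add]
    refine add_mem (add_mem (mul_mem (nat_mem_intQ _) (h.integral hl hl)) ?_)
      (mul_mem (nat_mem_intQ _) (h.nbrLattice_integral hy1 hx hx))
    have := mul_mem (int_mem_intQ 2) (h.bilin_mul_int hpx hl)
    convert this using 1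
    push_cast; ring

end IsGoodPrime

end Neighbours

/-! ### Isotropic vectors over a finite field -/

section Isotropic

variable {F : Type*} [Field F] [Fintype F] [DecidableEq F]

/-- The number of isotropic vectors of a regular ternary quadratic form over a finite field. -/
lemma card_isotropic (hF : ringChar F ≠ 2) {ψ : AddChar F ℂ} (hψ : ψ.IsPrimitive)
    {A : Matrix (Fin 3) (Fin 3) F} (hA : A.IsSymm) (hdet : A.det ≠ 0) :
    (Finset.univ.filter fun x : Fin 3 → F => x ⬝ᵥ A *ᵥ x = 0).card = Fintype.card F ^ 2 := by
  have h1 : ∀ x : Fin 3 → F, ∑ s : F, ψ (s * (x ⬝ᵥ A *ᵥ x)) =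
      if x ⬝ᵥ A *ᵥ x = 0 then (Fintype.card F : ℂ) else 0 := fun x => by
    exact_mod_cast AddChar.sum_mulShift (x ⬝ᵥ A *ᵥ x) hψ
  -- The rank is odd, so scaling the form by `s` multiplies its Gauss sum by the quadratic character
  -- of `s`. Summed over all `s ≠ 0` these terms vanish.
  have h2 : ∀ s : F, s ≠ 0 → ∑ x : Fin 3 → F, ψ (s * (x ⬝ᵥ A *ᵥ x)) =
      (quadraticChar F s : ℂ) * ((quadraticChar F A.det : ℂ) * (∑ t, ψ (t ^ 2)) ^ 3) := by
    intro s hs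
    have hd : (s • A).det = s ^ 3 * A.det := by
      rw [Matrix.det_smul, Fintype.card_fin]
    have := sum_addChar_quadratic hF hψ (A := s • A)
      (by rw [Matrix.IsSymm, Matrix.transpose_smul, hA.eq])
      (by rw [hd]; exact mul_ne_zero (pow_ne_zero _ hs) hdet)
    rw [hd, map_mul, pow_succ, map_mul, quadraticChar_sq_one' hs, one_mul] at this
    simp only [Matrix.smul_mulVec, dotProduct_smul, smul_eq_mul] at this
    rw [this]; push_cast; ring
  have h3 : (Fintype.card F : ℂ) *
      (Finset.univ.filter fun x : Fin 3 → F => x ⬝ᵥ A *ᵥ x = 0).card =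
      Fintype.card F * Fintype.card F ^ 2 := by
    calc _ = ∑ x : Fin 3 → F, ∑ s : F, ψ (s * (x ⬝ᵥ A *ᵥ x)) := by
          simp only [h1]
          rw [← Finset.sum_filter, Finset.sum_const, nsmul_eq_mul, mul_comm]
      _ = ∑ s : F, ∑ x : Fin 3 → F, ψ (s * (x ⬝ᵥ A *ᵥ x)) := Finset.sum_comm
      _ = ∑ s : F, ((if s = 0 then (Fintype.card F : ℂ) ^ 3 else 0) + (quadraticChar F s : ℂ) *
            ((quadraticChar F A.det : ℂ) * (∑ t, ψ (t ^ 2)) ^ 3)) := by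
          refine Finset.sum_congr rfl fun s _ => ?_
          by_cases hs : s = 0
          · subst hs; simp
          · rw [h2 s hs, if_neg hs, zero_add]
      _ = _ := by
          rw [Finset.sum_add_distrib, ← Finset.sum_mul, Finset.sum_ite_eq' Finset.univ,
            if_pos (Finset.mem_univ _)]
          have := quadraticChar_sum_zero hF
          have h0 : ∑ s : F, (quadraticChar F s : ℂ) = 0 := by exact_mod_cast this
          rw [h0]; ring
  have hq : (Fintype.card F : ℂ) ≠ 0 := by exact_mod_cast Fintype.card_ne_zero
  exact_mod_cast mul_left_cancel₀ hq h3

end Isotropic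

/-! ### The number of neighbours of a lattice -/

section Neighbours

variable {V : Type*} [AddCommGroup V] [Module ℚ V] {B : LinearMap.BilinForm ℚ V}
  {L : Submodule ℤ V}

/-- The lattice vector with the coordinates `n`. -/
def latVec (b : Module.Basis (Fin 3) ℤ L) (n : Fin 3 → ℤ) : V := ((∑ i, n i • b i : L) : V)

lemma latVec_mem (b : Module.Basis (Fin 3) ℤ L) (n : Fin 3 → ℤ) : latVec b n ∈ L :=
  (∑ i, n i • b i : L).2

lemma latVec_repr (b : Module.Basis (Fin 3) ℤ L) (l : L) : latVec b (b.repr l) = l := by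
  rw [latVec, b.sum_repr]

lemma latVec_sub_smul (b : Module.Basis (Fin 3) ℤ L) (n m : Fin 3 → ℤ) (k : ℤ) :
    latVec b n - k • latVec b m = latVec b (n - k • m) := by
  rw [latVec, latVec, latVec, ← Submodule.coe_smul, ← Submodule.coe_sub]
  congr 1
  simp only [Pi.sub_apply, Pi.smul_apply, sub_smul, Finset.sum_sub_distrib, Finset.smul_sum,
    smul_eq_mul, mul_smul]

lemma latVec_injective (b : Module.Basis (Fin 3) ℤ L) : Function.Injective (latVec b) := by
  intro n m h
  have h1 : (∑ i, n i • b i : L) = ∑ i, m i • b i := Subtype.ext h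
  have h2 := congrArg b.repr h1
  funext i
  simpa [Finsupp.single_apply] using DFunLike.congr_fun h2 i

lemma smul_latVec (b : Module.Basis (Fin 3) ℤ L) (k : ℤ) (m : Fin 3 → ℤ) :
    k • latVec b m = latVec b (k • m) := by
  have := latVec_sub_smul b 0 m (-k)
  have h0 : latVec b 0 = 0 := by simp [latVec]
  rw [h0] at this
  simpa using this

lemma bilin_latVec {b : Module.Basis (Fin 3) ℤ L} {A : Matrix (Fin 3) (Fin 3) ℤ}
    (hA : IsGram B b A) (n m : Fin 3 → ℤ) :
    B (latVec b n) (latVec b m) = ((n ⬝ᵥ A *ᵥ m : ℤ) : ℚ) := by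
  have := hA.apply (∑ i, n i • b i) (∑ i, m i • b i)
  rw [b.repr_sum_self, b.repr_sum_self] at this
  exact this

lemma inv_smul_latVec_mem_iff (b : Module.Basis (Fin 3) ℤ L) {p : ℕ} (hp : p ≠ 0)
    (n : Fin 3 → ℤ) : (p : ℚ)⁻¹ • latVec b n ∈ L ↔ ∀ i, (p : ℤ) ∣ n i := by
  have hpQ : (p : ℚ) ≠ 0 := by exact_mod_cast hp
  constructor
  · intro h i
    have h1 : latVec b n = latVec b ((p : ℤ) • b.repr ⟨_, h⟩) := by
      rw [← smul_latVec, latVec_repr, ← Int.cast_smul_eq_zsmul ℚ, Int.cast_natCast,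
        smul_inv_smul₀ hpQ]
    rw [latVec_injective b h1]
    exact ⟨_, rfl⟩
  · intro h
    choose m hm using h
    have : n = (p : ℤ) • m := funext fun i => by rw [hm]; rfl
    rw [this, ← smul_latVec, ← Int.cast_smul_eq_zsmul ℚ, Int.cast_natCast, inv_smul_smul₀ hpQ]
    exact latVec_mem b m

namespace IsGoodPrime

variable {N : ℕ} {D : ℤ} {p : ℕ}

/-- There are `p + 1` neighbours. -/
lemma ncard_nbrLattices (h : IsGoodPrime B L N D p) :
    (nbrLattices B p L).Finite ∧ (nbrLattices B p L).ncard = p + 1 := by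
  classical
  have hpf : Fact p.Prime := ⟨h.prime⟩
  have hpQ : (p : ℚ) ≠ 0 := by exact_mod_cast h.prime.ne_zero
  obtain ⟨b, A, C, hA, hAD, hC⟩ := h.level.gram
  set A' : Matrix (Fin 3) (Fin 3) (ZMod p) := A.map (Int.cast : ℤ → ZMod p) with hA'
  have hdet : A'.det ≠ 0 := by
    have h1 : A'.det = (A.det : ZMod p) := by
      rw [hA']
      exact ((Int.castRingHom (ZMod p)).map_det A).symm
    rw [h1, hAD, Ne, ZMod.intCast_zmod_eq_zero_iff_dvd]
    exact fun hd => h.not_dvd (h.level.prime_dvd p h.prime hd)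
  have hsymm : A'.IsSymm := by
    have := hA.symm h.ternary.symm
    rw [Matrix.IsSymm, hA', ← Matrix.transpose_map, this.eq]
  have hchar : ringChar (ZMod p) ≠ 2 := by rw [ZMod.ringChar_zmod_n]; exact h.odd
  have hcard := card_isotropic hchar (ZMod.isPrimitive_stdAddChar p) hsymm hdet
  rw [ZMod.card] at hcard
  -- The vectors of `𝔽_p³` parametrize `p⁻¹L / L`; isotropic vectors correspond to classes with `p
  -- Q(y) ∈ ℤ`.
  set Y : (Fin 3 → ZMod p) → V := fun x => (p : ℚ)⁻¹ • latVec b (fun i => ((x i).val : ℤ)) with hY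
  have hpY : ∀ x, (p : ℤ) • Y x ∈ L := fun x => by
    rw [hY, ← Int.cast_smul_eq_zsmul ℚ, Int.cast_natCast, smul_inv_smul₀ hpQ]
    exact latVec_mem b _
  have hsub : ∀ x x1 (k : ℤ), Y x - k • Y x1 ∈ L ↔ x = (k : ZMod p) • x1 := fun x x1 k => by
    rw [hY]
    simp only
    rw [smul_comm, ← smul_sub, latVec_sub_smul, inv_smul_latVec_mem_iff b h.prime.ne_zero,
      funext_iff]
    refine forall_congr' fun i => ?_
    rw [← ZMod.intCast_zmod_eq_zero_iff_dvd]
    simp [sub_eq_zero]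
  have hYL : ∀ x, Y x ∈ L ↔ x = 0 := fun x => by
    have := hsub x 0 0
    simpa using this
  have hYQ : ∀ x, (p : ℚ) * B (Y x) (Y x) ∈ intQ ↔ x ⬝ᵥ A' *ᵥ x = 0 := fun x => by
    have e1 : x ⬝ᵥ A' *ᵥ x = ((((fun i => ((x i).val : ℤ)) ⬝ᵥ A *ᵥ (fun i => ((x i).val : ℤ)) : ℤ)) :
        ZMod p) := by
      simp [dotProduct, Matrix.mulVec, hA']
    rw [e1, ZMod.intCast_zmod_eq_zero_iff_dvd, hY]
    simp only [map_smul, LinearMap.smul_apply, smul_eq_mul, bilin_latVec hA]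
    rw [mul_inv_cancel_left₀ hpQ, mem_intQ]
    refine exists_congr fun m => ?_
    rw [inv_mul_eq_iff_eq_mul₀ hpQ]
    exact_mod_cast Iff.rfl
  set S : Finset (Fin 3 → ZMod p) :=
    (Finset.univ.filter fun x : Fin 3 → ZMod p => x ⬝ᵥ A' *ᵥ x = 0).erase 0 with hS
  have hScard : S.card = p ^ 2 - 1 := by
    rw [hS, Finset.card_erase_of_mem (by simp), hcard]
  have hmemS : ∀ x, x ∈ S ↔ x ≠ 0 ∧ x ⬝ᵥ A' *ᵥ x = 0 := fun x => by simp [hS]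
  have hex : ∀ x, ∃ K, x ∈ S → ((K ∈ nbrLattices B p L ∧ Y x ∈ L ⊔ K) ∧
      ∀ K', K' ∈ nbrLattices B p L ∧ Y x ∈ L ⊔ K' → K' = K) := by
    intro x
    by_cases hx : x ∈ S
    · obtain ⟨K, hK, hK'⟩ := h.exists_unique_mem_sup (hpY x)
        (fun h0 => ((hmemS x).1 hx).1 ((hYL x).1 h0)) ((hYQ x).2 ((hmemS x).1 hx).2)
      exact ⟨K, fun _ => ⟨hK, hK'⟩⟩
    · exact ⟨⊥, fun h0 => absurd h0 hx⟩
  choose g hg using hex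
  have hrep : ∀ y1, IsNbrVector B p L y1 → ∃ x1 ∈ S, ∀ x ∈ S,
      (g x = nbrLattice B L y1 ↔ ∃ c : (ZMod p)ˣ, x = c • x1) := by
    intro y1 hy1
    set n := b.repr ⟨(p : ℤ) • y1, hy1.smul_mem⟩ with hn
    set x1 : Fin 3 → ZMod p := fun i => (n i : ZMod p) with hx1
    have hy1n : y1 = (p : ℚ)⁻¹ • latVec b n := by
      rw [hn, latVec_repr]
      simp only
      rw [← Int.cast_smul_eq_zsmul ℚ, Int.cast_natCast, inv_smul_smul₀ hpQ]
    have hd : Y x1 - y1 ∈ L := by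
      have := latVec_sub_smul b (fun i => ((x1 i).val : ℤ)) n 1
      rw [one_smul, one_smul] at this
      rw [hy1n, hY]
      simp only
      rw [← smul_sub, this, inv_smul_latVec_mem_iff b h.prime.ne_zero]
      intro i
      rw [← ZMod.intCast_zmod_eq_zero_iff_dvd]
      simp [hx1]
    have hsup : ∀ x, Y x ∈ L ⊔ nbrLattice B L y1 ↔ ∃ k : ℤ, x = (k : ZMod p) • x1 := by
      intro x
      rw [h.mem_sup_nbrLattice hy1]
      refine exists_congr fun k => ?_
      rw [← hsub]
      have : Y x - k • y1 = (Y x - k • Y x1) + k • (Y x1 - y1) := by rw [smul_sub]; abel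
      rw [this]
      exact L.add_mem_iff_left (L.smul_mem k hd)
    have hx1S : x1 ∈ S := by
      rw [hmemS]
      constructor
      · intro h0
        have h1 := (hYL x1).2 h0
        exact hy1.notMem (by simpa using sub_mem h1 hd)
      · rw [← hYQ]
        exact (h.of_mem_sup ⟨y1, hy1, rfl⟩ ((hsup x1).2 ⟨1, by simp⟩)).2
    refine ⟨x1, hx1S, fun x hx => ?_⟩
    constructor
    · intro he
      have h1 := (hg x hx).1.2
      rw [he, hsup] at h1
      obtain ⟨k, hk⟩ := h1
      have hk0 : (k : ZMod p) ≠ 0 := by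
        intro h0
        rw [h0, zero_smul] at hk
        exact ((hmemS x).1 hx).1 hk
      exact ⟨Units.mk0 _ hk0, hk⟩
    · rintro ⟨c, rfl⟩
      refine ((hg _ hx).2 _ ⟨⟨y1, hy1, rfl⟩, (hsup _).2 ⟨((c : ZMod p).val : ℤ), ?_⟩⟩).symm
      simp [Units.smul_def]
  have hT : (nbrLattices B p L) = ↑(S.image g) := by
    ext K
    rw [Finset.coe_image]
    constructor
    · rintro ⟨y1, hy1, rfl⟩
      obtain ⟨x1, hx1, H⟩ := hrep y1 hy1
      exact ⟨x1, hx1, (H x1 hx1).2 ⟨1, by simp⟩⟩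
    · rintro ⟨x, hx, rfl⟩
      exact (hg x hx).1.1
  have hfib : ∀ K ∈ S.image g, (S.filter fun x => g x = K).card = p - 1 := by
    intro K hK
    have hK' : K ∈ nbrLattices B p L := by rw [hT]; exact hK
    obtain ⟨y1, hy1, rfl⟩ := hK'
    obtain ⟨x1, hx1, H⟩ := hrep y1 hy1
    have hx1' := (hmemS x1).1 hx1
    have : (S.filter fun x => g x = nbrLattice B L y1) =
        (Finset.univ : Finset (ZMod p)ˣ).image (fun c => c • x1) := by
      ext x
      rw [Finset.mem_filter, Finset.mem_image]
      constructor
      · rintro ⟨hx, hgx⟩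
        obtain ⟨c, rfl⟩ := (H x hx).1 hgx
        exact ⟨c, Finset.mem_univ _, rfl⟩
      · rintro ⟨c, -, rfl⟩
        have hcS : c • x1 ∈ S := by
          rw [hmemS]
          refine ⟨by rw [Ne, smul_eq_zero_iff_eq]; exact hx1'.1, ?_⟩
          rw [Units.smul_def, Matrix.mulVec_smul, dotProduct_smul, smul_dotProduct, hx1'.2]
          simp
        exact ⟨hcS, (H _ hcS).2 ⟨c, rfl⟩⟩
    rw [this, Finset.card_image_of_injective, Finset.card_univ, ZMod.card_units]
    intro c c' hcc
    obtain ⟨i, hi⟩ := Function.ne_iff.1 hx1'.1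
    have := congrFun hcc i
    simp only [Units.smul_def, Pi.smul_apply, smul_eq_mul] at this
    exact Units.ext (mul_right_cancel₀ hi this)
  -- The `p² - 1` nonzero isotropic vectors fall into fibres of size `p - 1`.
  have hcount := Finset.card_eq_sum_card_image g S
  rw [Finset.sum_congr rfl hfib, Finset.sum_const, smul_eq_mul, hScard] at hcount
  refine ⟨by rw [hT]; exact Finset.finite_toSet _, ?_⟩
  rw [hT, Set.ncard_coe_finset]
  have hp2 := h.prime.two_le
  have e : p ^ 2 - 1 = (p + 1) * (p - 1) := by
    have := Nat.sq_sub_sq p 1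
    simpa using this
  rw [e] at hcount
  exact (Nat.eq_of_mul_eq_mul_right (by omega) hcount).symm

end IsGoodPrime

end Neighbours

/-! ### Coset representatives in towers and for cyclic quotients -/

section Towers

variable {V : Type*} [AddCommGroup V] [Module ℚ V]

lemma IsCosetReps.tower {ι κ : Type*} [Fintype ι] [Fintype κ] {t : ι → V} {s : κ → V}
    {N M₁ M : Submodule ℤ V} {h₀ h₁ : V} (ht : IsCosetReps t N M₁ h₀)
    (hs : IsCosetReps s M₁ M h₁) :
    IsCosetReps (fun i : ι × κ => t i.1 + s i.2) N M (h₀ + h₁) := by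
  intro x
  rw [Fintype.sum_prod_type, Finset.sum_comm]
  have h1 : ∀ j, ∑ i, ind N (t i + s j) x = ind M₁ (s j) (x - h₀) := by
    intro j
    have h2 := ht (x - s j)
    rw [show ind M₁ (s j) (x - h₀) = ind M₁ h₀ (x - s j) from ind_congr (by rw [sub_right_comm]),
      ← h2]
    exact Finset.sum_congr rfl fun i _ => ind_congr (by rw [sub_add_eq_sub_sub_swap])
  simp only [h1]
  rw [hs]
  exact ind_congr (by rw [sub_sub])

lemma isCosetReps_cyclic {p : ℕ} (hp : 0 < p) {N M : Submodule ℤ V} {y : V}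
    (hM : ∀ x, x ∈ M ↔ ∃ k : ℤ, x - k • y ∈ N) (hk : ∀ k : ℤ, k • y ∈ N ↔ (p : ℤ) ∣ k) :
    IsCosetReps (fun j : Fin p => ((j : ℕ) : ℤ) • y) N M 0 := by
  intro x
  by_cases hx : x ∈ M
  · obtain ⟨k, hkx⟩ := (hM x).1 hx
    have hp' : (p : ℤ) ≠ 0 := by exact_mod_cast hp.ne'
    have hj : ∀ j : Fin p, x - ((j : ℕ) : ℤ) • y ∈ N ↔ (p : ℤ) ∣ k - ((j : ℕ) : ℤ) := by
      intro j
      rw [← hk, show x - ((j : ℕ) : ℤ) • y = (x - k • y) + (k - ((j : ℕ) : ℤ)) • y by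
        rw [sub_smul]; abel]
      exact N.add_mem_iff_right hkx
    have h1 := Int.emod_nonneg k hp'
    have h2 := Int.emod_lt_of_pos k (show (0 : ℤ) < p by exact_mod_cast hp)
    rw [ind_of_mem (by simpa using hx), Finset.sum_eq_single ⟨(k % p).toNat, by omega⟩]
    · rw [ind_of_mem]
      rw [hj]
      simp only
      rw [Int.toNat_of_nonneg h1]
      exact Int.dvd_self_sub_emod
    · intro j _ hne
      refine ind_of_notMem fun hmem => hne ?_
      rw [hj] at hmem
      have h3 := (Int.emod_emod_of_dvd k (dvd_refl (p : ℤ)))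
      have h4 : k % p = ((j : ℕ) : ℤ) := by
        have h5 := (Int.emod_eq_emod_iff_emod_sub_eq_zero).2 (Int.emod_eq_zero_of_dvd hmem)
        rw [h5]
        exact Int.emod_eq_of_lt (by positivity) (by exact_mod_cast j.2)
      apply Fin.ext
      simp only
      omega
    · intro h; exact absurd (Finset.mem_univ _) h
  · rw [ind_of_notMem (by simpa using hx)]
    refine Finset.sum_eq_zero fun j _ => ind_of_notMem fun hmem => hx ((hM x).2 ⟨_, hmem⟩)

end Towers

/-! ### Sum and intersection of a lattice with its neighbour -/

section Neighbours

variable {V : Type*} [AddCommGroup V] [Module ℚ V] {B : LinearMap.BilinForm ℚ V}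
  {L : Submodule ℤ V} {N : ℕ} {D : ℤ} {p : ℕ}

namespace IsGoodPrime

lemma inf_nbrLattice (h : IsGoodPrime B L N D p) {y : V} (hy : IsNbrVector B p L y) :
    L ⊓ nbrLattice B L y = perpLattice B L y := by
  ext x
  constructor
  · rintro ⟨hxL, hx⟩
    obtain ⟨l, hl, k, rfl⟩ := mem_nbrLattice.1 hx
    have hk : k • y ∈ L := by simpa using sub_mem hxL hl.1
    obtain ⟨j, rfl⟩ := (h.smul_mem_iff hy.smul_mem hy.notMem).1 hk
    refine add_mem hl ?_
    rw [mul_comm, mul_smul]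
    exact Submodule.smul_mem _ _ (h.p_smul_self_mem_perpLattice hy)
  · exact fun hx => ⟨hx.1, Submodule.mem_sup_left hx⟩

/-- `L = L_y + ℤ l` for every `l ∈ L` outside of `L_y`. -/
lemma exists_sub_mem_perpLattice (h : IsGoodPrime B L N D p) {y l : V} (hy : (p : ℤ) • y ∈ L)
    (hl : l ∈ L) (hly : B l y ∉ intQ) {t : ℚ} (ht : (p : ℚ) * t ∈ intQ) :
    ∃ k : ℤ, t - k * B l y ∈ intQ := by
  have hp0 : (p : ℚ) ≠ 0 := by exact_mod_cast h.prime.ne_zero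
  obtain ⟨b, hb⟩ := mem_intQ.1 (h.bilin_mul_int hy hl)
  obtain ⟨m, hm⟩ := mem_intQ.1 ht
  have hbp : ¬ (p : ℤ) ∣ b := by
    rintro ⟨j, rfl⟩
    refine hly (mem_intQ.2 ⟨j, mul_left_cancel₀ hp0 ?_⟩)
    push_cast at hb; exact hb
  obtain ⟨u, v, huv⟩ := h.coprime_of_not_dvd hbp
  refine ⟨u * m, mem_intQ.2 ⟨v * m, mul_left_cancel₀ hp0 ?_⟩⟩
  have huv' : (u * b + v * p : ℚ) = 1 := by exact_mod_cast huv
  push_cast at hb ⊢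
  linear_combination hm - u * m * hb - m * huv'

lemma smul_mem_perpLattice_iff (h : IsGoodPrime B L N D p) {y l : V} (hy : (p : ℤ) • y ∈ L)
    (hl : l ∈ L) (hly : B l y ∉ intQ) (k : ℤ) : k • l ∈ perpLattice B L y ↔ (p : ℤ) ∣ k := by
  rw [mem_perpLattice, bilin_zsmul_left]
  constructor
  · rintro ⟨-, hk⟩
    by_contra hd
    exact hly (mem_intQ_of_coprime (h.coprime_of_not_dvd hd) hk (h.bilin_mul_int hy hl))
  · rintro ⟨j, rfl⟩
    refine ⟨L.smul_mem _ hl, ?_⟩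
    push_cast
    rw [mul_comm (p : ℚ), mul_assoc]
    exact mul_mem (int_mem_intQ _) (by simpa using h.bilin_mul_int hy hl)

lemma isFull_inf (h : IsGoodPrime B L N D p) {y : V} (hy : IsNbrVector B p L y) :
    IsFull (perpLattice B L y) := by
  have hp0 : (p : ℚ) ≠ 0 := by exact_mod_cast h.prime.ne_zero
  refine (h.level.full.scale hp0).of_le ?_ (h.level.full.fg_of_le fun x hx => hx.1)
  intro x hx
  obtain ⟨l, hl, rfl⟩ := mem_scale.1 hx
  have := h.p_smul_mem_perpLattice hy.smul_mem hl
  rwa [← Int.cast_smul_eq_zsmul ℚ, Int.cast_natCast] at this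

lemma isFull_nbrLattice (h : IsGoodPrime B L N D p) {y : V} (hy : IsNbrVector B p L y) :
    IsFull (nbrLattice B L y) :=
  (h.isFull_inf hy).of_le le_sup_left
    ((h.isFull_inf hy).1.sup (Submodule.fg_span_singleton y))

lemma isFull_sup (h : IsGoodPrime B L N D p) {y : V} (hy : IsNbrVector B p L y) :
    IsFull (L ⊔ nbrLattice B L y) :=
  h.level.full.of_le le_sup_left (h.level.full.1.sup (h.isFull_nbrLattice hy).1)

/-- The Gauss sum of the pair `a(L + K) ⊇ pa(L ∩ K)` is `p` times that of `aL ⊇ paL`. -/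
lemma exists_reps_sum (h : IsGoodPrime B L N D p) {y : V} (hy : IsNbrVector B p L y) {a : ℕ}
    (ha : 0 < a) (hpa : ¬ p ∣ a) {ν : V} (hν : ν ∈ L) {β : ℤ} (hβ : ¬ (p : ℤ) ∣ β) :
    ∃ (n m : ℕ) (s : Fin n → V) (t : Fin m → V),
      IsCosetReps s (scale ((p : ℤ) : ℚ) (scale (a : ℚ) L)) (scale (a : ℚ) L) ν ∧
      IsCosetReps t (scale ((p : ℤ) : ℚ) (scale (a : ℚ) (perpLattice B L y)))
        (scale (a : ℚ) (L ⊔ nbrLattice B L y)) ν ∧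
      ∑ i, ec (B (t i) (t i) * (β / (p : ℤ))) =
        p * ∑ i, ec (B (s i) (s i) * (β / (p : ℤ))) := by
  have hp0 : (p : ℚ) ≠ 0 := by exact_mod_cast h.prime.ne_zero
  have ha0 : (a : ℚ) ≠ 0 := by exact_mod_cast ha.ne'
  have hp0' : ((p : ℤ) : ℚ) ≠ 0 := by exact_mod_cast h.prime.ne_zero
  obtain ⟨l, hl, hly⟩ := h.exists_bilin_notMem hy.smul_mem hy.notMem
  have hfull := h.level.isFull_scale ha
  obtain ⟨n, s, hs⟩ := exists_isCosetReps (N := scale ((p : ℤ) : ℚ) (scale (a : ℚ) L))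
    (M := scale (a : ℚ) L) (scale_int_le _ _) hfull.1 (hfull.scale hp0').2 ν
  -- The quotient of `L + K` by `L` is cyclic of order `p`, generated by `y`.
  have hu : IsCosetReps (fun j : Fin p => ((j : ℕ) : ℤ) • ((a : ℚ) • y)) (scale (a : ℚ) L)
      (scale (a : ℚ) (L ⊔ nbrLattice B L y)) 0 := by
    refine isCosetReps_cyclic h.prime.pos (fun x => ?_) fun k => ?_
    · rw [mem_scale_iff ha0, h.mem_sup_nbrLattice hy]
      refine exists_congr fun k => ?_
      rw [mem_scale_iff ha0, smul_sub, smul_comm _ k, inv_smul_smul₀ ha0]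
    · rw [smul_comm, smul_mem_scale_iff ha0, h.smul_mem_iff hy.smul_mem hy.notMem]
  -- The quotient of `L` by `L ∩ K` is cyclic of order `p`, generated by any `l ∈ L` with `B(l, y) ∉
  -- ℤ`.
  have hr : IsCosetReps (fun j : Fin p => ((j : ℕ) : ℤ) • (((p : ℤ) : ℚ) • (a : ℚ) • l))
      (scale ((p : ℤ) : ℚ) (scale (a : ℚ) (perpLattice B L y)))
      (scale ((p : ℤ) : ℚ) (scale (a : ℚ) L)) 0 := by
    refine isCosetReps_cyclic h.prime.pos (fun x => ?_) fun k => ?_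
    · rw [mem_scale_iff hp0', mem_scale_iff ha0]
      have e : ∀ k : ℤ, x - k • (((p : ℤ) : ℚ) • (a : ℚ) • l) ∈
          scale ((p : ℤ) : ℚ) (scale (a : ℚ) (perpLattice B L y)) ↔
          (a : ℚ)⁻¹ • ((p : ℤ) : ℚ)⁻¹ • x - k • l ∈ perpLattice B L y := fun k => by
        rw [mem_scale_iff hp0', mem_scale_iff ha0, smul_sub, smul_sub, smul_comm _ k,
          smul_comm _ k, inv_smul_smul₀ hp0', inv_smul_smul₀ ha0]
      simp only [e]
      constructor
      · intro hx
        obtain ⟨k, hk⟩ := h.exists_sub_mem_perpLattice hy.smul_mem hl hly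
          (t := B ((a : ℚ)⁻¹ • ((p : ℤ) : ℚ)⁻¹ • x) y)
          (by exact_mod_cast h.bilin_mul_int hy.smul_mem hx)
        refine ⟨k, sub_mem hx (L.smul_mem _ hl), ?_⟩
        rw [map_sub, LinearMap.sub_apply, bilin_zsmul_left]
        exact hk
      · rintro ⟨k, hk⟩
        simpa using add_mem hk.1 (L.smul_mem k hl)
    · rw [smul_comm, smul_mem_scale_iff hp0', smul_comm, smul_mem_scale_iff ha0,
        h.smul_mem_perpLattice_iff hy.smul_mem hl hly]
  have htower := hr.tower (hs.tower hu)
  rw [zero_add, add_zero] at htower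
  refine ⟨n, Fintype.card (Fin p × Fin n × Fin p), s, fun i => (fun i : Fin p × Fin n × Fin p =>
    ((i.1 : ℕ) : ℤ) • (((p : ℤ) : ℚ) • (a : ℚ) • l) +
      (s i.2.1 + ((i.2.2 : ℕ) : ℤ) • ((a : ℚ) • y))) ((Fintype.equivFin _).symm i), hs, ?_, ?_⟩
  · intro x
    rw [← htower x]
    exact Equiv.sum_comp (Fintype.equivFin (Fin p × Fin n × Fin p)).symm (fun i => ind _ _ x)
  rw [Equiv.sum_comp (Fintype.equivFin (Fin p × Fin n × Fin p)).symm (fun i => ec (B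
    (((i.1 : ℕ) : ℤ) • (((p : ℤ) : ℚ) • (a : ℚ) • l) + (s i.2.1 + ((i.2.2 : ℕ) : ℤ) • ((a : ℚ) • y)))
    (((i.1 : ℕ) : ℤ) • (((p : ℤ) : ℚ) • (a : ℚ) • l) + (s i.2.1 + ((i.2.2 : ℕ) : ℤ) • ((a : ℚ) • y)))
    * (β / (p : ℤ))))]
  rw [Fintype.sum_prod_type, Finset.sum_comm, Fintype.sum_prod_type, Finset.mul_sum]
  refine Finset.sum_congr rfl fun i _ => ?_
  have hsL : s i ∈ L := by
    simpa using add_mem (scale_nat_le _ _ (hs.sub_mem i)) hν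
  obtain ⟨b, hb⟩ := mem_intQ.1 (h.bilin_mul_int hy.smul_mem hl)
  obtain ⟨c, hc⟩ := h.level.integral hl hsL
  obtain ⟨d, hd⟩ := h.level.integral hl hl
  -- The cross term between `r p a l` and `j a y` contributes the phase `r τ(j)`. As `B(l, y)` has
  -- denominator exactly `p`, summing over `r` gives zero unless `j = 0`, and the factor `p`
  -- otherwise.
  set τ : ℕ → ℚ := fun j => 2 * a ^ 2 * β * j * B l y with hτ
  have hterm : ∀ (j r : ℕ), ec (B ((r : ℤ) • (((p : ℤ) : ℚ) • (a : ℚ) • l) +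
      (s i + (j : ℤ) • ((a : ℚ) • y))) ((r : ℤ) • (((p : ℤ) : ℚ) • (a : ℚ) • l) +
      (s i + (j : ℤ) • ((a : ℚ) • y))) * (β / (p : ℤ))) =
      ec (r * τ j) * ec (B (s i + (j : ℤ) • ((a : ℚ) • y)) (s i + (j : ℤ) • ((a : ℚ) • y)) *
        (β / (p : ℤ))) := by
    intro j r
    rw [← ec_add]
    refine ec_eq_of_sub ⟨r ^ 2 * p * a ^ 2 * β * d + 2 * r * a * β * c, ?_⟩
    rw [h.ternary.self_add]
    simp only [map_add, LinearMap.add_apply, bilin_zsmul_left, bilin_zsmul_right, map_smul,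
      LinearMap.smul_apply, smul_eq_mul, hc, hd, hτ]
    push_cast
    field_simp
    ring
  have hsumr : ∀ j : Fin p, ∑ r : Fin p, ec (B (((r : ℕ) : ℤ) • (((p : ℤ) : ℚ) • (a : ℚ) • l) +
      (s i + ((j : ℕ) : ℤ) • ((a : ℚ) • y))) (((r : ℕ) : ℤ) • (((p : ℤ) : ℚ) • (a : ℚ) • l) +
      (s i + ((j : ℕ) : ℤ) • ((a : ℚ) • y))) * (β / (p : ℤ))) =
      if (j : ℕ) = 0 then p * ec (B (s i) (s i) * (β / (p : ℤ))) else 0 := by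
    classical
    intro j
    simp only [hterm]
    rw [← Finset.sum_mul, ← Finset.sum_range (fun r : ℕ => ec (r * τ j)),
      sum_ec_range p h.prime.ne_zero (τ j) ⟨2 * a ^ 2 * β * j * b, by
        rw [hτ]; push_cast at hb ⊢; linear_combination (2 * a ^ 2 * β * (j : ℕ) : ℚ) * hb⟩]
    by_cases hj : (j : ℕ) = 0
    · rw [if_pos ⟨0, by rw [hτ]; simp [hj]⟩, if_pos hj, hj]
      simp
    · rw [if_neg hj, if_neg, zero_mul]
      rintro ⟨m, hm⟩
      refine hly (mem_intQ_of_coprime (k := 2 * a ^ 2 * β * j) (l := p) ?_ ?_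
        (h.bilin_mul_int hy.smul_mem hl))
      · refine ((h.coprime_two.mul_left (IsCoprime.pow_left (h.coprime_of_not_dvd ?_))).mul_left
          (h.coprime_of_not_dvd hβ)).mul_left (h.coprime_of_not_dvd ?_)
        · exact fun hd => hpa (by exact_mod_cast hd)
        · intro hd
          have h1 : p ∣ (j : ℕ) := by exact_mod_cast hd
          exact absurd (Nat.le_of_dvd (Nat.pos_of_ne_zero hj) h1) (not_le.2 j.2)
      · exact mem_intQ.2 ⟨m, by rw [← hm, hτ]; push_cast; ring⟩
  calc _ = ∑ j : Fin p, (if (j : ℕ) = 0 then p * ec (B (s i) (s i) * (β / (p : ℤ))) else 0) := 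
        Finset.sum_congr rfl fun j _ => hsumr j
    _ = _ := by
      rw [← Finset.sum_range (fun j : ℕ => if j = 0 then
        (p : ℂ) * ec (B (s i) (s i) * (β / (p : ℤ))) else 0), Finset.sum_ite_eq' (Finset.range p),
        if_pos (Finset.mem_range.2 h.prime.pos)]

end IsGoodPrime

end Neighbours

/-! ### Transformation of the theta series of `L + K`, and the indicator identities -/

section Neighbours

variable {V : Type*} [AddCommGroup V] [Module ℚ V] {B : LinearMap.BilinForm ℚ V}
  {L : Submodule ℤ V} {N : ℕ} {D : ℤ} {p : ℕ}

namespace IsGoodPrime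

lemma not_dvd_det (h : IsGoodPrime B L N D p) : ¬ (p : ℤ) ∣ D :=
  fun hd => h.not_dvd (h.level.prime_dvd p h.prime hd)

/-- `L + K` and `L ∩ K` are dual to each other at `p`. A functional integral on `L ∩ K` becomes
integral on all of `L` after subtracting a multiple of `y`, and then the level of `L` applies. -/
lemma dual_perpLattice (h : IsGoodPrime B L N D p) {y u : V} (hy : IsNbrVector B p L y)
    (hu : ∀ x ∈ perpLattice B L y, B x u ∈ intQ) : (N : ℚ) • u ∈ L ⊔ nbrLattice B L y := by
  obtain ⟨l, hl, hly⟩ := h.exists_bilin_notMem hy.smul_mem hy.notMem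
  have hplu : (p : ℚ) * B l u ∈ intQ := by
    have := hu _ (h.p_smul_mem_perpLattice hy.smul_mem hl)
    rw [bilin_zsmul_left] at this
    exact_mod_cast this
  obtain ⟨j, hj⟩ := h.exists_sub_mem_perpLattice hy.smul_mem hl hly hplu
  have h1 : ∀ x ∈ L, ∃ m : ℤ, B x (u - j • y) = m := by
    intro x hx
    obtain ⟨k, hk⟩ := h.exists_sub_mem_perpLattice (t := B x y) hy.smul_mem hl hly
      (by exact_mod_cast h.bilin_mul_int hy.smul_mem hx)
    have hperp : x - k • l ∈ perpLattice B L y := by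
      refine ⟨sub_mem hx (L.smul_mem _ hl), ?_⟩
      rw [map_sub, LinearMap.sub_apply, bilin_zsmul_left]; exact hk
    rw [← mem_intQ]
    have e : B x (u - j • y) = B (x - k • l) u + k * (B l u - j * B l y) -
        j * (B (x - k • l) y) := by
      simp only [map_sub, LinearMap.sub_apply, bilin_zsmul_left, bilin_zsmul_right]
      ring
    rw [e]
    exact sub_mem (add_mem (hu _ hperp) (mul_mem (int_mem_intQ _) hj))
      (mul_mem (int_mem_intQ _) hperp.2)
  have h2 := h.level.smul_mem h1
  rw [h.mem_sup_nbrLattice hy]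
  refine ⟨N * j, ?_⟩
  rw [smul_sub] at h2
  convert h2 using 2
  rw [mul_smul, ← Int.cast_smul_eq_zsmul ℚ (N : ℤ), Int.cast_natCast]

/-- `thetaSum_transform` for the pair `a(L ∩ K) ≤ a(L + K)` with lower right entry `p`. Its
integrality condition involving `α` holds because `α = p t` and `p (L + K) ⊆ L ∩ K`. The Gauss sum
comes from `exists_reps_sum`, and comparison with `ℤ³` removes everything but `p` and the character.
-/
lemma thetaSum_sup (h : IsGoodPrime B L N D p) {y : V} (hy : IsNbrVector B p L y) {a : ℕ}
    (ha : 0 < a) (hpa : ¬ p ∣ a) {ν : V} (hν : ν ∈ L) {t β c : ℤ}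
    (hdet : (p * t) * p - β * c = 1) (hc : (4 * N * a ^ 2 : ℤ) ∣ c) {z : ℂ} (hz : 0 < z.im) :
    thetaSum B (ind (scale (a : ℚ) (L ⊔ nbrLattice B L y)) ν)
        (((p * t : ℤ) * z + β) / (c * z + p)) * thetaCube z =
      p * (chiFour D p * (thetaCube (((p * t : ℤ) * z + β) / (c * z + p)) *
        thetaSum B (ind (scale (a : ℚ) (perpLattice B L y)) (((p * t : ℤ) : ℚ) • ν)) z)) := by
  have hpf : Fact p.Prime := ⟨h.prime⟩
  have ha0 : (a : ℚ) ≠ 0 := by exact_mod_cast ha.ne'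
  have hβ : ¬ (p : ℤ) ∣ β := fun ⟨k, hk⟩ => h.primeInt.not_isUnit (isUnit_of_dvd_one
    ⟨p * t - k * c, by rw [hk] at hdet; linear_combination -hdet⟩)
  obtain ⟨n, m, s, r, hs, hr, hsr⟩ := h.exists_reps_sum hy ha hpa hν hβ
  obtain ⟨b, A, C, hA, hAD, hC⟩ := h.level.gram
  have haℓ : IsCoprime (a : ℤ) p := h.coprime_of_not_dvd fun hd => hpa (by exact_mod_cast hd)
  have hG := sum_ec_cosetReps_prime h.ternary.symm hA h.odd haℓ hν (β := β)
    (by rwa [Ne, ZMod.intCast_zmod_eq_zero_iff_dvd])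
    (by rw [hAD, Ne, ZMod.intCast_zmod_eq_zero_iff_dvd]; exact h.not_dvd_det) hs
  have hle : perpLattice B L y ≤ L ⊔ nbrLattice B L y := fun x hx => Submodule.mem_sup_left hx.1
  have key := thetaSum_transform (d := p) h.ternary.finrank h.ternary.symm h.ternary.pos
    ((h.isFull_sup hy).scale ha0) ((h.isFull_inf hy).scale ha0) (scale_mono _ hle) hdet
    (by exact_mod_cast h.prime.pos) (ν := ν)
    (fun x hx x' hx' => by
      obtain ⟨k, hk⟩ := (h.mem_sup_nbrLattice hy).1 (scale_nat_le _ _ hx)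
      have hx' := scale_nat_le _ _ hx'
      rw [← mem_intQ, ← sub_add_cancel x (k • y), map_add, LinearMap.add_apply, bilin_zsmul_left]
      refine add_mem (h.integral hk hx'.1) (mul_mem (int_mem_intQ _) ?_)
      rw [h.ternary.symm]; exact hx'.2)
    (fun x hx => h.level.integral hν (scale_nat_le _ _ hx).1)
    (fun u hu => by
      obtain ⟨k, rfl⟩ := hc
      have h1 : (N : ℚ) • ((2 * a : ℚ) • u) ∈ L ⊔ nbrLattice B L y := by
        refine h.dual_perpLattice hy fun x hx => ?_
        obtain ⟨m, hm⟩ := (mem_dualTwo.1 hu) _ (smul_mem_scale (a : ℚ) hx)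
        rw [mem_intQ]
        refine ⟨m, ?_⟩
        rw [← hm]
        simp only [map_smul, LinearMap.smul_apply, smul_eq_mul]
        ring
      have h2 := smul_mem_scale (a : ℚ) (Submodule.smul_mem _ k h1)
      convert h2 using 1
      rw [← Int.cast_smul_eq_zsmul ℚ, smul_smul, smul_smul, smul_smul]
      congr 1
      push_cast; ring)
    (fun x hx u hu => by
      obtain ⟨x', hx', rfl⟩ := mem_scale.1 hx
      obtain ⟨k, hk⟩ := (h.mem_sup_nbrLattice hy).1 hx'
      have h1 : (p : ℤ) • x' ∈ perpLattice B L y := by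
        rw [← sub_add_cancel x' (k • y), smul_add, smul_comm _ k]
        exact add_mem (h.p_smul_mem_perpLattice hy.smul_mem hk)
          (Submodule.smul_mem _ _ (h.p_smul_self_mem_perpLattice hy))
      obtain ⟨m, hm⟩ := (mem_dualTwo.1 hu) _ (smul_mem_scale (a : ℚ) h1)
      refine ⟨t * m, ?_⟩
      push_cast
      rw [← hm]
      simp only [map_smul, LinearMap.smul_apply, smul_eq_mul, bilin_zsmul_left]
      push_cast
      ring) hr hz
  have hstd := hasLevel_stdLattice.thetaSum_prime (by simp) stdForm_symm stdForm_pos one_pos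
      (zero_mem stdLattice) hdet
      ((Dvd.intro (N * a ^ 2 : ℤ) (by push_cast; ring)).trans hc) hz
  rw [Nat.cast_one, scale_one, smul_zero] at hstd
  change thetaCube _ = _ * _ * thetaCube _ at hstd
  rw [chiFour_prime 1 h.odd] at hstd
  have hchi := chiFour_prime D h.odd
  rw [hsr] at key
  simp only [Int.cast_natCast] at key
  rw [hG, hAD] at key
  rw [key, hstd, hchi]
  simp
  ring

lemma prime_int_mem_iff (h : IsGoodPrime B L N D p) {a : ℕ} (hpa : ¬ p ∣ a) {t : ℚ}
    (ht : (p : ℚ) * t ∈ intQ) : (a : ℚ) ^ 2 * t ∈ intQ ↔ t ∈ intQ := by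
  refine ⟨fun h1 => mem_intQ_of_coprime (k := (a : ℤ) ^ 2) (l := p) ?_ (by exact_mod_cast h1)
    (by exact_mod_cast ht), fun h1 => mul_mem (pow_mem (nat_mem_intQ _) 2) h1⟩
  exact (h.coprime_of_not_dvd fun hd => hpa (by exact_mod_cast hd)).pow_left

/-- The neighbours of `L` as a finset. -/
def nbrFinset (h : IsGoodPrime B L N D p) : Finset (Submodule ℤ V) :=
  h.ncard_nbrLattices.1.toFinset

lemma mem_nbrFinset (h : IsGoodPrime B L N D p) {K : Submodule ℤ V} :
    K ∈ h.nbrFinset ↔ K ∈ nbrLattices B p L := by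
  rw [nbrFinset, Set.Finite.mem_toFinset]

lemma card_nbrFinset (h : IsGoodPrime B L N D p) : h.nbrFinset.card = p + 1 := by
  rw [nbrFinset, ← Set.ncard_eq_toFinset_card _ h.ncard_nbrLattices.1]
  exact h.ncard_nbrLattices.2

/-- The existence and uniqueness of `exists_unique_mem_sup`, in the form of an identity of
indicators. -/
lemma sum_ite_sup (h : IsGoodPrime B L N D p) {y : V} (hy : (p : ℤ) • y ∈ L) (hyL : y ∉ L) :
    ∑ K ∈ h.nbrFinset, ind (L ⊔ K) 0 y = indInt B p y := by
  classical
  rw [indInt]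
  split_ifs with hint
  · obtain ⟨K, hK, huniq⟩ := h.exists_unique_mem_sup hy hyL (mem_intQ.2 hint)
    rw [Finset.sum_eq_single K, ind_of_mem (by simpa using hK.2)]
    · intro K' hK' hne
      exact ind_of_notMem fun hm => hne (huniq K' ⟨h.mem_nbrFinset.1 hK', by simpa using hm⟩)
    · exact fun hn => absurd (h.mem_nbrFinset.2 hK.1) hn
  · refine Finset.sum_eq_zero fun K hK => ind_of_notMem fun hm => hint ?_
    exact mem_intQ.1 (h.of_mem_sup (h.mem_nbrFinset.1 hK) (by simpa using hm)).2

lemma sum_ite_nbr (h : IsGoodPrime B L N D p) {y : V} (hy : (p : ℤ) • y ∈ L) (hyL : y ∉ L) :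
    ∑ K ∈ h.nbrFinset, ind K 0 y = indInt B 1 y := by
  classical
  rw [indInt]
  split_ifs with hint
  · have hyN : IsNbrVector B p L y := ⟨hy, hyL, by rw [mem_intQ]; simpa using hint⟩
    rw [Finset.sum_eq_single (nbrLattice B L y), ind_of_mem (by simpa using self_mem_nbrLattice y)]
    · intro K' hK' hne
      exact ind_of_notMem fun hm => hne
        ((h.mem_nbrLattices_iff hyL).1 ⟨h.mem_nbrFinset.1 hK', by simpa using hm⟩).2
    · exact fun hn => absurd (h.mem_nbrFinset.2 ⟨y, hyN, rfl⟩) hn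
  · refine Finset.sum_eq_zero fun K hK => ind_of_notMem fun hm => hint ?_
    have := ((h.mem_nbrLattices_iff hyL).1 ⟨h.mem_nbrFinset.1 hK, by simpa using hm⟩).1.int
    rw [mem_intQ] at this
    simpa using this

lemma p_smul_mem_of_mem (h : IsGoodPrime B L N D p) {K : Submodule ℤ V}
    (hK : K ∈ nbrLattices B p L) {x : V} (hx : x ∈ K) : (p : ℤ) • x ∈ L :=
  (h.of_mem_sup hK (Submodule.mem_sup_right hx)).1

lemma ind_scale {a : ℕ} (ha : 0 < a) (M : Submodule ℤ V) (ν y : V) :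
    ind (scale (a : ℚ) M) ν (ν + (a : ℚ) • y) = ind M 0 y := by
  have ha0 : (a : ℚ) ≠ 0 := by exact_mod_cast ha.ne'
  refine ind_congr ?_
  rw [add_sub_cancel_left, smul_mem_scale_iff ha0, sub_zero]

/-- The indicator function identity behind the second half of the Hecke sum. -/
lemma ind_mul_indInt_p (h : IsGoodPrime B L N D p) {a : ℕ} (ha : 0 < a) (hpa : ¬ p ∣ a) {ν : V}
    (hν : ν ∈ L) (x : V) :
    ind (scale (a : ℚ) L) ((p : ℤ) • ν) ((p : ℚ) • x) * indInt B p x =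
      (∑ K ∈ h.nbrFinset, ind (scale (a : ℚ) (L ⊔ K)) ν x) - p * ind (scale (a : ℚ) L) ν x := by
  have hp0 : (p : ℚ) ≠ 0 := by exact_mod_cast h.prime.ne_zero
  have ha0 : (a : ℚ) ≠ 0 := by exact_mod_cast ha.ne'
  -- In the coordinate `y` every condition depends only on `y` modulo `L`.
  obtain ⟨y, rfl⟩ : ∃ y, x = ν + (a : ℚ) • y :=
    ⟨(a : ℚ)⁻¹ • (x - ν), by rw [smul_inv_smul₀ ha0]; abel⟩
  have e1 : ind (scale (a : ℚ) L) ((p : ℤ) • ν) ((p : ℚ) • (ν + (a : ℚ) • y)) =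
      ind L 0 ((p : ℤ) • y) := by
    refine ind_congr ?_
    rw [sub_zero, ← smul_mem_scale_iff ha0 (x := (p : ℤ) • y)]
    rw [← Int.cast_smul_eq_zsmul ℚ, ← Int.cast_smul_eq_zsmul ℚ, Int.cast_natCast, smul_add,
      add_sub_cancel_left, smul_comm]
  simp only [e1, ind_scale ha]
  by_cases hy : (p : ℤ) • y ∈ L
  · rw [ind_of_mem (by simpa using hy), one_mul]
    -- If `y ∈ L`, all `p + 1` sums contain it and the right side is `(p + 1) - p = 1`. Otherwise it
    -- lies in exactly one of them or in none.
    by_cases hyL : y ∈ L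
    · rw [Finset.sum_congr rfl fun K _ => ind_of_mem (by
        rw [sub_zero]; exact Submodule.mem_sup_left hyL), ind_of_mem (by simpa using hyL),
        Finset.sum_const, h.card_nbrFinset, indInt, if_pos]
      · simp
      · have hx : ν + (a : ℚ) • y ∈ L := by
          rw [Nat.cast_smul_eq_nsmul]; exact add_mem hν (L.nsmul_mem hyL a)
        rw [← mem_intQ]
        exact mul_mem (nat_mem_intQ _) (h.integral hx hx)
    · rw [h.sum_ite_sup hy hyL, ind_of_notMem (by simpa using hyL), mul_zero, sub_zero, indInt,
        indInt]
      congr 1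
      rw [← mem_intQ, ← mem_intQ, ← h.prime_int_mem_iff hpa (t := p * B y y)]
      · apply propext
        -- Modulo integers `p Q(x)` is `a² (p Q(y))`, and `a` is prime to `p`.
        have e : (p : ℚ) * B (ν + (a : ℚ) • y) (ν + (a : ℚ) • y) = (a : ℚ) ^ 2 * (p * B y y) +
            (p * B ν ν + 2 * a * ((p : ℤ) * B ν y)) := by
          rw [h.ternary.self_add]
          simp only [map_smul, LinearMap.smul_apply, smul_eq_mul]
          push_cast
          ring
        rw [e]
        refine add_mem_cancel_right ?_
        exact add_mem (mul_mem (nat_mem_intQ _) (h.integral hν hν))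
          (mul_mem (mul_mem (int_mem_intQ 2) (nat_mem_intQ _)) (h.bilin_mul_int hy hν))
      · have := h.integral hy hy
        rw [bilin_zsmul_left, bilin_zsmul_right] at this
        exact_mod_cast this
  · rw [ind_of_notMem (by simpa using hy), zero_mul, ind_of_notMem, mul_zero, sub_zero,
      Finset.sum_eq_zero]
    · intro K hK
      refine ind_of_notMem fun hm => hy ?_
      exact (h.of_mem_sup (h.mem_nbrFinset.1 hK) (by simpa using hm)).1
    · rw [sub_zero]; exact fun hm => hy (L.smul_mem _ hm)

/-- The final indicator function identity. -/
lemma sum_ind_nbr (h : IsGoodPrime B L N D p) {a : ℕ} (ha : 0 < a) (hpa : ¬ p ∣ a) {ν : V}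
    (hν : ν ∈ L) {α t : ℤ} (hαt : α = p * t) (hα : (a : ℤ) ∣ p * α - 1) (x : V) :
    ind (scale (a : ℚ) L) ν ((p : ℚ) • x) * indInt B 1 x +
      ((∑ K ∈ h.nbrFinset, ind (scale (a : ℚ) (L ⊓ K)) (α • ν) x) -
        ind (scale (a : ℚ) L) (α • ν) x) =
      ∑ K ∈ h.nbrFinset, ind (scale (a : ℚ) K) (α • ν) x := by
  have hp0 : (p : ℚ) ≠ 0 := by exact_mod_cast h.prime.ne_zero
  have ha0 : (a : ℚ) ≠ 0 := by exact_mod_cast ha.ne'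
  have hαν : α • ν ∈ L := L.smul_mem _ hν
  obtain ⟨y, rfl⟩ : ∃ y, x = α • ν + (a : ℚ) • y :=
    ⟨(a : ℚ)⁻¹ • (x - α • ν), by rw [smul_inv_smul₀ ha0]; abel⟩
  have e1 : ind (scale (a : ℚ) L) ν ((p : ℚ) • (α • ν + (a : ℚ) • y)) =
      ind L 0 ((p : ℤ) • y) := by
    -- As `p α ≡ 1` modulo `a`, the condition `p x ∈ aL + ν` becomes `p y ∈ L`.
    have h1 := int_smul_sub_mem (L := L) hν hα
    rw [one_smul] at h1
    rw [← ind_eq_of_sub_mem h1]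
    refine ind_congr ?_
    rw [sub_zero, ← smul_mem_scale_iff ha0 (x := (p : ℤ) • y)]
    rw [← Int.cast_smul_eq_zsmul ℚ (p : ℤ), Int.cast_natCast, smul_add, mul_smul,
      ← Int.cast_smul_eq_zsmul ℚ (p : ℤ), Int.cast_natCast,
      add_sub_cancel_left, smul_comm]
  simp only [e1, ind_scale ha]
  by_cases hy : (p : ℤ) • y ∈ L
  · rw [ind_of_mem (by simpa using hy), one_mul]
    by_cases hyL : y ∈ L
    · have hx : α • ν + (a : ℚ) • y ∈ L := by
        rw [Nat.cast_smul_eq_nsmul]; exact add_mem hαν (L.nsmul_mem hyL a)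
      rw [indInt, if_pos (by rw [← mem_intQ, one_mul]; exact h.integral hx hx),
        ind_of_mem (by simpa using hyL), add_sub_cancel]
      exact Finset.sum_congr rfl fun K _ => ind_congr (by simp [hyL])
    · rw [h.sum_ite_nbr hy hyL, ind_of_notMem (by simpa using hyL), sub_zero,
        Finset.sum_eq_zero fun K _ => ind_of_notMem (by rw [sub_zero]; exact fun hm => hyL hm.1),
        add_zero, indInt, indInt]
      congr 1
      rw [← mem_intQ, ← mem_intQ, one_mul, one_mul]
      have hpp : (p : ℚ) * (p * B y y) ∈ intQ := by
        have := h.integral hy hy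
        rw [bilin_zsmul_left, bilin_zsmul_right] at this
        exact_mod_cast this
      have hcop : IsCoprime ((a : ℤ) ^ 2) ((p : ℤ) ^ 2) :=
        (h.coprime_of_not_dvd fun hd => hpa (by exact_mod_cast hd)).pow
      -- The divisibility of `α` by `p` makes the cross term `2 a t (p B(ν, y))` integral.
      have e : B (α • ν + (a : ℚ) • y) (α • ν + (a : ℚ) • y) = (a : ℚ) ^ 2 * B y y +
          (B (α • ν) (α • ν) + 2 * a * t * ((p : ℤ) * B ν y)) := by
        rw [h.ternary.self_add]
        simp only [map_smul, LinearMap.smul_apply, smul_eq_mul, hαt, bilin_zsmul_left]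
        push_cast
        ring
      rw [e]
      apply propext
      rw [add_mem_cancel_right]
      · refine ⟨fun h1 => mem_intQ_of_coprime hcop (by exact_mod_cast h1) ?_,
          fun h1 => mul_mem (pow_mem (nat_mem_intQ _) 2) h1⟩
        push_cast
        rwa [pow_two, mul_assoc]
      · exact add_mem (h.integral hαν hαν) (mul_mem (mul_mem (mul_mem (int_mem_intQ 2)
          (nat_mem_intQ _)) (int_mem_intQ _)) (h.bilin_mul_int hy hν))
  · rw [ind_of_notMem (by simpa using hy), zero_mul, ind_of_notMem, Finset.sum_eq_zero,
      Finset.sum_eq_zero]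
    · simp
    · intro K hK
      refine ind_of_notMem fun hm => hy ?_
      exact h.p_smul_mem_of_mem (h.mem_nbrFinset.1 hK) (by simpa using hm)
    · intro K hK
      refine ind_of_notMem fun hm => hy ?_
      rw [sub_zero] at hm
      exact L.smul_mem _ hm.1
    · rw [sub_zero]; exact fun hm => hy (L.smul_mem _ hm)

end IsGoodPrime

end Neighbours

/-! ### The Hecke image as a sum over neighbouring lattices -/

section Neighbours

variable {V : Type*} [AddCommGroup V] [Module ℚ V] {B : LinearMap.BilinForm ℚ V}
  {L : Submodule ℤ V} {N : ℕ} {D : ℤ} {p : ℕ}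

namespace IsGoodPrime

lemma isFull_of_mem (h : IsGoodPrime B L N D p) {K : Submodule ℤ V} (hK : K ∈ nbrLattices B p L) :
    IsFull K ∧ IsFull (L ⊔ K) ∧ IsFull (L ⊓ K) := by
  obtain ⟨y, hy, rfl⟩ := hK
  refine ⟨h.isFull_nbrLattice hy, h.isFull_sup hy, ?_⟩
  rw [h.inf_nbrLattice hy]; exact h.isFull_inf hy

/-- The image of `Θ_{aL + ν}` under `T(p²)` is the sum of the theta series of the neighbours. -/
lemma finsum_shimuraHecke_eq (h : IsGoodPrime B L N D p) (hD : 0 < D) {a : ℕ} [NeZero a]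
    (hpa : ¬ p ∣ a) {ν : V} (hν : ν ∈ L) {fam : DirichletCharacter ℂ a → ℍ → ℂ}
    (hfam : IsNebentypusDecomposition (4 * N * a ^ 2) a 3 (chiFour D)
      (fun z => cosetTheta B a L ν z) fam) {t β : ℤ}
    (ht : (p : ℤ) ^ 2 * t - β * ((4 * N * a ^ 2 : ℕ) : ℤ) = 1) (z : ℍ) :
    ∑ᶠ χ, shimuraHecke (4 * N * a ^ 2) 3 p (twist χ (chiFour D)) (fam χ) z =
      ∑ K ∈ h.nbrFinset, cosetTheta B a K ((p * t : ℤ) • ν) z := by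
  have ha : 0 < a := Nat.pos_of_ne_zero (NeZero.ne a)
  have ha0 : (a : ℚ) ≠ 0 := by exact_mod_cast ha.ne'
  have hp0 : (p : ℂ) ≠ 0 := by exact_mod_cast h.prime.ne_zero
  have hpQ : (p : ℚ) ≠ 0 := by exact_mod_cast h.prime.ne_zero
  rw [h.level.finsum_shimuraHecke h.ternary hD hν hfam h.prime ht z]
  set w : ℍ := lowerRep ht 0 • z with hw
  have hwc : (w : ℂ) = ((p * t : ℤ) * z + β) / (((4 * N * a ^ 2 : ℕ) : ℤ) * z + (p : ℤ)) := by
    rw [hw, coe_lowerRep_smul]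
    simp
  have hw0 := thetaCube_ne_zero w
  have hz0 := thetaCube_ne_zero z
  have hsK : ∀ K ∈ h.nbrFinset, ThetaSummable B (ind (scale (a : ℚ) (L ⊔ K)) ν) := fun K hK =>
    h.ternary.thetaSummable ((h.isFull_of_mem (h.mem_nbrFinset.1 hK)).2.1.scale ha0) ν
  have hsL : ThetaSummable B (ind (scale (a : ℚ) L) ν) :=
    h.ternary.thetaSummable (h.level.isFull_scale ha) ν
  have hdet : (p * t) * (p : ℤ) - β * ((4 * N * a ^ 2 : ℕ) : ℤ) = 1 := by linear_combination ht
  have hc : (4 * N * a ^ 2 : ℤ) ∣ ((4 * N * a ^ 2 : ℕ) : ℤ) := by push_cast; exact dvd_rfl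
  have hexp : thetaSum B (fun x => ind (scale (a : ℚ) L) ((p : ℤ) • ν) ((p : ℚ) • x) *
      indInt B p x) w = (∑ K ∈ h.nbrFinset, thetaSum B (ind (scale (a : ℚ) (L ⊔ K)) ν) w) +
        (-p : ℂ) * thetaSum B (ind (scale (a : ℚ) L) ν) w := by
    rw [← thetaSum_const_mul, ← thetaSum_sum hsK w.im_pos, ← thetaSum_add
      (ThetaSummable.sum hsK) (hsL.const_mul _) w.im_pos]
    congr 1
    funext x
    rw [h.ind_mul_indInt_p ha hpa hν]
    ring
  have hK : ∀ K ∈ h.nbrFinset, thetaSum B (ind (scale (a : ℚ) (L ⊔ K)) ν) w =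
      (thetaCube w / thetaCube z) * (p * (chiFour D p *
        thetaSum B (ind (scale (a : ℚ) (L ⊓ K)) ((p * t : ℤ) • ν)) z)) := by
    intro K hK
    obtain ⟨y, hy, rfl⟩ := h.mem_nbrFinset.1 hK
    have e := h.thetaSum_sup hy ha hpa hν hdet hc z.im_pos
    rw [Int.cast_smul_eq_zsmul, ← Int.cast_natCast p (R := ℂ), ← hwc] at e
    rw [h.inf_nbrLattice hy, div_mul_eq_mul_div, eq_div_iff hz0, e]
    push_cast
    ring
  have hL : thetaSum B (ind (scale (a : ℚ) L) ν) w =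
      (thetaCube w / thetaCube z) * (chiFour D p *
        thetaSum B (ind (scale (a : ℚ) L) ((p * t : ℤ) • ν)) z) := by
    have e := h.level.thetaSum_moebius h.ternary.finrank h.ternary.symm h.ternary.pos hD ha hν
      hdet hc z.im_pos
    rw [Int.cast_smul_eq_zsmul, ← hwc] at e
    rw [div_mul_eq_mul_div, eq_div_iff hz0, e]
    ring
  have hcop : IsCoprime (p : ℤ) (4 * N : ℤ) :=
    ⟨p * t, -(a ^ 2 * β), by push_cast at ht; linear_combination ht⟩
  have hcop' : IsCoprime (p * t : ℤ) (4 * N : ℤ) :=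
    ⟨p, -(a ^ 2 * β), by push_cast at ht; linear_combination ht⟩
  have hne : ∀ m : ℤ, IsCoprime m (4 * N : ℤ) → m ≠ 0 := by
    rintro m hm rfl
    rw [isCoprime_zero_left, Int.isUnit_iff] at hm
    omega
  have hchi : chiFour D (p * t) * chiFour D p = 1 := by
    rw [← chiFour_mul D (hne _ hcop') (hne _ hcop),
      chiFour_congr hD h.level.prime_dvd (hcop'.mul_left hcop) isCoprime_one_left
        ⟨a ^ 2 * β, by push_cast at ht; linear_combination ht⟩, chiFour_one]
  have hsI : ∀ K ∈ h.nbrFinset,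
      ThetaSummable B (ind (scale (a : ℚ) (L ⊓ K)) ((p * t : ℤ) • ν)) := fun K hK =>
    h.ternary.thetaSummable ((h.isFull_of_mem (h.mem_nbrFinset.1 hK)).2.2.scale ha0) _
  have hsLt : ThetaSummable B (ind (scale (a : ℚ) L) ((p * t : ℤ) • ν)) :=
    h.ternary.thetaSummable (h.level.isFull_scale ha) _
  have hs1 : ThetaSummable B (fun x => ind (scale (a : ℚ) L) ν ((p : ℚ) • x) * indInt B 1 x) := by
    refine (h.ternary.thetaSummable_smul (h.level.isFull_scale ha) ν hpQ).of_norm_le 1 fun x => ?_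
    rw [norm_mul, one_mul]
    refine mul_le_of_le_one_right (norm_nonneg _) ?_
    unfold indInt; split_ifs <;> simp
  -- The outer `p⁻¹` cancels the factor `p` carried by each `L + K` and the coefficient `-p` of `L`.
  -- The quotients of `θ³` cancel, and the characters do because `p · p t ≡ 1` modulo `4N`.
  have hsecond : (p : ℂ)⁻¹ * (chiFour D (p * t) * (thetaCube z / thetaCube w)) *
      ((∑ K ∈ h.nbrFinset, thetaSum B (ind (scale (a : ℚ) (L ⊔ K)) ν) w) +
        (-p : ℂ) * thetaSum B (ind (scale (a : ℚ) L) ν) w) =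
      (∑ K ∈ h.nbrFinset, thetaSum B (ind (scale (a : ℚ) (L ⊓ K)) ((p * t : ℤ) • ν)) z) +
        (-1) * thetaSum B (ind (scale (a : ℚ) L) ((p * t : ℤ) • ν)) z := by
    rw [Finset.sum_congr rfl hK, hL, ← Finset.mul_sum, ← Finset.mul_sum, ← Finset.mul_sum]
    field_simp
    linear_combination ((∑ K ∈ h.nbrFinset, thetaSum B
      (ind (scale (a : ℚ) (L ⊓ K)) ((p * t : ℤ) • ν)) z) -
        thetaSum B (ind (scale (a : ℚ) L) ((p * t : ℤ) • ν)) z) * hchi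
  rw [hexp, hsecond, ← thetaSum_const_mul, ← thetaSum_sum hsI z.im_pos, ← thetaSum_add
      (ThetaSummable.sum hsI) (hsLt.const_mul _) z.im_pos, ← thetaSum_add hs1
      ((ThetaSummable.sum hsI).add (hsLt.const_mul _)) z.im_pos]
  simp only [cosetTheta]
  rw [← thetaSum_sum (fun K hK => h.ternary.thetaSummable
    ((h.isFull_of_mem (h.mem_nbrFinset.1 hK)).1.scale ha0) _) z.im_pos]
  congr 1
  funext x
  have hα : (a : ℤ) ∣ p * (p * t) - 1 :=
    ⟨4 * N * a * β, by push_cast at ht; linear_combination ht⟩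
  rw [← h.sum_ind_nbr ha hpa hν rfl hα x]
  ring

end IsGoodPrime

end Neighbours

/-! ### Localization of lattices and cosets -/

section Local

variable {V : Type*} [AddCommGroup V] [Module ℚ V] {B : LinearMap.BilinForm ℚ V}

/-- The map from `V` to its localization. -/
def locMap (q : ℕ) [Fact q.Prime] : V →+ LocalSpace V q :=
  (TensorProduct.mk ℚ ℚ_[q] V 1).toAddMonoidHom

variable {q : ℕ} [Fact q.Prime]

lemma locMap_apply (x : V) : locMap q x = (1 : ℚ_[q]) ⊗ₜ[ℚ] x := rfl

lemma isUnit_intCast_padicInt {m : ℤ} (hm : ¬ (q : ℤ) ∣ m) : IsUnit (m : ℤ_[q]) := by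
  rw [PadicInt.isUnit_iff]
  refine le_antisymm (PadicInt.norm_le_one _) ?_
  rw [← not_lt, PadicInt.norm_int_lt_one_iff_dvd]
  exact hm

lemma mem_of_zsmul_mem {W : Type*} [AddCommGroup W] [Module ℤ_[q] W] {M : Submodule ℤ_[q] W}
    {m : ℤ} (hm : ¬ (q : ℤ) ∣ m) {z : W} (hz : m • z ∈ M) : z ∈ M := by
  obtain ⟨u, hu⟩ := isUnit_intCast_padicInt hm
  rw [← Int.cast_smul_eq_zsmul ℤ_[q], ← hu] at hz
  have := M.smul_mem (↑u⁻¹ : ℤ_[q]) hz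
  rwa [smul_smul, Units.inv_mul, one_smul] at this

lemma zsmul_mem_local {W : Type*} [AddCommGroup W] [Module ℤ_[q] W] {M : Submodule ℤ_[q] W}
    (m : ℤ) {z : W} (hz : z ∈ M) : m • z ∈ M := by
  rw [← Int.cast_smul_eq_zsmul ℤ_[q]]; exact M.smul_mem _ hz

lemma padicInt_smul_eq (c : ℤ_[q]) (z : LocalSpace V q) : c • z = (c : ℚ_[q]) • z := by
  rw [← PadicInt.algebraMap_apply, algebraMap_smul]

lemma locMap_mem {L : Submodule ℤ V} {x : V} (hx : x ∈ L) : locMap q x ∈ localLattice q L :=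
  Submodule.subset_span ⟨x, hx, rfl⟩

lemma localLattice_le {L : Submodule ℤ V} {M : Submodule ℤ_[q] (LocalSpace V q)}
    (h : ∀ x ∈ L, locMap q x ∈ M) : localLattice q L ≤ M := by
  refine Submodule.span_le.2 ?_
  rintro _ ⟨x, hx, rfl⟩
  exact h x hx

lemma IsFull.exists_basis {L : Submodule ℤ V} (hL : IsFull L) :
    ∃ n, Nonempty (Module.Basis (Fin n) ℤ L) := by
  have : Module.Finite ℤ L := Module.Finite.iff_fg.2 hL.1
  have : Module.IsTorsionFree ℤ V := Module.IsTorsionFree.trans_faithfulSMul ℤ ℚ V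
  have : Module.Free ℤ L := inferInstance
  exact ⟨_, ⟨Module.finBasis ℤ L⟩⟩

lemma norm_repr_le_one {L : Submodule ℤ V} {ι : Type*} [Fintype ι] (b : Module.Basis ι ℤ L)
    {e : Module.Basis ι ℚ V} (he : ∀ i, e i = b i) {z : LocalSpace V q}
    (hz : z ∈ localLattice q L) (i : ι) : ‖(e.baseChange ℚ_[q]).repr z i‖ ≤ 1 := by
  induction hz using Submodule.span_induction with
  | mem z h =>
    obtain ⟨x, hx, rfl⟩ := h
    have h1 : e.repr x i = ((b.repr ⟨x, hx⟩ i : ℤ) : ℚ) := by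
      have h2 : x = ∑ j, ((b.repr ⟨x, hx⟩ j : ℤ) : ℚ) • e j := by
        have := congrArg Subtype.val (b.sum_repr ⟨x, hx⟩)
        simp only [Submodule.coe_sum, Submodule.coe_smul] at this
        simp only [he, Int.cast_smul_eq_zsmul]
        exact this.symm
      conv_lhs => rw [h2]
      rw [e.repr_sum_self]
    rw [Module.Basis.baseChange_repr_tmul, h1]
    simp only [Algebra.smul_def, mul_one, eq_ratCast, Rat.cast_intCast]
    exact Padic.norm_int_le_one _
  | zero => simp
  | add x y _ _ hx hy =>
    rw [map_add, Finsupp.add_apply]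
    exact (Padic.nonarchimedean _ _).trans (max_le hx hy)
  | smul c x _ hx =>
    rw [padicInt_smul_eq, map_smul, Finsupp.smul_apply, smul_eq_mul, norm_mul]
    exact mul_le_one₀ (PadicInt.norm_le_one c) (norm_nonneg _) hx

lemma not_dvd_den {r : ℚ} (h : ‖(r : ℚ_[q])‖ ≤ 1) : ¬ (q : ℤ) ∣ (r.den : ℤ) := by
  have := PadicInt.isUnit_den r h
  rw [PadicInt.isUnit_iff] at this
  rw [← PadicInt.norm_int_lt_one_iff_dvd]
  push_cast
  rw [this]
  exact lt_irrefl _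

/-- Membership in a localization in terms of the lattice. -/
lemma locMap_mem_iff {L : Submodule ℤ V} (hL : IsFull L) {x : V} :
    locMap q x ∈ localLattice q L ↔ ∃ m : ℤ, ¬ (q : ℤ) ∣ m ∧ m • x ∈ L := by
  constructor
  · intro hx
    obtain ⟨n, ⟨b⟩⟩ := hL.exists_basis
    obtain ⟨e, he⟩ := exists_basis_rat hL.2 b
    have hr : ∀ i, ¬ (q : ℤ) ∣ ((e.repr x i).den : ℤ) := fun i => by
      have := norm_repr_le_one b he hx i
      rw [locMap_apply, Module.Basis.baseChange_repr_tmul] at this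
      simp only [Algebra.smul_def, mul_one, eq_ratCast] at this
      exact not_dvd_den this
    have hq : Prime (q : ℤ) := Nat.prime_iff_prime_int.1 Fact.out
    -- The product of the denominators of the coordinates works, since each of them is prime to `q`.
    refine ⟨∏ i, ((e.repr x i).den : ℤ), fun hd => ?_, ?_⟩
    · obtain ⟨i, -, hi⟩ := (Prime.dvd_finsetProd_iff hq _).1 hd
      exact hr i hi
    · suffices (∏ i, ((e.repr x i).den : ℤ)) • ∑ i, e.repr x i • e i ∈ L by
        rwa [e.sum_repr] at this
      rw [Finset.smul_sum]
      refine Submodule.sum_mem _ fun i _ => ?_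
      obtain ⟨c, hc⟩ := Finset.dvd_prod_of_mem (fun i => ((e.repr x i).den : ℤ)) (Finset.mem_univ i)
      have : (∏ i, ((e.repr x i).den : ℤ)) • (e.repr x i • e i) =
          (c * (e.repr x i).num) • (b i : V) := by
        rw [hc, he, ← Int.cast_smul_eq_zsmul ℚ, ← Int.cast_smul_eq_zsmul ℚ, smul_smul]
        congr 1
        push_cast
        have := Rat.mul_den_eq_num (e.repr x i)
        linear_combination (c : ℚ) * this
      rw [this]
      exact L.smul_mem _ (b i).2
  · rintro ⟨m, hm, hx⟩
    refine mem_of_zsmul_mem hm ?_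
    rw [← map_zsmul]
    exact locMap_mem hx

/-- A vector lies in a lattice if it does so locally everywhere. -/
lemma mem_of_forall_locMap_mem {L : Submodule ℤ V} (hL : IsFull L) {x : V}
    (h : ∀ (q : ℕ) [Fact q.Prime], locMap q x ∈ localLattice q L) : x ∈ L := by
  -- The ideal of the integers `m` with `m x ∈ L`. If it were proper, local membership at a prime
  -- dividing its generator would be contradicted.
  set I : Ideal ℤ := L.comap (LinearMap.toSpanSingleton ℤ V x) with hI
  have hmem : ∀ m : ℤ, m ∈ I ↔ m • x ∈ L := fun m => Iff.rfl
  by_contra hx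
  have hI1 : I ≠ ⊤ := by
    rw [Ne, Ideal.eq_top_iff_one, hmem, one_smul]; exact hx
  obtain ⟨g, hg⟩ := (IsPrincipalIdealRing.principal I).principal
  have hg1 : g.natAbs ≠ 1 := by
    intro h1
    apply hI1
    rw [hg]
    exact Ideal.span_singleton_eq_top.2 (Int.isUnit_iff_natAbs_eq.2 h1)
  obtain ⟨q, hq, hqg⟩ := Nat.exists_prime_and_dvd hg1
  have hqf : Fact q.Prime := ⟨hq⟩
  obtain ⟨m, hm, hmx⟩ := (locMap_mem_iff hL).1 (h q)
  rw [← hmem, hg, Submodule.mem_span_singleton] at hmx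
  obtain ⟨k, rfl⟩ := hmx
  exact hm ((Int.natCast_dvd.2 hqg).mul_left k)

lemma nsmul_mem_local {M : Submodule ℤ_[q] (LocalSpace V q)} {a : ℕ} (ha : ¬ q ∣ a)
    {z : LocalSpace V q} (hz : z ∈ M) : ∃ w ∈ M, z = a • w := by
  obtain ⟨u, hu⟩ := isUnit_intCast_padicInt (q := q) (m := a)
    (fun hd => ha (by exact_mod_cast hd))
  refine ⟨(↑u⁻¹ : ℤ_[q]) • z, M.smul_mem _ hz, ?_⟩
  rw [← Nat.cast_smul_eq_nsmul ℤ_[q], smul_smul, show ((a : ℕ) : ℤ_[q]) = u by rw [hu]; simp,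
    Units.mul_inv, one_smul]

lemma nsmul_injective_local {a : ℕ} (ha : 0 < a) {z w : LocalSpace V q} (h : a • z = a • w) :
    z = w := by
  rw [← Nat.cast_smul_eq_nsmul ℚ_[q], ← Nat.cast_smul_eq_nsmul ℚ_[q]] at h
  exact smul_right_injective _ (by exact_mod_cast ha.ne') h

lemma localCoset_eq_iff {a : ℕ} (ha : 0 < a) {K L : Submodule ℤ V} {μ ν : V} :
    localCoset q a K μ = localCoset q a L ν ↔ localLattice q K = localLattice q L ∧
      ∃ w ∈ localLattice q L, locMap q (μ - ν) = a • w := by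
  constructor
  · intro h
    have h1 : locMap q μ ∈ localCoset q a L ν := by
      rw [← h]; exact ⟨0, zero_mem _, by rw [smul_zero, zero_add]; rfl⟩
    obtain ⟨w, hw, hw'⟩ := h1
    have hd : locMap q (μ - ν) = a • w := by
      rw [map_sub, hw']; exact add_sub_cancel_right _ _
    refine ⟨?_, w, hw, hd⟩
    ext z
    constructor
    · intro hz
      have : a • z + locMap q μ ∈ localCoset q a L ν := by rw [← h]; exact ⟨z, hz, rfl⟩
      obtain ⟨y, hy, hy'⟩ := this
      have : z = y - w := by
        refine nsmul_injective_local ha ?_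
        rw [smul_sub, ← hd, map_sub]
        rw [eq_comm, sub_sub_eq_add_sub, sub_eq_iff_eq_add]
        exact hy'.symm
      rw [this]; exact sub_mem hy hw
    · intro hz
      have : a • (z + w) + locMap q ν ∈ localCoset q a K μ := by
        rw [h]; exact ⟨z + w, add_mem hz hw, rfl⟩
      obtain ⟨y, hy, hy'⟩ := this
      have : z = y := by
        refine nsmul_injective_local ha ?_
        rw [smul_add, ← hd, map_sub, add_assoc, sub_add_cancel] at hy'
        exact add_right_cancel hy'
      rw [this]; exact hy
  · rintro ⟨hKL, w, hw, hd⟩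
    have hμ : locMap q μ = a • w + locMap q ν := by rw [← hd, map_sub, sub_add_cancel]
    ext z
    constructor
    · rintro ⟨y, hy, rfl⟩
      rw [hKL] at hy
      exact ⟨y + w, add_mem hy hw, by rw [smul_add, add_assoc]; exact congrArg _ hμ⟩
    · rintro ⟨y, hy, rfl⟩
      refine ⟨y - w, by rw [hKL]; exact sub_mem hy hw, ?_⟩
      have : (1 : ℚ_[q]) ⊗ₜ[ℚ] μ = a • w + (1 : ℚ_[q]) ⊗ₜ[ℚ] ν := hμ
      rw [this, smul_sub]
      abel

end Local

/-! ### Subgroups of prime index -/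

section Index

variable {W : Type*} [AddCommGroup W]

/-- A subgroup whose quotient is cyclic of order `p` has index `p`. -/
lemma relIndex_eq_of_cyclic {A G : AddSubgroup W} {p : ℕ} (hAG : A ≤ G) {g : W} (hg : g ∈ G)
    (h : ∀ z ∈ G, ∃ k : ℤ, z - k • g ∈ A) (hk : ∀ k : ℤ, k • g ∈ A ↔ (p : ℤ) ∣ k) :
    A.relIndex G = p := by
  have h1 : A.comap (zmultiplesHom W g) = AddSubgroup.zmultiples (p : ℤ) := by
    ext k
    rw [AddSubgroup.mem_comap, zmultiplesHom_apply, hk, Int.mem_zmultiples_iff]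
  have h2 := AddSubgroup.relIndex_comap A (zmultiplesHom W g) ⊤
  rw [AddSubgroup.relIndex_top_right, h1, Int.index_zmultiples, Int.natAbs_natCast,
    ← AddSubgroup.relIndex_sup_right] at h2
  rw [h2]
  congr 1
  refine le_antisymm (fun z hz => ?_) (sup_le ?_ hAG)
  · obtain ⟨k, hk⟩ := h z hz
    rw [← add_sub_cancel (k • g) z]
    exact AddSubgroup.add_mem_sup ⟨k, trivial, rfl⟩ hk
  · rintro _ ⟨k, -, rfl⟩
    exact G.zsmul_mem hg k

lemma nsmul_mem_of_relIndex {A G : AddSubgroup W} {p : ℕ} (h : A.relIndex G = p) {z : W}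
    (hz : z ∈ G) : p • z ∈ A := by
  have := AddSubgroup.nsmul_index_mem (A.addSubgroupOf G) ⟨z, hz⟩
  rw [show (A.addSubgroupOf G).index = p from h] at this
  exact this

/-- A quotient of prime order is generated by each of its nonzero elements. -/
lemma exists_sub_zsmul_mem {A G : AddSubgroup W} {p : ℕ} [Fact p.Prime] (h : A.relIndex G = p)
    {g z : W} (hg : g ∈ G) (hgA : g ∉ A) (hz : z ∈ G) : ∃ k : ℤ, z - k • g ∈ A := by
  have hcard : Nat.card (G ⧸ A.addSubgroupOf G) = p := h
  have hne : ((⟨g, hg⟩ : G) : G ⧸ A.addSubgroupOf G) ≠ 0 := by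
    rw [Ne, QuotientAddGroup.eq_zero_iff]
    exact hgA
  obtain ⟨k, hk⟩ := AddSubgroup.mem_zmultiples_iff.1
    (mem_zmultiples_of_prime_card hcard (g' := ((⟨z, hz⟩ : G) : G ⧸ A.addSubgroupOf G)) hne)
  refine ⟨k, ?_⟩
  rw [← QuotientAddGroup.mk_zsmul, QuotientAddGroup.eq] at hk
  have : -(k • g) + z ∈ A := hk
  rwa [neg_add_eq_sub] at this

end Index

/-! ### Comparison of local and global cosets -/

section LocalCosets

variable {V : Type*} [AddCommGroup V] [Module ℚ V] {B : LinearMap.BilinForm ℚ V}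
  {q : ℕ} [Fact q.Prime]

/-- Integral multiples of `g` suffice despite the `q`-adic coefficients: an element of `ℤ_q` may be
replaced by an integer congruent to it modulo `q`, because `q g ∈ A`. -/
lemma exists_sub_zsmul_mem_local {K : Submodule ℤ V} {A : Submodule ℤ_[q] (LocalSpace V q)}
    {g : LocalSpace V q} (hg : (q : ℤ) • g ∈ A)
    (h : ∀ x ∈ K, ∃ k : ℤ, locMap q x - k • g ∈ A) {z : LocalSpace V q}
    (hz : z ∈ localLattice q K) : ∃ k : ℤ, z - k • g ∈ A := by
  induction hz using Submodule.span_induction with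
  | mem z hz =>
    obtain ⟨x, hx, rfl⟩ := hz
    exact h x hx
  | zero => exact ⟨0, by simp⟩
  | add x y _ _ hx hy =>
    obtain ⟨k, hk⟩ := hx
    obtain ⟨l, hl⟩ := hy
    exact ⟨k + l, by rw [add_smul, add_sub_add_comm]; exact add_mem hk hl⟩
  | smul c x _ hx =>
    obtain ⟨k, hk⟩ := hx
    obtain ⟨n, -, hn⟩ := PadicInt.exists_mem_range (c * (k : ℤ_[q]))
    rw [PadicInt.maximalIdeal_eq_span_p, Ideal.mem_span_singleton] at hn
    obtain ⟨e, he⟩ := hn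
    refine ⟨n, ?_⟩
    have : c • x - (n : ℤ) • g = c • (x - k • g) + e • ((q : ℤ) • g) := by
      rw [← Int.cast_smul_eq_zsmul ℤ_[q], ← Int.cast_smul_eq_zsmul ℤ_[q] k,
        ← Int.cast_smul_eq_zsmul ℤ_[q] (q : ℤ), smul_sub, smul_smul, smul_smul, sub_add,
        ← sub_smul]
      congr 2
      push_cast
      linear_combination -he
    rw [this]
    exact add_mem (A.smul_mem _ hk) (A.smul_mem _ hg)

lemma localLattice_eq_of_smul {K L : Submodule ℤ V} {m : ℤ} (hm : ¬ (q : ℤ) ∣ m)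
    (hKL : ∀ x ∈ K, m • x ∈ L) (hLK : ∀ x ∈ L, m • x ∈ K) :
    localLattice q K = localLattice q L := by
  refine le_antisymm (localLattice_le fun x hx => ?_) (localLattice_le fun x hx => ?_) <;>
    refine mem_of_zsmul_mem hm ?_ <;> rw [← map_zsmul]
  · exact locMap_mem (hKL x hx)
  · exact locMap_mem (hLK x hx)

lemma mem_scale_of_forall_locMap {L : Submodule ℤ V} (hL : IsFull L) {a : ℕ} (ha : 0 < a) {x : V}
    (h : ∀ (q : ℕ) [Fact q.Prime], ∃ w ∈ localLattice q L, locMap q x = a • w) :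
    x ∈ scale (a : ℚ) L := by
  have ha0 : (a : ℚ) ≠ 0 := by exact_mod_cast ha.ne'
  have hx : x = a • ((a : ℚ)⁻¹ • x) := by
    rw [← Nat.cast_smul_eq_nsmul ℚ, smul_smul, mul_inv_cancel₀ ha0, one_smul]
  refine mem_scale.2 ⟨(a : ℚ)⁻¹ • x, mem_of_forall_locMap_mem hL fun q _ => ?_, ?_⟩
  · obtain ⟨w, hw, hxw⟩ := h q
    rw [hx, map_nsmul] at hxw
    rwa [nsmul_injective_local ha hxw]
  · rw [smul_smul, mul_inv_cancel₀ ha0, one_smul]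

lemma exists_local_of_mem_scale {L : Submodule ℤ V} {a : ℕ} {x : V} (hx : x ∈ scale (a : ℚ) L) :
    ∃ w ∈ localLattice q L, locMap q x = a • w := by
  obtain ⟨y, hy, rfl⟩ := mem_scale.1 hx
  exact ⟨locMap q y, locMap_mem hy, by rw [Nat.cast_smul_eq_nsmul, map_nsmul]⟩

lemma cosetSet_eq_iff {a : ℕ} (ha : 0 < a) {K L : Submodule ℤ V} {μ ν : V} :
    cosetSet a K μ = cosetSet a L ν ↔ K = L ∧ μ - ν ∈ scale (a : ℚ) L := by
  have ha0 : (a : ℚ) ≠ 0 := by exact_mod_cast ha.ne'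
  constructor
  · intro h
    have h0 : ∀ x, x - μ ∈ scale (a : ℚ) K ↔ x - ν ∈ scale (a : ℚ) L := fun x => by
      rw [← mem_cosetSet, ← mem_cosetSet, h]
    have h1 : μ - ν ∈ scale (a : ℚ) L := (h0 μ).1 (by rw [sub_self]; exact zero_mem _)
    refine ⟨?_, h1⟩
    ext x
    rw [← smul_mem_scale_iff ha0, ← smul_mem_scale_iff (M := L) ha0]
    have := h0 ((a : ℚ) • x + μ)
    rw [add_sub_cancel_right, add_sub_assoc] at this
    rw [this, Submodule.add_mem_iff_left _ h1]
  · rintro ⟨rfl, h⟩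
    ext x
    rw [mem_cosetSet, mem_cosetSet, ← sub_add_sub_cancel x μ ν, Submodule.add_mem_iff_left _ h]

lemma IsIntegralLattice.isFull {L : Submodule ℤ V} (h : IsIntegralLattice B L) : IsFull L :=
  ⟨h.fg, h.span_eq_top⟩

lemma IsCoset.pos {a : ℕ} {L : Submodule ℤ V} {ν : V} (h : IsCoset B a L ν) : 0 < a :=
  h.conductor.1.1

lemma IsCoset.smul_mem_scale {a : ℕ} {L : Submodule ℤ V} {ν : V} (h : IsCoset B a L ν) {m : ℤ}
    (hm : (a : ℤ) ∣ m) : m • ν ∈ scale (a : ℚ) L := by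
  obtain ⟨k, rfl⟩ := hm
  refine mem_scale.2 ⟨k • ν, L.smul_mem _ h.mem, ?_⟩
  rw [mul_smul, ← Int.cast_smul_eq_zsmul ℚ (a : ℤ), Int.cast_natCast]

/-- A coset of the same conductor: `m ν` may be replaced by an equivalent multiple. -/
lemma IsCoset.of_smul_mem {a : ℕ} {L K : Submodule ℤ V} {ν μ : V} (h : IsCoset B a L ν)
    (hK : IsIntegralLattice B K) (hμ : μ ∈ K)
    (hle : ∀ m : ℕ, m • μ ∈ scale (a : ℚ) K → m • ν ∈ scale (a : ℚ) L) : IsCoset B a K μ := by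
  refine ⟨hK, hμ, ⟨⟨h.pos, μ, hμ, rfl⟩, ?_⟩⟩
  rintro m ⟨hm, x, hx, hxm⟩
  obtain ⟨y, hy, hyν⟩ := mem_scale.1
    (hle m (mem_scale.2 ⟨x, hx, by rw [hxm, Nat.cast_smul_eq_nsmul]⟩))
  exact h.conductor.2 ⟨hm, y, hy, by rw [← hyν, Nat.cast_smul_eq_nsmul]⟩

lemma baseChange_locMap (x y : V) : B.baseChange ℚ_[q] (locMap q x) (locMap q y) =
    ((B x y : ℚ) : ℚ_[q]) := by
  rw [locMap_apply, locMap_apply, LinearMap.BilinForm.baseChange_tmul]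
  simp [Algebra.smul_def]

lemma bilin_mem_padicInt {K : Submodule ℤ V} (h : ∀ x ∈ K, ∀ y ∈ K, B x y ∈ intQ)
    {z w : LocalSpace V q} (hz : z ∈ localLattice q K) (hw : w ∈ localLattice q K) :
    ‖B.baseChange ℚ_[q] z w‖ ≤ 1 := by
  induction hz using Submodule.span_induction with
  | mem z hz =>
    obtain ⟨x, hx, rfl⟩ := hz
    induction hw using Submodule.span_induction with
    | mem w hw =>
      obtain ⟨y, hy, rfl⟩ := hw
      obtain ⟨m, hm⟩ := mem_intQ.1 (h x hx y hy)
      have := baseChange_locMap (q := q) (B := B) x y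
      rw [locMap_apply, locMap_apply, hm, Rat.cast_intCast] at this
      rw [this]
      exact Padic.norm_int_le_one _
    | zero => simp
    | add w w' _ _ h1 h2 =>
      rw [map_add]; exact (Padic.nonarchimedean _ _).trans (max_le h1 h2)
    | smul c w _ h1 =>
      rw [padicInt_smul_eq, map_smul, smul_eq_mul, norm_mul]
      exact mul_le_one₀ (PadicInt.norm_le_one c) (norm_nonneg _) h1
  | zero => simp
  | add w w' _ _ h1 h2 =>
    rw [map_add, LinearMap.add_apply]; exact (Padic.nonarchimedean _ _).trans (max_le h1 h2)
  | smul c w _ h1 =>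
    rw [padicInt_smul_eq, map_smul, LinearMap.smul_apply, smul_eq_mul, norm_mul]
    exact mul_le_one₀ (PadicInt.norm_le_one c) (norm_nonneg _) h1

/-- The local norm ideal is the unit ideal if the form represents a unit. -/
lemma span_norms_eq {K : Submodule ℤ V} (h : ∀ x ∈ K, ∀ y ∈ K, B x y ∈ intQ) {x : V} (hx : x ∈ K)
    {m : ℤ} (hm : B x x = m) (hqm : ¬ (q : ℤ) ∣ m) :
    Submodule.span ℤ_[q] {t : ℚ_[q] | ∃ x ∈ localLattice q K, t = B.baseChange ℚ_[q] x x} =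
      LinearMap.range (Algebra.linearMap ℤ_[q] ℚ_[q]) := by
  refine le_antisymm (Submodule.span_le.2 ?_) ?_
  · rintro _ ⟨z, hz, rfl⟩
    exact ⟨⟨_, bilin_mem_padicInt h hz hz⟩, rfl⟩
  · rintro _ ⟨c, rfl⟩
    obtain ⟨u, hu⟩ := isUnit_intCast_padicInt hqm
    have : Algebra.linearMap ℤ_[q] ℚ_[q] c = (c * ↑u⁻¹ : ℤ_[q]) • ((m : ℤ) : ℚ_[q]) := by
      have h1 : (m : ℚ_[q]) = algebraMap ℤ_[q] ℚ_[q] u := by rw [hu]; simp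
      rw [h1, Algebra.smul_def, ← map_mul, mul_assoc, Units.inv_mul, mul_one]
      rfl
    rw [this]
    refine Submodule.smul_mem _ _ (Submodule.subset_span ⟨locMap q x, locMap_mem hx, ?_⟩)
    rw [baseChange_locMap, hm, Rat.cast_intCast]

end LocalCosets

/-! ### Neighbours of cosets: local definition and global description -/

section NeighbourCosets

variable {V : Type*} [AddCommGroup V] [Module ℚ V] {B : LinearMap.BilinForm ℚ V}
  {L : Submodule ℤ V} {N : ℕ} {D : ℤ} {p : ℕ} [Fact p.Prime] {a : ℕ} {ν : V}

namespace IsGoodPrime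

lemma dvd_of_locMap_mem (h : IsGoodPrime B L N D p) {M : Submodule ℤ V} (hM : IsFull M) {x : V}
    (hx : ∀ k : ℤ, k • x ∈ M → (p : ℤ) ∣ k) {k : ℤ} (hk : locMap p (k • x) ∈ localLattice p M) :
    (p : ℤ) ∣ k := by
  obtain ⟨m, hm, hmk⟩ := (locMap_mem_iff hM).1 hk
  rw [smul_smul] at hmk
  exact (h.primeInt.dvd_or_dvd (hx _ hmk)).resolve_left hm

/-- The quotient is cyclic of order `p`, generated by any `l ∈ L` with `B(l, y) ∉ ℤ`. -/
lemma relIndex_left (h : IsGoodPrime B L N D p) {y : V} (hy : IsNbrVector B p L y) :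
    (localLattice p L ⊓ localLattice p (nbrLattice B L y)).toAddSubgroup.relIndex
      (localLattice p L).toAddSubgroup = p := by
  obtain ⟨l, hl, hly⟩ := h.exists_bilin_notMem hy.smul_mem hy.notMem
  have hperp : ∀ x ∈ perpLattice B L y, locMap p x ∈
      localLattice p L ⊓ localLattice p (nbrLattice B L y) := fun x hx =>
    ⟨locMap_mem hx.1, locMap_mem (Submodule.mem_sup_left hx)⟩
  refine relIndex_eq_of_cyclic (fun x hx => hx.1) (g := locMap p l) (locMap_mem hl)
    (fun z hz => exists_sub_zsmul_mem_local
      (A := localLattice p L ⊓ localLattice p (nbrLattice B L y)) ?_ (fun x hx => ?_) hz)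
    (fun k => ⟨fun hk => ?_, ?_⟩)
  · rw [← map_zsmul]
    exact hperp _ (h.p_smul_mem_perpLattice hy.smul_mem hl)
  · obtain ⟨k, hk⟩ := h.exists_sub_mem_perpLattice hy.smul_mem hl hly (t := B x y)
      (h.bilin_mul_int hy.smul_mem hx)
    refine ⟨k, ?_⟩
    rw [← map_zsmul, ← map_sub]
    refine hperp _ ⟨sub_mem hx (L.smul_mem _ hl), ?_⟩
    rwa [map_sub, LinearMap.sub_apply, bilin_zsmul_left]
  · refine h.dvd_of_locMap_mem (h.isFull_nbrLattice hy) (fun j hj => ?_)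
      (x := l) (k := k) (by rw [map_zsmul]; exact hk.2)
    rw [← h.smul_mem_perpLattice_iff hy.smul_mem hl hly, ← h.inf_nbrLattice hy]
    exact ⟨L.smul_mem _ hl, hj⟩
  · intro hk
    rw [← map_zsmul]
    exact hperp _ ((h.smul_mem_perpLattice_iff hy.smul_mem hl hly k).2 hk)

/-- Here `y` itself generates the quotient. -/
lemma relIndex_right (h : IsGoodPrime B L N D p) {y : V} (hy : IsNbrVector B p L y) :
    (localLattice p L ⊓ localLattice p (nbrLattice B L y)).toAddSubgroup.relIndex
      (localLattice p (nbrLattice B L y)).toAddSubgroup = p := by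
  have hperp : ∀ x ∈ perpLattice B L y, locMap p x ∈
      localLattice p L ⊓ localLattice p (nbrLattice B L y) := fun x hx =>
    ⟨locMap_mem hx.1, locMap_mem (Submodule.mem_sup_left hx)⟩
  refine relIndex_eq_of_cyclic (fun x hx => hx.2) (g := locMap p y)
    (locMap_mem (self_mem_nbrLattice y))
    (fun z hz => exists_sub_zsmul_mem_local
      (A := localLattice p L ⊓ localLattice p (nbrLattice B L y)) ?_ (fun x hx => ?_) hz)
    (fun k => ⟨fun hk => ?_, ?_⟩)
  · rw [← map_zsmul]
    exact hperp _ (h.p_smul_self_mem_perpLattice hy)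
  · obtain ⟨l, hl, k, rfl⟩ := mem_nbrLattice.1 hx
    refine ⟨k, ?_⟩
    rw [← map_zsmul, ← map_sub, add_sub_cancel_right]
    exact hperp _ hl
  · exact h.dvd_of_locMap_mem h.level.full
      (fun j hj => (h.smul_mem_iff hy.smul_mem hy.notMem).1 hj)
      (x := y) (k := k) (by rw [map_zsmul]; exact hk.1)
  · rintro ⟨j, rfl⟩
    rw [← map_zsmul, mul_comm, mul_smul, map_zsmul]
    exact zsmul_mem_local (M := localLattice p L ⊓ localLattice p (nbrLattice B L y)) j
      (hperp _ (h.p_smul_self_mem_perpLattice hy))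

/-- A neighbour represents an integer prime to `p`. -/
lemma exists_norm_not_dvd (h : IsGoodPrime B L N D p) {y : V} (hy : IsNbrVector B p L y) :
    ∃ x ∈ nbrLattice B L y, ∃ m : ℤ, B x x = m ∧ ¬ (p : ℤ) ∣ m := by
  have hp0 : ((p : ℤ) : ℚ) ≠ 0 := by exact_mod_cast h.prime.ne_zero
  obtain ⟨m, hm⟩ := mem_intQ.1 hy.int
  -- If `p` divides `Q(y)`, then `y + p l` serves instead: its norm is `2 b` modulo `p`, where `b =
  -- p B(l, y)` is prime to `p`.
  by_cases hpm : (p : ℤ) ∣ m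
  · obtain ⟨l, hl, hly⟩ := h.exists_bilin_notMem hy.smul_mem hy.notMem
    obtain ⟨b, hb⟩ := mem_intQ.1 (h.bilin_mul_int hy.smul_mem hl)
    obtain ⟨n, hn⟩ := mem_intQ.1 (h.integral hl hl)
    have hbp : ¬ (p : ℤ) ∣ b := by
      rintro ⟨j, rfl⟩
      refine hly (mem_intQ.2 ⟨j, mul_left_cancel₀ hp0 ?_⟩)
      rw [hb]; push_cast; rfl
    refine ⟨y + (p : ℤ) • l, add_mem (self_mem_nbrLattice y) (h.p_smul_mem_nbrLattice hy hl),
      m + 2 * b + p * (p * n), ?_, fun hd => ?_⟩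
    · rw [h.ternary.self_add, bilin_zsmul_right, bilin_zsmul_right, bilin_zsmul_left,
        h.ternary.symm y l, hm, hb, hn]
      push_cast; ring
    · have h2 : (p : ℤ) ∣ 2 * b := by
        rw [show 2 * b = m + 2 * b + p * (p * n) - p * (p * n) - m by ring]
        exact dvd_sub (dvd_sub hd (dvd_mul_right (p : ℤ) (p * n))) hpm
      rcases h.primeInt.dvd_or_dvd h2 with h3 | h3
      · exact (h.primeInt.coprime_iff_not_dvd.1 h.coprime_two.symm) h3
      · exact hbp h3
  · exact ⟨y, self_mem_nbrLattice y, m, hm, hpm⟩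

lemma isIntegralLattice_nbrLattice (h : IsGoodPrime B L N D p) {y : V}
    (hy : IsNbrVector B p L y) : IsIntegralLattice B (nbrLattice B L y) :=
  ⟨(h.isFull_nbrLattice hy).1, (h.isFull_nbrLattice hy).2, fun _ hx _ hx' =>
    mem_intQ.1 (h.nbrLattice_integral hy hx hx')⟩

lemma p_mul_smul_mem (h : IsGoodPrime B L N D p) {y : V} (hy : IsNbrVector B p L y)
    (hν : ν ∈ L) (t : ℤ) : (p * t) • ν ∈ nbrLattice B L y := by
  rw [mul_smul]
  exact h.p_smul_mem_nbrLattice hy (L.smul_mem _ hν)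

/-- Multiplication by `p` maps `K` into `L` and takes `p t ν` to `ν` modulo `aL`. A relation `m (p t
ν) ∈ aK` thus yields `m ν ∈ aL`, and the conductor cannot drop. -/
lemma isCoset_nbrLattice (h : IsGoodPrime B L N D p) (hν : IsCoset B a L ν) {y : V}
    (hy : IsNbrVector B p L y) {t : ℤ} (ht : (p : ℤ) ^ 2 * t ≡ 1 [ZMOD a]) :
    IsCoset B a (nbrLattice B L y) ((p * t) • ν) := by
  refine hν.of_smul_mem (h.isIntegralLattice_nbrLattice hy) (h.p_mul_smul_mem hy hν.mem t)
    fun m hm => ?_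
  obtain ⟨x, hx, hxm⟩ := mem_scale.1 hm
  have h1 : ((p : ℤ) ^ 2 * t) • (m • ν) ∈ scale (a : ℚ) L := by
    refine mem_scale.2 ⟨(p : ℤ) • x, h.p_smul_mem_of_mem_nbrLattice hy hx, ?_⟩
    rw [smul_comm, hxm, smul_comm m, smul_smul]
    congr 1
    ring
  have h2 := hν.smul_mem_scale (m := (1 - (p : ℤ) ^ 2 * t) * m)
    (Dvd.dvd.mul_right ht.dvd _)
  have h3 : m • ν = ((p : ℤ) ^ 2 * t) • (m • ν) + ((1 - (p : ℤ) ^ 2 * t) * m) • ν := by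
    rw [mul_smul _ (m : ℤ), natCast_zsmul, ← add_smul, add_sub_cancel, one_smul]
  rw [h3]
  exact add_mem h1 h2

lemma localLattice_nbrLattice (h : IsGoodPrime B L N D p) {y : V} (hy : IsNbrVector B p L y)
    {q : ℕ} [hq : Fact q.Prime] (hqp : q ≠ p) :
    localLattice q (nbrLattice B L y) = localLattice q L :=
  localLattice_eq_of_smul (m := p) (fun hd => hqp
      ((Nat.prime_dvd_prime_iff_eq hq.out h.prime).1 (by exact_mod_cast hd)))
    (fun _ hx => h.p_smul_mem_of_mem_nbrLattice hy hx) (fun _ hx => h.p_smul_mem_nbrLattice hy hx)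

lemma localCoset_nbrLattice (h : IsGoodPrime B L N D p) (hν : IsCoset B a L ν) {y : V}
    (hy : IsNbrVector B p L y) {m n : ℤ} (hmn : m ≡ n [ZMOD a]) {q : ℕ} [hq : Fact q.Prime]
    (hqp : q ≠ p) :
    localCoset q a (nbrLattice B L y) (m • ν) = localCoset q a L (n • ν) := by
  refine (localCoset_eq_iff hν.pos).2 ⟨h.localLattice_nbrLattice hy hqp, ?_⟩
  rw [← sub_smul]
  exact exists_local_of_mem_scale (hν.smul_mem_scale hmn.symm.dvd)

/-- The neighbours of a coset are carried by the neighbours of the lattice. -/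
lemma cosetSet_mem_neighbours (h : IsGoodPrime B L N D p) (hν : IsCoset B a L ν) {pbar t : ℤ}
    (ht : (p : ℤ) ^ 2 * t ≡ 1 [ZMOD a]) (hpt : (p : ℤ) * t ≡ pbar [ZMOD a]) {y : V}
    (hy : IsNbrVector B p L y) :
    cosetSet a (nbrLattice B L y) ((p * t) • ν) ∈ neighbours B p pbar a L ν := by
  refine ⟨_, _, h.isCoset_nbrLattice hν hy ht, rfl, fun q _ hqp =>
    h.localCoset_nbrLattice hν hy hpt hqp, h.relIndex_left hy, h.relIndex_right hy, ?_⟩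
  obtain ⟨x, hx, m, hm, hpm⟩ := h.exists_norm_not_dvd hy
  exact span_norms_eq (fun x hx y' hy' => h.nbrLattice_integral hy hx hy') hx hm hpm

/-- A lattice which is locally a neighbour of `L` is a neighbour of `L`. -/
lemma mem_nbrLattices_of_local (h : IsGoodPrime B L N D p) {K : Submodule ℤ V}
    (hK : IsIntegralLattice B K)
    (hq : ∀ (q : ℕ) [Fact q.Prime], q ≠ p → localLattice q K = localLattice q L)
    (hL : (localLattice p L ⊓ localLattice p K).toAddSubgroup.relIndex
      (localLattice p L).toAddSubgroup = p)
    (hK' : (localLattice p L ⊓ localLattice p K).toAddSubgroup.relIndex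
      (localLattice p K).toAddSubgroup = p) :
    K ∈ nbrLattices B p L := by
  -- Away from `p` the two lattices coincide, so membership is decided at `p` alone.
  have memL : ∀ x ∈ K, locMap p x ∈ localLattice p L → x ∈ L := fun x hx hxp =>
    mem_of_forall_locMap_mem h.level.full fun q hqf => by
      by_cases hqp : q = p
      · subst hqp; exact hxp
      · rw [← hq q hqp]; exact locMap_mem hx
  have memK : ∀ x ∈ L, locMap p x ∈ localLattice p K → x ∈ K := fun x hx hxp =>
    mem_of_forall_locMap_mem hK.isFull fun q hqf => by
      by_cases hqp : q = p
      · subst hqp; exact hxp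
      · rw [hq q hqp]; exact locMap_mem hx
  have pL : ∀ x ∈ K, (p : ℤ) • x ∈ L := fun x hx => memL _ (K.smul_mem _ hx) (by
    rw [natCast_zsmul, map_nsmul]
    exact (nsmul_mem_of_relIndex hK' (locMap_mem hx)).1)
  have pK : ∀ x ∈ L, (p : ℤ) • x ∈ K := fun x hx => memK _ (L.smul_mem _ hx) (by
    rw [natCast_zsmul, map_nsmul]
    exact (nsmul_mem_of_relIndex hL (locMap_mem hx)).2)
  have hKL : ¬ K ≤ L := fun hle => by
    have hle' : localLattice p K ≤ localLattice p L :=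
      localLattice_le fun x hx => locMap_mem (hle hx)
    rw [inf_eq_right.2 hle', AddSubgroup.relIndex_self] at hK'
    exact h.prime.one_lt.ne hK'
  obtain ⟨y, hyK, hyL⟩ := SetLike.not_le_iff_exists.1 hKL
  have hy : IsNbrVector B p L y := ⟨pL y hyK, hyL, mem_intQ.2 (hK.integral y hyK y hyK)⟩
  obtain ⟨l, hl, hly⟩ := h.exists_bilin_notMem hy.smul_mem hy.notMem
  refine ⟨y, hy, le_antisymm (fun x hx => ?_) (sup_le (fun x hx => ?_) ?_)⟩
  · obtain ⟨k, hk⟩ := exists_sub_zsmul_mem hK' (locMap_mem hyK)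
      (fun hyA => hyL (memL y hyK hyA.1)) (locMap_mem hx)
    rw [← map_zsmul, ← map_sub] at hk
    have hxk : x - k • y ∈ K := sub_mem hx (K.smul_mem _ hyK)
    exact mem_nbrLattice.2 ⟨x - k • y, ⟨memL _ hxk hk.1,
      mem_intQ.2 (hK.integral _ hxk _ hyK)⟩, k, (sub_add_cancel _ _).symm⟩
  · have hlK : l ∉ K := fun hlK => hly (mem_intQ.2 (hK.integral l hlK y hyK))
    obtain ⟨k, hk⟩ := exists_sub_zsmul_mem hL (locMap_mem hl)
      (fun hlA => hlK (memK l hl hlA.2)) (locMap_mem hx.1)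
    rw [← map_zsmul, ← map_sub] at hk
    have hxk : x - k • l ∈ K := memK _ (sub_mem hx.1 (L.smul_mem _ hl)) hk.2
    have h1 : k • l ∈ perpLattice B L y := by
      rw [← sub_sub_cancel x (k • l)]
      refine sub_mem hx ⟨sub_mem hx.1 (L.smul_mem _ hl), mem_intQ.2 (hK.integral _ hxk _ hyK)⟩
    obtain ⟨j, rfl⟩ := (h.smul_mem_perpLattice_iff hy.smul_mem hl hly k).1 h1
    rw [← sub_add_cancel x ((↑p * j) • l)]
    refine add_mem hxk ?_
    rw [mul_smul]
    exact pK _ (L.smul_mem _ hl)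
  · rw [Submodule.span_singleton_le_iff_mem]; exact hyK

/-- A neighbouring coset is determined by its lattice: for `q ≠ p` its vector is prescribed modulo
`aK_q`, and at `p` the integer `a` is a unit, so any vector of `K_p` will do. The multiplier `p t`
is congruent to `pbar` modulo `a`, and its factor `p` puts the vector into `K`. -/
lemma neighbours_eq (h : IsGoodPrime B L N D p) (hν : IsCoset B a L ν) (hpa : ¬ p ∣ a)
    {pbar t : ℤ} (ht : (p : ℤ) ^ 2 * t ≡ 1 [ZMOD a]) (hpt : (p : ℤ) * t ≡ pbar [ZMOD a]) :
    neighbours B p pbar a L ν =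
      (fun K => cosetSet a K ((p * t) • ν)) '' nbrLattices B p L := by
  ext S
  constructor
  · rintro ⟨K, μ, hK, rfl, hq, hi, hi', -⟩
    have hq' := fun (q : ℕ) [Fact q.Prime] (hqp : q ≠ p) =>
      (localCoset_eq_iff hK.pos).1 (hq q hqp)
    have hKn := h.mem_nbrLattices_of_local hK.lattice (fun q _ hqp => (hq' q hqp).1) hi hi'
    refine ⟨K, hKn, (cosetSet_eq_iff hK.pos).2 ⟨rfl, ?_⟩⟩
    refine mem_scale_of_forall_locMap hK.lattice.isFull hK.pos fun q hqf => ?_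
    by_cases hqp : q = p
    · subst hqp
      refine nsmul_mem_local hpa (locMap_mem (sub_mem ?_ hK.mem))
      obtain ⟨y, hy, rfl⟩ := hKn
      exact h.p_mul_smul_mem hy hν.mem t
    · obtain ⟨hKL, w, hw, hwμ⟩ := hq' q hqp
      obtain ⟨w', hw', hwν⟩ := exists_local_of_mem_scale (q := q)
        (hν.smul_mem_scale (m := p * t - pbar) hpt.symm.dvd)
      refine ⟨w' - w, by rw [hKL]; exact sub_mem hw' hw, ?_⟩
      rw [smul_sub, ← hwμ, ← hwν, ← map_sub, sub_smul]
      congr 1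
      abel
  · rintro ⟨K, ⟨y, hy, rfl⟩, rfl⟩
    exact h.cosetSet_mem_neighbours hν ht hpt hy

lemma injective_cosetSet (ha : 0 < a) (μ : V) :
    Function.Injective fun K : Submodule ℤ V => cosetSet a K μ :=
  fun _ _ hKL => ((cosetSet_eq_iff ha).1 hKL).1

end IsGoodPrime

end NeighbourCosets

/-! ### Positivity and level of Gram matrices -/

section Gram

variable {V : Type*} [AddCommGroup V] [Module ℚ V] {B : LinearMap.BilinForm ℚ V}

lemma IsGram.dotProduct_pos (hB : IsTernary B) {L : Submodule ℤ V}
    {b : Module.Basis (Fin 3) ℤ L} {A : Matrix (Fin 3) (Fin 3) ℤ} (hA : IsGram B b A)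
    {x : Fin 3 → ℤ} (hx : x ≠ 0) : 0 < x ⬝ᵥ A *ᵥ x := by
  have h1 := hA.apply (b.equivFun.symm x) (b.equivFun.symm x)
  have h2 : (b.repr (b.equivFun.symm x) : Fin 3 → ℤ) = x := b.equivFun.apply_symm_apply x
  rw [h2] at h1
  have h3 : ((b.equivFun.symm x : L) : V) ≠ 0 := by
    rw [Ne, ZeroMemClass.coe_eq_zero, LinearEquiv.map_eq_zero_iff]
    exact hx
  have h4 := hB.pos _ h3
  rw [h1] at h4
  exact_mod_cast h4

/-- Sylvester's criterion for the determinant of a positive definite ternary Gram matrix. -/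
lemma IsGram.det_pos (hB : IsTernary B) {L : Submodule ℤ V}
    {b : Module.Basis (Fin 3) ℤ L} {A : Matrix (Fin 3) (Fin 3) ℤ} (hA : IsGram B b A) :
    0 < A.det := by
  have hs : ∀ i j, A i j = A j i := fun i j => by
    have := (hA i j).trans ((hB.symm _ _).trans (hA j i).symm)
    exact_mod_cast this
  have key : ∀ x y z : ℤ, (x ≠ 0 ∨ y ≠ 0 ∨ z ≠ 0) →
      0 < x * (A 0 0 * x + A 0 1 * y + A 0 2 * z) + y * (A 0 1 * x + A 1 1 * y + A 1 2 * z) +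
        z * (A 0 2 * x + A 1 2 * y + A 2 2 * z) := by
    intro x y z hxyz
    have hne : ![x, y, z] ≠ 0 := by
      intro h0
      have e0 := congrFun h0 0
      have e1 := congrFun h0 1
      have e2 := congrFun h0 2
      simp at e0 e1 e2
      tauto
    have := hA.dotProduct_pos hB hne
    simp only [dotProduct, Matrix.mulVec, Fin.sum_univ_three, hs 1 0, hs 2 0, hs 2 1] at this
    exact this
  have h1 : 0 < A 0 0 := by
    have := key 1 0 0 (by simp)
    linarith
  have h2 : 0 < A 0 0 * A 1 1 - A 0 1 ^ 2 := by
    -- The form takes the value `A₀₀ (A₀₀ A₁₁ - A₀₁²)` at this vector.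
    have := key (-A 0 1) (A 0 0) 0 (Or.inr (Or.inl h1.ne'))
    refine pos_of_mul_pos_right (a := A 0 0) ?_ h1.le
    linarith
  -- The vector is the last column of the adjugate; the form takes there the value of the `2 × 2`
  -- minor times the determinant.
  have h3 := key (A 0 1 * A 1 2 - A 0 2 * A 1 1) (A 0 1 * A 0 2 - A 0 0 * A 1 2)
    (A 0 0 * A 1 1 - A 0 1 ^ 2) (Or.inr (Or.inr h2.ne'))
  refine pos_of_mul_pos_right (a := A 0 0 * A 1 1 - A 0 1 ^ 2) ?_ h2.le
  rw [Matrix.det_fin_three, hs 1 0, hs 2 0, hs 2 1]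
  linarith

lemma IsGram.hasLevel (hB : IsTernary B) {L : Submodule ℤ V} (hL : IsFull L)
    {b : Module.Basis (Fin 3) ℤ L} {A : Matrix (Fin 3) (Fin 3) ℤ} (hA : IsGram B b A)
    (h0 : gramLevel A ≠ 0) : HasLevel B L (gramLevel A) A.det := by
  -- The infimum of the empty set is `0`, so a nonzero level means that the set has an element and
  -- the infimum is attained.
  have hne : {N : ℕ | 0 < N ∧ ∃ C : Matrix (Fin 3) (Fin 3) ℤ,
      (N : ℚ) • (A.map (Int.cast : ℤ → ℚ))⁻¹ = C.map (Int.cast : ℤ → ℚ)}.Nonempty := by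
    by_contra hn
    rw [Set.not_nonempty_iff_eq_empty] at hn
    exact h0 (by rw [gramLevel, hn, Nat.sInf_empty])
  obtain ⟨h1, C, hC⟩ := Nat.sInf_mem hne
  change 0 < gramLevel A at h1
  change (gramLevel A : ℚ) • _ = _ at hC
  refine ⟨hL, h1, b, A, C, hA, rfl, ?_⟩
  have hinj : Function.Injective fun M : Matrix (Fin 3) (Fin 3) ℤ => M.map (Int.castRingHom ℚ) :=
    Matrix.map_injective Int.cast_injective
  refine hinj ?_
  have hdet : IsUnit (A.map (Int.cast : ℤ → ℚ)).det := by
    have : (A.map (Int.castRingHom ℚ)).det = ((A.det : ℤ) : ℚ) := (RingHom.map_det _ _).symm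
    rw [show A.map (Int.cast : ℤ → ℚ) = A.map (Int.castRingHom ℚ) from rfl, this]
    exact IsUnit.mk0 _ (by exact_mod_cast (hA.det_pos hB).ne')
  simp only [Matrix.map_mul]
  change A.map (Int.cast : ℤ → ℚ) * C.map (Int.cast : ℤ → ℚ) = _
  rw [← hC, Matrix.mul_smul, Matrix.mul_nonsing_inv _ hdet]
  ext i j
  by_cases hij : i = j <;> simp [hij, Matrix.natCast_apply]

end Gram

/-! ### The Hecke image of the theta series of a coset -/

section Hecke

variable {V : Type*} [AddCommGroup V] [Module ℚ V] {B : LinearMap.BilinForm ℚ V}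
  {L : Submodule ℤ V} {N : ℕ} {D : ℤ} {p : ℕ} {a : ℕ} {ν : V}

lemma exists_inverse_sq {M : ℕ} (hp : p.Prime) (hM : ¬ p ∣ M) :
    ∃ t β : ℤ, (p : ℤ) ^ 2 * t - β * (M : ℤ) = 1 := by
  have h1 : IsCoprime ((p ^ 2 : ℕ) : ℤ) (M : ℤ) :=
    Nat.isCoprime_iff_coprime.2 (((Nat.Prime.coprime_iff_not_dvd hp).2 hM).pow_left 2)
  obtain ⟨u, v, huv⟩ := h1
  exact ⟨u, -v, by push_cast at huv; linear_combination huv⟩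

lemma exists_inverse_modEq {pbar : ℤ} (hpbar : (p : ℤ) * pbar ≡ 1 [ZMOD a]) :
    ∃ t : ℤ, (p : ℤ) ^ 2 * t ≡ 1 [ZMOD a] ∧ (p : ℤ) * t ≡ pbar [ZMOD a] := by
  have e : (p : ℤ) * (pbar ^ 2) ≡ pbar [ZMOD a] := by
    have := hpbar.mul_right pbar
    rw [one_mul] at this
    convert this using 1
    ring
  refine ⟨pbar ^ 2, ?_, e⟩
  have := (e.mul_left p).trans hpbar
  convert this using 1
  ring

namespace IsGoodPrime

/-- Multiples of `ν` by congruent multiples of `p` define the same coset of a neighbour. -/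
lemma cosetSet_congr (h : IsGoodPrime B L N D p) (ha : 0 < a) (hpa : ¬ p ∣ a) (hν : ν ∈ L)
    {K : Submodule ℤ V} (hK : K ∈ nbrLattices B p L) {m n : ℤ} (hm : (p : ℤ) ∣ m)
    (hn : (p : ℤ) ∣ n) (hmn : m ≡ n [ZMOD a]) : cosetSet a K (m • ν) = cosetSet a K (n • ν) := by
  refine (cosetSet_eq_iff ha).2 ⟨rfl, ?_⟩
  obtain ⟨y, hy, rfl⟩ := hK
  obtain ⟨j, hj⟩ := hmn.symm.dvd
  have h1 : (p : ℤ) ∣ j := by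
    refine (h.primeInt.dvd_or_dvd (a := (a : ℤ)) ?_).resolve_left
      (fun hd => hpa (by exact_mod_cast hd))
    rw [← hj]; exact dvd_sub hm hn
  obtain ⟨k, rfl⟩ := h1
  refine mem_scale.2 ⟨(p : ℤ) • k • ν, h.p_smul_mem_nbrLattice hy (L.smul_mem _ hν), ?_⟩
  rw [← sub_smul, hj, mul_smul, mul_smul, ← Int.cast_smul_eq_zsmul ℚ (a : ℤ), Int.cast_natCast]

/-- The Hecke computation produces the multiplier `p t` with `t` inverse to `p²` modulo `4Na²`.
Among multiples of `p`, only the class modulo `a` matters for the coset, which frees the multiplier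
from the choice of `t`. -/
lemma hasHeckeImage (h : IsGoodPrime B L N D p) (hD : 0 < D) (ha : 0 < a)
    (hpa : ¬ p ∣ a) (hν : ν ∈ L) {m : ℤ} (hpm : (p : ℤ) ∣ m) (hm : p * m ≡ 1 [ZMOD a]) :
    HasHeckeImage (4 * N * a ^ 2) a 3 p (chiFour D) (thetaSeries B (cosetSet a L ν))
      (fun z => ∑ K ∈ h.nbrFinset, thetaSeries B (cosetSet a K (m • ν)) z) := by
  have : NeZero a := ⟨ha.ne'⟩
  have hf : thetaSeries B (cosetSet a L ν) = fun z : ℍ => cosetTheta B a L ν (z : ℂ) :=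
    funext fun z => thetaSeries_cosetSet a L ν z
  rw [hf]
  refine ⟨h.level.isHalfIntegralForm h.ternary hD ha hν,
    ⟨_, h.level.isNebentypusDecomposition h.ternary hD hν⟩, fun fam hfam z => ?_⟩
  obtain ⟨t, β, ht⟩ := exists_inverse_sq h.prime (M := 4 * N * a ^ 2) (by
    intro hd
    rcases (Nat.Prime.dvd_mul h.prime).1 hd with h1 | h1
    · rcases (Nat.Prime.dvd_mul h.prime).1 h1 with h2 | h2
      · exact h.odd ((Nat.prime_dvd_prime_iff_eq h.prime Nat.prime_two).1
          (h.prime.dvd_of_dvd_pow (n := 2) h2))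
      · exact h.not_dvd h2
    · exact hpa (h.prime.dvd_of_dvd_pow h1))
  rw [h.finsum_shimuraHecke_eq hD hpa hν hfam ht z]
  refine Finset.sum_congr rfl fun K hK => ?_
  rw [← thetaSeries_cosetSet, h.cosetSet_congr ha hpa hν (h.mem_nbrFinset.1 hK) hpm
    (dvd_mul_right _ _)]
  have h1 : p * (p * t) ≡ 1 [ZMOD a] := by
    refine (Int.modEq_iff_dvd.2 ⟨-(4 * N * a * β), ?_⟩)
    push_cast at ht
    linear_combination -ht
  have h2 : m * (p * (p * t)) ≡ p * t [ZMOD a] := by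
    have := hm.mul_right (p * t)
    rw [one_mul] at this
    convert this using 1
    ring
  have h3 := h1.mul_left m
  rw [mul_one] at h3
  exact h3.symm.trans h2

end IsGoodPrime

end Hecke

/-! ### First assertion: the number of neighbours and the Hecke image -/

section PartOne

variable {V : Type*} [AddCommGroup V] [Module ℚ V] {B : LinearMap.BilinForm ℚ V}
  {L : Submodule ℤ V} {N : ℕ} {D : ℤ} {p : ℕ} [Fact p.Prime] {a : ℕ} {ν : V}

lemma IsGoodPrime.ncard_neighbours (h : IsGoodPrime B L N D p) (hν : IsCoset B a L ν)
    (hpa : ¬ p ∣ a) {pbar : ℤ} (hpbar : (p : ℤ) * pbar ≡ 1 [ZMOD a]) :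
    (neighbours B p pbar a L ν).ncard = p + 1 := by
  obtain ⟨t, ht, hpt⟩ := exists_inverse_modEq hpbar
  rw [h.neighbours_eq hν hpa ht hpt,
    Set.ncard_image_of_injective _ (IsGoodPrime.injective_cosetSet hν.pos _),
    h.ncard_nbrLattices.2]

lemma IsGoodPrime.hasHeckeImage_finsum (h : IsGoodPrime B L N D p) (hD : 0 < D)
    (hν : IsCoset B a L ν) (hpa : ¬ p ∣ a) {pbar : ℤ} (hpbar : (p : ℤ) * pbar ≡ 1 [ZMOD a]) :
    HasHeckeImage (4 * N * a ^ 2) a 3 p (chiFour D) (thetaSeries B (cosetSet a L ν))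
      (fun z => ∑ᶠ S ∈ neighbours B p pbar a L ν, thetaSeries B S z) := by
  obtain ⟨t, ht, hpt⟩ := exists_inverse_modEq hpbar
  convert h.hasHeckeImage hD hν.pos hpa hν.mem (m := p * t) (dvd_mul_right _ _)
    (by convert ht using 1; ring) using 2 with z
  rw [h.neighbours_eq hν hpa ht hpt,
    finsum_mem_image (IsGoodPrime.injective_cosetSet hν.pos _).injOn,
    ← finsum_mem_coe_finset]
  congr 1
  ext K
  simp only [Finset.mem_coe, h.mem_nbrFinset]

end PartOne

/-! ### Genus invariance of discriminant and level -/

section Genus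

variable {V : Type*} [AddCommGroup V] [Module ℚ V] {B : LinearMap.BilinForm ℚ V}

/-- No prime divides the denominator of `n / m`, since the quotient is integral at each of them. -/
lemma Int.dvd_of_forall_padicInt {m n : ℤ} (hm : m ≠ 0)
    (h : ∀ (q : ℕ) [Fact q.Prime], (m : ℤ_[q]) ∣ (n : ℤ_[q])) : m ∣ n := by
  have hmQ : (m : ℚ) ≠ 0 := by exact_mod_cast hm
  have hden : ((n : ℚ) / m).den = 1 := by
    by_contra hne
    obtain ⟨q, hq, hqd⟩ := Nat.exists_prime_and_dvd hne
    have : Fact q.Prime := ⟨hq⟩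
    refine not_dvd_den (q := q) (r := (n : ℚ) / m) ?_ (by exact_mod_cast hqd)
    obtain ⟨c, hc⟩ := h q
    have hmq : (m : ℚ_[q]) ≠ 0 := by exact_mod_cast hm
    have hc' : (n : ℚ_[q]) = m * (c : ℚ_[q]) := by
      have := congrArg (fun x : ℤ_[q] => (x : ℚ_[q])) hc
      simpa using this
    push_cast
    rw [hc', mul_div_cancel_left₀ _ hmq]
    exact PadicInt.norm_le_one c
  refine ⟨((n : ℚ) / m).num, ?_⟩
  have h1 := Rat.mul_den_eq_num ((n : ℚ) / m)
  rw [hden, Nat.cast_one, mul_one] at h1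
  have h2 : (n : ℚ) = m * (((n : ℚ) / m).num : ℚ) := by
    rw [← h1, mul_div_cancel₀ _ hmQ]
  exact_mod_cast h2

/-- The lattices `L` and `M` are locally isometric at `q`. -/
def IsLocalIsometry {q : ℕ} [Fact q.Prime] (B : LinearMap.BilinForm ℚ V) (L M : Submodule ℤ V)
    (σ : LocalSpace V q ≃ₗ[ℚ_[q]] LocalSpace V q) : Prop :=
  (∀ x y, B.baseChange ℚ_[q] (σ x) (σ y) = B.baseChange ℚ_[q] x y) ∧
  (∀ z ∈ localLattice q L, σ z ∈ localLattice q M) ∧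
  ∀ z ∈ localLattice q M, σ.symm z ∈ localLattice q L

section Matrices

variable {q : ℕ} [Fact q.Prime] {L M : Submodule ℤ V}
  {σ : LocalSpace V q ≃ₗ[ℚ_[q]] LocalSpace V q}

lemma IsLocalIsometry.symm (h : IsLocalIsometry B L M σ) : IsLocalIsometry B M L σ.symm :=
  ⟨fun x y => by rw [← h.1, LinearEquiv.apply_symm_apply, LinearEquiv.apply_symm_apply],
    h.2.2, by simpa using h.2.1⟩

lemma toMatrix_baseChange {L : Submodule ℤ V} {b : Module.Basis (Fin 3) ℤ L}
    {A : Matrix (Fin 3) (Fin 3) ℤ} (hA : IsGram B b A) {e : Module.Basis (Fin 3) ℚ V}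
    (he : ∀ i, e i = b i) :
    LinearMap.BilinForm.toMatrix (e.baseChange ℚ_[q]) (B.baseChange ℚ_[q]) =
      (A.map (Int.castRingHom ℤ_[q])).map (algebraMap ℤ_[q] ℚ_[q]) := by
  ext i j
  rw [LinearMap.BilinForm.toMatrix_apply, Module.Basis.baseChange_apply,
    Module.Basis.baseChange_apply]
  have := baseChange_locMap (q := q) (B := B) (e i) (e j)
  rw [locMap_apply, locMap_apply, he, he, ← hA] at this
  rw [he, he, this]
  simp

lemma exists_toMatrix_eq {b : Module.Basis (Fin 3) ℤ L} {c : Module.Basis (Fin 3) ℤ M}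
    {e f : Module.Basis (Fin 3) ℚ V} (he : ∀ i, e i = b i) (hf : ∀ i, f i = c i)
    (hσ : ∀ z ∈ localLattice q L, σ z ∈ localLattice q M) :
    ∃ P : Matrix (Fin 3) (Fin 3) ℤ_[q], P.map (algebraMap ℤ_[q] ℚ_[q]) =
      LinearMap.toMatrix (e.baseChange ℚ_[q]) (f.baseChange ℚ_[q])
        (σ : LocalSpace V q →ₗ[ℚ_[q]] LocalSpace V q) := by
  have h1 : ∀ i j, ‖LinearMap.toMatrix (e.baseChange ℚ_[q]) (f.baseChange ℚ_[q])
        (σ : LocalSpace V q →ₗ[ℚ_[q]] LocalSpace V q) i j‖ ≤ 1 := fun i j => by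
    rw [LinearMap.toMatrix_apply]
    refine norm_repr_le_one c hf (hσ _ ?_) i
    rw [Module.Basis.baseChange_apply, he]
    exact locMap_mem (b j).2
  exact ⟨Matrix.of fun i j => ⟨_, h1 i j⟩, rfl⟩

/-- In lattice bases `σ` and its inverse have entries in `ℤ_q`, so the two Gram matrices are
equivalent over `ℤ_q`. -/
lemma IsLocalIsometry.exists_matrix (h : IsLocalIsometry B L M σ)
    {b : Module.Basis (Fin 3) ℤ L} {c : Module.Basis (Fin 3) ℤ M}
    {e f : Module.Basis (Fin 3) ℚ V} (he : ∀ i, e i = b i) (hf : ∀ i, f i = c i)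
    {A A' : Matrix (Fin 3) (Fin 3) ℤ} (hA : IsGram B b A) (hA' : IsGram B c A') :
    ∃ P P' : Matrix (Fin 3) (Fin 3) ℤ_[q], P' * P = 1 ∧
      A.map (Int.castRingHom ℤ_[q]) = Pᵀ * A'.map (Int.castRingHom ℤ_[q]) * P := by
  obtain ⟨P, hP⟩ := exists_toMatrix_eq he hf h.2.1
  obtain ⟨P', hP'⟩ := exists_toMatrix_eq hf he h.symm.2.1
  have hinj : Function.Injective fun X : Matrix (Fin 3) (Fin 3) ℤ_[q] =>
      X.map (algebraMap ℤ_[q] ℚ_[q]) :=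
    Matrix.map_injective (FaithfulSMul.algebraMap_injective ℤ_[q] ℚ_[q])
  refine ⟨P, P', hinj ?_, hinj ?_⟩
  · simp only [Matrix.map_mul]
    rw [hP, hP', ← LinearMap.toMatrix_comp, LinearEquiv.symm_comp, LinearMap.toMatrix_id]
    exact (Matrix.map_one _ (map_zero _) (map_one _)).symm
  · simp only [Matrix.map_mul]
    rw [show Pᵀ.map (algebraMap ℤ_[q] ℚ_[q]) = (P.map (algebraMap ℤ_[q] ℚ_[q]))ᵀ from rfl, hP, ← toMatrix_baseChange hA he, ← toMatrix_baseChange hA' hf,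
      ← LinearMap.BilinForm.toMatrix_comp]
    congr 1
    ext x y
    simp [h.1]

end Matrices

lemma IsTernary.exists_gram (hB : IsTernary B) {M : Submodule ℤ V} (hM : IsIntegralLattice B M) :
    ∃ (c : Module.Basis (Fin 3) ℤ M) (A : Matrix (Fin 3) (Fin 3) ℤ), IsGram B c A := by
  obtain ⟨n, ⟨c⟩⟩ := hM.isFull.exists_basis
  obtain ⟨f, hf⟩ := exists_basis_rat hM.span_eq_top c
  have hn : n = 3 := by
    have := Module.finrank_eq_card_basis f
    rw [hB.finrank, Fintype.card_fin] at this
    exact this.symm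
  subst hn
  have := fun i j => hM.integral (c i) (c i).2 (c j) (c j).2
  choose A hA using this
  exact ⟨c, Matrix.of A, fun i j => (hA i j).symm⟩

/-- The discriminant and the level are invariants of the genus. -/
lemma HasLevel.of_isLocalIsometry (hB : IsTernary B) {L M : Submodule ℤ V} {N : ℕ} {D : ℤ}
    (h : HasLevel B L N D) (hM : IsIntegralLattice B M)
    (hloc : ∀ (q : ℕ) [Fact q.Prime], ∃ σ : LocalSpace V q ≃ₗ[ℚ_[q]] LocalSpace V q,
      IsLocalIsometry B L M σ) : HasLevel B M N D := by
  obtain ⟨b, A, C, hA, hAD, hC⟩ := h.gram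
  obtain ⟨e, he⟩ := exists_basis_rat h.full.2 b
  obtain ⟨c, A', hA'⟩ := hB.exists_gram hM
  obtain ⟨f, hf⟩ := exists_basis_rat hM.span_eq_top c
  have hd := hA.det_pos hB
  have hd' := hA'.det_pos hB
  have hdet : ∀ X : Matrix (Fin 3) (Fin 3) ℤ, ∀ (q : ℕ) [Fact q.Prime],
      ((X.det : ℤ) : ℤ_[q]) = (X.map (Int.castRingHom ℤ_[q])).det := fun X q _ =>
    RingHom.map_det (Int.castRingHom ℤ_[q]) X
  have h1 : A'.det ∣ A.det := Int.dvd_of_forall_padicInt hd'.ne' fun q _ => by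
    obtain ⟨σ, hσ⟩ := hloc q
    obtain ⟨P, P', -, hP⟩ := hσ.exists_matrix he hf hA hA'
    rw [hdet, hdet, hP, Matrix.det_mul, Matrix.det_mul]
    exact Dvd.dvd.mul_right (dvd_mul_left _ _) _
  have h2 : A.det ∣ A'.det := Int.dvd_of_forall_padicInt hd.ne' fun q _ => by
    obtain ⟨σ, hσ⟩ := hloc q
    obtain ⟨P, P', -, hP⟩ := hσ.symm.exists_matrix hf he hA' hA
    rw [hdet, hdet, hP, Matrix.det_mul, Matrix.det_mul]
    exact Dvd.dvd.mul_right (dvd_mul_left _ _) _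
  -- Integrality of `N A'⁻¹` is the divisibility of the entries of `N adj(A')` by `det A'`. It is
  -- checked prime by prime, by transporting the integral matrix `C` through the local equivalence.
  have h3 : ∀ i j, ∃ m : ℤ, N * A'.adjugate i j = A'.det * m := fun i j => by
    change A'.det ∣ N * A'.adjugate i j
    refine Int.dvd_of_forall_padicInt hd'.ne' fun q _ => ?_
    obtain ⟨σ, hσ⟩ := hloc q
    obtain ⟨P, P', hPP, hP⟩ := hσ.symm.exists_matrix hf he hA' hA
    set Aq := A.map (Int.castRingHom ℤ_[q])
    set Aq' := A'.map (Int.castRingHom ℤ_[q]) with hAq'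
    set Cq := C.map (Int.castRingHom ℤ_[q])
    have hCq : Aq * Cq = (N : ℤ_[q]) • 1 := by
      have := congrArg (fun X : Matrix (Fin 3) (Fin 3) ℤ => X.map (Int.castRingHom ℤ_[q])) hC
      simp only [Matrix.map_mul] at this
      rw [this]
      ext i j
      by_cases hij : i = j <;> simp [hij, Matrix.natCast_apply]
    have hPP' : P * P' = 1 := mul_eq_one_comm.1 hPP
    have e1 : Aq' * (P' * Cq * P'ᵀ) = (N : ℤ_[q]) • 1 := by
      rw [hP]
      calc Pᵀ * Aq * P * (P' * Cq * P'ᵀ) = Pᵀ * (Aq * (P * P') * Cq) * P'ᵀ := by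
            simp only [Matrix.mul_assoc]
        _ = (N : ℤ_[q]) • (P' * P)ᵀ := by
            rw [hPP', Matrix.mul_one, hCq, Matrix.mul_smul, Matrix.smul_mul, Matrix.mul_one,
              Matrix.transpose_mul]
        _ = _ := by rw [hPP, Matrix.transpose_one]
    have e2 : Aq'.det • (P' * Cq * P'ᵀ) = (N : ℤ_[q]) • Aq'.adjugate := by
      have := congrArg (fun X => Aq'.adjugate * X) e1
      simp only [← Matrix.mul_assoc, Matrix.adjugate_mul, Matrix.mul_smul, Matrix.mul_one,
        Matrix.smul_mul, Matrix.one_mul] at this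
      simpa only [Matrix.mul_assoc] using this
    have e3 := congrFun (congrFun e2 i) j
    rw [Matrix.smul_apply, Matrix.smul_apply, smul_eq_mul, smul_eq_mul, hAq', ← hdet] at e3
    have e4 : (A'.map (Int.castRingHom ℤ_[q])).adjugate =
        A'.adjugate.map (Int.castRingHom ℤ_[q]) :=
      (RingHom.map_adjugate (Int.castRingHom ℤ_[q]) A').symm
    rw [e4] at e3
    exact ⟨_, by rw [Int.cast_mul, Int.cast_natCast]; exact e3.symm⟩
  choose C' hC' using h3
  refine ⟨hM.isFull, h.pos, c, A', Matrix.of C', hA',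
    (Int.dvd_antisymm hd'.le hd.le h1 h2).trans hAD, ?_⟩
  have h4 : A'.det • Matrix.of C' = (N : ℤ) • A'.adjugate := by
    ext i j
    exact (hC' i j).symm
  have h5 : A'.det • (A' * Matrix.of C') = A'.det • ((N : ℤ) • (1 : Matrix (Fin 3) (Fin 3) ℤ)) := by
    rw [← Matrix.mul_smul, h4, Matrix.mul_smul, Matrix.mul_adjugate, smul_comm]
  exact smul_right_injective _ hd'.ne' h5

end Genus

/-! ### Rotations and their action on local cosets -/

section Rotations

variable {V : Type*} [AddCommGroup V] [Module ℚ V] {B : LinearMap.BilinForm ℚ V}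

lemma IsRotation.trans {F W : Type*} [Field F] [AddCommGroup W] [Module F W]
    {B : LinearMap.BilinForm F W} {σ τ : W ≃ₗ[F] W} (hσ : IsRotation B σ) (hτ : IsRotation B τ) :
    IsRotation B (σ.trans τ) :=
  ⟨fun x y => by rw [LinearEquiv.trans_apply, LinearEquiv.trans_apply, hτ.1, hσ.1], by
    rw [LinearEquiv.coe_trans, LinearMap.det_comp, hσ.2, hτ.2, one_mul]⟩

/-- The negative of the reflection in the vector `w`. -/
def negReflection (B : LinearMap.BilinForm ℚ V) (w : V) (hw : B w w ≠ 0) : V ≃ₗ[ℚ] V :=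
  (Module.reflection (x := w) (f := (2 / B w w) • B w) (by simp [hw])).trans (LinearEquiv.neg ℚ)

lemma negReflection_apply (w : V) (hw : B w w ≠ 0) (x : V) :
    negReflection B w hw x = (2 / B w w * B w x) • w - x := by
  simp [negReflection, Module.reflection_apply]

lemma negReflection_symm (w : V) (hw : B w w ≠ 0) :
    (negReflection B w hw).symm = negReflection B w hw := by
  ext x
  rw [LinearEquiv.symm_apply_eq, negReflection_apply, negReflection_apply, map_sub, map_smul,
    sub_sub_eq_add_sub, eq_sub_iff_add_eq, add_comm x, add_left_inj]
  congr 1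
  rw [smul_eq_mul]
  field_simp
  ring

/-- A reflection has determinant `-1`, and so does `-1` in dimension three. -/
lemma IsTernary.isRotation_negReflection (hB : IsTernary B) (w : V) (hw : B w w ≠ 0) :
    IsRotation B (negReflection B w hw) := by
  have : Module.Finite ℚ V := Module.finite_of_finrank_pos (by rw [hB.finrank]; norm_num)
  refine ⟨fun x y => ?_, ?_⟩
  · rw [negReflection_apply, negReflection_apply]
    simp only [map_sub, map_smul, LinearMap.sub_apply, LinearMap.smul_apply, smul_eq_mul]
    rw [hB.symm x w]
    field_simp
    ring
  · have h1 : (negReflection B w hw : V →ₗ[ℚ] V) =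
        (-1 : ℚ) • LinearMap.transvection (-((2 / B w w) • B w)) w := by
      ext x
      rw [LinearEquiv.coe_coe, negReflection_apply, LinearMap.smul_apply,
        LinearMap.transvection.apply]
      simp only [LinearMap.neg_apply, LinearMap.smul_apply, smul_eq_mul]
      module
    rw [h1, LinearMap.det_smul, hB.finrank, LinearMap.transvection.det]
    simp only [LinearMap.neg_apply, LinearMap.smul_apply, smul_eq_mul]
    field_simp
    norm_num

/-- The base change of a rotation to `ℚ_q`. -/
lemma IsRotation.baseChange {q : ℕ} [Fact q.Prime] {σ : V ≃ₗ[ℚ] V} (h : IsRotation B σ) 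
    (hV : Module.finrank ℚ V = 3) :
    IsRotation (B.baseChange ℚ_[q]) (σ.baseChange ℚ ℚ_[q] V V) := by
  have : Module.Finite ℚ V := Module.finite_of_finrank_pos (by rw [hV]; norm_num)
  refine ⟨fun x y => ?_, ?_⟩
  · induction x using TensorProduct.induction_on with
    | zero => simp
    | add x x' hx hx' => simp only [map_add, LinearMap.add_apply, hx, hx']
    | tmul c x =>
      induction y using TensorProduct.induction_on with
      | zero => simp
      | add y y' hy hy' => simp only [map_add, hy, hy']
      | tmul d y =>
        rw [LinearEquiv.baseChange_tmul, LinearEquiv.baseChange_tmul,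
          LinearMap.BilinForm.baseChange_tmul, LinearMap.BilinForm.baseChange_tmul, h.1]
  · have h1 : ((σ.baseChange ℚ ℚ_[q] V V : LocalSpace V q ≃ₗ[ℚ_[q]] LocalSpace V q) :
        LocalSpace V q →ₗ[ℚ_[q]] LocalSpace V q) = (σ : V →ₗ[ℚ] V).baseChange ℚ_[q] := rfl
    rw [h1, LinearMap.det_baseChange, h.2, map_one]

lemma baseChange_mem_local {q : ℕ} [Fact q.Prime] {σ : V ≃ₗ[ℚ] V} {L K : Submodule ℤ V} {m : ℤ}
    (hm : ¬ (q : ℤ) ∣ m) (h : ∀ x ∈ L, m • σ x ∈ K) {z : LocalSpace V q}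
    (hz : z ∈ localLattice q L) : σ.baseChange ℚ ℚ_[q] V V z ∈ localLattice q K := by
  let φ : LocalSpace V q →ₗ[ℚ_[q]] LocalSpace V q := σ.baseChange ℚ ℚ_[q] V V
  refine localLattice_le (M := (localLattice q K).comap
    (LinearMap.restrictScalars ℤ_[q] φ)) (fun x hx => ?_) hz
  change σ.baseChange ℚ ℚ_[q] V V (locMap q x) ∈ localLattice q K
  rw [locMap_apply, LinearEquiv.baseChange_tmul, ← locMap_apply]
  refine mem_of_zsmul_mem hm ?_
  rw [← map_zsmul]
  exact locMap_mem (h x hx)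

lemma image_localCoset_eq_iff {q : ℕ} [Fact q.Prime] {a : ℕ} (ha : 0 < a) {L M : Submodule ℤ V}
    {ν μ : V} {σ : LocalSpace V q ≃ₗ[ℚ_[q]] LocalSpace V q} :
    σ '' localCoset q a L ν = localCoset q a M μ ↔
      (∀ z ∈ localLattice q L, σ z ∈ localLattice q M) ∧
      (∀ z ∈ localLattice q M, σ.symm z ∈ localLattice q L) ∧
      ∃ w ∈ localLattice q M, σ (locMap q ν) - locMap q μ = a • w := by
  constructor
  · intro h
    have h1 : σ (locMap q ν) ∈ localCoset q a M μ := by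
      rw [← h]
      exact ⟨_, ⟨0, zero_mem _, by rw [smul_zero, zero_add]; rfl⟩, rfl⟩
    obtain ⟨w, hw, hw'⟩ := h1
    have hd : σ (locMap q ν) = a • w + locMap q μ := hw'
    refine ⟨fun z hz => ?_, fun z hz => ?_, w, hw, by rw [hd, add_sub_cancel_right]⟩
    · have : σ (a • z + locMap q ν) ∈ localCoset q a M μ := by
        rw [← h]; exact ⟨_, ⟨z, hz, rfl⟩, rfl⟩
      obtain ⟨y, hy, hy'⟩ := this
      have : σ z = y - w := by
        refine nsmul_injective_local ha ?_
        rw [map_add, hd, map_nsmul, ← add_assoc] at hy'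
        rw [smul_sub, eq_sub_iff_add_eq]
        exact add_right_cancel hy'
      rw [this]; exact sub_mem hy hw
    · have : a • (z + w) + locMap q μ ∈ σ '' localCoset q a L ν := by
        rw [h]; exact ⟨z + w, add_mem hz hw, rfl⟩
      obtain ⟨_, ⟨y, hy, rfl⟩, hy'⟩ := this
      have : z = σ y := by
        refine nsmul_injective_local ha ?_
        rw [map_add, map_nsmul, smul_add, add_assoc, ← hd] at hy'
        exact (add_right_cancel hy').symm
      rw [this, LinearEquiv.symm_apply_apply]; exact hy
  · rintro ⟨h1, h2, w, hw, hd⟩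
    rw [sub_eq_iff_eq_add] at hd
    ext z
    constructor
    · rintro ⟨_, ⟨y, hy, rfl⟩, rfl⟩
      refine ⟨σ y + w, add_mem (h1 y hy) hw, ?_⟩
      rw [map_add, map_nsmul, smul_add, add_assoc]
      exact congrArg _ hd
    · rintro ⟨y, hy, rfl⟩
      refine ⟨_, ⟨σ.symm (y - w), h2 _ (sub_mem hy hw), rfl⟩, ?_⟩
      change σ (a • σ.symm (y - w) + locMap q ν) = a • y + locMap q μ
      rw [map_add, map_nsmul, LinearEquiv.apply_symm_apply, hd, smul_sub]
      abel

end Rotations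

/-! ### A rotation carrying a lattice to its neighbour at `p` -/

section LocalRotation

variable {V : Type*} [AddCommGroup V] [Module ℚ V] {B : LinearMap.BilinForm ℚ V}
  {L : Submodule ℤ V} {N : ℕ} {D : ℤ} {p : ℕ} [Fact p.Prime]

/-- A neighbour of `L` is the image of `L` under a rotation, up to an index prime to `p`. -/
lemma IsGoodPrime.exists_rotation (h : IsGoodPrime B L N D p) {y : V} (hy : IsNbrVector B p L y) :
    ∃ (σ : V ≃ₗ[ℚ] V) (u : ℤ), IsRotation B σ ∧ ¬ (p : ℤ) ∣ u ∧
      (∀ x ∈ L, u • σ x ∈ nbrLattice B L y) ∧ ∀ x ∈ nbrLattice B L y, u • σ.symm x ∈ L := by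
  have hp0 : ((p : ℤ) : ℚ) ≠ 0 := by exact_mod_cast h.prime.ne_zero
  obtain ⟨l, hl, hly⟩ := h.exists_bilin_notMem hy.smul_mem hy.notMem
  obtain ⟨b, hb⟩ := mem_intQ.1 (h.bilin_mul_int hy.smul_mem hl)
  obtain ⟨m, hm⟩ := mem_intQ.1 hy.int
  obtain ⟨n, hn⟩ := mem_intQ.1 (h.integral hl hl)
  have hbp : ¬ (p : ℤ) ∣ b := by
    rintro ⟨j, rfl⟩
    refine hly (mem_intQ.2 ⟨j, mul_left_cancel₀ hp0 ?_⟩)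
    rw [hb]; push_cast; rfl
  -- For `w = y + l` one has `p Q(w) = u`, which is prime to `p`. The negative reflection in `w`
  -- sends `x` to `(2 B(w, x) / Q(w)) w - x`; after multiplication by `u` this is `2 p B(w, x) w - u
  -- x`, and it exchanges the two lattices at `p`.
  set u : ℤ := p * m + 2 * b + p * n with hu
  have hpu : ¬ (p : ℤ) ∣ u := by
    intro hd
    have h2 : (p : ℤ) ∣ 2 * b := by
      rw [show 2 * b = u - p * (m + n) by rw [hu]; ring]
      exact dvd_sub hd (dvd_mul_right _ _)
    rcases h.primeInt.dvd_or_dvd h2 with h3 | h3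
    · exact (h.primeInt.coprime_iff_not_dvd.1 h.coprime_two.symm) h3
    · exact hbp h3
  have hw : ((p : ℤ) : ℚ) * B (y + l) (y + l) = u := by
    rw [h.ternary.self_add, h.ternary.symm y l, hm, hn, hu, mul_add, mul_add]
    push_cast at hb ⊢
    linear_combination 2 * hb
  have hu0 : (u : ℚ) ≠ 0 := by
    have : u ≠ 0 := by rintro h0; exact hpu (by rw [h0]; exact dvd_zero _)
    exact_mod_cast this
  have hw0 : B (y + l) (y + l) ≠ 0 := by
    intro h0; rw [h0, mul_zero] at hw; exact hu0 hw.symm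
  have key : ∀ x : V, ∀ β : ℤ, ((p : ℤ) : ℚ) * B (y + l) x = β →
      u • negReflection B (y + l) hw0 x = (2 * β) • (y + l) - u • x := by
    intro x β hβ
    rw [negReflection_apply, smul_sub]
    congr 1
    rw [← Int.cast_smul_eq_zsmul ℚ, ← Int.cast_smul_eq_zsmul ℚ, smul_smul]
    congr 1
    rw [← hw]
    push_cast at hβ ⊢
    rw [← hβ]
    field_simp
  refine ⟨negReflection B (y + l) hw0, u, h.ternary.isRotation_negReflection _ _, hpu,
    fun x hx => ?_, fun x hx => ?_⟩
  · obtain ⟨c, hc⟩ := mem_intQ.1 (h.bilin_mul_int hy.smul_mem hx)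
    obtain ⟨d, hd⟩ := mem_intQ.1 (h.integral hl hx)
    rw [key x (c + p * d) (by
      rw [map_add, LinearMap.add_apply, h.ternary.symm y x, hd]
      push_cast at hc ⊢
      linear_combination hc)]
    refine mem_nbrLattice.2 ⟨(2 * (c + p * d)) • l - u • x, ⟨sub_mem (L.smul_mem _ hl)
      (L.smul_mem _ hx), ?_⟩, 2 * (c + p * d), by rw [smul_add]; abel⟩
    refine mem_intQ.2 ⟨2 * d * b - (m + n) * c, ?_⟩
    refine mul_left_cancel₀ hp0 ?_
    rw [map_sub, LinearMap.sub_apply, bilin_zsmul_left, bilin_zsmul_left, hu]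
    push_cast at hb hc ⊢
    linear_combination (2 * (c + p * d) : ℚ) * hb - (p * m + 2 * b + p * n : ℚ) * hc
  · rw [negReflection_symm]
    obtain ⟨x, hx', k, rfl⟩ := mem_nbrLattice.1 hx
    obtain ⟨c, hc⟩ := mem_intQ.1 hx'.2
    obtain ⟨d, hd⟩ := mem_intQ.1 (h.integral hl hx'.1)
    rw [key (x + k • y) (p * c + p * d + k * (p * m + b)) (by
      rw [map_add, map_add, LinearMap.add_apply, LinearMap.add_apply, bilin_zsmul_right,
        bilin_zsmul_right, h.ternary.symm y x, hc, hd, hm]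
      push_cast at hb ⊢
      linear_combination (k : ℚ) * hb)]
    -- The coefficient of `y` is divisible by `p`, because the terms `2 k b` cancel against those in
    -- `u k`.
    have e : (2 * (p * c + p * d + k * (p * m + b))) • (y + l) - u • (x + k • y) =
        (2 * (p * c + p * d + k * (p * m + b))) • l - u • x +
          (2 * c + 2 * d + k * (m - n)) • ((p : ℤ) • y) := by
      rw [hu]
      module
    rw [e]
    exact add_mem (sub_mem (L.smul_mem _ hl) (L.smul_mem _ hx'.1)) (L.smul_mem _ hy.smul_mem)

end LocalRotation

/-! ### Proper classes, and neighbours inside the proper genus -/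

section Classes

variable {V : Type*} [AddCommGroup V] [Module ℚ V] {B : LinearMap.BilinForm ℚ V}
  {L M K : Submodule ℤ V} {N : ℕ} {D : ℤ} {p : ℕ} [Fact p.Prime] {a : ℕ} {ν μ : V}

lemma thetaSeries_of_mem_properClass {S T : Set V} (h : T ∈ properClass B S) (z : ℍ) :
    thetaSeries B T z = thetaSeries B S z := by
  obtain ⟨σ, hσ, rfl⟩ := h
  refine (Equiv.tsum_eq (σ.toEquiv.image S) _).symm.trans (tsum_congr fun x => ?_)
  change Complex.exp (2 * Real.pi * Complex.I * ((B (σ x) (σ x) : ℚ) : ℂ) * z) = _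
  rw [hσ.1]

lemma image_cosetSet (σ : V ≃ₗ[ℚ] V) :
    σ '' cosetSet a L ν = cosetSet a (L.map (σ.toLinearMap.restrictScalars ℤ)) (σ ν) := by
  ext x
  constructor
  · rintro ⟨_, ⟨y, hy, rfl⟩, rfl⟩
    exact ⟨σ y, ⟨y, hy, rfl⟩, by rw [map_add, map_nsmul]⟩
  · rintro ⟨_, ⟨y, hy, rfl⟩, rfl⟩
    exact ⟨_, ⟨y, hy, rfl⟩, by rw [map_add, map_nsmul]; rfl⟩

/-- Multiplication of the representing vectors by an integer respects proper classes. -/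
lemma smul_mem_properClass (ha : 0 < a) (h : cosetSet a K μ ∈ properClass B (cosetSet a M ν))
    (n : ℤ) : cosetSet a K (n • μ) ∈ properClass B (cosetSet a M (n • ν)) := by
  obtain ⟨σ, hσ, h⟩ := h
  rw [image_cosetSet, cosetSet_eq_iff ha] at h
  refine ⟨σ, hσ, ?_⟩
  rw [image_cosetSet, cosetSet_eq_iff ha, map_zsmul, ← smul_sub]
  exact ⟨h.1, Submodule.smul_mem _ _ h.2⟩

/-- A coset whose underlying set lies in a proper genus is locally isometric to its members. -/
lemma exists_isRotation_of_mem_properGenus (ha : 0 < a)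
    (h : cosetSet a M μ ∈ properGenus B a L ν) (q : ℕ) [Fact q.Prime] :
    ∃ σ : LocalSpace V q ≃ₗ[ℚ_[q]] LocalSpace V q,
      IsRotation (B.baseChange ℚ_[q]) σ ∧ σ '' localCoset q a L ν = localCoset q a M μ := by
  obtain ⟨K, ξ, hK, he, hloc⟩ := h
  obtain ⟨rfl, h2⟩ := (cosetSet_eq_iff ha).1 he
  obtain ⟨σ, hσ, himg⟩ := hloc q
  exact ⟨σ, hσ, himg.trans
    ((localCoset_eq_iff ha).2 ⟨rfl, exists_local_of_mem_scale h2⟩).symm⟩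

namespace IsGoodPrime

/-- Multiplying a neighbouring coset by `p` gives a coset in the genus. -/
lemma cosetSet_mem_properGenus (h : IsGoodPrime B L N D p) (hM : HasLevel B M N D)
    (hν : IsCoset B a L ν) (hpa : ¬ p ∣ a) (hμ : IsCoset B a M μ)
    (hgen : cosetSet a M μ ∈ properGenus B a L ν) {t : ℤ}
    (ht : (p : ℤ) ^ 2 * t ≡ 1 [ZMOD a]) (hK : K ∈ nbrLattices B p M) :
    cosetSet a K ((p * (p * t)) • μ) ∈ properGenus B a L ν := by
  have h' : IsGoodPrime B M N D p := ⟨h.ternary, hM, h.prime, h.odd, h.not_dvd⟩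
  have ht' : (p : ℤ) * (p * t) ≡ 1 [ZMOD a] := by convert ht using 1; ring
  obtain ⟨y, hy, rfl⟩ := hK
  have hcos : IsCoset B a (nbrLattice B M y) ((p * (p * t)) • μ) := by
    refine hμ.of_smul_mem (h'.isIntegralLattice_nbrLattice hy)
      (h'.p_mul_smul_mem hy hμ.mem _) fun m hm => ?_
    obtain ⟨x, hx, hxm⟩ := mem_scale.1 hm
    have h1 : ((p : ℤ) * t * p * (p * (p * t))) • (m • μ) ∈ scale (a : ℚ) M := by
      refine mem_scale.2 ⟨((p : ℤ) * t) • (p : ℤ) • x,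
        M.smul_mem _ (h'.p_smul_mem_of_mem_nbrLattice hy hx), ?_⟩
      rw [smul_comm, smul_comm (a : ℚ), hxm, smul_comm m, smul_smul, smul_smul]
    have h2 := hμ.smul_mem_scale (m := (1 - (p : ℤ) * t * p * (p * (p * t))) * m)
      (Dvd.dvd.mul_right (by
        refine Int.ModEq.dvd ?_
        have := ht'.mul ht'
        rw [one_mul] at this
        convert this using 1; ring) _)
    have h3 : m • μ = ((p : ℤ) * t * p * (p * (p * t))) • (m • μ) +
        ((1 - (p : ℤ) * t * p * (p * (p * t))) * m) • μ := by
      rw [mul_smul _ (m : ℤ), natCast_zsmul, ← add_smul, add_sub_cancel, one_smul]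
    rw [h3]
    exact add_mem h1 h2
  refine ⟨_, _, hcos, rfl, fun q hqf => ?_⟩
  obtain ⟨σ, hσ, hσL⟩ := exists_isRotation_of_mem_properGenus hν.pos hgen q
  -- At `p` the vector is immaterial, `a` being a unit, so it is enough to rotate `M` to `K`. Away
  -- from `p` the lattices agree, and `p (p t) ≡ 1` modulo `a` leaves the coset unchanged.
  by_cases hqp : q = p
  · subst hqp
    obtain ⟨τ, u, hτ, hu, hτM, hτK⟩ := h'.exists_rotation hy
    have hτq : (τ.baseChange ℚ ℚ_[q] V V : LocalSpace V q ≃ₗ[ℚ_[q]] LocalSpace V q) ''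
        localCoset q a M μ = localCoset q a (nbrLattice B M y) ((q * (q * t)) • μ) := by
      refine (image_localCoset_eq_iff hν.pos).2 ⟨fun z hz => baseChange_mem_local hu hτM hz,
        fun z hz => ?_, nsmul_mem_local hpa (sub_mem
          (baseChange_mem_local hu hτM (locMap_mem hμ.mem)) (locMap_mem hcos.mem))⟩
      exact baseChange_mem_local (σ := τ.symm) hu hτK hz
    have himg : ∀ ρ : LocalSpace V q ≃ₗ[ℚ_[q]] LocalSpace V q,
        (σ.trans ρ) '' localCoset q a L ν = ρ '' (σ '' localCoset q a L ν) := fun ρ =>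
      Set.image_comp ρ σ _
    exact ⟨_, hσ.trans (hτ.baseChange h.ternary.finrank),
      by rw [himg, hσL, hτq]⟩
  · refine ⟨σ, hσ, hσL.trans ?_⟩
    rw [h'.localCoset_nbrLattice hμ hy ht' hqp, one_smul]

end IsGoodPrime

end Classes

/-! ### Second assertion: sorting the neighbours by proper class -/

section PartTwo

variable {V : Type*} [AddCommGroup V] [Module ℚ V] {B : LinearMap.BilinForm ℚ V}
  {L M : Submodule ℤ V} {N : ℕ} {D : ℤ} {p : ℕ} [Fact p.Prime] {a : ℕ} {ν μ : V}

lemma HasLevel.of_mem_properGenus (hB : IsTernary B) (h : HasLevel B L N D) (ha : 0 < a)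
    (hμ : IsCoset B a M μ) (hgen : cosetSet a M μ ∈ properGenus B a L ν) : HasLevel B M N D :=
  h.of_isLocalIsometry hB hμ.lattice fun q _ => by
    obtain ⟨σ, hσ, hσL⟩ := exists_isRotation_of_mem_properGenus ha hgen q
    obtain ⟨h1, h2, -⟩ := (image_localCoset_eq_iff ha).1 hσL
    exact ⟨σ, hσ.1, h1, h2⟩

namespace IsGoodPrime

open Classical in
/-- The number of neighbours in a given class, in terms of the neighbouring lattices. -/
lemma neighbourCount_eq (h : IsGoodPrime B L N D p) (hν : IsCoset B a L ν) (hpa : ¬ p ∣ a)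
    {pbar t : ℤ} (ht : (p : ℤ) ^ 2 * t ≡ 1 [ZMOD a]) (hpt : (p : ℤ) * t ≡ pbar [ZMOD a])
    (S : Set V) : neighbourCount B p pbar a L ν S =
      (h.nbrFinset.filter fun K => cosetSet a K ((p * t) • ν) ∈ properClass B S).card := by
  rw [neighbourCount, h.neighbours_eq hν hpa ht hpt, ← Set.ncard_coe_finset,
    ← Set.ncard_image_of_injective _ (injective_cosetSet hν.pos ((p * t) • ν))]
  congr 1
  ext T
  simp only [Set.mem_image, Finset.coe_filter, h.mem_nbrFinset]
  constructor
  · rintro ⟨⟨K, hK, rfl⟩, hT⟩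
    exact ⟨K, ⟨hK, hT⟩, rfl⟩
  · rintro ⟨K, ⟨hK, hT⟩, rfl⟩
    exact ⟨⟨K, hK, rfl⟩, hT⟩

/-- The neighbours of a representative of a class in the genus are isometric to
representatives of the classes in the genus. -/
lemma sum_nbrFinset_eq (h : IsGoodPrime B L N D p) (hν : IsCoset B a L ν) (hpa : ¬ p ∣ a)
    {pbar t : ℤ} (hpbar : (p : ℤ) * pbar ≡ 1 [ZMOD a]) (ht : (p : ℤ) ^ 2 * t ≡ 1 [ZMOD a])
    (hpt : (p : ℤ) * t ≡ pbar [ZMOD a])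
    {n : ℕ} {Li : Fin n → Submodule ℤ V} {νi : Fin n → V}
    (hrep : IsClassRepresentatives B a L ν Li νi) {i : Fin n} (hi : IsGoodPrime B (Li i) N D p)
    (k : ℕ) (z : ℍ) :
    ∑ K ∈ hi.nbrFinset, thetaSeries B (cosetSet a K ((p * t) • (pbar ^ k • νi i))) z =
      (neighbourMatrix B p pbar a Li νi *ᵥ thetaVector B pbar a Li νi (k + 1) z) i := by
  classical
  have ha := hν.pos
  obtain ⟨hcos, hgen⟩ := hrep.1 i
  -- Multiplied by `p`, the neighbouring coset lies in the proper genus. This attaches to `K` a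
  -- class index `J K`, which does not involve `k`.
  have hex : ∀ K : Submodule ℤ V, ∃ j, K ∈ nbrLattices B p (Li i) →
      ∀ j', cosetSet a K ((p * (p * t)) • νi i) ∈ properClass B (cosetSet a (Li j') (νi j')) ↔
        j = j' := fun K => by
    by_cases hK : K ∈ nbrLattices B p (Li i)
    · obtain ⟨j, hj, hj'⟩ := hrep.2 _
        (h.cosetSet_mem_properGenus hi.level hν hpa hcos hgen ht hK)
      exact ⟨j, fun _ j' => ⟨fun hj'' => (hj' j' hj'').symm, fun e => e ▸ hj⟩⟩
    · exact ⟨i, fun hK' => absurd hK' hK⟩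
  choose J hJ using hex
  have ht' : (p : ℤ) * (p * t) ≡ 1 [ZMOD a] := by convert ht using 1; ring
  -- Multiplying this class relation by `pbar ^ (l + 1)` undoes the factor `p` and raises the
  -- exponent of `pbar` by one, whence the index `k + 1` in the conclusion.
  have hpow : ∀ K ∈ hi.nbrFinset, ∀ l : ℕ,
      cosetSet a K ((p * t) • (pbar ^ l • νi i)) ∈
        properClass B (cosetSet a (Li (J K)) (pbar ^ (l + 1) • νi (J K))) := fun K hK l => by
    have hK' := hi.mem_nbrFinset.1 hK
    have h1 := smul_mem_properClass ha ((hJ K hK' (J K)).2 rfl) (pbar ^ (l + 1))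
    rw [smul_smul] at h1
    rw [smul_smul, hi.cosetSet_congr ha hpa hcos.mem hK'
      (n := pbar ^ (l + 1) * (p * (p * t)))]
    · exact h1
    · exact (dvd_mul_right _ _).mul_right _
    · exact (dvd_mul_right _ _).mul_left _
    · have h2 := (ht'.symm.mul_left (pbar ^ (l + 1)))
      rw [mul_one, pow_succ'] at h2
      rw [pow_succ']
      exact (hpt.mul_right _).trans h2
  have hiff : ∀ K ∈ hi.nbrFinset, ∀ j, cosetSet a K ((p * t) • νi i) ∈
      properClass B (cosetSet a (Li j) (pbar • νi j)) ↔ J K = j := fun K hK j => by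
    constructor
    · intro h1
      have h2 := smul_mem_properClass ha h1 p
      rw [smul_smul, smul_smul] at h2
      refine (hJ K (hi.mem_nbrFinset.1 hK) j).1 ?_
      rwa [(cosetSet_eq_iff ha (μ := (p * pbar) • νi j) (ν := νi j)).2 ⟨rfl, ?_⟩] at h2
      have h3 := int_smul_sub_mem (hrep.1 j).1.mem hpbar.symm.dvd
      rwa [one_smul] at h3
    · rintro rfl
      have := hpow K hK 0
      simpa using this
  -- The neighbours are grouped by class index. The fibre over `j` has as many elements as the
  -- matrix entry prescribes, and all its members have the same theta series.
  rw [Matrix.mulVec, dotProduct, ← Finset.sum_fiberwise hi.nbrFinset J]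
  refine Finset.sum_congr rfl fun j _ => ?_
  rw [neighbourMatrix, Matrix.of_apply, hi.neighbourCount_eq hcos hpa ht hpt, thetaVector]
  refine Eq.trans ?_ ((Finset.sum_const _).trans (nsmul_eq_mul _ _))
  refine Finset.sum_congr (Finset.filter_congr fun K hK => (hiff K hK j).symm) fun K hK => ?_
  obtain ⟨hK, hKj⟩ := Finset.mem_filter.1 hK
  rw [← (hiff K hK j).1 hKj]
  exact thetaSeries_of_mem_properClass (hpow K hK k) z

end IsGoodPrime

end PartTwo

end

theorem mainTheorem2 {V : Type*} [AddCommGroup V] [Module ℚ V]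
    (hV : Module.finrank ℚ V = 3)
    (B : LinearMap.BilinForm ℚ V) (hsymm : ∀ x y, B x y = B y x)
    (hpos : ∀ x, x ≠ 0 → 0 < B x x)
    (a : ℕ) (L : Submodule ℤ V) (ν : V) (hcoset : IsCoset B a L ν)
    (b : Module.Basis (Fin 3) ℤ L) (A : Matrix (Fin 3) (Fin 3) ℤ)
    (hA : ∀ i j, ((A i j : ℤ) : ℚ) = B (b i) (b j))
    (p : ℕ) [Fact p.Prime] (hp : ¬ p ∣ 4 * gramLevel A * a ^ 2)
    (pbar : ℤ) (hpbar : (p : ℤ) * pbar ≡ 1 [ZMOD a]) :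
    ((neighbours B p pbar a L ν).ncard = p + 1 ∧
      HasHeckeImage (4 * gramLevel A * a ^ 2) a 3 p (chiFour A.det)
        (thetaSeries B (cosetSet a L ν))
        (fun z => ∑ᶠ S ∈ neighbours B p pbar a L ν, thetaSeries B S z)) ∧
    ∀ (h : ℕ) (Li : Fin h → Submodule ℤ V) (νi : Fin h → V),
      IsClassRepresentatives B a L ν Li νi →
      ∀ (k : ℕ) (i : Fin h),
        HasHeckeImage (4 * gramLevel A * a ^ 2) a 3 p (chiFour A.det)
          (fun z => thetaVector B pbar a Li νi k z i)
          (fun z => (neighbourMatrix B p pbar a Li νi *ᵥ thetaVector B pbar a Li νi (k + 1) z) i) := by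
  have hB : IsTernary B := ⟨hV, hsymm, hpos⟩
  have hgram : IsGram B b A := hA
  have hprime : p.Prime := Fact.out
  -- A vanishing level would make `p` a divisor of `0`.
  have h0 : gramLevel A ≠ 0 := fun h0 => hp (by simp [h0])
  have hp2 : p ≠ 2 := by
    rintro rfl
    exact hp (Dvd.dvd.mul_right (Dvd.dvd.mul_right (by norm_num) _) _)
  have hpN : ¬ p ∣ gramLevel A := fun hd => hp (Dvd.dvd.mul_right (hd.mul_left 4) _)
  have hpa : ¬ p ∣ a := fun hd => hp (Dvd.dvd.mul_left (dvd_pow hd two_ne_zero) _)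
  have hlevel := hgram.hasLevel hB hcoset.lattice.isFull h0
  have hD := hgram.det_pos hB
  have h : IsGoodPrime B L (gramLevel A) A.det p := ⟨hB, hlevel, hprime, hp2, hpN⟩
  refine ⟨⟨h.ncard_neighbours hcoset hpa hpbar, h.hasHeckeImage_finsum hD hcoset hpa hpbar⟩,
    fun n Li νi hrep k i => ?_⟩
  obtain ⟨t, ht, hpt⟩ := exists_inverse_modEq hpbar
  obtain ⟨hcos, hgen⟩ := hrep.1 i
  have hi : IsGoodPrime B (Li i) (gramLevel A) A.det p :=
    ⟨hB, hlevel.of_mem_properGenus hB hcoset.pos hcos hgen, hprime, hp2, hpN⟩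
  -- The Hecke computation needs only that the shift lies in `L_i`, so it applies directly to `pbar
  -- ^ k • νi i`.
  have himage := hi.hasHeckeImage hD hcoset.pos hpa (ν := pbar ^ k • νi i)
    ((Li i).smul_mem _ hcos.mem) (m := p * t) (dvd_mul_right _ _) (by rwa [← mul_assoc, ← sq])
  have hsum : (fun z => (neighbourMatrix B p pbar a Li νi *ᵥ
      thetaVector B pbar a Li νi (k + 1) z) i) = fun z => ∑ K ∈ hi.nbrFinset,
        thetaSeries B (cosetSet a K ((p * t) • (pbar ^ k • νi i))) z := funext fun z =>
    (h.sum_nbrFinset_eq hcoset hpa hpbar ht hpt hrep hi k z).symm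
  rw [hsum]
  exact himage
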